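/- **Notation.** Write $(x;q)=\prod_{r\ge0}(1-xq^r)$, $\theta(x;p)=(x;p)(p/x;p)$, $\theta(x;q;p)_m=\prod_{r=0}^{m-1}\theta(xq^r;p)$ and $\Gamma(x)=\Gamma(x;p,q)=\prod_{i,j\ge0}\frac{1-p^{i+1}q^{j+1}/x}{1-p^iq^jx}$. Several arguments, or signs $\pm$ in an argument, denote a product. Powers $p^s$, $s\in\mathbb R$, of $p\in\mathbb C^*$ are taken with the principal branch. A family $F_p$ of functions on $(\mathbb C^*)^n$ *has a series* if, for small $p$, $F_p(z)=\sum_{s\in S}a_s(z)p^s$, where $S\subset\mathbb R$ is closed, discrete and bounded below, the $a_s$ are rational functions, and the series converges normally on compact sets outside the zero set of some nonzero polynomial. If $F\neq0$, then $val(F)$ is the least $s$ with $a_s\ne0$, and $lc(F)=a_{val(F)}$. For $u\in\mathbb C^*$ and $m\ge0$ put $\Theta_{u,m}(z)=\prod_{i=1}^n\theta(pqz_i^{\pm1}/u;q;p)_m$. Let $A^{(n)}_m(u;p,q)$ be the space of meromorphic functions $f$ on $(\mathbb C^*)^n$ that are invariant under permutations of the $z_i$, under $z_i\to1/z_i$ and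 under $z_i\to pz_i$, and for which $\Theta_{u,m}f$ is holomorphic. For $u=u(p)$, let $\tilde A^{(n)}_m(u)$ be the set of families $f=(f_p)_{0<|p|<1}$ with $f_p\in A^{(n)}_m(u(p);p,q)$ such that (i) for every $\xi\in\mathbb R^n$ the family $f_p(p^{\xi_1}z_1,\dots,p^{\xi_n}z_n)$ has a series, and (ii) for all $M>0$ and $\xi\in\mathbb R$ there are $K>0$ and $\kappa\in\mathbb R$ with $|\Theta_{u(p),m}(z)f_p(z)|\le K|p|^{-\kappa}$ whenever $0<|p|<\frac12$ and $(M|p|^{\xi})^{-1}<|z_i|,|u(p)|<M|p|^{\xi}$. A *contour* $C$ is an integral chain of circles that is the oriented boundary of a bounded open set $\Omega_C\ni0$. A point is contained in $C$ if it lies in $\Omega_C$, and excluded if it lies outside $\overline{\Omega_C}$. A set is contained (excluded) if all of its points are. **Setting.** Let $n\ge1$ and $0<|q|,|t|<1$. Let $t_0,\dots,t_5\in\mathbb C$ satisfy $t^{2(n-1)}\prod_{r=0}^5t_r=q$, let $a,b,c\in\{0,\dots,5\}$ be pairwise distinct, $T=\{a,b,c\}$, and let $\alpha\in\mathbb R^6$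 and $-\frac12\le\zeta<0$ satisfy $\sum_{r=0}^5\alpha_r=1$, $\alpha_a+\alpha_b+\alpha_c=\zeta$, $\zeta\le\alpha_r\le-\zeta$ for $r\in T$ and $-\zeta\le\alpha_r\le1+\zeta$ for $r\notin T$. Assume that the $t_r$ are generic in the following sense: $t_rt_s\notin q^{\mathbb Z_{\le0}}t^{\mathbb Z_{\le0}}$ for $0\le r,s\le3$; $t_rt_4,t_rt_5\notin q^{\mathbb Z}t^{\mathbb Z_{\le0}}$ for $0\le r\le5$; and $t^kt_rt_s\notin q^{\mathbb Z_{\ge1}}$ for $0\le k<n$ and all $r\ne s$ for which $\alpha_r+\alpha_s=1$, or $r,s\in T$ and $\alpha_r+\alpha_s=0$. Let $G$ be the set of $p\in\mathbb C^*$ for which the numbers $\tau_r=t_rp^{\alpha_r}$ satisfy $\tau_r\tau_s\notin p^{\mathbb Z_{\le0}}q^{\mathbb Z_{\le0}}t^{\mathbb Z_{\le0}}$ for $0\le r,s\le3$ and $\tau_r\tau_4,\tau_r\tau_5\notin p^{\mathbb Z_{\le0}}q^{\mathbb Z}t^{\mathbb Z_{\le0}}$ for $0\le r\le5$. Let $m_f,m_g\ge0$,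 $f\in\tilde A^{(n)}_{m_f}(t_4p^{\alpha_4})$ and $g\in\tilde A^{(n)}_{m_g}(t_5p^{\alpha_5})$, and let $val(f),lc(f)$ and $val(g),lc(g)$ be the valuations and leading coefficients of the families $f_p(p^\zeta z)$ and $g_p(p^\zeta z)$, both assumed nonzero. Put $\tilde t_r=t_r$ for $r\le3$, $\tilde t_4=t_4q^{-m_f}$, $\tilde t_5=t_5q^{-m_g}$, and $\tilde\tau_r=\tilde t_rp^{\alpha_r}$. For $p\in G$, $|p|<1$, define $$\langle f,g\rangle_{t_rp^{\alpha_r}}=\frac{(q;q)^n(p;p)^n\Gamma(t)^n}{2^nn!\prod_{j=1}^n\Gamma(t^j)\prod_{0\le r<s\le5}\Gamma(t^{n-j}\tau_r\tau_s)}\int_{C_p^n}f_p(z)g_p(z)\prod_{1\le j<k\le n}\frac{\Gamma(tz_j^{\pm1}z_k^{\pm1})}{\Gamma(z_j^{\pm1}z_k^{\pm1})}\prod_{j=1}^n\frac{\prod_{r=0}^5\Gamma(\tau_rz_j^{\pm1})}{\Gamma(z_j^{\pm2})}\frac{dz_j}{2\pi iz_j},$$ where $C_p=C_p^{-1}$ is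 a contour that contains the points $p^iq^j\tilde\tau_r$ $(0\le r\le5)$, excludes their reciprocals, and contains $p^iq^jt\,\overline{\Omega_{C_p}}$, for all $i,j\ge0$. **Proposition.** The point $0$ is a limit point of $G$. Contours $C_p$ as above exist for all $p\in G$ with $|p|<1$, and contours $C$ as below exist. For all such contours, as $p\to0$ in $G$, $$\lim_{p\to0}p^{-val(f)-val(g)}\langle f,g\rangle_{t_rp^{\alpha_r}}=\frac{(q;q)^n\prod_{j=1}^n(t^j;q)\prod_{\substack{r<s;\ r,s\in T\\ \alpha_r+\alpha_s=-1}}(t^{n-j}t_rt_s;q)\prod_{\substack{r\in T,\,s\notin T\\ \alpha_r+\alpha_s=0}}(t^{n-j}t_rt_s;q)}{n!(t;q)^n\prod_{j=1}^n\prod_{\substack{r<s;\ r,s\in T\\ \alpha_r+\alpha_s=0}}(qt^{j-n}t_r^{-1}t_s^{-1};q)\prod_{\substack{r<s\\ \alpha_r+\alpha_s=1}}(qt^{j-n}t_r^{-1}t_s^{-1};q)}$$ $$\times\int_{C^n}lc(f)(z)\,lc(g)(z)\prod_{1\le j<k\le n}\frac{(z_j/z_k,z_k/z_j;q)}{(tz_j/z_k,tz_k/z_j;q)}\left(\frac{(z_jz_k,qz_jz_k/t;q)}{(tz_jz_k,qz_jz_k;q)}\right)^{1_{\zeta=-1/2}}$$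 $$\times\prod_{j=1}^n\frac{\prod_{r\in T,\,\alpha_r=-\zeta}(q/t_rz_j;q)\prod_{r\notin T,\,\alpha_r=1+\zeta}(qz_j/t_r;q)}{\prod_{r\in T,\,\alpha_r=\zeta}(t_r/z_j;q)\prod_{r\notin T,\,\alpha_r=-\zeta}(t_rz_j;q)}\left(\frac{(z_j^2;q)\prod_{r\in T,\,\alpha_r=1/2}(qz_j/t_r;q)}{(qz_j^2;q)\prod_{r\in T,\,\alpha_r=-1/2}(t_rz_j;q)}\right)^{1_{\zeta=-1/2}}\theta(qt^{1-n}z_j/t_at_bt_c;q)\frac{dz_j}{2\pi iz_j}.$$ In the numerator and in the denominator of the constant, the product over $j$ extends over all factors that follow it. Here $C$ is any contour that, for all $j\ge0$, contains the points $q^j\tilde t_r$ with $r\in T$, $\alpha_r=\zeta$, excludes the points $q^{-j}/\tilde t_r$ with $r\notin T$, $\alpha_r=-\zeta$, and contains $q^jt\,\overline{\Omega_C}$. If $\zeta=-\frac12$, then $C$ must also exclude, for all $j\ge0$, the points $q^{-j}/\tilde t_r$ with $r\in T$, $\alpha_r=-\frac12$, and the points $(q^jtw)^{-1}$ with $0\ne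 w\in\overline{\Omega_C}$. -/

import Mathlib

open Filter Topology

noncomputable section

namespace EllipticSelberg

/-! ### Univariate symbols -/

/-- The infinite `q`-symbol `(x;q) = ∏_{r ≥ 0} (1 - x q^r)`. -/
def qPoch (x q : ℂ) : ℂ := ∏' r : ℕ, (1 - x * q ^ r)

/-- The double product `(x;p,q) = ∏_{i,j ≥ 0} (1 - x p^i q^j)`. -/
def pqPoch (x p q : ℂ) : ℂ := ∏' r : ℕ × ℕ, (1 - x * p ^ r.1 * q ^ r.2)

/-- The theta function `θ(x;p) = (x, p/x; p)`. -/
def theta (x p : ℂ) : ℂ := qPoch x p * qPoch (p / x) p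

/-- The theta Pochhammer symbol `θ(x;q;p)_m = ∏_{0 ≤ r < m} θ(x q^r; p)`. -/
def thetaPoch (x q p : ℂ) (m : ℕ) : ℂ := ∏ r ∈ Finset.range m, theta (x * q ^ r) p

/-- The elliptic gamma function
`Γ(x;p,q) = ∏_{i,j ≥ 0} (1 - p^{i+1} q^{j+1} / x) / (1 - p^i q^j x)`. -/
def ellGamma (x p q : ℂ) : ℂ := pqPoch (p * q / x) p q / pqPoch x p q

/-! ### Power series in real powers of `p` with rational coefficients

Powers `p ^ (s : ℂ)` of the complex number `p` are taken with the principal branch. -/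

/-- Rational functions in `n` variables over `ℂ`. -/
abbrev RatFun (n : ℕ) := FractionRing (MvPolynomial (Fin n) ℂ)

/-- The denominator of a rational function in lowest terms, as a function. -/
def RatFun.denEval {n : ℕ} (r : RatFun n) (z : Fin n → ℂ) : ℂ :=
  MvPolynomial.eval z (IsFractionRing.den (MvPolynomial (Fin n) ℂ) r : MvPolynomial (Fin n) ℂ)

/-- The value of a rational function, written in lowest terms, at a point. -/
def RatFun.eval {n : ℕ} (r : RatFun n) (z : Fin n → ℂ) : ℂ :=
  MvPolynomial.eval z (IsFractionRing.num (MvPolynomial (Fin n) ℂ) r) / RatFun.denEval r z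

/-- The family `F p` of functions on `(ℂ^*)^n` is represented, for small `p`, by the series
`∑_s a_s(z) p^s`. The exponents form a closed discrete subset of `ℝ` that is bounded below,
the coefficients are rational functions, and the series converges normally on compact sets
outside the zero set of some nonzero polynomial. -/
structure HasPSeries {n : ℕ} (F : ℂ → (Fin n → ℂ) → ℂ) (a : ℝ → RatFun n) : Prop where
  discrete : ∀ B : ℝ, {s : ℝ | s ≤ B ∧ a s ≠ 0}.Finite
  converges : ∃ P : MvPolynomial (Fin n) ℂ, P ≠ 0 ∧
    (∀ (s : ℝ) (z : Fin n → ℂ), MvPolynomial.eval z P ≠ 0 → (a s).denEval z ≠ 0) ∧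
    ∀ K : Set (Fin n → ℂ), IsCompact K →
      (∀ z ∈ K, (∀ i, z i ≠ 0) ∧ MvPolynomial.eval z P ≠ 0) →
      ∃ δ : ℝ, 0 < δ ∧
        (∃ b : ℝ → ℝ, Summable b ∧ ∀ (s : ℝ), ∀ z ∈ K, ‖(a s).eval z‖ * δ ^ s ≤ b s) ∧
        ∀ p : ℂ, 0 < ‖p‖ → ‖p‖ < δ → ∀ z ∈ K,
          HasSum (fun s : ℝ => (a s).eval z * p ^ (s : ℂ)) (F p z)

/-- `v = val(F)` is the least exponent of the series of `F`, and `l = lc(F)` its coefficient. -/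
def HasLeadingTerm {n : ℕ} (F : ℂ → (Fin n → ℂ) → ℂ) (v : ℝ) (l : RatFun n) : Prop :=
  ∃ a : ℝ → RatFun n, HasPSeries F a ∧ IsLeast {s : ℝ | a s ≠ 0} v ∧ l = a v

/-! ### The spaces of functions -/

/-- `∏_i θ(p q z_i^{±1} / u; q; p)_m`. -/
def poleFactor (n m : ℕ) (q p u : ℂ) (z : Fin n → ℂ) : ℂ :=
  ∏ i, (thetaPoch (p * q * z i / u) q p m * thetaPoch (p * q / (z i * u)) q p m)

/-- The points of `(ℂ^*)^n` away from the zeros of `poleFactor`. -/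
def regularSet (n m : ℕ) (q p u : ℂ) : Set (Fin n → ℂ) :=
  {z | (∀ i, z i ≠ 0) ∧ poleFactor n m q p u z ≠ 0}

/-- `f` is a `BC_n`-symmetric `p`-abelian function such that
`∏_i θ(p q z_i^{±1} / u; q; p)_m f(z)` is holomorphic on `(ℂ^*)^n`. The values of `f` at the
zeros of the theta factor are irrelevant. -/
structure MemA (n m : ℕ) (q p u : ℂ) (f : (Fin n → ℂ) → ℂ) : Prop where
  holomorphic : ∃ F : (Fin n → ℂ) → ℂ, DifferentiableOn ℂ F {z | ∀ i, z i ≠ 0} ∧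
    ∀ z ∈ regularSet n m q p u, poleFactor n m q p u z * f z = F z
  perm : ∀ (σ : Equiv.Perm (Fin n)), ∀ z ∈ regularSet n m q p u, f (fun i => z (σ i)) = f z
  inv : ∀ i, ∀ z ∈ regularSet n m q p u, f (Function.update z i (z i)⁻¹) = f z
  shift : ∀ i, ∀ z ∈ regularSet n m q p u, f (Function.update z i (p * z i)) = f z

/-- Families `p ↦ f p ∈ A^{(n)}(u(p);p,q)`, with pole order `m` independent of `p`, which behave
well as `p → 0`: all rescalings `f p (p^{ζ_i} z_i)` have a series in powers of `p`, and `f`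
without its poles grows at most like a power of `1/|p|`. -/
structure MemATilde (n m : ℕ) (q : ℂ) (u : ℂ → ℂ) (f : ℂ → (Fin n → ℂ) → ℂ) : Prop where
  mem : ∀ p : ℂ, 0 < ‖p‖ → ‖p‖ < 1 → MemA n m q p (u p) (f p)
  series : ∀ ξ : Fin n → ℝ, ∃ a : ℝ → RatFun n,
    HasPSeries (fun p z => f p (fun i => p ^ (ξ i : ℂ) * z i)) a
  bound : ∀ M : ℝ, 0 < M → ∀ ξ : ℝ, ∃ C : ℝ, 0 < C ∧ ∃ κ : ℝ,
    ∀ p : ℂ, 0 < ‖p‖ → ‖p‖ < 1 / 2 →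
      (M * ‖p‖ ^ ξ)⁻¹ < ‖u p‖ → ‖u p‖ < M * ‖p‖ ^ ξ →
      ∀ z : Fin n → ℂ, (∀ i, (M * ‖p‖ ^ ξ)⁻¹ < ‖z i‖ ∧ ‖z i‖ < M * ‖p‖ ^ ξ) →
        ‖poleFactor n m q p (u p) z * f p z‖ ≤ C * ‖p‖ ^ (-κ)

/-! ### Integration over chains -/

/-- Integral chains of positively oriented circles, given by centre and radius. -/
abbrev CircleChain := (ℂ × ℝ) →₀ ℤ

/-- The union of the circles of a chain. -/
def carrier (C : CircleChain) : Set ℂ := ⋃ x ∈ C.support, Metric.sphere x.1 x.2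

/-- The winding number of a chain about a point off its circles. -/
def winding (C : CircleChain) (w : ℂ) : ℤ := C.sum fun x k => if ‖w - x.1‖ < x.2 then k else 0

/-- The points which the chain contains. -/
def inside (C : CircleChain) : Set ℂ := {w | w ∉ carrier C ∧ winding C w = 1}

/-- The points which the chain excludes. -/
def outside (C : CircleChain) : Set ℂ := {w | w ∉ carrier C ∧ winding C w = 0}

/-- The chain is the positively oriented boundary of a bounded region containing `0`. -/
structure IsContour (C : CircleChain) : Prop where
  radius_pos : ∀ x ∈ C.support, 0 < x.2
  region : ∀ w, w ∉ carrier C → w ∈ inside C ∨ w ∈ outside C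
  zero_mem : (0 : ℂ) ∈ inside C

/-- The integral `∫_{C^n} F(z) ∏_j dz_j / (2 π i z_j)`. -/
def chainIntegral (n : ℕ) (C : CircleChain) (F : (Fin n → ℂ) → ℂ) : ℂ :=
  ∑ x ∈ Fintype.piFinset (fun _ : Fin n => C.support), (∏ j, (C (x j) : ℂ)) *
    torusIntegral (fun z => F z * ∏ j, (2 * (Real.pi : ℂ) * Complex.I * z j)⁻¹)
      (fun j => (x j).1) (fun j => (x j).2)

/-! ### The continuous bilinear form -/

/-- The genericity conditions on six parameters, where `S` is the set of allowed powers of `p`: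
`S = {p^{-i} : i ≥ 0}` for the elliptic parameters, and `S = {1}` after the limit. -/
def IsGeneric (S : Set ℂ) (q t : ℂ) (τ : Fin 6 → ℂ) : Prop :=
  (∀ r s : Fin 6, r.val ≤ 3 → s.val ≤ 3 → ∀ w ∈ S, ∀ j k : ℕ,
    τ r * τ s ≠ w * (q ^ j)⁻¹ * (t ^ k)⁻¹) ∧
  (∀ r s : Fin 6, (s = 4 ∨ s = 5) → ∀ w ∈ S, ∀ (j : ℤ) (k : ℕ),
    τ r * τ s ≠ w * q ^ j * (t ^ k)⁻¹)

/-- The rescaled parameters `t_r p^{α_r}`. -/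
def scaled (τ : Fin 6 → ℂ) (α : Fin 6 → ℝ) (p : ℂ) : Fin 6 → ℂ := fun r => τ r * p ^ (α r : ℂ)

/-- The values of `p ≠ 0` for which the parameters `t_r p^{α_r}` are generic. -/
def genericSet (q t : ℂ) (τ : Fin 6 → ℂ) (α : Fin 6 → ℝ) : Set ℂ :=
  {p | p ≠ 0 ∧ IsGeneric {w | ∃ i : ℕ, w = (p ^ i)⁻¹} q t (scaled τ α p)}

/-- The parameters `t_0, t_1, t_2, t_3, t_4 q^{-m_f}, t_5 q^{-m_g}`. -/
def tilde (q : ℂ) (mf mg : ℕ) (τ : Fin 6 → ℂ) : Fin 6 → ℂ :=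
  ![τ 0, τ 1, τ 2, τ 3, τ 4 / q ^ mf, τ 5 / q ^ mg]

/-- The contours of the bilinear form: `C = C^{-1}` contains the points `p^i q^j τ_r`, excludes
their reciprocals, and contains `p^i q^j t C` together with its interior. -/
structure IsEllipticContour (q t p : ℂ) (τ : Fin 6 → ℂ) (C : CircleChain) : Prop
    extends IsContour C where
  symmetric : ∀ w : ℂ, w ≠ 0 → (w ∈ inside C ↔ w⁻¹ ∈ outside C)
  contains : ∀ (r : Fin 6) (i j : ℕ), p ^ i * q ^ j * τ r ∈ inside C
  excludes : ∀ (r : Fin 6) (i j : ℕ), (p ^ i * q ^ j * τ r)⁻¹ ∈ outside C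
  cross : ∀ i j : ℕ, ∀ w ∈ carrier C ∪ inside C, p ^ i * q ^ j * t * w ∈ inside C

/-- The integrand `∏_{j<k} Γ(t z_j^{±1} z_k^{±1}) / Γ(z_j^{±1} z_k^{±1})
∏_j ∏_r Γ(t_r z_j^{±1}) / Γ(z_j^{±2})` of the elliptic Selberg integral. -/
def selbergWeight (n : ℕ) (q t p : ℂ) (τ : Fin 6 → ℂ) (z : Fin n → ℂ) : ℂ :=
  (∏ j : Fin n, ∏ k ∈ Finset.Ioi j,
    (ellGamma (t * z j * z k) p q * ellGamma (t * z j / z k) p q *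
      ellGamma (t * z k / z j) p q * ellGamma (t / (z j * z k)) p q) /
    (ellGamma (z j * z k) p q * ellGamma (z j / z k) p q *
      ellGamma (z k / z j) p q * ellGamma (1 / (z j * z k)) p q)) *
  ∏ j : Fin n, (∏ r, ellGamma (τ r * z j) p q * ellGamma (τ r / z j) p q) /
    (ellGamma (z j ^ 2) p q * ellGamma (1 / z j ^ 2) p q)

/-- The bilinear form `⟨f,g⟩_{τ_0,…,τ_5;q,t;p}`, computed with the contour `C`. -/
def bilinearForm (n : ℕ) (q t p : ℂ) (τ : Fin 6 → ℂ) (C : CircleChain)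
    (f g : (Fin n → ℂ) → ℂ) : ℂ :=
  qPoch q q ^ n * qPoch p p ^ n * ellGamma t p q ^ n /
    (2 ^ n * (n.factorial : ℂ) * ∏ j ∈ Finset.Icc 1 n, (ellGamma (t ^ j) p q *
      ∏ r : Fin 6, ∏ s ∈ Finset.Ioi r, ellGamma (t ^ (n - j) * (τ r * τ s)) p q)) *
  chainIntegral n C (fun z => f z * g z * selbergWeight n q t p τ z)

/-! ### The limit -/

/-- The constant in front of the limiting integral; `T = {a,b,c}`. -/
def limitConstant (n : ℕ) (q t : ℂ) (τ : Fin 6 → ℂ) (α : Fin 6 → ℝ) (T : Finset (Fin 6)) : ℂ :=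
  (qPoch q q ^ n * ∏ j ∈ Finset.Icc 1 n, (qPoch (t ^ j) q *
    (∏ x : Fin 6 × Fin 6 with x.1 < x.2 ∧ x.1 ∈ T ∧ x.2 ∈ T ∧ α x.1 + α x.2 = -1,
      qPoch (t ^ (n - j) * (τ x.1 * τ x.2)) q) *
    ∏ x : Fin 6 × Fin 6 with x.1 ∈ T ∧ x.2 ∉ T ∧ α x.1 + α x.2 = 0,
      qPoch (t ^ (n - j) * (τ x.1 * τ x.2)) q)) /
  ((n.factorial : ℂ) * qPoch t q ^ n * ∏ j ∈ Finset.Icc 1 n,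
    ((∏ x : Fin 6 × Fin 6 with x.1 < x.2 ∧ x.1 ∈ T ∧ x.2 ∈ T ∧ α x.1 + α x.2 = 0,
      qPoch (q / (t ^ (n - j) * (τ x.1 * τ x.2))) q) *
    ∏ x : Fin 6 × Fin 6 with x.1 < x.2 ∧ α x.1 + α x.2 = 1,
      qPoch (q / (t ^ (n - j) * (τ x.1 * τ x.2))) q))

/-- The limiting weight function, including the theta factors
`θ(q t^{1-n} z_j / (t_a t_b t_c); q)`; `T = {a,b,c}`. -/
def limitWeight (n : ℕ) (q t : ℂ) (τ : Fin 6 → ℂ) (α : Fin 6 → ℝ) (ζ : ℝ) (T : Finset (Fin 6))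
    (z : Fin n → ℂ) : ℂ :=
  (∏ j : Fin n, ∏ k ∈ Finset.Ioi j,
    (qPoch (z j / z k) q * qPoch (z k / z j) q) /
      (qPoch (t * z j / z k) q * qPoch (t * z k / z j) q) *
    if ζ = -1 / 2 then
      (qPoch (z j * z k) q * qPoch (q * z j * z k / t) q) /
        (qPoch (t * z j * z k) q * qPoch (q * z j * z k) q)
    else 1) *
  ∏ j : Fin n,
    (((∏ r : Fin 6 with r ∈ T ∧ α r + ζ = 0, qPoch (q / (τ r * z j)) q) *
      ∏ r : Fin 6 with r ∉ T ∧ α r = 1 + ζ, qPoch (q * z j / τ r) q) /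
    ((∏ r : Fin 6 with r ∈ T ∧ α r = ζ, qPoch (τ r / z j) q) *
      ∏ r : Fin 6 with r ∉ T ∧ α r = -ζ, qPoch (τ r * z j) q) *
    (if ζ = -1 / 2 then
      (qPoch (z j ^ 2) q * ∏ r : Fin 6 with r ∈ T ∧ α r = 1 / 2, qPoch (q * z j / τ r) q) /
        (qPoch (q * z j ^ 2) q * ∏ r : Fin 6 with r ∈ T ∧ α r = -1 / 2, qPoch (τ r * z j) q)
    else 1) *
    theta (q * z j / (t ^ (n - 1) * ∏ r ∈ T, τ r)) q)

/-- The contours of the limiting integral: `C` separates the pole sequences of the integrand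
which are to be contained from those which are to be excluded; here `τ` stands for the shifted
parameters and `T = {a,b,c}`. -/
structure IsLimitContour (q t : ℂ) (τ : Fin 6 → ℂ) (α : Fin 6 → ℝ) (ζ : ℝ) (T : Finset (Fin 6))
    (C : CircleChain) : Prop extends IsContour C where
  contains : ∀ r ∈ T, α r = ζ → ∀ j : ℕ, q ^ j * τ r ∈ inside C
  excludes : ∀ r ∉ T, α r = -ζ → ∀ j : ℕ, (q ^ j * τ r)⁻¹ ∈ outside C
  cross : ∀ j : ℕ, ∀ w ∈ carrier C ∪ inside C, q ^ j * t * w ∈ inside C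
  excludes_half : ζ = -1 / 2 → ∀ r ∈ T, α r = -1 / 2 → ∀ j : ℕ, (q ^ j * τ r)⁻¹ ∈ outside C
  cross_half : ζ = -1 / 2 → ∀ j : ℕ, ∀ w ∈ carrier C ∪ inside C, w ≠ 0 →
    (q ^ j * t * w)⁻¹ ∈ outside C

end EllipticSelberg

end

open EllipticSelberg

/-!
The proof breaks the symmetry of the integrand under `z_j → 1 / z_j`, after which the rescaled
integrand has a pointwise limit, and moves the contour to a rescaled contour of the limiting
integral.

**Breaking the symmetry.** Multiply the weight by `∏_j ∏_{r<4} θ(u_r z_j; q) / θ(z_j^2; q) ∏_{j<k}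
θ(t z_j z_k; q) / θ(z_j z_k; q)` with `(u_0, u_1, u_2, u_3) = (τ_a, τ_b, τ_c, q / (t^{n-1} τ_a τ_b
τ_c))`. Summed over all sign changes `z_j → z_j^{±1}`, this factor is a product of theta functions
of the pairs in `T = {a, b, c}`, which does not depend on `z` (`sum_breakingFactor`). As `C_p =
C_p⁻¹`, all terms of the sum have the same integral, so that the bilinear form is `2^n` times the
integral of the modified integrand, divided by this constant
(`IsEllipticContour.const_mul_chainIntegral`). The functional equation `Γ(p x) = θ(x; q) Γ(x)`
turns the gamma factors `Γ(τ_r z_j)` with `r ∈ T` into `Γ(p τ_r z_j)`, and `Γ(t z_j z_k)` into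
`Γ(p t z_j z_k)`. Writing `f` and `g` as holomorphic functions divided by their theta factors
amounts to the passage from `τ_r` to the parameters `tilde` (`brokenWeight_mul_poleFactor`).

**Moving the contour.** Let `C` be a contour of the limiting integral. For small `p`, the contour
`p^ζ C` separates the poles of the modified integrand in the same way as `C_p`
(`IsLimitContour.eventually_separates`), although it is not invariant under inversion. In several
variables it is not obvious that two such contours give the same integral, since the contours
cannot be moved in one variable at a time without crossing the divisors `z_j = s z_k`. Integrals
over contours are therefore rewritten as area integrals against `∂χ/∂z̄` for a cutoff function `χ`
of the enclosed region. Two regions are connected by regions which agree with their union near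
`0`, with one of the two in an annulus, and with their intersection near infinity. As the products
`p^i q^j t` have absolute value bounded by a number less than `1`, these still separate the poles,
and finitely many steps lead from one region to the other (`Separates.inter`,
`iterInt_eq_of_separates_of_separates`). In each step one may exchange the variables one at a
time.

**The limit.** After rescaling by `p^ζ`, all gamma factors have the form `Γ(x p^s)` with `0 ≤ s ≤
1`, and tend to `(q/x; q)` for `s = 1`, to `1 / (x; q)` for `s = 0`, and to `1` otherwise
(`tendsto_ellGamma_cpow`). The functions `f` and `g` converge off the zero set of a polynomial
only, but the holomorphic integrand is bounded near the contour by the maximum principle on small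
discs whose boundary circles avoid this zero set (`exists_bound_of_bound_off_zeros`). Hence the
integrals converge, by dominated convergence (`IsLimitContour.tendsto_chainIntegral_rescaled`). In
the normalizing constant, the theta functions of the pairs in `T` turn `Γ(t^{n-j} τ_r τ_s)` into
`Γ(p t^{n-j} τ_r τ_s)`, so that all exponents of `p` are again in `[0, 1]`
(`IsDenGeneric.tendsto_constant`).

**Existence.** The contours consist of a circle through `1` and `-1` with `0` inside, small
circles around finitely many poles outside of it, and the images of these under inversion
(`exists_symmetric_contour`, which for `p = 0` gives the contours of the limiting integral). The
absolute values of the non-generic `p` form a countable set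
(`exists_countable_norm_notMem_genericSet`).
-/

open Filter Topology

noncomputable section

namespace EllipticSelberg

/-! ### Infinite products -/

lemma summable_norm_pqPoch {p q : ℂ} (hp : ‖p‖ < 1) (hq : ‖q‖ < 1) (x : ℂ) :
    Summable fun r : ℕ × ℕ => ‖-(x * p ^ r.1 * q ^ r.2)‖ := by
  have h := (Summable.mul_of_nonneg (summable_geometric_of_lt_one (norm_nonneg p) hp)
    (summable_geometric_of_lt_one (norm_nonneg q) hq)
    (fun _ => by positivity) (fun _ => by positivity)).mul_left ‖x‖
  refine h.congr fun r => ?_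
  simp only [norm_neg, norm_mul, norm_pow]
  ring

lemma multipliable_pqPoch {p q : ℂ} (hp : ‖p‖ < 1) (hq : ‖q‖ < 1) (x : ℂ) :
    Multipliable fun r : ℕ × ℕ => 1 - x * p ^ r.1 * q ^ r.2 := by
  simpa [sub_eq_add_neg] using multipliable_one_add_of_summable (summable_norm_pqPoch hp hq x)

lemma summable_norm_qPoch {q : ℂ} (hq : ‖q‖ < 1) (x : ℂ) :
    Summable fun r : ℕ => ‖-(x * q ^ r)‖ := by
  refine ((summable_geometric_of_lt_one (norm_nonneg q) hq).mul_left ‖x‖).congr fun r => ?_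
  simp

lemma multipliable_qPoch {q : ℂ} (hq : ‖q‖ < 1) (x : ℂ) :
    Multipliable fun r : ℕ => 1 - x * q ^ r := by
  simpa [sub_eq_add_neg] using multipliable_one_add_of_summable (summable_norm_qPoch hq x)

lemma qPoch_eq_mul {q : ℂ} (hq : ‖q‖ < 1) (x : ℂ) :
    qPoch x q = (1 - x) * qPoch (q * x) q := by
  unfold qPoch
  have h : Multipliable fun r : ℕ => 1 - x * q ^ (r + 1) := by
    refine (multipliable_qPoch hq (q * x)).congr fun r => ?_
    ring
  have e := tprod_eq_zero_mul' (f := fun r : ℕ => 1 - x * q ^ r) h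
  rw [e, pow_zero, mul_one]
  exact congrArg _ (tprod_congr fun r => by ring)

lemma pqPoch_comm (x p q : ℂ) : pqPoch x p q = pqPoch x q p := by
  unfold pqPoch
  rw [← (Equiv.prodComm ℕ ℕ).tprod_eq]
  congr 1
  funext r
  simp only [Equiv.prodComm_apply, Prod.fst_swap, Prod.snd_swap]
  ring

lemma pqPoch_eq_mul {p q : ℂ} (hp : ‖p‖ < 1) (hq : ‖q‖ < 1) (x : ℂ) :
    pqPoch x p q = qPoch x q * pqPoch (p * x) p q := by
  have key : ∀ y : ℂ, pqPoch y p q = ∏' i : ℕ, qPoch (y * p ^ i) q := fun y =>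
    (multipliable_pqPoch hp hq y).tprod_prod' fun i => multipliable_qPoch hq (y * p ^ i)
  have h : Multipliable fun i : ℕ => qPoch (x * p ^ (i + 1)) q := by
    have h1 := (multipliable_pqPoch hp hq (p * x)).hasProd.prod_fiberwise
      fun i => (multipliable_qPoch hq (p * x * p ^ i)).hasProd
    refine h1.multipliable.congr fun i => ?_
    unfold qPoch
    congr 1
    funext r
    ring
  have e := tprod_eq_zero_mul' (f := fun i : ℕ => qPoch (x * p ^ i) q) h
  rw [key, e, pow_zero, mul_one, key]
  exact congrArg _ (tprod_congr fun r => by ring_nf)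

/-- The convention `0 ^ 0 = 1` makes `(x; 0, q)` equal to `(x; q)`, so that the limit `p → 0` is
a matter of continuity. -/
lemma pqPoch_zero_left {q : ℂ} (hq : ‖q‖ < 1) (x : ℂ) : pqPoch x 0 q = qPoch x q := by
  rw [pqPoch_eq_mul (by simp) hq]
  simp [pqPoch]


@[simp] lemma qPoch_zero (q : ℂ) : qPoch 0 q = 1 := by simp [qPoch]


lemma pqPoch_ne_zero_iff {p q : ℂ} (hp : ‖p‖ < 1) (hq : ‖q‖ < 1) (x : ℂ) :
    pqPoch x p q ≠ 0 ↔ ∀ i j : ℕ, x * p ^ i * q ^ j ≠ 1 := by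
  constructor
  · intro h i j hij
    refine h (tprod_of_exists_eq_zero ⟨(i, j), ?_⟩)
    simp [hij]
  · intro h
    have := tprod_one_add_ne_zero_of_summable (f := fun r : ℕ × ℕ => -(x * p ^ r.1 * q ^ r.2))
      (fun r => by
        rw [← sub_eq_add_neg, sub_ne_zero]
        exact (h r.1 r.2).symm) (summable_norm_pqPoch hp hq x)
    simpa [pqPoch, sub_eq_add_neg] using this

lemma qPoch_ne_zero_iff {q : ℂ} (hq : ‖q‖ < 1) (x : ℂ) :
    qPoch x q ≠ 0 ↔ ∀ j : ℕ, x * q ^ j ≠ 1 := by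
  rw [← pqPoch_zero_left hq, pqPoch_ne_zero_iff (by simp) hq]
  refine ⟨fun h j => by simpa using h 0 j, fun h i j => ?_⟩
  rcases i with _ | i
  · simpa using h j
  · simp

lemma pqPoch_ne_zero_of_norm_lt {p q x : ℂ} (hp : ‖p‖ < 1) (hq : ‖q‖ < 1) (hx : ‖x‖ < 1) :
    pqPoch x p q ≠ 0 := by
  rw [pqPoch_ne_zero_iff hp hq]
  intro i j h
  have h1 := congrArg norm h
  rw [norm_mul, norm_mul, norm_pow, norm_pow, norm_one] at h1
  have h2 : ‖p‖ ^ i ≤ 1 := pow_le_one₀ (norm_nonneg _) hp.le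
  have h3 : ‖q‖ ^ j ≤ 1 := pow_le_one₀ (norm_nonneg _) hq.le
  have h4 : ‖x‖ * ‖p‖ ^ i * ‖q‖ ^ j ≤ ‖x‖ * 1 * 1 := by gcongr
  linarith

lemma qPoch_ne_zero_of_norm_lt {q x : ℂ} (hq : ‖q‖ < 1) (hx : ‖x‖ < 1) : qPoch x q ≠ 0 := by
  rw [← pqPoch_zero_left hq]
  exact pqPoch_ne_zero_of_norm_lt (by simp) hq hx

/-- The double product converges locally uniformly in all three variables jointly; this gives its
continuity at `p = 0`. -/
lemma hasProdLocallyUniformlyOn_pqPoch (R ρ σ : ℝ) (hρ : ρ < 1) (hσ : σ < 1) :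
    HasProdLocallyUniformlyOn
      (fun (r : ℕ × ℕ) (w : ℂ × ℂ × ℂ) => 1 + -(w.1 * w.2.1 ^ r.1 * w.2.2 ^ r.2))
      (fun w => ∏' r : ℕ × ℕ, (1 + -(w.1 * w.2.1 ^ r.1 * w.2.2 ^ r.2)))
      {w | ‖w.1‖ < R ∧ ‖w.2.1‖ < ρ ∧ ‖w.2.2‖ < σ} := by
  rcases lt_or_ge 0 ρ with h0 | h0
  swap
  · have : {w : ℂ × ℂ × ℂ | ‖w.1‖ < R ∧ ‖w.2.1‖ < ρ ∧ ‖w.2.2‖ < σ} = ∅ := by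
      ext w
      simp only [Set.mem_ofPred_eq, Set.mem_empty_iff_false, iff_false]
      rintro ⟨_, h, _⟩
      linarith [norm_nonneg w.2.1]
    rw [this]
    exact hasProdLocallyUniformlyOn_of_of_forall_exists_nhds (by simp)
  rcases lt_or_ge 0 σ with h1 | h1
  swap
  · have : {w : ℂ × ℂ × ℂ | ‖w.1‖ < R ∧ ‖w.2.1‖ < ρ ∧ ‖w.2.2‖ < σ} = ∅ := by
      ext w
      simp only [Set.mem_ofPred_eq, Set.mem_empty_iff_false, iff_false]
      rintro ⟨_, _, h⟩
      linarith [norm_nonneg w.2.2]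
    rw [this]
    exact hasProdLocallyUniformlyOn_of_of_forall_exists_nhds (by simp)
  refine Summable.hasProdLocallyUniformlyOn_one_add (u := fun r => R * (ρ ^ r.1 * σ ^ r.2)) ?_ ?_ ?_
      ?_
  · refine (isOpen_lt (by fun_prop) (by fun_prop)).and
      ((isOpen_lt (by fun_prop) (by fun_prop)).and (isOpen_lt (by fun_prop) (by fun_prop)))
  · exact (Summable.mul_of_nonneg (summable_geometric_of_lt_one h0.le hρ)
      (summable_geometric_of_lt_one h1.le hσ)
      (fun _ => by positivity) (fun _ => by positivity)).mul_left R
  · refine Eventually.of_forall fun r w hw => ?_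
    rw [norm_neg, norm_mul, norm_mul, norm_pow, norm_pow, mul_assoc]
    have := hw.1.le
    have := hw.2.1.le
    have := hw.2.2.le
    have : 0 ≤ R := (norm_nonneg _).trans hw.1.le
    gcongr
  · intro r
    fun_prop

lemma continuousAt_pqPoch_joint {x p q : ℂ} (hp : ‖p‖ < 1) (hq : ‖q‖ < 1) :
    ContinuousAt (fun w : ℂ × ℂ × ℂ => pqPoch w.1 w.2.1 w.2.2) (x, p, q) := by
  obtain ⟨ρ, hρ, hρ1⟩ := exists_between hp
  obtain ⟨σ, hσ, hσ1⟩ := exists_between hq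
  have h := (hasProdLocallyUniformlyOn_pqPoch (‖x‖ + 1) ρ σ hρ1 hσ1)
  have h2 : ContinuousOn (fun w : ℂ × ℂ × ℂ => pqPoch w.1 w.2.1 w.2.2)
      {w | ‖w.1‖ < ‖x‖ + 1 ∧ ‖w.2.1‖ < ρ ∧ ‖w.2.2‖ < σ} := by
    have h3 := (hasProdLocallyUniformlyOn_iff_tendstoLocallyUniformlyOn.1 h).continuousOn
      (Eventually.of_forall fun s => by fun_prop).frequently
    simpa [pqPoch, sub_eq_add_neg] using h3
  refine h2.continuousAt (IsOpen.mem_nhds ?_ ⟨by simp, hρ, hσ⟩)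
  refine (isOpen_lt (by fun_prop) (by fun_prop)).and
      ((isOpen_lt (by fun_prop) (by fun_prop)).and (isOpen_lt (by fun_prop) (by fun_prop)))

lemma Tendsto.pqPoch {α : Type*} {l : Filter α} {x p q : α → ℂ} {x₀ p₀ q₀ : ℂ}
    (hx : Tendsto x l (𝓝 x₀)) (hp : Tendsto p l (𝓝 p₀)) (hq : Tendsto q l (𝓝 q₀))
    (hp1 : ‖p₀‖ < 1) (hq1 : ‖q₀‖ < 1) :
    Tendsto (fun a => pqPoch (x a) (p a) (q a)) l (𝓝 (pqPoch x₀ p₀ q₀)) :=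
  Filter.Tendsto.comp (f := fun a => (x a, p a, q a))
    (continuousAt_pqPoch_joint hp1 hq1) (hx.prodMk_nhds (hp.prodMk_nhds hq))

lemma differentiable_pqPoch {p q : ℂ} (hp : ‖p‖ < 1) (hq : ‖q‖ < 1) :
    Differentiable ℂ fun x => pqPoch x p q := by
  intro x
  have h : HasProdLocallyUniformlyOn
      (fun (r : ℕ × ℕ) (x : ℂ) => 1 + -(x * p ^ r.1 * q ^ r.2))
      (fun x => ∏' r : ℕ × ℕ, (1 + -(x * p ^ r.1 * q ^ r.2))) (Metric.ball 0 (‖x‖ + 1)) := by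
    refine Summable.hasProdLocallyUniformlyOn_one_add
      (u := fun r => (‖x‖ + 1) * (‖p‖ ^ r.1 * ‖q‖ ^ r.2)) Metric.isOpen_ball ?_ ?_ ?_
    · exact (Summable.mul_of_nonneg (summable_geometric_of_lt_one (norm_nonneg _) hp)
        (summable_geometric_of_lt_one (norm_nonneg _) hq)
        (fun _ => by positivity) (fun _ => by positivity)).mul_left _
    · refine Eventually.of_forall fun r w hw => ?_
      rw [norm_neg, norm_mul, norm_mul, norm_pow, norm_pow, mul_assoc]
      have : ‖w‖ ≤ ‖x‖ + 1 := (mem_ball_zero_iff.1 hw).le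
      gcongr
    · intro r
      fun_prop
  have h2 := (hasProdLocallyUniformlyOn_iff_tendstoLocallyUniformlyOn.1 h).differentiableOn
    (Eventually.of_forall fun s => by fun_prop) Metric.isOpen_ball
  have h3 : DifferentiableAt ℂ (fun x => ∏' r : ℕ × ℕ, (1 + -(x * p ^ r.1 * q ^ r.2))) x :=
    h2.differentiableAt (Metric.isOpen_ball.mem_nhds (by simp))
  simpa [pqPoch, sub_eq_add_neg] using h3

lemma differentiable_qPoch {q : ℂ} (hq : ‖q‖ < 1) : Differentiable ℂ fun x => qPoch x q := by
  simpa only [pqPoch_zero_left hq] using differentiable_pqPoch (p := 0) (by simp) hq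

lemma Tendsto.qPoch {α : Type*} {l : Filter α} {x q : α → ℂ} {x₀ q₀ : ℂ}
    (hx : Tendsto x l (𝓝 x₀)) (hq : Tendsto q l (𝓝 q₀)) (hq1 : ‖q₀‖ < 1) :
    Tendsto (fun a => qPoch (x a) (q a)) l (𝓝 (qPoch x₀ q₀)) := by
  have h := Tendsto.pqPoch hx (tendsto_const_nhds (x := (0 : ℂ))) hq (by simp) hq1
  rw [pqPoch_zero_left hq1] at h
  refine h.congr' ?_
  filter_upwards [hq.norm.eventually (gt_mem_nhds hq1)] with a ha
  exact pqPoch_zero_left ha _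


/-! ### Theta functions and elliptic gamma functions -/

lemma theta_inv_mul (x : ℂ) {p : ℂ} (hp0 : p ≠ 0) : theta (p / x) p = theta x p := by
  unfold theta
  rcases eq_or_ne x 0 with rfl | hx
  · simp
  · rw [mul_comm]
    congr 2
    field_simp

lemma theta_mul_left {x p : ℂ} (hp : ‖p‖ < 1) (hp0 : p ≠ 0) (hx : x ≠ 0) :
    theta (p * x) p = -x⁻¹ * theta x p := by
  unfold theta
  rw [qPoch_eq_mul hp x, show p / (p * x) = x⁻¹ by field_simp, qPoch_eq_mul hp x⁻¹]
  rw [div_eq_mul_inv p x]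
  field_simp
  ring


lemma theta_ne_zero_iff {x p : ℂ} (hp : ‖p‖ < 1) (hp0 : p ≠ 0) (hx : x ≠ 0) :
    theta x p ≠ 0 ↔ ∀ k : ℤ, x ≠ p ^ k := by
  unfold theta
  rw [mul_ne_zero_iff, qPoch_ne_zero_iff hp, qPoch_ne_zero_iff hp]
  constructor
  · rintro ⟨h1, h2⟩ k rfl
    rcases le_or_gt k 0 with hk | hk
    · obtain ⟨m, rfl⟩ : ∃ m : ℕ, k = -m := ⟨(-k).toNat, by omega⟩
      refine h1 m ?_
      rw [← zpow_natCast, ← zpow_add₀ hp0, neg_add_cancel, zpow_zero]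
    · obtain ⟨m, rfl⟩ : ∃ m : ℕ, k = m + 1 := ⟨(k - 1).toNat, by omega⟩
      refine h2 m ?_
      rw [zpow_add₀ hp0, zpow_natCast, zpow_one]
      field_simp
  · intro h
    refine ⟨fun j hj => h (-(j : ℤ)) ?_, fun j hj => h (j + 1 : ℤ) ?_⟩
    · rw [zpow_neg, zpow_natCast]
      exact eq_inv_of_mul_eq_one_left hj
    · rw [div_mul_eq_mul_div, div_eq_one_iff_eq hx] at hj
      rw [zpow_add₀ hp0, zpow_natCast, ← hj, zpow_one, mul_comm]

lemma theta_one (p : ℂ) : theta 1 p = 0 := by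
  unfold theta
  rw [show qPoch 1 p = 0 from tprod_of_exists_eq_zero ⟨0, by simp⟩, zero_mul]

lemma differentiableAt_theta {x p : ℂ} (hp : ‖p‖ < 1) (hx : x ≠ 0) :
    DifferentiableAt ℂ (fun x => theta x p) x := by
  unfold theta
  exact ((differentiable_qPoch hp) x).mul
    (((differentiable_qPoch hp) (p / x)).comp x ((differentiableAt_const p).div differentiableAt_id
        hx))

/-- The zeros of the denominator of `Γ(x; p, q)` are its poles. -/
lemma differentiableAt_ellGamma {x p q : ℂ} (hp : ‖p‖ < 1) (hq : ‖q‖ < 1) (hx : x ≠ 0)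
    (h : pqPoch x p q ≠ 0) : DifferentiableAt ℂ (fun x => ellGamma x p q) x := by
  unfold ellGamma
  exact (((differentiable_pqPoch hp hq) (p * q / x)).comp x
    ((differentiableAt_const (p * q)).div differentiableAt_id hx)).div
      (differentiable_pqPoch hp hq x) h

lemma ellGamma_comm (x p q : ℂ) : ellGamma x p q = ellGamma x q p := by
  unfold ellGamma
  rw [pqPoch_comm, pqPoch_comm x, mul_comm p q]

/-- The functional equation of the elliptic gamma function. -/
lemma ellGamma_mul_left {x p q : ℂ} (hp : ‖p‖ < 1) (hq : ‖q‖ < 1) (hp0 : p ≠ 0)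
    (h : qPoch x q ≠ 0) : ellGamma (p * x) p q = theta x q * ellGamma x p q := by
  unfold ellGamma theta
  rw [pqPoch_eq_mul hp hq x, show p * q / (p * x) = q / x by field_simp,
    pqPoch_eq_mul hp hq (q / x), show p * (q / x) = p * q / x by ring]
  field_simp

/-- The reflection of the reciprocal gamma function, which turns the denominators of the weight
function into theta functions. -/
lemma ellGamma_mul_ellGamma_inv {x p q : ℂ} (hp : ‖p‖ < 1) (hq : ‖q‖ < 1)
    (hx : x ≠ 0) (h1 : pqPoch (p * q * x) p q ≠ 0) (h2 : pqPoch (p * q / x) p q ≠ 0) :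
    (ellGamma x p q * ellGamma (1 / x) p q)⁻¹ = theta x p * theta (1 / x) q := by
  have e1 : pqPoch x p q = qPoch x p * (qPoch (q * x) q * pqPoch (p * q * x) p q) := by
    rw [pqPoch_comm x, pqPoch_eq_mul hq hp x, pqPoch_comm, pqPoch_eq_mul hp hq (q * x),
      show p * (q * x) = p * q * x by ring]
  have e2 : pqPoch (1 / x) p q = qPoch (1 / x) q * (qPoch (p / x) p * pqPoch (p * q / x) p q) := by
    rw [pqPoch_eq_mul hp hq (1 / x), show p * (1 / x) = p / x by ring, pqPoch_comm,
      pqPoch_eq_mul hq hp (p / x), pqPoch_comm, show q * (p / x) = p * q / x by ring]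
  unfold ellGamma theta
  rw [e1, e2, show p * q / (1 / x) = p * q * x by field_simp,
    show q / (1 / x) = q * x by field_simp, mul_inv, inv_div, inv_div]
  generalize pqPoch (p * q * x) p q = A at *
  generalize pqPoch (p * q / x) p q = B at *
  field_simp

/-! ### Theta functions of one variable -/

lemma hasDerivAt_theta_ne_zero {q : ℂ} (hq : ‖q‖ < 1) (hq0 : q ≠ 0) (k : ℤ) :
    deriv (fun x => theta x q) (q ^ k) ≠ 0 := by
  have hd : ∀ x : ℂ, x ≠ 0 → DifferentiableAt ℂ (fun x => theta x q) x :=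
    fun x hx => differentiableAt_theta hq hx
  have hz : ∀ k : ℤ, theta (q ^ k) q = 0 := fun k => by
    by_contra h
    exact (theta_ne_zero_iff hq hq0 (zpow_ne_zero k hq0)).1 h k rfl
  have step : ∀ k : ℤ, q * deriv (fun x => theta x q) (q ^ (k + 1)) =
      -(q ^ k)⁻¹ * deriv (fun x => theta x q) (q ^ k) := by
    intro k
    have hk := zpow_ne_zero k hq0
    have h1 : HasDerivAt (fun x => theta (q * x) q)
        (deriv (fun x => theta x q) (q * q ^ k) * (q * 1)) (q ^ k) :=
      HasDerivAt.comp (h₂ := fun x => theta x q) (q ^ k)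
        (hd _ (mul_ne_zero hq0 hk)).hasDerivAt ((hasDerivAt_id (q ^ k)).const_mul q)
    have h2 : HasDerivAt (fun x => -x⁻¹ * theta x q)
        (-(-(q ^ k ^ 2)⁻¹) * theta (q ^ k) q + -(q ^ k)⁻¹ * deriv (fun x => theta x q) (q ^ k))
        (q ^ k) := by
      have := ((hasDerivAt_inv hk).neg).mul (hd _ hk).hasDerivAt
      simp only [hz, mul_zero, zero_add] at this ⊢
      exact this
    have h3 : (fun x => theta (q * x) q) =ᶠ[𝓝 (q ^ k)] fun x => -x⁻¹ * theta x q := by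
      filter_upwards [isOpen_ne.mem_nhds hk] with x hx
      exact theta_mul_left hq hq0 hx
    have := (h1.congr_of_eventuallyEq h3.symm).unique h2
    rw [hz, mul_zero, zero_add] at this
    rw [← this, zpow_add₀ hq0, zpow_one, mul_comm q (q ^ k)]
    ring
  have h0 : deriv (fun x => theta x q) (q ^ (0 : ℤ)) ≠ 0 := by
    have e : (fun x => theta x q) = fun x => (1 - x) * (qPoch (q * x) q * qPoch (q / x) q) := by
      funext x
      rw [theta, qPoch_eq_mul hq x, mul_assoc]
    have hg : DifferentiableAt ℂ (fun x => qPoch (q * x) q * qPoch (q / x) q) 1 :=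
      ((differentiable_qPoch hq _).comp (1 : ℂ) ((differentiableAt_id).const_mul q)).mul
        ((differentiable_qPoch hq _).comp (1 : ℂ)
          ((differentiableAt_const q).div differentiableAt_id one_ne_zero))
    have h1 : HasDerivAt (fun x : ℂ => (1 - x) * (qPoch (q * x) q * qPoch (q / x) q)) _ 1 :=
      ((hasDerivAt_id (1 : ℂ)).const_sub 1).mul hg.hasDerivAt
    rw [zpow_zero, e, h1.deriv]
    have hqq : qPoch q q ≠ 0 := qPoch_ne_zero_of_norm_lt hq hq
    simpa using hqq
  induction k with
  | zero => exact h0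
  | succ k ih =>
    have := step k
    intro h
    rw [h, mul_zero] at this
    exact mul_ne_zero (neg_ne_zero.2 (inv_ne_zero (zpow_ne_zero _ hq0))) ih this.symm
  | pred k ih =>
    have := step (-(k : ℤ) - 1)
    rw [sub_add_cancel] at this
    intro h
    rw [h, mul_zero] at this
    exact mul_ne_zero hq0 ih this

/-- A function holomorphic on `ℂ^*` that vanishes at `a q^k` for all `k ∈ ℤ` is divisible by
`θ(x/a;q)`. -/
lemma exists_eq_theta_mul {q a : ℂ} (hq : ‖q‖ < 1) (hq0 : q ≠ 0) (ha : a ≠ 0) {φ : ℂ → ℂ}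
    (hφ : ∀ x, x ≠ 0 → DifferentiableAt ℂ φ x) (h0 : ∀ k : ℤ, φ (a * q ^ k) = 0) :
    ∃ ψ : ℂ → ℂ, (∀ x, x ≠ 0 → DifferentiableAt ℂ ψ x) ∧
      ∀ x, x ≠ 0 → φ x = theta (x / a) q * ψ x := by
  set Θ : ℂ → ℂ := fun x => theta (x / a) q with hΘ
  have hd : ∀ x, x ≠ 0 → DifferentiableAt ℂ Θ x := fun x hx =>
    DifferentiableAt.comp (g := fun x => theta x q) x
      (differentiableAt_theta hq (div_ne_zero hx ha)) (differentiableAt_id.div_const a)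
  have hz : ∀ x, x ≠ 0 → Θ x = 0 → φ x = 0 ∧ deriv Θ x ≠ 0 := by
    intro x hx h
    obtain ⟨k, hk⟩ : ∃ k : ℤ, x / a = q ^ k := by
      by_contra hc
      push Not at hc
      exact (theta_ne_zero_iff hq hq0 (div_ne_zero hx ha)).2 hc h
    have hxk : x = a * q ^ k := by rw [← hk]; field_simp
    refine ⟨hxk ▸ h0 k, ?_⟩
    have h1 : HasDerivAt Θ (deriv (fun x => theta x q) (x / a) * (1 / a)) x :=
      HasDerivAt.comp (h₂ := fun x => theta x q) x
        (differentiableAt_theta hq (div_ne_zero hx ha)).hasDerivAt ((hasDerivAt_id x).div_const a)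
    rw [h1.deriv, hk]
    exact mul_ne_zero (hasDerivAt_theta_ne_zero hq hq0 k) (one_div_ne_zero ha)
  refine ⟨fun x => if Θ x = 0 then deriv φ x / deriv Θ x else φ x / Θ x, fun x hx => ?_,
    fun x hx => ?_⟩
  · by_cases h : Θ x = 0
    · obtain ⟨hφx, hΘx⟩ := hz x hx h
      have hs : {y : ℂ | y ≠ 0} ∈ 𝓝 x := isOpen_ne.mem_nhds hx
      have d1 : DifferentiableAt ℂ (dslope φ x) x :=
        ((Complex.differentiableOn_dslope hs).2
          (fun y hy => (hφ y hy).differentiableWithinAt)).differentiableAt hs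
      have d2 : DifferentiableAt ℂ (dslope Θ x) x :=
        ((Complex.differentiableOn_dslope hs).2
          (fun y hy => (hd y hy).differentiableWithinAt)).differentiableAt hs
      have hne : dslope Θ x x ≠ 0 := by rwa [dslope_same]
      refine (d1.div d2 hne).congr_of_eventuallyEq ?_
      filter_upwards [d2.continuousAt.eventually_ne hne] with y hy
      rcases eq_or_ne y x with rfl | hyx
      · simp [h, dslope_same]
      · have e1 : Θ y = (y - x) * dslope Θ x y := by
          rw [dslope_of_ne _ hyx, slope_def_field, h, sub_zero]
          field_simp [sub_ne_zero.2 hyx]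
        have e2 : φ y = (y - x) * dslope φ x y := by
          rw [dslope_of_ne _ hyx, slope_def_field, hφx, sub_zero]
          field_simp [sub_ne_zero.2 hyx]
        have hy' : Θ y ≠ 0 := by
          rw [e1]
          exact mul_ne_zero (sub_ne_zero.2 hyx) hy
        simp only [if_neg hy', Pi.div_apply]
        rw [e1, e2, mul_div_mul_left _ _ (sub_ne_zero.2 hyx)]
    · refine ((hφ x hx).div (hd x hx) h).congr_of_eventuallyEq ?_
      filter_upwards [(hd x hx).continuousAt.eventually_ne h] with y hy
      simp [hy]
  · by_cases h : Θ x = 0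
    · simp only [if_pos h]
      rw [(hz x hx h).1]
      exact (mul_eq_zero_of_left h _).symm
    · simp only [if_neg h]
      exact (mul_div_cancel₀ _ h).symm

/-- A function holomorphic on `ℂ^*` with `ψ(qx) = κ ψ(x)` is a multiple of a power of `x`;
hence it vanishes unless `κ` is an integral power of `q`. -/
lemma eq_zero_of_quasiperiodic {q κ : ℂ} (hq : ‖q‖ < 1) (hq0 : q ≠ 0) (hκ0 : κ ≠ 0)
    (hκ : ∀ k : ℤ, κ ≠ q ^ k) {ψ : ℂ → ℂ} (hψ : ∀ x, x ≠ 0 → DifferentiableAt ℂ ψ x)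
    (h : ∀ x, x ≠ 0 → ψ (q * x) = κ * ψ x) : ∀ x, x ≠ 0 → ψ x = 0 := by
  have hlq : Real.log ‖q‖ < 0 := Real.log_neg (norm_pos_iff.2 hq0) hq
  -- the real exponent for which `|ψ(x)| |x|^{-s}` is invariant under `x → q x`
  set s : ℝ := Real.log ‖κ‖ / Real.log ‖q‖ with hs
  have hsq : Real.exp (s * Real.log ‖q‖) = ‖κ‖ := by
    rw [hs, div_mul_cancel₀ _ hlq.ne, Real.exp_log (norm_pos_iff.2 hκ0)]
  set g : ℂ → ℂ := fun y => ψ (Complex.exp y) * Complex.exp (-(s * y)) with hg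
  have hgd : Differentiable ℂ g := fun y =>
    ((hψ _ (Complex.exp_ne_zero y)).comp y Complex.differentiableAt_exp).mul (by fun_prop)
  have hshift : ∀ y, ‖g (y + Complex.log q)‖ = ‖g y‖ := by
    intro y
    simp only [hg]
    rw [Complex.exp_add, Complex.exp_log hq0, mul_comm (Complex.exp y) q,
      h _ (Complex.exp_ne_zero y), mul_add, neg_add, Complex.exp_add, norm_mul, norm_mul, norm_mul,
      norm_mul]
    have : ‖Complex.exp (-(s * Complex.log q))‖ = ‖κ‖⁻¹ := by
      rw [Complex.norm_exp, ← hsq, ← Real.exp_neg]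
      simp [Complex.log_re]
    rw [this]
    field_simp [norm_ne_zero_iff.2 hκ0]
  have hshift2 : ∀ y, ‖g (y + 2 * Real.pi * Complex.I)‖ = ‖g y‖ := by
    intro y
    simp only [hg]
    rw [Complex.exp_periodic y, norm_mul, norm_mul]
    congr 1
    rw [Complex.norm_exp, Complex.norm_exp]
    simp
  have hshift' : ∀ (m : ℤ) y, ‖g (y + m * Complex.log q)‖ = ‖g y‖ := fun m =>
    (show Function.Periodic (fun y => ‖g y‖) (Complex.log q) from hshift).int_mul m
  have hshift2' : ∀ (m : ℤ) y, ‖g (y + m * (2 * Real.pi * Complex.I))‖ = ‖g y‖ := fun m =>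
    (show Function.Periodic (fun y => ‖g y‖) (2 * Real.pi * Complex.I) from hshift2).int_mul m
  have hbdd : Bornology.IsBounded (Set.range g) := by
    have hK : IsCompact ((Set.Icc (Real.log ‖q‖) 0) ×ℂ (Set.Icc 0 (2 * Real.pi))) :=
      isCompact_Icc.reProdIm isCompact_Icc
    obtain ⟨C, hC⟩ := hK.exists_bound_of_continuousOn hgd.continuous.continuousOn
    rw [isBounded_iff_forall_norm_le]
    refine ⟨C, ?_⟩
    rintro _ ⟨y, rfl⟩
    have hπ := Real.two_pi_pos
    set m : ℤ := ⌈y.re / -Real.log ‖q‖⌉ with hm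
    set y' : ℂ := y + m * Complex.log q with hy'
    set l : ℤ := -⌊y'.im / (2 * Real.pi)⌋ with hl
    rw [← hshift' m y, ← hy', ← hshift2' l]
    have hm1 : y.re / -Real.log ‖q‖ ≤ m := Int.le_ceil _
    have hm2 : (m : ℝ) < y.re / -Real.log ‖q‖ + 1 := Int.ceil_lt_add_one _
    have hl1 : (⌊y'.im / (2 * Real.pi)⌋ : ℝ) ≤ y'.im / (2 * Real.pi) := Int.floor_le _
    have hl2 : y'.im / (2 * Real.pi) < ⌊y'.im / (2 * Real.pi)⌋ + 1 := Int.lt_floor_add_one _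
    rw [div_le_iff₀ (by linarith)] at hm1
    rw [← sub_lt_iff_lt_add, lt_div_iff₀ (by linarith)] at hm2
    rw [le_div_iff₀ hπ] at hl1
    rw [div_lt_iff₀ hπ] at hl2
    refine hC _ ⟨?_, ?_⟩
    · have : (y' + l * (2 * Real.pi * Complex.I)).re = y.re + m * Real.log ‖q‖ := by
        simp [hy', Complex.log_re]
      rw [Set.mem_preimage, this]
      constructor <;> linarith
    · have : (y' + l * (2 * Real.pi * Complex.I)).im = y'.im + l * (2 * Real.pi) := by
        simp
      rw [Set.mem_preimage, this, hl]
      push_cast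
      constructor <;> linarith
  obtain ⟨c, hc⟩ := hgd.exists_const_forall_eq_of_bounded hbdd
  have hψc : ∀ y, ψ (Complex.exp y) = c * Complex.exp (s * y) := by
    intro y
    have := hc y
    simp only [hg] at this
    rw [← this, mul_assoc, ← Complex.exp_add]
    simp
  by_cases hc0 : c = 0
  · intro x hx
    rw [← Complex.exp_log hx, hψc, hc0, zero_mul]
  exfalso
  have h1 := hψc (2 * Real.pi * Complex.I)
  rw [Complex.exp_two_pi_mul_I, ← Complex.exp_zero, hψc] at h1
  have h2 := mul_left_cancel₀ hc0 h1
  rw [mul_zero, Complex.exp_zero] at h2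
  obtain ⟨k, hk⟩ := Complex.exp_eq_one_iff.1 h2.symm
  have hsk : (s : ℂ) = k := mul_right_cancel₀ Complex.two_pi_I_ne_zero hk
  refine hκ k ?_
  have h3 := h 1 one_ne_zero
  rw [mul_one, ← Complex.exp_log hq0, ← Complex.exp_zero, hψc, hψc, mul_zero, Complex.exp_zero,
    mul_one, mul_comm κ, hsk, Complex.exp_int_mul, Complex.exp_log hq0] at h3
  exact (mul_left_cancel₀ hc0 h3).symm

/-- A theta function of degree `#s` on `ℂ^*` with `#s` inequivalent zeros vanishes unless
the product of the zeros fits its multiplier. -/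
lemma eq_zero_of_theta_zeros {ι : Type*} [DecidableEq ι] {q : ℂ} (hq : ‖q‖ < 1) (hq0 : q ≠ 0)
    (s : Finset ι) (a : ι → ℂ) (ha : ∀ i ∈ s, a i ≠ 0)
    (hsep : ∀ i ∈ s, ∀ j ∈ s, i ≠ j → ∀ k : ℤ, a j ≠ a i * q ^ k) :
    ∀ (κ : ℂ) (φ : ℂ → ℂ), κ ≠ 0 → (∀ k : ℤ, κ * ∏ i ∈ s, (-(a i)⁻¹) ≠ q ^ k) →
    (∀ x, x ≠ 0 → DifferentiableAt ℂ φ x) → (∀ i ∈ s, φ (a i) = 0) →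
    (∀ x, x ≠ 0 → x ^ s.card * φ (q * x) = κ * φ x) → ∀ x, x ≠ 0 → φ x = 0 := by
  induction s using Finset.induction_on with
  | empty =>
    intro κ φ hκ0 hκ hφ _ h
    exact eq_zero_of_quasiperiodic hq hq0 hκ0 (by simpa using hκ) hφ (by simpa using h)
  | insert i s hi ih =>
    intro κ φ hκ0 hκ hφ hz h
    have hai : a i ≠ 0 := ha i (Finset.mem_insert_self i s)
    have hshift : ∀ x, x ≠ 0 → (φ (q * x) = 0 ↔ φ x = 0) := by
      intro x hx
      have h1 := h x hx
      constructor
      · intro h2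
        rw [h2, mul_zero] at h1
        exact (mul_eq_zero.1 h1.symm).resolve_left hκ0
      · intro h2
        rw [h2, mul_zero] at h1
        exact (mul_eq_zero.1 h1).resolve_left (pow_ne_zero _ hx)
    have hzk : ∀ k : ℤ, φ (a i * q ^ k) = 0 := by
      intro k
      induction k with
      | zero => simpa using hz i (Finset.mem_insert_self i s)
      | succ k ih =>
        rw [zpow_add₀ hq0, zpow_one, ← mul_assoc, mul_comm _ q,
          hshift _ (mul_ne_zero hai (zpow_ne_zero _ hq0))]
        exact ih
      | pred k ih =>
        rw [← hshift _ (mul_ne_zero hai (zpow_ne_zero _ hq0)), mul_left_comm, ← zpow_one_add₀ hq0]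
        simpa using ih
    obtain ⟨ψ, hψ, hφψ⟩ := exists_eq_theta_mul hq hq0 hai hφ hzk
    have hψ0 : ∀ x, x ≠ 0 → ψ x = 0 := by
      refine ih (fun j hj => ha j (Finset.mem_insert_of_mem hj))
        (fun j hj k hk => hsep j (Finset.mem_insert_of_mem hj) k (Finset.mem_insert_of_mem hk))
        (κ * (-(a i)⁻¹)) ψ (mul_ne_zero hκ0 (neg_ne_zero.2 (inv_ne_zero hai))) ?_ hψ ?_ ?_
      · intro k
        rw [mul_assoc, ← Finset.prod_insert (f := fun i => -(a i)⁻¹) hi]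
        exact hκ k
      · intro j hj
        have hj0 := ha j (Finset.mem_insert_of_mem hj)
        have h1 := hφψ (a j) hj0
        rw [hz j (Finset.mem_insert_of_mem hj)] at h1
        refine (mul_eq_zero.1 h1.symm).resolve_left ?_
        refine (theta_ne_zero_iff hq hq0 (div_ne_zero hj0 hai)).2 fun k hk => ?_
        refine hsep i (Finset.mem_insert_self i s) j (Finset.mem_insert_of_mem hj) ?_ k ?_
        · rintro rfl
          exact hi hj
        · rw [← hk]
          field_simp
      · -- at the zeros of the theta factor the functional equation follows by continuity
        have hcont : ∀ x, x ≠ 0 → ContinuousAt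
            (fun x => x ^ s.card * ψ (q * x) - κ * -(a i)⁻¹ * ψ x) x := by
          intro x hx
          have c1 : ContinuousAt (fun x => ψ (q * x)) x :=
            ContinuousAt.comp (f := fun x => q * x) (g := ψ) (hψ _ (mul_ne_zero hq0
                hx)).continuousAt
              (by fun_prop)
          exact (((continuous_pow _).continuousAt).mul c1).sub
            (continuousAt_const.mul (hψ x hx).continuousAt)
        have hgood : ∀ x, x ≠ 0 → theta (x / a i) q ≠ 0 →
            x ^ s.card * ψ (q * x) - κ * -(a i)⁻¹ * ψ x = 0 := by
          intro x hx hθ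
          have h1 := h x hx
          rw [hφψ x hx, hφψ _ (mul_ne_zero hq0 hx), Finset.card_insert_of_notMem hi, mul_div_assoc,
            theta_mul_left hq hq0 (div_ne_zero hx hai)] at h1
          have h2 : theta (x / a i) q *
              (x ^ s.card * ψ (q * x) - κ * -(a i)⁻¹ * ψ x) = 0 := by
            have : (x ^ (s.card + 1) * (-(x / a i)⁻¹ * theta (x / a i) q * ψ (q * x))) * (-(a i)⁻¹)
                =
              theta (x / a i) q * (x ^ s.card * ψ (q * x)) := by
              rw [pow_succ]
              field_simp
            rw [mul_sub, ← this, h1]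
            ring
          exact (mul_eq_zero.1 h2).resolve_left hθ
        intro x hx
        rw [← sub_eq_zero]
        by_cases hθ : theta (x / a i) q = 0
        · obtain ⟨k, hk⟩ : ∃ k : ℤ, x / a i = q ^ k := by
            by_contra hc
            push Not at hc
            exact (theta_ne_zero_iff hq hq0 (div_ne_zero hx hai)).2 hc hθ
          have hd : DifferentiableAt ℂ (fun y => theta y q) (x / a i) :=
            differentiableAt_theta hq (div_ne_zero hx hai)
          have h1 : ∀ᶠ y in 𝓝[≠] (x / a i), theta y q ≠ 0 := by
            have := hd.hasDerivAt.eventually_ne (c := theta (x / a i) q)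
              (by rw [hk]; exact hasDerivAt_theta_ne_zero hq hq0 k)
            simpa [hθ] using this
          have h2 : Tendsto (fun y => y / a i) (𝓝[≠] x) (𝓝[≠] (x / a i)) := by
            refine tendsto_nhdsWithin_iff.2 ⟨?_, ?_⟩
            · exact (Continuous.tendsto (by fun_prop) x).mono_left nhdsWithin_le_nhds
            · filter_upwards [self_mem_nhdsWithin] with y hy
              intro hc
              exact hy ((div_left_inj' hai).1 hc)
          have h3 : ∀ᶠ y in 𝓝[≠] x, y ^ s.card * ψ (q * y) - κ * -(a i)⁻¹ * ψ y = 0 := by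
            filter_upwards [h2.eventually h1, (isOpen_ne.mem_nhds hx : {y : ℂ | y ≠ 0} ∈ 𝓝 x) |>
              mem_nhdsWithin_of_mem_nhds] with y hy hy0
            exact hgood y hy0 hy
          exact tendsto_nhds_unique ((hcont x hx).tendsto.mono_left nhdsWithin_le_nhds)
            (tendsto_const_nhds.congr' (h3.mono fun y hy => hy.symm))
        · exact hgood x hx hθ
    intro x hx
    rw [hφψ x hx, hψ0 x hx, mul_zero]

/-! ### A theta function identity for sums over sign changes -/

/-- A choice of signs in `z_i^{±1}`. -/
def signFlip {n : ℕ} (σ : Fin n → Bool) (z : Fin n → ℂ) : Fin n → ℂ :=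
  fun i => if σ i then z i else (z i)⁻¹

/-- The factor `θ(txy;q) / θ(xy;q)`. -/
def crossTheta (q t x y : ℂ) : ℂ := theta (t * (x * y)) q / theta (x * y) q

/-- The function `∏_i ∏_r θ(u_r w_i;q) / θ(w_i^2;q) ∏_{i<k} θ(t w_i w_k;q) / θ(w_i w_k;q)`, which
breaks the symmetry under `w_i → 1 / w_i`. -/
def breakingFactor {n : ℕ} (q t u₀ u₁ u₂ u₃ : ℂ) (w : Fin n → ℂ) : ℂ :=
  (∏ i, theta (u₀ * w i) q * theta (u₁ * w i) q * theta (u₂ * w i) q * theta (u₃ * w i) q /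
    theta (w i ^ 2) q) * ∏ i, ∏ k ∈ Finset.Ioi i, crossTheta q t (w i) (w k)

/-- Genericity of `z`: the numbers `z_i^{±1}` are pairwise inequivalent modulo powers of `q`. -/
structure ThetaGeneric {n : ℕ} (q : ℂ) (z : Fin n → ℂ) : Prop where
  ne_zero : ∀ i, z i ≠ 0
  sq : ∀ i, ∀ k : ℤ, z i ^ 2 ≠ q ^ k
  mul : ∀ i j, i ≠ j → ∀ k : ℤ, z i * z j ≠ q ^ k
  div : ∀ i j, i ≠ j → ∀ k : ℤ, z i / z j ≠ q ^ k

lemma prod_pairs_succAbove {n : ℕ} {M : Type*} [CommMonoid M] (f : ℂ → ℂ → M)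
    (hf : ∀ x y, f x y = f y x) (j : Fin (n + 1)) (w : Fin (n + 1) → ℂ) :
    ∏ i, ∏ k ∈ Finset.Ioi i, f (w i) (w k) =
      (∏ k, f (w j) (w (j.succAbove k))) *
        ∏ i, ∏ k ∈ Finset.Ioi i, f (w (j.succAbove i)) (w (j.succAbove k)) := by
  have e : ∀ (m : ℕ) (g : Fin m → Fin m → M), ∏ i, ∏ k ∈ Finset.Ioi i, g i k =
      ∏ i, ∏ k, if i < k then g i k else 1 := by
    intro m g
    refine Finset.prod_congr rfl fun i _ => ?_
    rw [← Finset.prod_filter]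
    congr 1
    ext k
    simp
  rw [e, e, Fin.prod_univ_succAbove _ j, Fin.prod_univ_succAbove _ j]
  simp only [lt_self_iff_false, if_false, one_mul]
  have : ∀ i, (∏ k, if j.succAbove i < k then f (w (j.succAbove i)) (w k) else 1) =
      (if j.succAbove i < j then f (w (j.succAbove i)) (w j) else 1) *
        ∏ k, if i < k then f (w (j.succAbove i)) (w (j.succAbove k)) else 1 := by
    intro i
    rw [Fin.prod_univ_succAbove _ j]
    simp only [Fin.succAbove_lt_succAbove_iff]
  simp only [this]
  rw [Finset.prod_mul_distrib, ← mul_assoc, ← Finset.prod_mul_distrib]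
  congr 1
  refine Finset.prod_congr rfl fun k _ => ?_
  rcases lt_or_gt_of_ne (Fin.succAbove_ne j k) with h | h
  · simp [h, h.not_gt, hf (w j)]
  · simp [h, h.not_gt]

lemma ThetaGeneric.succAbove {n : ℕ} {q : ℂ} {z : Fin (n + 1) → ℂ} (h : ThetaGeneric q z)
    (j : Fin (n + 1)) : ThetaGeneric q fun i => z (j.succAbove i) where
  ne_zero _ := h.ne_zero _
  sq _ := h.sq _
  mul _ _ hik := h.mul _ _ fun hc => hik (Fin.succAbove_right_injective hc)
  div _ _ hik := h.div _ _ fun hc => hik (Fin.succAbove_right_injective hc)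

lemma thetaGeneric_signFlip {n : ℕ} {q : ℂ} {z : Fin n → ℂ} (h : ThetaGeneric q z)
    (σ : Fin n → Bool) : ThetaGeneric q (signFlip σ z) := by
  have hz := h.ne_zero
  have key : ∀ (x : ℂ), (∀ k : ℤ, x ≠ q ^ k) → ∀ k : ℤ, x⁻¹ ≠ q ^ k := by
    intro x hx k hk
    exact hx (-k) (by rw [zpow_neg, ← hk, inv_inv])
  have hi : ∀ i j, i ≠ j → ∀ k : ℤ, (z i)⁻¹ * z j ≠ q ^ k := fun i j hij k => by
    rw [mul_comm, ← div_eq_mul_inv]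
    exact h.div j i hij.symm k
  refine ⟨fun _ => ?_, fun i => ?_, fun i j hij => ?_, fun i j hij => ?_⟩
  · unfold signFlip
    split_ifs <;> simp [hz]
  · unfold signFlip
    split_ifs
    · exact h.sq i
    · rw [inv_pow]
      exact key _ (h.sq i)
  · unfold signFlip
    split_ifs
    · exact h.mul i j hij
    · rw [← div_eq_mul_inv]
      exact h.div i j hij
    · exact hi i j hij
    · rw [← mul_inv]
      exact key _ (h.mul i j hij)
  · unfold signFlip
    split_ifs
    · exact h.div i j hij
    · rw [div_inv_eq_mul]
      exact h.mul i j hij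
    · rw [div_eq_mul_inv, ← mul_inv]
      exact key _ (h.mul i j hij)
    · rw [div_inv_eq_mul]
      exact hi i j hij

/-- At `u₀ = w_j^{-1}` a term vanishes, and at `u₀ = w_j` it reduces to a term in one variable
less, with `u₀` replaced by `t u₀`. -/
lemma breakingFactor_succAbove {n : ℕ} {q : ℂ} (hq : ‖q‖ < 1) (hq0 : q ≠ 0) (t u₁ u₂ u₃ : ℂ)
    {w : Fin (n + 1) → ℂ} (hw : ThetaGeneric q w) (j : Fin (n + 1)) :
    breakingFactor q t (w j) u₁ u₂ u₃ w =
      theta (w j * u₁) q * theta (w j * u₂) q * theta (w j * u₃) q *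
        breakingFactor q t (t * w j) u₁ u₂ u₃ fun i => w (j.succAbove i) := by
  unfold breakingFactor
  rw [prod_pairs_succAbove (crossTheta q t)
    (fun x y => by unfold crossTheta; rw [mul_comm x y]) j, Fin.prod_univ_succAbove _ j]
  have hsq : theta (w j ^ 2) q ≠ 0 :=
    (theta_ne_zero_iff hq hq0 (pow_ne_zero 2 (hw.ne_zero j))).2 (hw.sq j)
  have hc : ∀ i, theta (w j * w (j.succAbove i)) q ≠ 0 := fun i =>
    (theta_ne_zero_iff hq hq0 (mul_ne_zero (hw.ne_zero j) (hw.ne_zero _))).2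
      (hw.mul _ _ (Fin.succAbove_ne j i).symm)
  have e : (∏ i, theta (w j * w (j.succAbove i)) q * theta (u₁ * w (j.succAbove i)) q *
      theta (u₂ * w (j.succAbove i)) q * theta (u₃ * w (j.succAbove i)) q /
        theta (w (j.succAbove i) ^ 2) q) * ∏ k, crossTheta q t (w j) (w (j.succAbove k)) =
      ∏ i, theta (t * w j * w (j.succAbove i)) q * theta (u₁ * w (j.succAbove i)) q *
      theta (u₂ * w (j.succAbove i)) q * theta (u₃ * w (j.succAbove i)) q /
        theta (w (j.succAbove i) ^ 2) q := by
    rw [← Finset.prod_mul_distrib]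
    refine Finset.prod_congr rfl fun i _ => ?_
    unfold crossTheta
    have := hc i
    rw [mul_assoc t]
    field_simp
  rw [← e, show w j * w j = w j ^ 2 by ring, mul_comm (w j) u₁, mul_comm (w j) u₂,
    mul_comm (w j) u₃]
  field_simp

lemma breakingFactor_eq_zero {n : ℕ} {q t u₀ u₁ u₂ u₃ : ℂ} {w : Fin n → ℂ} (j : Fin n)
    (h : u₀ * w j = 1) : breakingFactor q t u₀ u₁ u₂ u₃ w = 0 := by
  unfold breakingFactor
  rw [Finset.prod_eq_zero (Finset.mem_univ j), zero_mul]
  rw [h, theta_one]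
  simp

lemma signFlip_succAbove {n : ℕ} (σ : Fin n → Bool) (z : Fin (n + 1) → ℂ) (j : Fin (n + 1))
    (b : Bool) : (fun i => signFlip (j.insertNth (α := fun _ => Bool) b σ) z (j.succAbove i)) =
      signFlip σ fun i => z (j.succAbove i) := by
  funext i
  simp [signFlip]

lemma differentiableAt_theta_mul {q : ℂ} (hq : ‖q‖ < 1) {c x : ℂ} (h : c * x ≠ 0) :
    DifferentiableAt ℂ (fun x => theta (c * x) q) x :=
  DifferentiableAt.comp (g := fun x => theta x q) x (differentiableAt_theta hq h)
    (differentiableAt_id.const_mul c)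

lemma prod_range_pow_two_mul (t : ℂ) (n : ℕ) :
    ∏ i ∈ Finset.range (n + 1), (t ^ i) ^ 2 = (t ^ n) ^ (n + 1) := by
  rw [Finset.prod_pow, Finset.prod_pow_eq_pow_sum, ← pow_mul, ← pow_mul,
    Finset.sum_range_id_mul_two]
  congr 1
  simp [mul_comm]

/-- The identity for sums over sign changes, by induction on the number of variables. As
functions of `u₀` both sides are theta functions of degree `2n` with the same multiplier, and they
agree at the `2n` points `z_i^{±1}` by the induction hypothesis. -/
theorem sum_breakingFactor {q t : ℂ} (hq : ‖q‖ < 1) (hq0 : q ≠ 0) (ht0 : t ≠ 0)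
    (n : ℕ) : ∀ (z : Fin n → ℂ), ThetaGeneric q z → ∀ u₀ u₁ u₂ u₃ : ℂ, u₀ ≠ 0 → u₁ ≠ 0 → u₂ ≠ 0 →
    u₃ ≠ 0 → t ^ n * (u₀ * u₁ * u₂ * u₃) = q * t →
    ∑ σ : Fin n → Bool, breakingFactor q t u₀ u₁ u₂ u₃ (signFlip σ z) =
      ∏ i ∈ Finset.range n, theta (t ^ i * (u₀ * u₁)) q * theta (t ^ i * (u₀ * u₂)) q *
        theta (t ^ i * (u₀ * u₃)) q := by
  induction n with
  | zero =>
    intro z _ u₀ u₁ u₂ u₃ _ _ _ _ _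
    simp [breakingFactor]
  | succ n ih =>
    intro z hz
    -- the assertion for `u₁`, `u₂` in general position
    have main : ∀ u₁ u₂ : ℂ, u₁ ≠ 0 → u₂ ≠ 0 →
        (∀ k : ℤ, (t ^ n * (u₁ * u₂))⁻¹ ^ (n + 1) ≠ q ^ k) → ∀ u₀ u₃ : ℂ, u₀ ≠ 0 → u₃ ≠ 0 →
        t ^ (n + 1) * (u₀ * u₁ * u₂ * u₃) = q * t →
        ∑ σ : Fin (n + 1) → Bool, breakingFactor q t u₀ u₁ u₂ u₃ (signFlip σ z) =
        ∏ i ∈ Finset.range (n + 1), theta (t ^ i * (u₀ * u₁)) q * theta (t ^ i * (u₀ * u₂)) q *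
          theta (t ^ i * (u₀ * u₃)) q := by
      intro u₁ u₂ hu₁ hu₂ hgen
      set C : ℂ := q / (t ^ n * (u₁ * u₂)) with hC
      have hC0 : C ≠ 0 := div_ne_zero hq0 (mul_ne_zero (pow_ne_zero _ ht0) (mul_ne_zero hu₁ hu₂))
      set φ : ℂ → ℂ := fun x =>
        ∑ σ : Fin (n + 1) → Bool, breakingFactor q t x u₁ u₂ (C / x) (signFlip σ z) -
        ∏ i ∈ Finset.range (n + 1), theta (t ^ i * (x * u₁)) q * theta (t ^ i * (x * u₂)) q *
          theta (t ^ i * (x * (C / x))) q with hφ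
      have hw0 : ∀ (σ : Fin (n + 1) → Bool) i, signFlip σ z i ≠ 0 := fun σ => (thetaGeneric_signFlip
          hz σ).ne_zero
      suffices h : ∀ x, x ≠ 0 → φ x = 0 by
        intro u₀ u₃ hu₀ hu₃ hU
        have h3 : u₃ = C / u₀ := by
          rw [hC]
          field_simp
          rw [pow_succ] at hU
          have : t * (t ^ n * (u₀ * u₁ * u₂ * u₃)) = t * q := by linear_combination hU
          linear_combination mul_left_cancel₀ ht0 this
        rw [h3]
        exact sub_eq_zero.1 (h u₀ hu₀)
      let pt : Fin (n + 1) × Bool → ℂ := fun p => if p.2 then z p.1 else (z p.1)⁻¹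
      refine eq_zero_of_theta_zeros hq hq0 (Finset.univ : Finset (Fin (n + 1) × Bool)) pt ?_ ?_
        ((C / q) ^ (n + 1)) φ ?_ ?_ ?_ ?_ ?_
      · rintro ⟨i, b⟩ _
        simp only [pt]
        split_ifs <;> simp [hz.ne_zero]
      · rintro ⟨i, b⟩ _ ⟨j, b'⟩ _ hne k h
        simp only [pt] at h
        rcases eq_or_ne i j with rfl | hij
        · have hi := hz.ne_zero i
          cases b <;> cases b' <;> simp only [Bool.false_eq_true, if_false, if_true] at h
          · exact hne rfl
          · refine hz.sq i k ?_
            rw [pow_two]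
            nth_rewrite 1 [h]
            field_simp
          · refine hz.sq i (-k) ?_
            rw [zpow_neg]
            refine eq_inv_of_mul_eq_one_left ?_
            rw [pow_two, mul_assoc, ← h]
            field_simp
          · exact hne rfl
        · have hi := hz.ne_zero i
          have hj := hz.ne_zero j
          have hqk := zpow_ne_zero k hq0
          cases b <;> cases b' <;> simp only [Bool.false_eq_true, if_false, if_true] at h
          · refine hz.div i j hij k ?_
            rw [div_eq_mul_inv, h]
            field_simp
          · refine hz.mul j i hij.symm k ?_
            rw [h]
            field_simp
          · refine hz.mul j i hij.symm (-k) ?_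
            rw [zpow_neg]
            refine eq_inv_of_mul_eq_one_left ?_
            rw [mul_assoc, ← h]
            field_simp
          · refine hz.div j i hij.symm k ?_
            rw [h]
            field_simp
      · exact pow_ne_zero _ (div_ne_zero hC0 hq0)
      · intro k
        have : ∏ i, (-(pt i)⁻¹) = 1 := by
          rw [Fintype.prod_prod_type]
          refine Finset.prod_eq_one fun i _ => ?_
          have hi := hz.ne_zero i
          simp [pt, hi]
        rw [this, mul_one]
        convert! hgen k using 2
        rw [hC]
        field_simp
      · intro x hx
        have d : ∀ c : ℂ, c ≠ 0 → DifferentiableAt ℂ (fun x => theta (c * x) q) x := fun c hc =>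
          differentiableAt_theta_mul hq (mul_ne_zero hc hx)
        refine DifferentiableAt.sub ?_ ?_
        · refine DifferentiableAt.fun_sum fun σ _ => ?_
          unfold breakingFactor
          refine DifferentiableAt.mul_const (DifferentiableAt.fun_finsetProd fun i _ => ?_) _
          refine DifferentiableAt.div_const (((DifferentiableAt.mul_const
            (DifferentiableAt.mul_const ?_ _) _)).mul ?_) _
          · simpa only [mul_comm] using d _ (hw0 σ i)
          · refine DifferentiableAt.comp (g := fun x => theta x q) x (differentiableAt_theta hq
              (mul_ne_zero (div_ne_zero hC0 hx) (hw0 σ i)))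
              (((differentiableAt_const C).div differentiableAt_id hx).mul_const _)
        · refine DifferentiableAt.fun_finsetProd fun i _ => ?_
          refine ((?_ : DifferentiableAt ℂ _ x).mul ?_).mul ?_
          · have e : (fun x => theta (t ^ i * (x * u₁)) q) = fun x => theta (t ^ i * u₁ * x) q := by
              funext x
              ring_nf
            rw [e]
            exact d (t ^ i * u₁) (mul_ne_zero (pow_ne_zero _ ht0) hu₁)
          · have e : (fun x => theta (t ^ i * (x * u₂)) q) = fun x => theta (t ^ i * u₂ * x) q := by
              funext x
              ring_nf
            rw [e]
            exact d (t ^ i * u₂) (mul_ne_zero (pow_ne_zero _ ht0) hu₂)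
          · refine (differentiableAt_const (theta (t ^ i * C) q)).congr_of_eventuallyEq ?_
            filter_upwards [isOpen_ne.mem_nhds hx] with y hy
            rw [mul_div_cancel₀ _ hy]
      · -- the values at `z_j^{±1}`
        rintro ⟨j, b⟩ _
        have hy0 : pt (j, b) ≠ 0 := by
          simp only [pt]
          split_ifs <;> simp [hz.ne_zero]
        simp only [hφ]
        rw [sub_eq_zero]
        have hflip : ∀ σ : Fin n → Bool,
            signFlip (j.insertNth (α := fun _ => Bool) b σ) z j = pt (j, b) := by
          intro σ
          simp [signFlip, pt]
        have hflip' : ∀ σ : Fin n → Bool,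
            pt (j, b) * signFlip (j.insertNth (α := fun _ => Bool) (!b) σ) z j = 1 := by
          intro σ
          have hj := hz.ne_zero j
          cases b <;> simp [signFlip, pt, hj]
        rw [← (Fin.insertNthEquiv (fun _ => Bool) j).sum_comp, Fintype.sum_prod_type,
          Finset.sum_eq_single b]
        · simp only [Fin.insertNthEquiv, Equiv.coe_fn_mk]
          have e : ∀ σ : Fin n → Bool, breakingFactor q t (pt (j, b)) u₁ u₂ (C / pt (j, b))
              (signFlip (j.insertNth (α := fun _ => Bool) b σ) z) =
              theta (pt (j, b) * u₁) q * theta (pt (j, b) * u₂) q *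
                theta (pt (j, b) * (C / pt (j, b))) q *
                breakingFactor q t (t * pt (j, b)) u₁ u₂ (C / pt (j, b))
                  (signFlip σ fun i => z (j.succAbove i)) := by
            intro σ
            have := breakingFactor_succAbove hq hq0 t u₁ u₂ (C / pt (j, b))
              (thetaGeneric_signFlip hz (j.insertNth (α := fun _ => Bool) b σ)) j
            rw [signFlip_succAbove, hflip] at this
            exact this
          simp only [e]
          rw [← Finset.mul_sum, ih _ (hz.succAbove j) _ _ _ _ (mul_ne_zero ht0 hy0) hu₁ hu₂
            (div_ne_zero hC0 hy0), Finset.prod_range_succ', mul_comm]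
          · congr 1
            · refine Finset.prod_congr rfl fun i _ => ?_
              rw [pow_succ]
              simp only [mul_assoc]
            · simp
          · rw [hC]
            field_simp
        · intro b' _ hb'
          refine Finset.sum_eq_zero fun σ _ => ?_
          have : b' = !b := by
            cases b <;> cases b' <;> simp_all
          subst this
          exact breakingFactor_eq_zero j (hflip' σ)
        · simp
      · -- the multiplier
        intro x hx
        have hθ : ∀ y, y ≠ 0 → theta (y / q) q = -(y / q) * theta y q := by
          intro y hy
          have := theta_mul_left hq hq0 (div_ne_zero hy hq0)
          rw [mul_div_cancel₀ _ hq0] at this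
          rw [this]
          field_simp
        have hcard : (Finset.univ : Finset (Fin (n + 1) × Bool)).card = 2 * (n + 1) := by
          simp [mul_comm]
        rw [hcard]
        simp only [hφ]
        rw [mul_sub, mul_sub, Finset.mul_sum, Finset.mul_sum]
        congr 1
        · refine Finset.sum_congr rfl fun σ _ => ?_
          unfold breakingFactor
          rw [← mul_assoc, ← mul_assoc]
          congr 1
          have hp : ∀ c : ℂ, c ^ (n + 1) = ∏ _i : Fin (n + 1), c := fun c => by simp
          rw [pow_mul, hp (x ^ 2), hp (C / q), ← Finset.prod_mul_distrib, ← Finset.prod_mul_distrib]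
          refine Finset.prod_congr rfl fun i _ => ?_
          have hi := hw0 σ i
          rw [mul_assoc q, theta_mul_left hq hq0 (mul_ne_zero hx hi),
            show C / (q * x) * signFlip σ z i = C / x * signFlip σ z i / q by field_simp,
            hθ _ (mul_ne_zero (div_ne_zero hC0 hx) hi)]
          field_simp
        · rw [show (C / q) ^ (n + 1) = ∏ i ∈ Finset.range (n + 1), (((t ^ i) ^ 2)⁻¹ * (C * t ^ n /
              q)) by
            rw [Finset.prod_mul_distrib, Finset.prod_inv_distrib, prod_range_pow_two_mul,
                Finset.prod_const,
              Finset.card_range, ← inv_pow, ← mul_pow]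
            field_simp]
          rw [pow_mul, show (x ^ 2) ^ (n + 1) = ∏ i ∈ Finset.range (n + 1), x ^ 2 by simp,
            ← Finset.prod_mul_distrib, ← Finset.prod_mul_distrib]
          refine Finset.prod_congr rfl fun i _ => ?_
          have hti := pow_ne_zero i ht0
          rw [show t ^ i * (q * x * u₁) = q * (t ^ i * (x * u₁)) by ring,
            show t ^ i * (q * x * u₂) = q * (t ^ i * (x * u₂)) by ring,
            theta_mul_left hq hq0 (mul_ne_zero hti (mul_ne_zero hx hu₁)),
            theta_mul_left hq hq0 (mul_ne_zero hti (mul_ne_zero hx hu₂)),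
            mul_div_cancel₀ _ hx, mul_div_cancel₀ _ (mul_ne_zero hq0 hx)]
          rw [hC]
          field_simp
    -- the general case by continuity, moving `u₁` and `u₃` in opposite directions
    intro u₀ u₁ u₂ u₃ hu₀ hu₁ hu₂ hu₃ hU
    set a : ℝ → ℂ := fun s => Complex.exp s with ha
    have ha0 : ∀ s, a s ≠ 0 := fun s => Complex.exp_ne_zero _
    have hac : Continuous a := by fun_prop
    have hθc : ∀ f : ℝ → ℂ, Continuous f → (∀ s, f s ≠ 0) → Continuous fun s => theta (f s) q :=
      fun f hf hf0 => continuous_iff_continuousAt.2 fun s =>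
        ContinuousAt.comp (g := fun x => theta x q) (differentiableAt_theta hq (hf0 s)).continuousAt
          hf.continuousAt
    have hw0 : ∀ (σ : Fin (n + 1) → Bool) i, signFlip σ z i ≠ 0 :=
      fun σ => (thetaGeneric_signFlip hz σ).ne_zero
    have hdense : Dense {s : ℝ | ∀ k : ℤ, (t ^ n * (u₁ * a s * u₂))⁻¹ ^ (n + 1) ≠ q ^ k} := by
      set c : ℝ := Real.log ‖t ^ n * (u₁ * u₂)‖ with hc
      have hcount : (Set.range fun k : ℤ => -c - k * Real.log ‖q‖ / (n + 1 : ℕ)).Countable :=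
        Set.countable_range _
      refine (hcount.dense_compl ℝ).mono fun s hs => ?_
      rw [Set.mem_ofPred_eq]
      intro k hk
      refine hs ⟨k, ?_⟩
      have h1 := congrArg (fun x => Real.log ‖x‖) hk
      have hne : ‖t ^ n * (u₁ * u₂)‖ ≠ 0 := by simp [ht0, hu₁, hu₂]
      have h2 : ‖t ^ n * (u₁ * a s * u₂)‖ = ‖t ^ n * (u₁ * u₂)‖ * Real.exp s := by
        rw [show t ^ n * (u₁ * a s * u₂) = t ^ n * (u₁ * u₂) * a s by ring, norm_mul, ha,
          Complex.norm_exp_ofReal]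
      simp only [norm_pow, norm_inv, norm_zpow, Real.log_pow, Real.log_inv, Real.log_zpow, h2,
        Real.log_mul hne (Real.exp_ne_zero s), Real.log_exp] at h1
      simp only
      rw [← h1, ← hc]
      have : ((n + 1 : ℕ) : ℝ) ≠ 0 := by positivity
      field_simp
      ring
    have hcont := Continuous.ext_on hdense
      (f := fun s => ∑ σ : Fin (n + 1) → Bool,
        breakingFactor q t u₀ (u₁ * a s) u₂ (u₃ * (a s)⁻¹) (signFlip σ z))
      (g := fun s => ∏ i ∈ Finset.range (n + 1), theta (t ^ i * (u₀ * (u₁ * a s))) q *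
        theta (t ^ i * (u₀ * u₂)) q * theta (t ^ i * (u₀ * (u₃ * (a s)⁻¹))) q) ?_ ?_ ?_
    · have := congrFun hcont 0
      simpa [ha] using this
    · refine continuous_finsetSum _ fun σ _ => ?_
      unfold breakingFactor
      refine (continuous_finsetProd _ fun i _ => ?_).mul continuous_const
      refine Continuous.div_const (((continuous_const.mul (hθc _ ?_ ?_)).mul continuous_const).mul
        (hθc _ ?_ ?_)) _
      · fun_prop
      · intro s
        simp [hu₁, ha0, hw0]
      · exact (continuous_const.mul (hac.inv₀ ha0)).mul continuous_const
      · intro s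
        simp [hu₃, ha0, hw0]
    · refine continuous_finsetProd _ fun i _ => ?_
      refine ((hθc _ ?_ ?_).mul continuous_const).mul (hθc _ ?_ ?_)
      · fun_prop
      · intro s
        simp [ht0, hu₀, hu₁, ha0]
      · exact continuous_const.mul (continuous_const.mul (continuous_const.mul (hac.inv₀ ha0)))
      · intro s
        simp [ht0, hu₀, hu₃, ha0]
    · intro s hs
      refine main _ _ (mul_ne_zero hu₁ (ha0 s)) hu₂ hs _ _ hu₀
        (mul_ne_zero hu₃ (inv_ne_zero (ha0 s))) ?_
      rw [← hU]
      have := ha0 s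
      field_simp

/-! ### Iterated integrals of kernels -/

open MeasureTheory in
/-- The functional `A` is given on functions continuous on `K` by integration along a map `γ` into
`K` with an integrable weight `w`. Contour integrals and area integrals are both of this form. -/
def IsKernelOn (K : Set ℂ) (A : (ℂ → ℂ) → ℂ) : Prop :=
  ∃ (X : Type) (_ : MeasurableSpace X) (ν : Measure X) (γ : X → ℂ) (w : X → ℂ),
    SFinite ν ∧ Measurable γ ∧ Integrable w ν ∧ (∀ x, w x ≠ 0 → γ x ∈ K) ∧
      ∀ h, ContinuousOn h K → A h = ∫ x, w x * h (γ x) ∂ν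

/-- The iterated functional `A_0 (z_0 ↦ A_1 (z_1 ↦ ⋯ F(z_0, …, z_{n-1})))`. -/
def iterInt : (n : ℕ) → (Fin n → (ℂ → ℂ) → ℂ) → ((Fin n → ℂ) → ℂ) → ℂ
  | 0, _, F => F fun i => i.elim0
  | n + 1, A, F => A 0 fun x => iterInt n (fun i => A i.succ) fun z => F (Fin.cons x z)

/-- The set `K^n`. -/
def piSet (n : ℕ) (K : Set ℂ) : Set (Fin n → ℂ) := {z | ∀ i, z i ∈ K}

lemma isCompact_piSet (n : ℕ) {K : Set ℂ} (hK : IsCompact K) : IsCompact (piSet n K) := by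
  have : piSet n K = Set.pi Set.univ fun _ => K := by
    ext z
    simp [piSet]
  rw [this]
  exact isCompact_univ_pi fun _ => hK

section Kernel

open MeasureTheory

variable {K : Set ℂ} {A B : (ℂ → ℂ) → ℂ}

lemma IsKernelOn.congr (hA : IsKernelOn K A) {h h' : ℂ → ℂ} (hh : ContinuousOn h K)
    (e : Set.EqOn h h' K) : A h = A h' := by
  obtain ⟨X, _, ν, γ, w, _, _, _, hw, hAh⟩ := hA
  rw [hAh h hh, hAh h' (hh.congr e.symm)]
  refine integral_congr_ae (Eventually.of_forall fun x => ?_)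
  by_cases hx : w x = 0
  · simp [hx]
  · simp only
    rw [e (hw x hx)]

lemma IsKernelOn.eq_zero (hA : IsKernelOn ∅ A) (h : ℂ → ℂ) : A h = 0 := by
  obtain ⟨X, _, ν, γ, w, _, _, _, hw, hAh⟩ := hA
  rw [hAh h (continuousOn_empty h)]
  have : ∀ x, w x = 0 := fun x => by_contra fun hx => hw x hx
  simp [this]

lemma aestronglyMeasurable_weight_mul {X : Type*} [MeasurableSpace X] {ν : Measure X} {γ w : X → ℂ}
    (hK : MeasurableSet K) (hγ : Measurable γ) (hw : Integrable w ν) (hwK : ∀ x, w x ≠ 0 → γ x ∈ K)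
    {h : ℂ → ℂ} (hh : ContinuousOn h K) :
    AEStronglyMeasurable (fun x => w x * h (γ x)) ν := by
  classical
  have h1 : Measurable (K.piecewise h 0) := hh.measurable_piecewise continuousOn_const hK
  have : (fun x => w x * h (γ x)) = fun x => w x * K.piecewise h 0 (γ x) := by
    funext x
    by_cases hx : w x = 0
    · simp [hx]
    · rw [Set.piecewise_eq_of_mem _ _ _ (hwK x hx)]
  rw [this]
  exact hw.aestronglyMeasurable.mul (h1.comp hγ).aestronglyMeasurable

lemma norm_weight_mul_le {X : Type*} {γ w : X → ℂ} (hwK : ∀ x, w x ≠ 0 → γ x ∈ K)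
    {h : ℂ → ℂ} {C : ℝ} (hC : ∀ z ∈ K, ‖h z‖ ≤ C) (x : X) : ‖w x * h (γ x)‖ ≤ ‖w x‖ * C := by
  by_cases hx : w x = 0
  · simp [hx]
  · rw [norm_mul]
    exact mul_le_mul_of_nonneg_left (hC _ (hwK x hx)) (norm_nonneg _)

lemma integrable_weight_mul {X : Type*} [MeasurableSpace X] {ν : Measure X} {γ w : X → ℂ}
    (hK : IsCompact K) (hγ : Measurable γ) (hw : Integrable w ν) (hwK : ∀ x, w x ≠ 0 → γ x ∈ K)
    {h : ℂ → ℂ} (hh : ContinuousOn h K) : Integrable (fun x => w x * h (γ x)) ν := by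
  obtain ⟨C, hC⟩ := hK.exists_bound_of_continuousOn hh
  exact (hw.norm.mul_const C).mono' (aestronglyMeasurable_weight_mul hK.measurableSet hγ hw hwK hh)
    (Eventually.of_forall fun x => norm_weight_mul_le hwK hC x)

lemma continuousOn_slice {T U : Type*} [TopologicalSpace T] [TopologicalSpace U] {S : Set T}
    {L : Set U} {F : T → U → ℂ} (hF : ContinuousOn (Function.uncurry F) (S ×ˢ L)) {t : T}
    (ht : t ∈ S) : ContinuousOn (F t) L :=
  hF.comp (f := fun u => (t, u)) (by fun_prop) fun _ hu => ⟨ht, hu⟩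

lemma IsKernelOn.continuousOn (hK : IsCompact K) (hA : IsKernelOn K A) {T : Type*}
    [TopologicalSpace T] [FirstCountableTopology T] {S : Set T} (hS : IsCompact S)
    {F : T → ℂ → ℂ} (hF : ContinuousOn (Function.uncurry F) (S ×ˢ K)) :
    ContinuousOn (fun t => A (F t)) S := by
  obtain ⟨X, _, ν, γ, w, _, hγ, hw, hwK, hAh⟩ := hA
  obtain ⟨C, hC⟩ := (hS.prod hK).exists_bound_of_continuousOn hF
  have : Set.EqOn (fun t => A (F t)) (fun t => ∫ x, w x * F t (γ x) ∂ν) S := fun t ht =>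
    hAh _ (continuousOn_slice hF ht)
  refine ContinuousOn.congr (fun t ht => ?_) this
  refine continuousWithinAt_of_dominated (bound := fun x => ‖w x‖ * C) ?_ ?_ (hw.norm.mul_const C)
      ?_
  · filter_upwards [self_mem_nhdsWithin] with s hs
    exact aestronglyMeasurable_weight_mul hK.measurableSet hγ hw hwK (continuousOn_slice hF hs)
  · filter_upwards [self_mem_nhdsWithin] with s hs
    exact Eventually.of_forall fun x =>
      norm_weight_mul_le hwK (h := F s) (fun z hz => hC (s, z) ⟨hs, hz⟩) x
  · refine Eventually.of_forall fun x => ?_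
    by_cases hx : w x = 0
    · simpa [hx] using continuousWithinAt_const
    · refine continuousWithinAt_const.mul ?_
      exact (hF (t, γ x) ⟨ht, hwK x hx⟩).comp (f := fun s => (s, γ x))
        (by fun_prop) fun s hs => ⟨hs, hwK x hx⟩

/-- Fubini's theorem for kernels. -/
lemma IsKernelOn.comm (hK : IsCompact K) (hA : IsKernelOn K A) (hB : IsKernelOn K B)
    {F : ℂ → ℂ → ℂ} (hF : ContinuousOn (Function.uncurry F) (K ×ˢ K)) :
    A (fun x => B (F x)) = B fun y => A fun x => F x y := by
  have hF' : ContinuousOn (Function.uncurry fun y x => F x y) (K ×ˢ K) :=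
    hF.comp (f := fun p : ℂ × ℂ => (p.2, p.1)) (by fun_prop) fun p hp => ⟨hp.2, hp.1⟩
  have c1 := hB.continuousOn hK hK hF
  have c2 := hA.continuousOn hK hK hF'
  obtain ⟨X, _, ν, γ, w, _, hγ, hw, hwK, hAh⟩ := hA
  obtain ⟨Y, _, μ, δ, v, _, hδ, hv, hvK, hBh⟩ := hB
  rw [hAh _ c1, hBh _ c2]
  have e1 : ∫ x, w x * B (F (γ x)) ∂ν = ∫ x, ∫ y, w x * v y * F (γ x) (δ y) ∂μ ∂ν := by
    refine integral_congr_ae (Eventually.of_forall fun x => ?_)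
    by_cases hx : w x = 0
    · simp [hx]
    · simp only
      rw [hBh _ (continuousOn_slice hF (hwK x hx)), ← integral_const_mul]
      simp only [mul_assoc]
  have e2 : ∫ y, v y * A (fun x => F x (δ y)) ∂μ = ∫ y, ∫ x, w x * v y * F (γ x) (δ y) ∂ν ∂μ := by
    refine integral_congr_ae (Eventually.of_forall fun y => ?_)
    by_cases hy : v y = 0
    · simp [hy]
    · simp only
      rw [hAh _ (continuousOn_slice hF' (hvK y hy)), ← integral_const_mul]
      congr 1
      funext x
      ring
  rw [e1, e2]
  refine integral_integral_swap ?_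
  classical
  obtain ⟨C, hC⟩ := (hK.prod hK).exists_bound_of_continuousOn hF
  have hg : ∀ p : X × Y, Function.uncurry (fun x y => w x * v y * F (γ x) (δ y)) p =
      (w p.1 * v p.2) * (K ×ˢ K).piecewise (Function.uncurry F) 0 (γ p.1, δ p.2) := by
    rintro ⟨x, y⟩
    by_cases hx : w x = 0
    · simp [hx]
    by_cases hy : v y = 0
    · simp [hy]
    rw [Set.piecewise_eq_of_mem _ _ _ (Set.mk_mem_prod (hwK x hx) (hvK y hy))]
    rfl
  have hm : Measurable ((K ×ˢ K).piecewise (Function.uncurry F) 0) :=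
    hF.measurable_piecewise continuousOn_const (hK.measurableSet.prod hK.measurableSet)
  have hwv : Integrable (fun p : X × Y => w p.1 * v p.2) (ν.prod μ) := hw.mul_prod hv
  refine (hwv.norm.mul_const C).mono' ?_ (Eventually.of_forall fun p => ?_)
  · rw [funext hg]
    exact hwv.aestronglyMeasurable.mul
      (hm.comp ((hγ.comp measurable_fst).prodMk (hδ.comp measurable_snd))).aestronglyMeasurable
  · rcases p with ⟨x, y⟩
    by_cases hx : w x = 0
    · simp [hx]
    by_cases hy : v y = 0
    · simp [hy]
    simp only [Function.uncurry_apply_pair]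
    rw [norm_mul]
    exact mul_le_mul_of_nonneg_left (hC (γ x, δ y) (Set.mk_mem_prod (hwK x hx) (hvK y hy)))
      (norm_nonneg _)

lemma continuous_cons {n : ℕ} {T : Type*} [TopologicalSpace T] {f : T → ℂ} {g : T → Fin n → ℂ}
    (hf : Continuous f) (hg : Continuous g) :
    Continuous fun t => (Fin.cons (f t) (g t) : Fin (n + 1) → ℂ) := by
  refine continuous_pi fun i => ?_
  refine Fin.cases ?_ (fun i => ?_) i
  · simpa using hf
  · simpa [Function.comp_def] using (continuous_apply i).comp hg

lemma continuousOn_cons {n : ℕ} {T : Type*} [TopologicalSpace T] {S : Set T}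
    {F : T → (Fin (n + 1) → ℂ) → ℂ} (hF : ContinuousOn (Function.uncurry F) (S ×ˢ piSet (n + 1) K))
        :
    ContinuousOn (Function.uncurry fun (p : T × ℂ) (z : Fin n → ℂ) => F p.1 (Fin.cons p.2 z))
      ((S ×ˢ K) ×ˢ piSet n K) := by
  refine hF.comp (f := fun p : (T × ℂ) × (Fin n → ℂ) => (p.1.1, (Fin.cons p.1.2 p.2 : Fin (n + 1) →
      ℂ)))
    ?_ ?_
  · refine Continuous.continuousOn ?_
    refine (continuous_fst.comp continuous_fst).prodMk ?_
    exact continuous_cons (continuous_snd.comp continuous_fst) continuous_snd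
  · rintro ⟨⟨t, x⟩, z⟩ ⟨⟨ht, hx⟩, hz⟩
    refine ⟨ht, fun i => ?_⟩
    refine Fin.cases hx (fun i => ?_) i
    simpa using hz i

lemma continuousOn_iterInt (hK : IsCompact K) {n : ℕ} : ∀ {A : Fin n → (ℂ → ℂ) → ℂ}
    (_ : ∀ i, IsKernelOn K (A i)) {T : Type} [TopologicalSpace T] [FirstCountableTopology T]
    {S : Set T} (_ : IsCompact S) {F : T → (Fin n → ℂ) → ℂ}
    (_ : ContinuousOn (Function.uncurry F) (S ×ˢ piSet n K)),
    ContinuousOn (fun t => iterInt n A (F t)) S := by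
  induction n with
  | zero =>
    intro A hA T _ _ S hS F hF
    exact hF.comp (f := fun t => (t, fun i => i.elim0)) (by fun_prop) fun t ht => ⟨ht, fun i =>
        i.elim0⟩
  | succ n ih =>
    intro A hA T _ _ S hS F hF
    refine (hA 0).continuousOn hK hS
      (F := fun t x => iterInt n (fun i => A i.succ) fun z => F t (Fin.cons x z)) ?_
    exact ih (fun i => hA i.succ) (hS.prod hK) (continuousOn_cons hF)

lemma continuousOn_cons' {n : ℕ} {F : (Fin (n + 1) → ℂ) → ℂ}
    (hF : ContinuousOn F (piSet (n + 1) K)) :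
    ContinuousOn (Function.uncurry fun (x : ℂ) (z : Fin n → ℂ) => F (Fin.cons x z))
      (K ×ˢ piSet n K) := by
  refine hF.comp (f := fun p : ℂ × (Fin n → ℂ) => (Fin.cons p.1 p.2 : Fin (n + 1) → ℂ)) ?_ ?_
  · exact (continuous_cons continuous_fst continuous_snd).continuousOn
  · rintro ⟨x, z⟩ ⟨hx, hz⟩ i
    refine Fin.cases hx (fun i => ?_) i
    simpa using hz i

lemma iterInt_congr (hK : IsCompact K) {n : ℕ} : ∀ {A : Fin n → (ℂ → ℂ) → ℂ}
    (_ : ∀ i, IsKernelOn K (A i)) {F G : (Fin n → ℂ) → ℂ} (_ : ContinuousOn F (piSet n K))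
    (_ : Set.EqOn F G (piSet n K)), iterInt n A F = iterInt n A G := by
  induction n with
  | zero =>
    intro A _ F G _ e
    exact e fun i => i.elim0
  | succ n ih =>
    intro A hA F G hF e
    have hF' := continuousOn_cons' hF
    refine (hA 0).congr (continuousOn_iterInt hK (fun i => hA i.succ) hK hF') fun x hx => ?_
    refine ih (fun i => hA i.succ) (continuousOn_slice hF' hx) fun z hz => e fun i => ?_
    refine Fin.cases hx (fun i => ?_) i
    simpa using hz i

lemma iterInt_comm (hK : IsCompact K) (hB : IsKernelOn K B) {n : ℕ} :
    ∀ {A : Fin n → (ℂ → ℂ) → ℂ} (_ : ∀ i, IsKernelOn K (A i)) {F : ℂ → (Fin n → ℂ) → ℂ}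
    (_ : ContinuousOn (Function.uncurry F) (K ×ˢ piSet n K)),
    B (fun x => iterInt n A (F x)) = iterInt n A fun z => B fun x => F x z := by
  induction n with
  | zero =>
    intro A _ F _
    rfl
  | succ n ih =>
    intro A hA F hF
    have hF' := continuousOn_cons hF
    have h1 := hB.comm hK (hA 0)
      (F := fun x y => iterInt n (fun i => A i.succ) fun z => F x (Fin.cons y z))
      (continuousOn_iterInt hK (fun i => hA i.succ) (hK.prod hK) hF')
    refine h1.trans ?_
    refine (hA 0).congr ?_ fun y hy => ?_
    · refine hB.continuousOn hK hK
        (F := fun y x => iterInt n (fun i => A i.succ) fun z => F x (Fin.cons y z)) ?_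
      refine (continuousOn_iterInt hK (fun i => hA i.succ) (hK.prod hK) hF').comp
        (f := fun p : ℂ × ℂ => (p.2, p.1)) (by fun_prop) fun p hp => ⟨hp.2, hp.1⟩
    · refine ih (fun i => hA i.succ) (F := fun x z => F x (Fin.cons y z)) ?_
      exact hF'.comp (f := fun p : ℂ × (Fin n → ℂ) => ((p.1, y), p.2)) (by fun_prop)
        fun p hp => ⟨⟨hp.1, hy⟩, hp.2⟩

/-- The kernels of an iterated integral may be exchanged one variable at a time. -/
theorem iterInt_eq_of_slices (hK : IsCompact K) {n : ℕ} : ∀ {A B : Fin n → (ℂ → ℂ) → ℂ}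
    (_ : ∀ i, IsKernelOn K (A i)) (_ : ∀ i, IsKernelOn K (B i)) {F : (Fin n → ℂ) → ℂ}
    (_ : ContinuousOn F (piSet n K))
    (_ : ∀ j, ∀ z ∈ piSet n K, A j (fun x => F (Function.update z j x)) =
      B j fun x => F (Function.update z j x)), iterInt n A F = iterInt n B F := by
  induction n with
  | zero =>
    intro A B _ _ F _ _
    rfl
  | succ n ih =>
    intro A B hA hB F hF h
    have hF' := continuousOn_cons' hF
    have hcons : ∀ x ∈ K, ∀ z ∈ piSet n K, (Fin.cons x z : Fin (n + 1) → ℂ) ∈ piSet (n + 1) K := by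
      intro x hx z hz i
      refine Fin.cases hx (fun i => ?_) i
      simpa using hz i
    have hswap : ContinuousOn (Function.uncurry fun (z : Fin n → ℂ) (x : ℂ) => F (Fin.cons x z))
        (piSet n K ×ˢ K) := hF'.comp (f := fun p : (Fin n → ℂ) × ℂ => (p.2, p.1)) (by fun_prop)
          fun p hp => ⟨hp.2, hp.1⟩
    calc iterInt (n + 1) A F
        = A 0 fun x => iterInt n (fun i => B i.succ) fun z => F (Fin.cons x z) := by
          refine (hA 0).congr (continuousOn_iterInt hK (fun i => hA i.succ) hK hF') fun x hx => ?_
          refine ih (fun i => hA i.succ) (fun i => hB i.succ) (continuousOn_slice hF' hx)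
            fun j z hz => ?_
          have := h j.succ _ (hcons x hx z hz)
          simpa only [← Fin.cons_update] using this
      _ = iterInt n (fun i => B i.succ) fun z => A 0 fun x => F (Fin.cons x z) :=
          iterInt_comm hK (hA 0) (fun i => hB i.succ) hF'
      _ = iterInt n (fun i => B i.succ) fun z => B 0 fun x => F (Fin.cons x z) := by
          refine iterInt_congr hK (fun i => hB i.succ)
            ((hA 0).continuousOn hK (isCompact_piSet n hK) hswap) fun z hz => ?_
          by_cases hne : K.Nonempty
          · obtain ⟨x₀, hx₀⟩ := hne
            have := h 0 _ (hcons x₀ hx₀ z hz)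
            simpa only [Fin.update_cons_zero] using this
          · rw [Set.not_nonempty_iff_eq_empty] at hne
            subst hne
            rw [(hA 0).eq_zero, (hB 0).eq_zero]
      _ = iterInt (n + 1) B F := (iterInt_comm hK (hB 0) (fun i => hB i.succ) hF').symm

end Kernel

/-! ### Chains of circles as kernels -/

section KernelAlgebra

open MeasureTheory

variable {K : Set ℂ} {A B : (ℂ → ℂ) → ℂ}

lemma IsKernelOn.zero : IsKernelOn K fun _ => 0 :=
  ⟨ℝ, inferInstance, volume, fun _ => 0, 0, inferInstance, measurable_const, integrable_zero _ _ _,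
    by simp, by simp⟩

lemma IsKernelOn.const_mul (hA : IsKernelOn K A) (a : ℂ) : IsKernelOn K fun h => a * A h := by
  obtain ⟨X, _, ν, γ, w, hν, hγ, hw, hwK, hAh⟩ := hA
  refine ⟨X, _, ν, γ, fun x => a * w x, hν, hγ, hw.const_mul a,
    fun x hx => hwK x (right_ne_zero_of_mul hx), fun h hh => ?_⟩
  change a * A h = ∫ x, a * w x * h (γ x) ∂ν
  rw [hAh h hh, ← integral_const_mul]
  simp only [mul_assoc]

lemma measurableEmbedding_inl {X Y : Type*} [MeasurableSpace X] [MeasurableSpace Y] :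
    MeasurableEmbedding (Sum.inl : X → X ⊕ Y) :=
  ⟨Sum.inl_injective, measurable_inl, fun _ h => measurableSet_inl_image.2 h⟩

lemma measurableEmbedding_inr {X Y : Type*} [MeasurableSpace X] [MeasurableSpace Y] :
    MeasurableEmbedding (Sum.inr : Y → X ⊕ Y) :=
  ⟨Sum.inr_injective, measurable_inr, fun _ h => measurableSet_inr_image.2 h⟩

lemma IsKernelOn.add (hK : IsCompact K) (hA : IsKernelOn K A) (hB : IsKernelOn K B) :
    IsKernelOn K fun h => A h + B h := by
  obtain ⟨X, _, ν, γ, w, _, hγ, hw, hwK, hAh⟩ := hA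
  obtain ⟨Y, _, μ, δ, v, _, hδ, hv, hvK, hBh⟩ := hB
  have hγδ : Measurable (Sum.elim γ δ) := Measurable.sumElim hγ hδ
  have hwl : Integrable (Sum.elim w v) (ν.map Sum.inl) :=
    ((measurableEmbedding_inl).integrable_map_iff).2 (by simpa using hw)
  have hvr : Integrable (Sum.elim w v) (μ.map Sum.inr) :=
    (measurableEmbedding_inr.integrable_map_iff).2 (by simpa using hv)
  have hwv : ∀ x, Sum.elim w v x ≠ 0 → Sum.elim γ δ x ∈ K := by
    rintro (x | x) hx
    · exact hwK x hx
    · exact hvK x hx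
  refine ⟨X ⊕ Y, _, ν.map Sum.inl + μ.map Sum.inr, Sum.elim γ δ, Sum.elim w v, inferInstance, hγδ,
    hwl.add_measure hvr, hwv, fun h hh => ?_⟩
  change A h + B h = _
  rw [integral_add_measure (integrable_weight_mul hK hγδ hwl hwv hh)
    (integrable_weight_mul hK hγδ hvr hwv hh), measurableEmbedding_inl.integral_map,
    measurableEmbedding_inr.integral_map, hAh h hh, hBh h hh]
  simp

lemma IsKernelOn.sum (hK : IsCompact K) {ι : Type*} (s : Finset ι) {A : ι → (ℂ → ℂ) → ℂ}
    (hA : ∀ i ∈ s, IsKernelOn K (A i)) : IsKernelOn K fun h => ∑ i ∈ s, A i h := by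
  classical
  induction s using Finset.induction_on with
  | empty => simpa using IsKernelOn.zero
  | insert i s hi ih =>
    simp only [Finset.sum_insert hi]
    exact (hA i (Finset.mem_insert_self i s)).add hK
      (ih fun j hj => hA j (Finset.mem_insert_of_mem hj))

lemma IsKernelOn.apply_sum (hK : IsCompact K) (hA : IsKernelOn K A) {ι : Type*} (s : Finset ι)
    (a : ι → ℂ) (h : ι → ℂ → ℂ) (hh : ∀ i ∈ s, ContinuousOn (h i) K) :
    A (fun z => ∑ i ∈ s, a i * h i z) = ∑ i ∈ s, a i * A (h i) := by
  obtain ⟨X, _, ν, γ, w, _, hγ, hw, hwK, hAh⟩ := hA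
  have hc : ContinuousOn (fun z => ∑ i ∈ s, a i * h i z) K :=
    continuousOn_finsetSum s fun i hi => continuousOn_const.mul (hh i hi)
  rw [hAh _ hc]
  have : ∀ x, w x * ∑ i ∈ s, a i * h i (γ x) = ∑ i ∈ s, a i * (w x * h i (γ x)) := fun x => by
    rw [Finset.mul_sum]
    refine Finset.sum_congr rfl fun i _ => ?_
    ring
  simp only [this]
  rw [integral_finsetSum _ fun i hi =>
    (integrable_weight_mul hK hγ hw hwK (hh i hi)).const_mul (a i)]
  refine Finset.sum_congr rfl fun i hi => ?_
  rw [integral_const_mul, hAh _ (hh i hi)]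

lemma IsKernelOn.mono {L : Set ℂ} (hA : IsKernelOn K A) (h : K ⊆ L) : IsKernelOn L A := by
  obtain ⟨X, _, ν, γ, w, hν, hγ, hw, hwK, hAh⟩ := hA
  exact ⟨X, _, ν, γ, w, hν, hγ, hw, fun x hx => h (hwK x hx), fun f hf => hAh f (hf.mono h)⟩

end KernelAlgebra

/-- The functional `h ↦ ∮ h(z) dz / (2πiz)` over a circle. -/
def circleFun (x : ℂ × ℝ) (h : ℂ → ℂ) : ℂ :=
  ∮ z in C(x.1, x.2), h z * (2 * (Real.pi : ℂ) * Complex.I * z)⁻¹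

/-- The functional `h ↦ ∫ h(z) dz / (2πiz)` over a chain of circles. -/
def chainFun (C : CircleChain) (h : ℂ → ℂ) : ℂ := ∑ x ∈ C.support, (C x : ℂ) * circleFun x h

lemma isCompact_carrier (C : CircleChain) : IsCompact (carrier C) :=
  C.support.finite_toSet.isCompact_biUnion fun _ _ => isCompact_sphere _ _

lemma sphere_subset_carrier {C : CircleChain} {x : ℂ × ℝ} (hx : x ∈ C.support) :
    Metric.sphere x.1 x.2 ⊆ carrier C := fun _ hz => Set.mem_biUnion hx hz

lemma IsContour.zero_notMem {C : CircleChain} (hC : IsContour C) : (0 : ℂ) ∉ carrier C :=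
  hC.zero_mem.1

open MeasureTheory in
lemma isKernelOn_circleFun {x : ℂ × ℝ} (hx : 0 < x.2) {K : Set ℂ}
    (hK : Metric.sphere x.1 x.2 ⊆ K) (h0 : (0 : ℂ) ∉ K) : IsKernelOn K (circleFun x) := by
  have hmem : ∀ θ, circleMap x.1 x.2 θ ∈ K := fun θ => hK (circleMap_mem_sphere _ hx.le θ)
  have h0' : ∀ θ, circleMap x.1 x.2 θ ≠ 0 := fun θ h => h0 (h ▸ hmem θ)
  have hcont : Continuous fun θ : ℝ => deriv (circleMap x.1 x.2) θ *
      (2 * (Real.pi : ℂ) * Complex.I * circleMap x.1 x.2 θ)⁻¹ := by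
    refine Continuous.mul ?_ (Continuous.inv₀ (by fun_prop) fun θ => ?_)
    · rw [show deriv (circleMap x.1 x.2) = fun θ => circleMap 0 x.2 θ * Complex.I from
        funext fun θ => deriv_circleMap _ _ θ]
      fun_prop
    · exact mul_ne_zero Complex.two_pi_I_ne_zero (h0' θ)
  refine ⟨ℝ, inferInstance, volume.restrict (Set.Ioc 0 (2 * Real.pi)), circleMap x.1 x.2,
    fun θ => deriv (circleMap x.1 x.2) θ * (2 * (Real.pi : ℂ) * Complex.I * circleMap x.1 x.2 θ)⁻¹,
    inferInstance, (continuous_circleMap _ _).measurable,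
    (hcont.integrableOn_Icc).mono_set Set.Ioc_subset_Icc_self, fun θ _ => hmem θ, fun h _ => ?_⟩
  unfold circleFun circleIntegral
  rw [intervalIntegral.integral_of_le Real.two_pi_pos.le]
  congr 1
  funext θ
  simp only [smul_eq_mul]
  ring

lemma isKernelOn_chainFun {C : CircleChain} (hC : IsContour C) : IsKernelOn (carrier C) (chainFun
    C) :=
  IsKernelOn.sum (isCompact_carrier C) _ fun x hx =>
    (isKernelOn_circleFun (hC.radius_pos x hx) (sphere_subset_carrier hx) hC.zero_notMem).const_mul
        _

open MeasureTheory in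
lemma torusIntegral_eq_iterInt {K : Set ℂ} (h0 : (0 : ℂ) ∉ K) {n : ℕ} :
    ∀ {x : Fin n → ℂ × ℝ} (_ : ∀ j, 0 < (x j).2) (_ : ∀ j, Metric.sphere (x j).1 (x j).2 ⊆ K)
    {F : (Fin n → ℂ) → ℂ} (_ : ContinuousOn F (piSet n K)),
    torusIntegral (fun z => F z * ∏ j, (2 * (Real.pi : ℂ) * Complex.I * z j)⁻¹)
      (fun j => (x j).1) (fun j => (x j).2) = iterInt n (fun j => circleFun (x j)) F := by
  induction n with
  | zero =>
    intro x _ _ F _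
    rw [torusIntegral_dim0]
    simp only [Finset.univ_eq_empty, Finset.prod_empty, mul_one, iterInt]
    congr 1
    exact Subsingleton.elim _ _
  | succ n ih =>
    intro x hx hxK F hF
    rw [torusIntegral_succ]
    · change _ = ∮ z in C((x 0).1, (x 0).2), iterInt n (fun j => circleFun (x j.succ))
        (fun y => F (Fin.cons z y)) * (2 * (Real.pi : ℂ) * Complex.I * z)⁻¹
      refine circleIntegral.integral_congr (hx 0).le fun z hz => ?_
      have hF' : ContinuousOn (fun y : Fin n → ℂ => F (Fin.cons z y)) (piSet n K) :=
        continuousOn_slice (continuousOn_cons' hF) (hxK 0 hz)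
      rw [← ih (fun j => hx j.succ) (fun j => hxK j.succ) hF', mul_comm (torusIntegral _ _ _),
        ← torusIntegral_const_mul]
      congr 1
      funext y
      rw [Fin.prod_univ_succ]
      simp only [Fin.cons_zero, Fin.cons_succ]
      ring
    · have hmap : ∀ θ, torusMap (fun j => (x j).1) (fun j => (x j).2) θ ∈ piSet (n + 1) K :=
        fun θ j => hxK j (circleMap_mem_sphere _ (hx j).le (θ j))
      unfold TorusIntegrable
      refine ContinuousOn.integrableOn_compact isCompact_Icc (Continuous.continuousOn ?_)
      have hc : ContinuousOn (fun z : Fin (n + 1) → ℂ =>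
          F z * ∏ j, (2 * (Real.pi : ℂ) * Complex.I * z j)⁻¹) (piSet (n + 1) K) := by
        refine hF.mul (continuousOn_finsetProd _ fun j _ => ContinuousOn.inv₀ (by fun_prop) ?_)
        intro z hz
        refine mul_ne_zero Complex.two_pi_I_ne_zero fun h => h0 (h ▸ hz j)
      refine hc.comp_continuous ?_ hmap
      unfold torusMap
      fun_prop

lemma sum_piFinset_succ {α : Type*} {M : Type*} [AddCommMonoid M] (s : Finset α) (n : ℕ)
    (f : (Fin (n + 1) → α) → M) :
    ∑ x ∈ Fintype.piFinset (fun _ : Fin (n + 1) => s), f x =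
      ∑ a ∈ s, ∑ x ∈ Fintype.piFinset (fun _ : Fin n => s), f (Fin.cons a x) := by
  rw [← Finset.sum_product']
  refine (Finset.sum_bij' (fun p _ => (Fin.cons p.1 p.2 : Fin (n + 1) → α))
    (fun x _ => (x 0, Fin.tail x)) ?_ ?_ ?_ ?_ ?_).symm
  · rintro ⟨a, x⟩ h
    rw [Finset.mem_product, Fintype.mem_piFinset] at h
    rw [Fintype.mem_piFinset]
    intro i
    refine Fin.cases ?_ (fun i => ?_) i
    · simpa using h.1
    · simpa using h.2 i
  · intro x h
    rw [Fintype.mem_piFinset] at h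
    rw [Finset.mem_product, Fintype.mem_piFinset]
    exact ⟨h 0, fun i => h i.succ⟩
  · simp
  · simp
  · simp

theorem chainIntegral_eq_iterInt {C : CircleChain} (hC : IsContour C) {n : ℕ} :
    ∀ {F : (Fin n → ℂ) → ℂ} (_ : ContinuousOn F (piSet n (carrier C))),
    chainIntegral n C F = iterInt n (fun _ => chainFun C) F := by
  have hcirc : ∀ x ∈ C.support, IsKernelOn (carrier C) (circleFun x) := fun x hx =>
    isKernelOn_circleFun (hC.radius_pos x hx) (sphere_subset_carrier hx) hC.zero_notMem
  have h1 : ∀ {n : ℕ} {F : (Fin n → ℂ) → ℂ} (_ : ContinuousOn F (piSet n (carrier C))),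
      chainIntegral n C F = ∑ x ∈ Fintype.piFinset (fun _ : Fin n => C.support),
        (∏ j, (C (x j) : ℂ)) * iterInt n (fun j => circleFun (x j)) F := by
    intro n F hF
    unfold chainIntegral
    refine Finset.sum_congr rfl fun x hx => ?_
    rw [Fintype.mem_piFinset] at hx
    rw [torusIntegral_eq_iterInt hC.zero_notMem (fun j => hC.radius_pos _ (hx j))
      (fun j => sphere_subset_carrier (hx j)) hF]
  intro F hF
  rw [h1 hF]
  clear h1
  induction n with
  | zero => simp [iterInt]
  | succ n ih =>
    have hF' := continuousOn_cons' hF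
    rw [sum_piFinset_succ]
    simp only [iterInt]
    unfold chainFun
    refine Finset.sum_congr rfl fun a ha => ?_
    have hc : ∀ x ∈ Fintype.piFinset (fun _ : Fin n => C.support), ContinuousOn
        (fun z => iterInt n (fun j => circleFun (x j)) fun y => F (Fin.cons z y)) (carrier C) := by
      intro x hx
      rw [Fintype.mem_piFinset] at hx
      exact continuousOn_iterInt (isCompact_carrier C) (fun i => hcirc _ (hx i))
        (isCompact_carrier C) hF'
    have h2 := (hcirc a ha).apply_sum (isCompact_carrier C)
      (Fintype.piFinset (fun _ : Fin n => C.support)) (fun x => ∏ j, (C (x j) : ℂ))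
      (fun x z => iterInt n (fun j => circleFun (x j)) fun y => F (Fin.cons z y)) hc
    have h3 : circleFun a (fun z => iterInt n (fun _ => chainFun C) fun y => F (Fin.cons z y)) =
        ∑ x ∈ Fintype.piFinset (fun _ : Fin n => C.support), (∏ j, (C (x j) : ℂ)) *
          circleFun a fun z => iterInt n (fun j => circleFun (x j)) fun y => F (Fin.cons z y) := by
      rw [← h2]
      refine (hcirc a ha).congr (continuousOn_iterInt (isCompact_carrier C)
        (fun _ => isKernelOn_chainFun hC) (isCompact_carrier C) hF') fun z hz => ?_
      exact (ih (continuousOn_slice hF' hz)).symm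
    change _ = (C a : ℂ) * circleFun a (fun z => iterInt n (fun _ => chainFun C) fun y => F
        (Fin.cons z y))
    rw [h3, Finset.mul_sum]
    refine Finset.sum_congr rfl fun x _ => ?_
    rw [Fin.prod_univ_succ]
    simp only [Fin.cons_zero, Fin.cons_succ, mul_assoc]

/-! ### Area integrals attached to cutoff functions -/

section Cutoff

open MeasureTheory Complex

/-- The Wirtinger derivative `∂χ/∂z̄`. -/
def dbar (χ : ℂ → ℂ) (z : ℂ) : ℂ := (fderiv ℝ χ z 1 + I * fderiv ℝ χ z I) / 2

/-- The functional `h ↦ -π⁻¹ ∬ (∂χ/∂z̄) h(z) dA / z`. If `χ` is a cutoff function, equal to `1`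
well inside and to `0` well outside of a contour, Stokes' theorem identifies it with
`h ↦ ∫ h(z) dz / (2πiz)` on functions that are holomorphic where `χ` varies. -/
def cutoffInt (χ h : ℂ → ℂ) : ℂ := -(Real.pi : ℂ)⁻¹ * ∫ z, dbar χ z * (h z / z)

lemma fderiv_real_of_differentiableAt {g : ℂ → ℂ} {z : ℂ} (hg : DifferentiableAt ℂ g z) (v : ℂ) :
    fderiv ℝ g z v = v * deriv g z := by
  rw [(hg.hasFDerivAt.restrictScalars ℝ).fderiv]
  change fderiv ℂ g z v = _
  rw [fderiv_eq_smul_deriv, smul_eq_mul]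

lemma dbar_congr {f g : ℂ → ℂ} {z : ℂ} (h : f =ᶠ[𝓝 z] g) : dbar f z = dbar g z := by
  unfold dbar
  rw [h.fderiv_eq]

lemma dbar_const (c z : ℂ) : dbar (fun _ => c) z = 0 := by
  simp [dbar]

lemma dbar_eq_zero_of_eventually_const {f : ℂ → ℂ} {c z : ℂ} (h : ∀ᶠ w in 𝓝 z, f w = c) :
    dbar f z = 0 := by
  rw [dbar_congr (g := fun _ => c) h, dbar_const]

lemma dbar_mul {f g : ℂ → ℂ} {z : ℂ} (hf : DifferentiableAt ℝ f z) (hg : DifferentiableAt ℂ g z) :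
    dbar (fun w => f w * g w) z = dbar f z * g z := by
  have hg' : DifferentiableAt ℝ g z := hg.restrictScalars ℝ
  unfold dbar
  rw [fderiv_fun_mul hf hg']
  simp only [_root_.add_apply, _root_.smul_apply, smul_eq_mul, fderiv_real_of_differentiableAt hg]
  linear_combination (f z * deriv g z / 2) * I_sq

lemma dbar_sub {f g : ℂ → ℂ} {z : ℂ} (hf : DifferentiableAt ℝ f z) (hg : DifferentiableAt ℝ g z) :
    dbar (fun w => f w - g w) z = dbar f z - dbar g z := by
  unfold dbar
  rw [fderiv_fun_sub hf hg]
  simp only [_root_.sub_apply]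
  ring

lemma dbar_sum {ι : Type*} (s : Finset ι) (a : ι → ℂ) {f : ι → ℂ → ℂ} {z : ℂ}
    (hf : ∀ i ∈ s, DifferentiableAt ℝ (f i) z) :
    dbar (fun w => ∑ i ∈ s, a i * f i w) z = ∑ i ∈ s, a i * dbar (f i) z := by
  have h : HasFDerivAt (fun w => ∑ i ∈ s, a i * f i w) (∑ i ∈ s, a i • fderiv ℝ (f i) z) z :=
    HasFDerivAt.fun_sum fun i hi => (hf i hi).hasFDerivAt.const_mul (a i)
  unfold dbar
  rw [h.fderiv]
  simp only [_root_.sum_apply, _root_.smul_apply, smul_eq_mul, Finset.mul_sum]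
  rw [← Finset.sum_add_distrib, Finset.sum_div]
  refine Finset.sum_congr rfl fun i _ => ?_
  ring

lemma continuous_dbar {χ : ℂ → ℂ} (h : ContDiff ℝ 1 χ) : Continuous (dbar χ) := by
  have := h.continuous_fderiv one_ne_zero
  unfold dbar
  fun_prop

/-- Stokes' theorem for compactly supported functions. -/
lemma integral_dbar_eq_zero {G : ℂ → ℂ} (hG : ContDiff ℝ 1 G) (hs : HasCompactSupport G) :
    ∫ z, dbar G z = 0 := by
  have hc : ∀ v : ℂ, Continuous fun z => fderiv ℝ G z v := fun v => by
    have := hG.continuous_fderiv one_ne_zero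
    fun_prop
  have hi : ∀ v : ℂ, Integrable fun z => fderiv ℝ G z v := fun v =>
    (hc v).integrable_of_hasCompactSupport (hs.fderiv_apply (𝕜 := ℝ) v)
  have h0 : ∀ v : ℂ, ∫ z, fderiv ℝ G z v = 0 := fun v => by
    have := integral_mul_fderiv_eq_neg_fderiv_mul_of_integrable (μ := (volume : Measure ℂ))
      (f := fun _ : ℂ => (1 : ℂ)) (g := G) (v := v) (by simp) (by simpa using hi v)
      (by simpa using hG.continuous.integrable_of_hasCompactSupport hs)
      (fun x _ => differentiableAt_const _) (fun x _ => hG.differentiable one_ne_zero x)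
    simpa using this
  unfold dbar
  rw [integral_div, integral_add (hi 1) ((hi I).const_mul I), integral_const_mul, h0, h0]
  simp

/-- `χ` is a cutoff function which vanishes off `K` and is equal to `1` on `O`. -/
structure IsCut (χ : ℂ → ℂ) (K O : Set ℂ) : Prop where
  contDiff : ContDiff ℝ 1 χ
  isCompact : IsCompact K
  isOpen : IsOpen O
  eq_zero : ∀ z ∉ K, χ z = 0
  eq_one : ∀ z ∈ O, χ z = 1


lemma IsCut.dbar_eq_zero {χ : ℂ → ℂ} {K O : Set ℂ} (h : IsCut χ K O) {z : ℂ} (hz : z ∉ K \ O) :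
    dbar χ z = 0 := by
  by_cases hK : z ∈ K
  · have hO : z ∈ O := by_contra fun hO => hz ⟨hK, hO⟩
    exact dbar_eq_zero_of_eventually_const ((h.isOpen.eventually_mem hO).mono h.eq_one)
  · exact dbar_eq_zero_of_eventually_const
      ((h.isCompact.isClosed.isOpen_compl.eventually_mem hK).mono h.eq_zero)

lemma isKernelOn_cutoffInt {χ : ℂ → ℂ} {L : Set ℂ} (hχ : ContDiff ℝ 1 χ) (hL : IsCompact L)
    (h0 : (0 : ℂ) ∉ L) (hz : ∀ z ∉ L, dbar χ z = 0) : IsKernelOn L (cutoffInt χ) := by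
  have hc : ContinuousOn (fun z => -(Real.pi : ℂ)⁻¹ * dbar χ z / z) L :=
    ((continuous_const.mul (continuous_dbar hχ)).continuousOn).div continuousOn_id
      fun z hz h => h0 (h ▸ hz)
  refine ⟨ℂ, inferInstance, volume.restrict L, id, fun z => -(Real.pi : ℂ)⁻¹ * dbar χ z / z,
    inferInstance, measurable_id, hc.integrableOn_compact hL, fun x hx => ?_, fun h _ => ?_⟩
  · by_contra hxL
    exact hx (by simp [hz x hxL])
  · have : ∀ z ∉ L, -(Real.pi : ℂ)⁻¹ * dbar χ z / z * h (id z) = 0 := fun z hzL => by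
      simp [hz z hzL]
    rw [setIntegral_eq_integral_of_forall_compl_eq_zero this]
    unfold cutoffInt
    rw [← integral_const_mul]
    congr 1
    funext z
    simp only [id]
    ring

lemma integrable_dbar_mul {χ : ℂ → ℂ} {L : Set ℂ} (hχ : ContDiff ℝ 1 χ) (hL : IsCompact L)
    (h0 : (0 : ℂ) ∉ L) (hz : ∀ z ∉ L, dbar χ z = 0) {h : ℂ → ℂ} (hh : ContinuousOn h L) :
    Integrable fun z => dbar χ z * (h z / z) := by
  have hc : ContinuousOn (fun z => dbar χ z * (h z / z)) L :=
    (continuous_dbar hχ).continuousOn.mul (hh.div continuousOn_id fun z hz h => h0 (h ▸ hz))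
  refine (integrableOn_iff_integrable_of_support_subset fun z hzs => ?_).1
    (hc.integrableOn_compact hL)
  by_contra hzL
  exact hzs (by simp [hz z hzL])

/-- The functional attached to a cutoff function does not change if the cutoff function is changed
on a compact set in the domain of holomorphy. -/
lemma cutoffInt_eq {χ χ' : ℂ → ℂ} {L V : Set ℂ} (hχ : ContDiff ℝ 1 χ) (hχ' : ContDiff ℝ 1 χ')
    (hL : IsCompact L) (h0 : (0 : ℂ) ∉ L) (hz : ∀ z ∉ L, dbar χ z = 0)
    (hz' : ∀ z ∉ L, dbar χ' z = 0) (e : ∀ z ∉ L, χ z = χ' z) (hV : IsOpen V) (hLV : L ⊆ V)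
    {h : ℂ → ℂ} (hh : DifferentiableOn ℂ h V) : cutoffInt χ h = cutoffInt χ' h := by
  have hcL : ContinuousOn h L := hh.continuousOn.mono hLV
  have hg : ∀ z ∈ L, ContDiffAt ℂ 1 (fun w => h w / w) z := fun z hzL =>
    (((hh.contDiffOn hV).contDiffAt (hV.mem_nhds (hLV hzL))).div contDiffAt_id
      fun h => h0 (h ▸ hzL))
  have hL0 : ∀ z ∉ L, ∀ᶠ w in 𝓝 z, χ w - χ' w = 0 := fun z hzL =>
    (hL.isClosed.isOpen_compl.eventually_mem hzL).mono fun w hw => sub_eq_zero.2 (e w hw)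
  have hG : ContDiff ℝ 1 fun z => (χ z - χ' z) * (h z / z) := by
    rw [contDiff_iff_contDiffAt]
    intro z
    by_cases hzL : z ∈ L
    · exact (hχ.contDiffAt.sub hχ'.contDiffAt).mul ((hg z hzL).restrict_scalars ℝ)
    · refine (contDiffAt_const (c := (0 : ℂ))).congr_of_eventuallyEq ?_
      filter_upwards [hL0 z hzL] with w hw
      rw [hw, zero_mul]
  have hd : ∀ z, dbar (fun z => (χ z - χ' z) * (h z / z)) z =
      dbar χ z * (h z / z) - dbar χ' z * (h z / z) := by
    intro z
    by_cases hzL : z ∈ L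
    · have h1 := hχ.differentiable one_ne_zero z
      have h2 := hχ'.differentiable one_ne_zero z
      rw [dbar_mul (h1.fun_sub h2) ((hg z hzL).differentiableAt one_ne_zero), dbar_sub h1 h2]
      ring
    · rw [hz z hzL, hz' z hzL, dbar_eq_zero_of_eventually_const (c := 0)]
      · ring
      · filter_upwards [hL0 z hzL] with w hw
        rw [hw, zero_mul]
  have := integral_dbar_eq_zero hG (HasCompactSupport.intro hL fun z hzL => by
    rw [e z hzL, sub_self, zero_mul])
  simp only [hd] at this
  rw [integral_sub (integrable_dbar_mul hχ hL h0 hz hcL) (integrable_dbar_mul hχ' hL h0 hz' hcL),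
    sub_eq_zero] at this
  unfold cutoffInt
  rw [this]

lemma dbar_radial {φ : ℝ → ℝ} {φ' : ℝ} {c z : ℂ} (h : HasDerivAt φ φ' (‖z - c‖ ^ 2)) :
    dbar (fun w => (φ (‖w - c‖ ^ 2) : ℂ)) z = φ' * (z - c) := by
  have h1 : HasFDerivAt (fun w : ℂ => ‖w - c‖ ^ 2) (2 • innerSL ℝ (z - c)) z := by
    simpa using ((hasFDerivAt_id (𝕜 := ℝ) z).sub_const c).norm_sq
  have h2 := (Complex.ofRealCLM.hasFDerivAt).comp z (h.comp_hasFDerivAt z h1)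
  have h3 : HasFDerivAt (fun w : ℂ => (φ (‖w - c‖ ^ 2) : ℂ)) _ z := h2
  unfold dbar
  rw [h3.fderiv]
  simp [Complex.inner, Complex.ext_iff]
  constructor <;> ring

/-- A cutoff function for the disc with centre `c` and radius `r`. -/
def discCut (c : ℂ) (r δ : ℝ) (z : ℂ) : ℂ :=
  (Real.smoothTransition (((r + δ) ^ 2 - ‖z - c‖ ^ 2) / (4 * r * δ)) : ℝ)

lemma contDiff_discCut (c : ℂ) (r δ : ℝ) : ContDiff ℝ 1 (discCut c r δ) := by
  unfold discCut
  refine Complex.ofRealCLM.contDiff.comp (Real.smoothTransition.contDiff.comp ?_)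
  exact (contDiff_const.sub ((contDiff_id.sub contDiff_const).norm_sq ℝ)).div_const _

lemma discCut_eq_zero {c z : ℂ} {r δ : ℝ} (hδ : 0 < δ) (hr : δ < r) (hz : r + δ ≤ ‖z - c‖) :
    discCut c r δ z = 0 := by
  unfold discCut
  rw [Real.smoothTransition.zero_of_nonpos]
  · simp
  · refine div_nonpos_of_nonpos_of_nonneg ?_ (by nlinarith)
    nlinarith

lemma discCut_eq_one {c z : ℂ} {r δ : ℝ} (hδ : 0 < δ) (hr : δ < r) (hz : ‖z - c‖ ≤ r - δ) :
    discCut c r δ z = 1 := by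
  unfold discCut
  rw [Real.smoothTransition.one_of_one_le]
  · simp
  · rw [one_le_div (by nlinarith)]
    nlinarith [norm_nonneg (z - c)]

end Cutoff

section Disc

open MeasureTheory Complex

lemma circleIntegral_eq_neg_pi_pi (g : ℂ → ℂ) (c : ℂ) (ρ : ℝ) :
    (∮ z in C(c, ρ), g z) = ∫ θ in Set.Ioo (-Real.pi) Real.pi,
      (circleMap 0 ρ θ * I) * g (circleMap c ρ θ) := by
  have hper : Function.Periodic (fun θ : ℝ => (circleMap 0 ρ θ * I) * g (circleMap c ρ θ))
      (2 * Real.pi) := fun θ => by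
    simp only [periodic_circleMap _ _ θ]
  have := hper.intervalIntegral_add_eq 0 (-Real.pi)
  rw [zero_add, show -Real.pi + 2 * Real.pi = Real.pi by ring] at this
  unfold circleIntegral
  simp only [deriv_circleMap, smul_eq_mul]
  rw [this, intervalIntegral.integral_of_le (by linarith [Real.pi_pos]),
      integral_Ioc_eq_integral_Ioo]

lemma circleIntegral_eq_of_annulus {g : ℂ → ℂ} {c : ℂ} {r r' : ℝ} (hr : 0 < r) (hr' : r ≤ r')
    (hg : ∀ z, r ≤ ‖z - c‖ → ‖z - c‖ ≤ r' → DifferentiableAt ℂ g z) :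
    (∮ z in C(c, r), g z) = ∮ z in C(c, r'), g z := by
  refine (circleIntegral_eq_of_differentiable_on_annulus_off_countable hr hr'
    Set.countable_empty (fun z hz => ?_) fun z hz => ?_).symm
  · simp only [Set.mem_sdiff, Metric.mem_closedBall, Metric.mem_ball, not_lt, dist_eq_norm] at hz
    exact (hg z hz.2 hz.1).continuousAt.continuousWithinAt
  · simp only [Set.mem_sdiff, Metric.mem_closedBall, Metric.mem_ball, not_le, dist_eq_norm,
      Set.mem_empty_iff_false, not_false_eq_true, and_true] at hz
    exact hg z hz.2.le hz.1.le

/-- On functions which are holomorphic in an annulus, integration over the circle is given by the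
area functional of a radial cutoff function. -/
lemma circleFun_eq_cutoffInt {c : ℂ} {r δ : ℝ} (hδ : 0 < δ) (hr : δ < r) {h : ℂ → ℂ}
    (hh : ∀ z, r - δ ≤ ‖z - c‖ → ‖z - c‖ ≤ r + δ → DifferentiableAt ℂ h z ∧ z ≠ 0) :
    circleFun (c, r) h = cutoffInt (discCut c r δ) h := by
  set φ : ℝ → ℝ := fun u => Real.smoothTransition (((r + δ) ^ 2 - u) / (4 * r * δ)) with hφ
  have hφs : ContDiff ℝ 1 φ := Real.smoothTransition.contDiff.comp (by fun_prop)
  have hφ' : ∀ u, HasDerivAt φ (deriv φ u) u := fun u => (hφs.differentiable one_ne_zero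
      u).hasDerivAt
  have hφc : Continuous (deriv φ) := hφs.continuous_deriv le_rfl
  have h0 : ∀ ρ : ℝ, 0 < ρ → ¬(r - δ ≤ ρ ∧ ρ ≤ r + δ) → deriv φ (ρ ^ 2) = 0 := by
    intro ρ hρ hn
    by_cases h1 : r - δ ≤ ρ
    · have h2 : r + δ < ρ := by
        by_contra h2
        exact hn ⟨h1, not_lt.1 h2⟩
      have : φ =ᶠ[𝓝 (ρ ^ 2)] fun _ => 0 := by
        filter_upwards [lt_mem_nhds (show (r + δ) ^ 2 < ρ ^ 2 by nlinarith)] with u hu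
        exact Real.smoothTransition.zero_of_nonpos
          (div_nonpos_of_nonpos_of_nonneg (by linarith) (by nlinarith))
      rw [this.deriv_eq, deriv_const]
    · have : φ =ᶠ[𝓝 (ρ ^ 2)] fun _ => 1 := by
        filter_upwards [gt_mem_nhds (show ρ ^ 2 < (r - δ) ^ 2 by nlinarith)] with u hu
        refine Real.smoothTransition.one_of_one_le ?_
        rw [one_le_div (by nlinarith)]
        nlinarith
      rw [this.deriv_eq, deriv_const]
  set g : ℂ → ℂ := fun z => h z / z with hg
  have hgd : ∀ z, r - δ ≤ ‖z - c‖ → ‖z - c‖ ≤ r + δ → DifferentiableAt ℂ g z := fun z h1 h2 =>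
    (hh z h1 h2).1.div differentiableAt_id (hh z h1 h2).2
  -- the integrals over all circles in the annulus agree
  set J : ℂ := ∮ z in C(c, r), g z with hJ
  have hJρ : ∀ ρ, r - δ ≤ ρ → ρ ≤ r + δ → (∮ z in C(c, ρ), g z) = J := by
    intro ρ h1 h2
    rcases le_total ρ r with h3 | h3
    · exact circleIntegral_eq_of_annulus (by linarith) h3 fun z h4 h5 =>
        hgd z (by linarith) (by linarith)
    · exact (circleIntegral_eq_of_annulus (by linarith) h3 fun z h4 h5 =>
        hgd z (by linarith) (by linarith)).symm
  have hnorm : ∀ ρ θ : ℝ, 0 < ρ → ‖circleMap c ρ θ - c‖ = ρ := fun ρ θ hρ => by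
    simp [circleMap, abs_of_pos hρ]
  -- the area integral in polar coordinates
  set f : ℝ × ℝ → ℂ := fun x => (x.1 * deriv φ (x.1 ^ 2) : ℝ) *
    (circleMap 0 x.1 x.2 * g (circleMap c x.1 x.2)) with hf
  have hpolar : ∫ z, dbar (discCut c r δ) z * (h z / z) =
      ∫ x in Set.Ioi (0 : ℝ) ×ˢ Set.Ioo (-Real.pi) Real.pi, f x := by
    have e : ∀ z, dbar (discCut c r δ) z = deriv φ (‖z - c‖ ^ 2) * (z - c) := fun z =>
      dbar_radial (hφ' _)
    simp only [e]
    rw [← integral_add_right_eq_self _ c, ← Complex.integral_comp_polarCoord_symm]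
    refine setIntegral_congr_fun ?_ fun x hx => ?_
    · exact polarCoord.open_target.measurableSet
    · have hx1 : 0 < x.1 := hx.1
      have e1 : Complex.polarCoord.symm x = circleMap 0 x.1 x.2 := by
        rw [Complex.polarCoord_symm_apply, circleMap, Complex.exp_mul_I]
        push_cast
        ring
      have e2 : Complex.polarCoord.symm x + c = circleMap c x.1 x.2 := by
        rw [e1]
        simp [circleMap, add_comm]
      simp only [hf, e2, hnorm _ _ hx1, hg]
      rw [← e2, add_sub_cancel_right, e1, real_smul]
      push_cast
      ring
  have hfint : IntegrableOn f (Set.Ioi (0 : ℝ) ×ˢ Set.Ioo (-Real.pi) Real.pi) := by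
    have hc : ContinuousOn f (Set.Icc (r - δ) (r + δ) ×ˢ Set.Icc (-Real.pi) Real.pi) := by
      have c1 : Continuous fun x : ℝ × ℝ => circleMap c x.1 x.2 := by
        unfold circleMap
        fun_prop
      have c2 : Continuous fun x : ℝ × ℝ => circleMap 0 x.1 x.2 := by
        unfold circleMap
        fun_prop
      have c3 : ContinuousOn (fun x : ℝ × ℝ => g (circleMap c x.1 x.2))
          (Set.Icc (r - δ) (r + δ) ×ˢ Set.Icc (-Real.pi) Real.pi) := fun x hx => by
        have hx1 : 0 < x.1 := by linarith [hx.1.1]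
        have := hgd (circleMap c x.1 x.2) (by rw [hnorm _ _ hx1]; exact hx.1.1)
          (by rw [hnorm _ _ hx1]; exact hx.1.2)
        exact (this.continuousAt.comp (f := fun x : ℝ × ℝ => circleMap c x.1 x.2)
          c1.continuousAt).continuousWithinAt
      have c4 : Continuous fun x : ℝ × ℝ => ((x.1 * deriv φ (x.1 ^ 2) : ℝ) : ℂ) := by
        fun_prop
      exact c4.continuousOn.mul (c2.continuousOn.mul c3)
    refine (hc.integrableOn_compact (isCompact_Icc.prod isCompact_Icc)).of_forall_sdiff_eq_zero
      (measurableSet_Ioi.prod measurableSet_Ioo) fun x hx => ?_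
    have : deriv φ (x.1 ^ 2) = 0 := h0 _ hx.1.1 fun h1 => hx.2
      ⟨h1, hx.1.2.1.le, hx.1.2.2.le⟩
    simp [hf, this]
  have hinner : ∀ ρ ∈ Set.Ioi (0 : ℝ), (∫ θ in Set.Ioo (-Real.pi) Real.pi, f (ρ, θ)) =
      ((ρ * deriv φ (ρ ^ 2) : ℝ) : ℂ) * (J / I) := by
    intro ρ hρ
    simp only [hf]
    rw [integral_const_mul]
    by_cases h1 : r - δ ≤ ρ ∧ ρ ≤ r + δ
    · rw [← hJρ ρ h1.1 h1.2, circleIntegral_eq_neg_pi_pi, ← integral_div]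
      congr 2
      funext θ
      field_simp
    · rw [h0 ρ hρ h1]
      simp
  have hcont : Continuous fun ρ : ℝ => ρ * deriv φ (ρ ^ 2) := by fun_prop
  have hrad : ∫ ρ in Set.Ioi (0 : ℝ), ρ * deriv φ (ρ ^ 2) = -1 / 2 := by
    have hd : ∀ ρ : ℝ, HasDerivAt (fun ρ => φ (ρ ^ 2) / 2) (ρ * deriv φ (ρ ^ 2)) ρ := fun ρ => by
      have := ((hφ' (ρ ^ 2)).comp ρ (hasDerivAt_pow 2 ρ)).div_const 2
      refine this.congr_deriv ?_
      simp
      ring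
    have hint : IntegrableOn (fun ρ : ℝ => ρ * deriv φ (ρ ^ 2)) (Set.Ioi 0) := by
      refine (hcont.integrableOn_Icc (a := r - δ) (b := r + δ)).of_forall_sdiff_eq_zero
        measurableSet_Ioi fun ρ hρ => ?_
      rw [h0 ρ hρ.1 hρ.2, mul_zero]
    have hlim : Tendsto (fun ρ : ℝ => φ (ρ ^ 2) / 2) atTop (𝓝 0) := by
      refine tendsto_const_nhds.congr' ?_
      filter_upwards [eventually_ge_atTop (r + δ)] with ρ hρ
      have : φ (ρ ^ 2) = 0 := Real.smoothTransition.zero_of_nonpos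
        (div_nonpos_of_nonpos_of_nonneg (by nlinarith) (by nlinarith))
      rw [this, zero_div]
    rw [integral_Ioi_of_hasDerivAt_of_tendsto (hd 0).continuousAt.continuousWithinAt
      (fun ρ _ => hd ρ) hint hlim]
    have : φ (0 ^ 2) = 1 := by
      refine Real.smoothTransition.one_of_one_le ?_
      rw [one_le_div (by nlinarith)]
      nlinarith [sq_nonneg (r - δ)]
    rw [this]
    norm_num
  have hfin : ∫ z, dbar (discCut c r δ) z * (h z / z) = (-1 / 2 : ℂ) * (J / I) := by
    rw [hpolar]
    change ∫ x in _, f x ∂(volume.prod volume) = _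
    rw [setIntegral_prod _ hfint, setIntegral_congr_fun measurableSet_Ioi hinner,
      integral_mul_const]
    have : ∫ ρ in Set.Ioi (0 : ℝ), ((ρ * deriv φ (ρ ^ 2) : ℝ) : ℂ) = ((-1 / 2 : ℝ) : ℂ) := by
      rw [← hrad]
      exact integral_ofReal
    rw [this]
    push_cast
    ring
  have hcirc : circleFun (c, r) h = (2 * (Real.pi : ℂ) * I)⁻¹ * J := by
    rw [hJ, ← smul_eq_mul, ← circleIntegral.integral_smul]
    unfold circleFun
    congr 1
    funext z
    simp only [hg, smul_eq_mul, mul_inv]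
    ring
  rw [hcirc]
  unfold cutoffInt
  rw [hfin]
  have := Real.pi_ne_zero
  field_simp

end Disc

section ChangeOfVariables

open MeasureTheory Complex

/-- The change of variables formula for holomorphic bijections of `ℂ \ {0}`. -/
lemma integral_comp_holomorphic {φ φ' : ℂ → ℂ} (hd : ∀ z ≠ 0, HasDerivAt φ (φ' z) z)
    (hi : Set.InjOn φ {0}ᶜ) (him : φ '' {0}ᶜ = {0}ᶜ) (g : ℂ → ℂ) :
    ∫ z, g z = ∫ z, ((‖φ' z‖ ^ 2 : ℝ) : ℂ) * g (φ z) := by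
  have key : ∀ g : ℂ → ℂ, ∫ z in {0}ᶜ, g z = ∫ z, g z := fun g => by
    rw [restrict_compl_singleton]
  rw [← key, ← key fun z => ((‖φ' z‖ ^ 2 : ℝ) : ℂ) * g (φ z), ← him,
    integral_image_eq_integral_abs_det_fderiv_smul volume (measurableSet_singleton 0).compl
      (f' := fun z => (ContinuousLinearMap.toSpanSingleton ℂ (φ' z)).restrictScalars ℝ)
      (fun z hz => ((hd z hz).hasFDerivAt.restrictScalars ℝ).hasFDerivWithinAt) hi, him]
  refine setIntegral_congr_fun (measurableSet_singleton 0).compl fun z _ => ?_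
  have : ((ContinuousLinearMap.toSpanSingleton ℂ (φ' z)).restrictScalars ℝ).det = ‖φ' z‖ ^ 2 := by
    have h1 : Algebra.norm ℝ (φ' z) = normSq (φ' z) := Algebra.norm_complex_apply _
    rw [← normSq_eq_norm_sq, ← h1, Algebra.norm_apply, ContinuousLinearMap.det]
    congr 1
    ext w
    simp [mul_comm]
  simp only [this, abs_of_nonneg (sq_nonneg ‖φ' z‖), real_smul]

lemma dbar_comp {χ φ : ℂ → ℂ} {φ' z : ℂ} (hχ : DifferentiableAt ℝ χ (φ z))
    (hφ : HasDerivAt φ φ' z) :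
    dbar (fun w => χ (φ w)) z = dbar χ (φ z) * (starRingEnd ℂ) φ' := by
  have h1 := hχ.hasFDerivAt.comp z (hφ.hasFDerivAt.restrictScalars ℝ)
  have h2 : HasFDerivAt (fun w => χ (φ w)) _ z := h1
  unfold dbar
  rw [h2.fderiv]
  have hv : ∀ v : ℂ, fderiv ℝ χ (φ z) v =
      v.re * fderiv ℝ χ (φ z) 1 + v.im * fderiv ℝ χ (φ z) I := fun v => by
    have e : v = v.re • (1 : ℂ) + v.im • I := by simp
    conv_lhs => rw [e]
    rw [map_add, map_smul, map_smul, real_smul, real_smul]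
  have e1 := hv φ'
  have e2 := hv (I * φ')
  simp only [ContinuousLinearMap.comp_apply, ContinuousLinearMap.coe_restrictScalars',
    ContinuousLinearMap.toSpanSingleton_apply, smul_eq_mul, one_mul]
  rw [e1, e2]
  have e3 : (starRingEnd ℂ) φ' = φ'.re - φ'.im * I := by
    apply Complex.ext <;> simp
  rw [e3]
  simp only [I_mul_re, I_mul_im]
  push_cast
  linear_combination (φ'.im * fderiv ℝ χ (φ z) I - 0) / 2 * (I_sq)

lemma cutoffInt_comp_mul {χ : ℂ → ℂ} (hχ : ContDiff ℝ 1 χ) {l : ℂ} (hl : l ≠ 0) (h : ℂ → ℂ) :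
    cutoffInt χ (fun z => h (l * z)) = cutoffInt (fun z => χ (z / l)) h := by
  unfold cutoffInt
  rw [integral_comp_holomorphic (φ := fun w => w / l) (φ' := fun _ => l⁻¹)]
  · congr 2
    funext z
    have hd : HasDerivAt (fun w : ℂ => w / l) l⁻¹ z := by
      simpa [div_eq_mul_inv] using (hasDerivAt_id z).div_const l
    rw [dbar_comp (φ := fun w => w / l) (hχ.differentiable one_ne_zero _) hd]
    simp only [mul_div_cancel₀ _ hl]
    rw [← normSq_eq_norm_sq, normSq_eq_conj_mul_self, div_div_eq_mul_div]
    field_simp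
  · intro z _
    simpa [div_eq_mul_inv] using (hasDerivAt_id z).div_const l
  · intro z _ w _ e
    exact (div_left_inj' hl).1 e
  · ext z
    simp only [Set.mem_image, Set.mem_compl_iff, Set.mem_singleton_iff]
    constructor
    · rintro ⟨w, hw, rfl⟩
      exact div_ne_zero hw hl
    · intro hz
      exact ⟨z * l, mul_ne_zero hz hl, mul_div_cancel_right₀ z hl⟩

lemma IsCut.comp_div {χ : ℂ → ℂ} {K O : Set ℂ} (hχ : IsCut χ K O) {l : ℂ} (hl : l ≠ 0) :
    IsCut (fun z => χ (z / l)) {z | z / l ∈ K} {z | z / l ∈ O} where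
  contDiff := hχ.contDiff.comp (by fun_prop)
  isCompact := by
    have : {z | z / l ∈ K} = (fun z => z * l) '' K := by
      ext z
      simp only [Set.mem_image]
      exact ⟨fun h => ⟨z / l, h, div_mul_cancel₀ z hl⟩, fun ⟨w, hw, e⟩ => by
        rw [Set.mem_ofPred_eq, ← e, mul_div_cancel_right₀ w hl]
        exact hw⟩
    rw [this]
    exact hχ.isCompact.image (by fun_prop)
  isOpen := hχ.isOpen.preimage (by fun_prop)
  eq_zero := fun z hz => hχ.eq_zero _ hz
  eq_one := fun z hz => hχ.eq_one _ hz

/-- The cutoff function for the image of the exterior under inversion. -/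
def invCut (χ : ℂ → ℂ) (z : ℂ) : ℂ := if z = 0 then 1 else 1 - χ z⁻¹

lemma IsCut.eventually_inv {χ : ℂ → ℂ} {K O : Set ℂ} (hχ : IsCut χ K O) :
    ∃ ε > 0, ∀ z : ℂ, z ≠ 0 → ‖z‖ < ε → z⁻¹ ∉ K := by
  obtain ⟨R, hR⟩ := hχ.isCompact.isBounded.exists_norm_le
  refine ⟨(|R| + 1)⁻¹, by positivity, fun z hz hzε h => ?_⟩
  have h1 := hR _ h
  rw [norm_inv] at h1
  have h2 := (lt_inv_comm₀ (norm_pos_iff.2 hz) (by positivity)).1 hzε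
  linarith [le_abs_self R]

/-- Inversion exchanges the roles of the larger and the smaller set. -/
lemma isCut_invCut {χ : ℂ → ℂ} {K O : Set ℂ} (hχ : IsCut χ K O) (h0 : (0 : ℂ) ∈ O) :
    IsCut (invCut χ) {z | z = 0 ∨ z⁻¹ ∉ O} {z | z = 0 ∨ z⁻¹ ∉ K} := by
  obtain ⟨ε, hε, hεK⟩ := hχ.eventually_inv
  have hnear : ∀ z : ℂ, ‖z‖ < ε → z = 0 ∨ z⁻¹ ∉ K := fun z hz =>
    (em (z = 0)).imp id fun h => hεK z h hz
  have hone : ∀ z : ℂ, (z = 0 ∨ z⁻¹ ∉ K) → invCut χ z = 1 := by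
    intro z hz
    unfold invCut
    split_ifs with h
    · rfl
    · rw [hχ.eq_zero _ (hz.resolve_left h), sub_zero]
  have hinv : ∀ z : ℂ, z ≠ 0 → ContinuousAt (fun z : ℂ => z⁻¹) z := fun z hz => continuousAt_inv₀ hz
  refine ⟨?_, ?_, ?_, ?_, hone⟩
  · rw [contDiff_iff_contDiffAt]
    intro z
    by_cases hz : z = 0
    · refine (contDiffAt_const (c := (1 : ℂ))).congr_of_eventuallyEq ?_
      filter_upwards [Metric.ball_mem_nhds z hε] with w hw
      rw [Metric.mem_ball, hz, dist_zero_right] at hw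
      exact hone w (hnear w hw)
    · have h1 : ContDiffAt ℝ 1 (fun w : ℂ => w⁻¹) z := (contDiffAt_inv ℂ hz).restrict_scalars ℝ
      refine ((contDiffAt_const (c := (1 : ℂ))).sub
        (hχ.contDiff.contDiffAt.comp z h1)).congr_of_eventuallyEq ?_
      filter_upwards [isOpen_ne.eventually_mem hz] with w hw
      unfold invCut
      rw [if_neg hw]
      rfl
  · obtain ⟨d, hd, hdO⟩ := Metric.isOpen_iff.1 hχ.isOpen 0 h0
    have hbdd : Bornology.IsBounded {z : ℂ | z = 0 ∨ z⁻¹ ∉ O} := by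
      refine (Metric.isBounded_closedBall (x := (0 : ℂ)) (r := d⁻¹)).subset ?_
      rintro z (hz | hz)
      · rw [hz]
        simp [hd.le]
      · rw [mem_closedBall_zero_iff]
        by_contra hlt
        push Not at hlt
        refine hz (hdO ?_)
        rw [mem_ball_zero_iff, norm_inv]
        exact inv_lt_of_inv_lt₀ hd hlt
    refine Metric.isCompact_of_isClosed_isBounded ?_ hbdd
    rw [← isOpen_compl_iff, isOpen_iff_mem_nhds]
    intro z hz
    simp only [Set.mem_compl_iff, Set.mem_ofPred_eq, not_or, not_not] at hz
    filter_upwards [isOpen_ne.eventually_mem hz.1,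
      (hinv z hz.1).eventually_mem (hχ.isOpen.mem_nhds hz.2)] with w h1 h2
    simp only [Set.mem_compl_iff, Set.mem_ofPred_eq, not_or, not_not]
    exact ⟨h1, h2⟩
  · rw [isOpen_iff_mem_nhds]
    intro z hz
    by_cases h : z = 0
    · filter_upwards [Metric.ball_mem_nhds z hε] with w hw
      rw [Metric.mem_ball, h, dist_zero_right] at hw
      exact hnear w hw
    · filter_upwards [(hinv z h).eventually_mem
        (hχ.isCompact.isClosed.isOpen_compl.mem_nhds (hz.resolve_left h))] with w hw
      exact Or.inr hw
  · intro z hz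
    rw [Set.mem_ofPred_eq, not_or, not_not] at hz
    unfold invCut
    rw [if_neg hz.1, hχ.eq_one _ hz.2, sub_self]

lemma cutoffInt_comp_inv {χ : ℂ → ℂ} {K O : Set ℂ} (hχ : IsCut χ K O) (h : ℂ → ℂ) :
    cutoffInt χ (fun z => h z⁻¹) = cutoffInt (invCut χ) h := by
  unfold cutoffInt
  rw [integral_comp_holomorphic (φ := fun w => w⁻¹) (φ' := fun z => -(z ^ 2)⁻¹)]
  · congr 1
    have h0 : ∀ᵐ z : ℂ, z ≠ 0 := by
      simp [ae_iff]
    refine integral_congr_ae ?_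
    filter_upwards [h0] with z hz
    have e : dbar (invCut χ) z = dbar χ z⁻¹ * (starRingEnd ℂ) (z ^ 2)⁻¹ := by
      rw [dbar_congr (g := fun w => 1 - χ w⁻¹) (by
        filter_upwards [isOpen_ne.eventually_mem hz] with w hw
        unfold invCut
        rw [if_neg hw])]
      have hi : DifferentiableAt ℝ (fun w : ℂ => χ w⁻¹) z :=
        (hχ.contDiff.differentiable one_ne_zero _).comp z
          ((differentiableAt_inv (𝕜 := ℂ) hz).restrictScalars ℝ)
      rw [dbar_sub (differentiableAt_const _) hi, dbar_const,
        dbar_comp (hχ.contDiff.differentiable one_ne_zero _) (hasDerivAt_inv hz)]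
      simp
    rw [e, inv_inv, ← normSq_eq_norm_sq, normSq_eq_conj_mul_self]
    have hz' : (starRingEnd ℂ) z ≠ 0 := (map_ne_zero _).2 hz
    simp only [map_neg, map_inv₀, map_pow]
    field_simp
  · exact fun z hz => hasDerivAt_inv (𝕜 := ℂ) hz
  · exact fun z _ w _ e => inv_injective e
  · ext z
    simp only [Set.mem_image, Set.mem_compl_iff, Set.mem_singleton_iff]
    exact ⟨fun ⟨w, hw, e⟩ => e ▸ inv_ne_zero hw, fun hz => ⟨z⁻¹, inv_ne_zero hz, inv_inv z⟩⟩

end ChangeOfVariables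

/-! ### Cutoff functions for chains -/

/-- The union of the closed annuli of width `2δ` around the circles of a chain. -/
def tube (C : CircleChain) (δ : ℝ) : Set ℂ :=
  ⋃ x ∈ C.support, {w : ℂ | x.2 - δ ≤ ‖w - x.1‖ ∧ ‖w - x.1‖ ≤ x.2 + δ}

/-- The cutoff function for the region bounded by a chain. -/
def chainCut (C : CircleChain) (δ : ℝ) (z : ℂ) : ℂ :=
  ∑ x ∈ C.support, (C x : ℂ) * discCut x.1 x.2 δ z

lemma mem_carrier {C : CircleChain} {w : ℂ} : w ∈ carrier C ↔ ∃ x ∈ C.support, ‖w - x.1‖ = x.2 := by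
  simp only [carrier, Set.mem_iUnion, mem_sphere_iff_norm, exists_prop]

lemma mem_tube {C : CircleChain} {δ : ℝ} {w : ℂ} :
    w ∈ tube C δ ↔ ∃ x ∈ C.support, x.2 - δ ≤ ‖w - x.1‖ ∧ ‖w - x.1‖ ≤ x.2 + δ := by
  simp only [tube, Set.mem_iUnion, Set.mem_ofPred_eq, exists_prop]

lemma carrier_subset_tube (C : CircleChain) {δ : ℝ} (hδ : 0 ≤ δ) : carrier C ⊆ tube C δ := by
  intro w hw
  obtain ⟨x, hx, e⟩ := mem_carrier.1 hw
  exact mem_tube.2 ⟨x, hx, by linarith, by linarith⟩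

lemma isCompact_tube (C : CircleChain) (δ : ℝ) : IsCompact (tube C δ) := by
  refine C.support.finite_toSet.isCompact_biUnion fun x _ => ?_
  refine Metric.isCompact_of_isClosed_isBounded ?_ ?_
  · have hc : Continuous fun w : ℂ => ‖w - x.1‖ := by fun_prop
    exact (isClosed_le continuous_const hc).inter (isClosed_le hc continuous_const)
  · refine (Metric.isBounded_closedBall (x := x.1) (r := x.2 + δ)).subset fun w hw => ?_
    rw [Metric.mem_closedBall, dist_eq_norm]
    exact hw.2

lemma winding_eq_sum (C : CircleChain) (w : ℂ) :
    winding C w = ∑ x ∈ C.support, if ‖w - x.1‖ < x.2 then C x else 0 := rfl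

lemma eventually_winding_eq {C : CircleChain} {w : ℂ} (hw : w ∉ carrier C) :
    ∀ᶠ v in 𝓝 w, v ∉ carrier C ∧ winding C v = winding C w := by
  have h1 : ∀ x ∈ C.support, ∀ᶠ v in 𝓝 w, (‖v - x.1‖ < x.2 ↔ ‖w - x.1‖ < x.2) := by
    intro x hx
    have hc : Continuous fun v : ℂ => ‖v - x.1‖ := by fun_prop
    rcases lt_trichotomy ‖w - x.1‖ x.2 with h | h | h
    · filter_upwards [(isOpen_lt hc continuous_const).eventually_mem h] with v hv
      exact iff_of_true hv h
    · exact absurd (mem_carrier.2 ⟨x, hx, h⟩) hw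
    · filter_upwards [(isOpen_lt continuous_const hc).eventually_mem h] with v hv
      exact iff_of_false (not_lt.2 (le_of_lt hv)) (not_lt.2 h.le)
  filter_upwards [(Finset.eventually_all C.support).2 h1,
    (isCompact_carrier C).isClosed.isOpen_compl.eventually_mem hw] with v hv hv'
  refine ⟨hv', ?_⟩
  rw [winding_eq_sum, winding_eq_sum]
  refine Finset.sum_congr rfl fun x hx => ?_
  simp only [hv x hx]

lemma isOpen_inside (C : CircleChain) : IsOpen (inside C) := by
  rw [isOpen_iff_mem_nhds]
  rintro w ⟨h1, h2⟩
  filter_upwards [eventually_winding_eq h1] with v hv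
  exact ⟨hv.1, hv.2.trans h2⟩

lemma isOpen_outside (C : CircleChain) : IsOpen (outside C) := by
  rw [isOpen_iff_mem_nhds]
  rintro w ⟨h1, h2⟩
  filter_upwards [eventually_winding_eq h1] with v hv
  exact ⟨hv.1, hv.2.trans h2⟩

lemma isBounded_inside (C : CircleChain) : Bornology.IsBounded (inside C) := by
  have : inside C ⊆ ⋃ x ∈ C.support, Metric.closedBall x.1 x.2 := by
    rintro w ⟨_, h⟩
    rw [winding_eq_sum] at h
    obtain ⟨x, hx, hne⟩ := Finset.exists_ne_zero_of_sum_ne_zero (h ▸ one_ne_zero)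
    refine Set.mem_biUnion hx ?_
    rw [Metric.mem_closedBall, dist_eq_norm]
    by_contra hlt
    exact hne (if_neg fun h => hlt h.le)
  refine Bornology.IsBounded.subset ?_ this
  exact (Bornology.isBounded_biUnion C.support.finite_toSet).2 fun x _ =>
      Metric.isBounded_closedBall

lemma outside_disjoint_inside {C : CircleChain} {w : ℂ} (h : w ∈ outside C) : w ∉ inside C :=
  fun h' => by
    have := h.2.symm.trans h'.2
    norm_num at this

lemma chainCut_eq_winding {C : CircleChain} {δ : ℝ} (hδ : 0 < δ) (hδC : ∀ x ∈ C.support, δ < x.2)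
    {w : ℂ} (hw : w ∉ tube C δ) : chainCut C δ w = winding C w := by
  rw [winding_eq_sum, chainCut, Int.cast_sum]
  refine Finset.sum_congr rfl fun x hx => ?_
  by_cases h : ‖w - x.1‖ < x.2
  · rw [if_pos h, discCut_eq_one hδ (hδC x hx), mul_one]
    by_contra h'
    exact hw (mem_tube.2 ⟨x, hx, by linarith, by linarith⟩)
  · rw [if_neg h, discCut_eq_zero hδ (hδC x hx), mul_zero, Int.cast_zero]
    by_contra h'
    exact hw (mem_tube.2 ⟨x, hx, by linarith, by linarith⟩)

lemma contDiff_chainCut (C : CircleChain) (δ : ℝ) : ContDiff ℝ 1 (chainCut C δ) := by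
  unfold chainCut
  exact ContDiff.sum fun x _ => contDiff_const.mul (contDiff_discCut _ _ _)

lemma IsContour.isCut {C : CircleChain} (hC : IsContour C) {δ : ℝ} (hδ : 0 < δ)
    (hδC : ∀ x ∈ C.support, δ < x.2) :
    IsCut (chainCut C δ) (tube C δ ∪ inside C) (inside C \ tube C δ) where
  contDiff := contDiff_chainCut C δ
  isCompact := by
    refine Metric.isCompact_of_isClosed_isBounded ?_
      ((isCompact_tube C δ).isBounded.union (isBounded_inside C))
    have : tube C δ ∪ inside C = tube C δ ∪ (outside C)ᶜ := by
      ext w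
      simp only [Set.mem_union, Set.mem_compl_iff]
      refine or_congr_right' fun h => ?_
      have hw : w ∉ carrier C := fun h' => h (carrier_subset_tube C hδ.le h')
      exact ⟨fun h1 h2 => outside_disjoint_inside h2 h1, fun h1 => (hC.region w hw).resolve_right
          h1⟩
    rw [this]
    exact (isCompact_tube C δ).isClosed.union (isOpen_outside C).isClosed_compl
  isOpen := (isOpen_inside C).sdiff (isCompact_tube C δ).isClosed
  eq_zero := fun w hw => by
    rw [Set.mem_union, not_or] at hw
    rw [chainCut_eq_winding hδ hδC hw.1]
    have hw' : w ∉ carrier C := fun h' => hw.1 (carrier_subset_tube C hδ.le h')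
    rw [((hC.region w hw').resolve_left hw.2).2, Int.cast_zero]
  eq_one := fun w hw => by
    rw [chainCut_eq_winding hδ hδC hw.2, hw.1.2, Int.cast_one]

lemma tube_subset_cthickening {C : CircleChain} {δ : ℝ} (hδC : ∀ x ∈ C.support, δ < x.2)
    (hδ : 0 < δ) : tube C δ ⊆ Metric.cthickening δ (carrier C) := by
  intro w hw
  obtain ⟨x, hx, h1, h2⟩ := mem_tube.1 hw
  have h0 : 0 < ‖w - x.1‖ := by linarith [hδC x hx]
  refine Metric.mem_cthickening_of_dist_le w (x.1 + (x.2 / ‖w - x.1‖ : ℝ) * (w - x.1)) δ _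
    (mem_carrier.2 ⟨x, hx, ?_⟩) ?_
  · rw [add_sub_cancel_left, norm_mul, Complex.norm_real, norm_div, norm_norm, Real.norm_eq_abs,
      abs_of_pos (by linarith [hδC x hx]), div_mul_cancel₀ _ h0.ne']
  · have : w - (x.1 + (x.2 / ‖w - x.1‖ : ℝ) * (w - x.1)) = (1 - x.2 / ‖w - x.1‖ : ℝ) * (w -
        x.1) := by
      push_cast
      ring
    rw [dist_eq_norm, this, norm_mul, Complex.norm_real, Real.norm_eq_abs,
      ← abs_of_pos h0, ← abs_mul, abs_of_pos h0, sub_mul, div_mul_cancel₀ _ h0.ne', one_mul, abs_le]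
    exact ⟨by linarith, by linarith⟩

/-- Thin tubes lie in any given neighbourhood of the chain. -/
lemma IsContour.eventually_tube {C : CircleChain} (hC : IsContour C) {V : Set ℂ} (hV : IsOpen V)
    (h : carrier C ⊆ V) :
    ∀ᶠ δ : ℝ in 𝓝[>] 0, tube C δ ⊆ V ∧ ∀ x ∈ C.support, δ < x.2 := by
  obtain ⟨ε, hε, hεV⟩ := (isCompact_carrier C).exists_cthickening_subset_open hV h
  have h1 : ∀ᶠ δ : ℝ in 𝓝[>] 0, ∀ x ∈ C.support, δ < x.2 :=
    (Finset.eventually_all C.support).2 fun x hx =>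
      nhdsWithin_le_nhds (gt_mem_nhds (hC.radius_pos x hx))
  filter_upwards [h1, self_mem_nhdsWithin, nhdsWithin_le_nhds (gt_mem_nhds hε)] with δ h2 h3 h4
  exact ⟨((tube_subset_cthickening h2 h3).trans (Metric.cthickening_mono h4.le _)).trans hεV, h2⟩

lemma dbar_discCut_eq_zero {C : CircleChain} {δ : ℝ} (hδ : 0 < δ)
    (hδC : ∀ x ∈ C.support, δ < x.2) {x : ℂ × ℝ} (hx : x ∈ C.support) {z : ℂ} (hz : z ∉ tube C δ) :
    dbar (discCut x.1 x.2 δ) z = 0 := by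
  have hc : Continuous fun z : ℂ => ‖z - x.1‖ := by fun_prop
  by_cases h1 : ‖z - x.1‖ < x.2 - δ
  · refine dbar_eq_zero_of_eventually_const (c := 1) ?_
    filter_upwards [(isOpen_lt hc continuous_const).eventually_mem h1] with w hw
    exact discCut_eq_one hδ (hδC x hx) (le_of_lt hw)
  · have h2 : x.2 + δ < ‖z - x.1‖ := by
      by_contra h2
      exact hz (mem_tube.2 ⟨x, hx, not_lt.1 h1, not_lt.1 h2⟩)
    refine dbar_eq_zero_of_eventually_const (c := 0) ?_
    filter_upwards [(isOpen_lt continuous_const hc).eventually_mem h2] with w hw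
    exact discCut_eq_zero hδ (hδC x hx) (le_of_lt hw)

lemma cutoffInt_chainCut {C : CircleChain} {δ : ℝ} (hδ : 0 < δ)
    (hδC : ∀ x ∈ C.support, δ < x.2) (h0 : (0 : ℂ) ∉ tube C δ) {h : ℂ → ℂ}
    (hh : ContinuousOn h (tube C δ)) :
    cutoffInt (chainCut C δ) h =
      ∑ x ∈ C.support, (C x : ℂ) * cutoffInt (discCut x.1 x.2 δ) h := by
  have hsum : ∀ z, dbar (chainCut C δ) z * (h z / z) =
      ∑ x ∈ C.support, (C x : ℂ) * (dbar (discCut x.1 x.2 δ) z * (h z / z)) := fun z => by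
    have := dbar_sum C.support (fun x => (C x : ℂ)) (f := fun x => discCut x.1 x.2 δ) (z := z)
      fun x _ => (contDiff_discCut x.1 x.2 δ).differentiable one_ne_zero z
    unfold chainCut
    rw [this, Finset.sum_mul]
    simp only [mul_assoc]
  have hint : ∀ x ∈ C.support, MeasureTheory.Integrable fun z =>
      (C x : ℂ) * (dbar (discCut x.1 x.2 δ) z * (h z / z)) := fun x hx =>
    (integrable_dbar_mul (contDiff_discCut x.1 x.2 δ) (isCompact_tube C δ) h0
      (fun z hz => dbar_discCut_eq_zero hδ hδC hx hz) hh).const_mul _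
  unfold cutoffInt
  simp only [hsum]
  rw [MeasureTheory.integral_finsetSum _ hint, Finset.mul_sum]
  refine Finset.sum_congr rfl fun x hx => ?_
  rw [MeasureTheory.integral_const_mul, mul_left_comm]

lemma chainFun_eq_cutoffInt {C : CircleChain} {δ : ℝ} (hδ : 0 < δ)
    (hδC : ∀ x ∈ C.support, δ < x.2) (h0 : (0 : ℂ) ∉ tube C δ) {V : Set ℂ} (hV : IsOpen V)
    (hCV : tube C δ ⊆ V) {h : ℂ → ℂ} (hh : DifferentiableOn ℂ h V) :
    chainFun C h = cutoffInt (chainCut C δ) h := by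
  rw [cutoffInt_chainCut hδ hδC h0 (hh.continuousOn.mono hCV), chainFun]
  refine Finset.sum_congr rfl fun x hx => ?_
  congr 1
  refine circleFun_eq_cutoffInt (c := x.1) (r := x.2) hδ (hδC x hx) fun z h1 h2 => ?_
  have hzt : z ∈ tube C δ := mem_tube.2 ⟨x, hx, h1, h2⟩
  exact ⟨hh.differentiableAt (hV.mem_nhds (hCV hzt)), fun h => h0 (h ▸ hzt)⟩

/-! ### Deformation of contours -/

lemma continuous_update_apply {n : ℕ} (z : Fin n → ℂ) (j : Fin n) :
    Continuous fun x : ℂ => Function.update z j x := by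
  fun_prop

lemma differentiable_update_apply {n : ℕ} (z : Fin n → ℂ) (j : Fin n) :
    Differentiable ℂ fun x : ℂ => Function.update z j x := fun x =>
  (hasFDerivAt_update z x).differentiableAt

lemma update_mem_piSet {n : ℕ} {L : Set ℂ} {z : Fin n → ℂ} (hz : z ∈ piSet n L) (j : Fin n) {x : ℂ}
    (hx : x ∈ L) : Function.update z j x ∈ piSet n L := by
  intro i
  by_cases h : i = j
  · subst h
    simpa using hx
  · simpa [h] using hz i

/-- Two cutoff functions that differ only on a compact set `L` give the same iterated integral of a
function that is holomorphic near `L^n`: they are exchanged one variable at a time. -/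
lemma iterInt_cutoffInt_eq {χ χ' : ℂ → ℂ} {L : Set ℂ} (hχ : ContDiff ℝ 1 χ) (hχ' : ContDiff ℝ 1 χ')
    (hL : IsCompact L) (h0 : (0 : ℂ) ∉ L) (hz : ∀ z ∉ L, dbar χ z = 0)
    (hz' : ∀ z ∉ L, dbar χ' z = 0) (e : ∀ z ∉ L, χ z = χ' z) {n : ℕ} {V : Set (Fin n → ℂ)}
    (hV : IsOpen V) (hLV : piSet n L ⊆ V) {F : (Fin n → ℂ) → ℂ} (hF : DifferentiableOn ℂ F V) :
    iterInt n (fun _ => cutoffInt χ) F = iterInt n (fun _ => cutoffInt χ') F := by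
  refine iterInt_eq_of_slices hL (fun _ => isKernelOn_cutoffInt hχ hL h0 hz)
    (fun _ => isKernelOn_cutoffInt hχ' hL h0 hz') (hF.continuousOn.mono hLV) fun j z hzL => ?_
  refine cutoffInt_eq (V := {x | Function.update z j x ∈ V}) hχ hχ' hL h0 hz hz' e
    (hV.preimage (continuous_update_apply z j)) (fun x hx => hLV (update_mem_piSet hzL j hx)) ?_
  exact hF.comp (differentiable_update_apply z j).differentiableOn fun x hx => hx

/-- The integral over a chain is given by the area functional of its cutoff function. -/
lemma IsContour.chainIntegral_eq_cutoffInt {C : CircleChain} (hC : IsContour C) {δ : ℝ} (hδ : 0 < δ)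
    (hδC : ∀ x ∈ C.support, δ < x.2) (h0 : (0 : ℂ) ∉ tube C δ) {n : ℕ} {V : Set (Fin n → ℂ)}
    (hV : IsOpen V) (hCV : piSet n (tube C δ) ⊆ V) {F : (Fin n → ℂ) → ℂ}
    (hF : DifferentiableOn ℂ F V) :
    chainIntegral n C F = iterInt n (fun _ => cutoffInt (chainCut C δ)) F := by
  have hsub : piSet n (carrier C) ⊆ piSet n (tube C δ) := fun z hz i =>
    carrier_subset_tube C hδ.le (hz i)
  rw [chainIntegral_eq_iterInt hC (hF.continuousOn.mono (hsub.trans hCV))]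
  have hcut := hC.isCut hδ hδC
  refine iterInt_eq_of_slices (isCompact_tube C δ)
    (fun _ => (isKernelOn_chainFun hC).mono (carrier_subset_tube C hδ.le))
    (fun _ => isKernelOn_cutoffInt hcut.contDiff (isCompact_tube C δ) h0 fun z hz =>
      hcut.dbar_eq_zero fun h => h.2 ⟨h.1.resolve_left hz, hz⟩)
    (hF.continuousOn.mono hCV) fun j z hz => ?_
  exact chainFun_eq_cutoffInt hδ hδC h0 (V := {x | Function.update z j x ∈ V})
    (hV.preimage (continuous_update_apply z j)) (fun x hx => hCV (update_mem_piSet hz j hx))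
    (hF.comp (differentiable_update_apply z j).differentiableOn fun x hx => hx)

/-- The points of `(ℂ^*)^n` off the polar divisors `z_j ∈ E`, `x z_j = 1` with `x ∈ X`,
`z_j = s z_k` and `z_j z_k = s` with `s ∈ S`, and `s z_j z_k = 1` with `s ∈ S'`. -/
def offPoles (n : ℕ) (E X S S' : Set ℂ) : Set (Fin n → ℂ) :=
  {z | ∀ j, z j ≠ 0 ∧ z j ∉ E ∧ (∀ x ∈ X, x * z j ≠ 1) ∧
    ∀ k, k ≠ j → (∀ s ∈ S, z j ≠ s * z k ∧ z j * z k ≠ s) ∧ ∀ s ∈ S', s * (z j * z k) ≠ 1}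

/-- A pair of sets `K` and `O`, thought of as slightly larger and slightly smaller than the region
bounded by a contour, which separates the two kinds of poles. The conditions imply that the polar
divisors in `offPoles` do not meet `(K \ O)^n`. -/
structure Separates (E X S S' K O : Set ℂ) : Prop where
  zero_mem : 0 ∈ O
  contains : E ⊆ O
  excludes : ∀ x ∈ X, ∀ z ∈ K, x * z ≠ 1
  cross : ∀ s ∈ S, ∀ z ∈ K, s * z ∈ O
  cross_inv : ∀ s ∈ S, ∀ w ∉ O, s / w ∈ O
  cross_mul : ∀ s ∈ S', ∀ z ∈ K, ∀ w ∈ K, s * (z * w) ≠ 1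

lemma Separates.piSet_subset {E X S S' K O : Set ℂ} (h : Separates E X S S' K O) (n : ℕ) :
    piSet n (K \ O) ⊆ offPoles n E X S S' := by
  intro z hz j
  have h0 : ∀ k, z k ≠ 0 := fun k e => (hz k).2 (e ▸ h.zero_mem)
  refine ⟨h0 j, fun e => (hz j).2 (h.contains e), fun x hx => h.excludes x hx _ (hz j).1,
    fun k _ => ⟨fun s hs => ⟨fun e => (hz j).2 (e ▸ h.cross s hs _ (hz k).1), fun e => ?_⟩,
      fun s hs => h.cross_mul s hs _ (hz j).1 _ (hz k).1⟩⟩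
  refine (hz j).2 ?_
  rw [← mul_div_cancel_right₀ (z j) (h0 k), e]
  exact h.cross_inv s hs _ (hz k).2

/-- The points in both `K` and `K'`, the points of `K` with absolute value less than `a`, and those
    of
`K'` with absolute value less than `b`. With `b` proportional to `ρ` and `a` to `1 / ρ`, this is `K`
for small `ρ` and `K'` for large `ρ`, if `K` and `K'` are bounded neighbourhoods of `0`. -/
def interSet (K K' : Set ℂ) (a b : ℝ) : Set ℂ :=
  {z | (z ∈ K ∧ z ∈ K') ∨ (z ∈ K ∧ ‖z‖ < a) ∨ (z ∈ K' ∧ ‖z‖ < b)}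

/-- The intermediate sets separate the poles again. The products `s z w` with `z ∈ K` and `w ∈ K'`
differ from `1` because `‖z‖ ‖w‖` is bounded by the product of the two cutoff radii. -/
lemma Separates.inter {E X S S' K O K' O' : Set ℂ} (h : Separates E X S S' K O)
    (h' : Separates E X S S' K' O') {ρ η : ℝ} (hρ : 0 < ρ) (hη : 0 < η)
    (hS : ∀ s ∈ S, ‖s‖ < η ^ 2) (hS' : ∀ s ∈ S', ‖s‖ < η ^ 2) :
    Separates E X S S' (interSet K K' (1 / (ρ * η)) (ρ / η))
      (interSet O O' (η / ρ) (ρ * η)) where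
  zero_mem := Or.inl ⟨h.zero_mem, h'.zero_mem⟩
  contains := fun z hz => Or.inl ⟨h.contains hz, h'.contains hz⟩
  excludes := by
    rintro x hx z (⟨hz, _⟩ | ⟨hz, _⟩ | ⟨hz, _⟩)
    · exact h.excludes x hx z hz
    · exact h.excludes x hx z hz
    · exact h'.excludes x hx z hz
  cross := by
    rintro s hs z (⟨hz, hz'⟩ | ⟨hz, hn⟩ | ⟨hz, hn⟩)
    · exact Or.inl ⟨h.cross s hs z hz, h'.cross s hs z hz'⟩
    · refine Or.inr (Or.inl ⟨h.cross s hs z hz, ?_⟩)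
      rw [norm_mul]
      calc ‖s‖ * ‖z‖ ≤ ‖s‖ * (1 / (ρ * η)) := by gcongr
        _ < η ^ 2 * (1 / (ρ * η)) := by
          have := hS s hs
          gcongr
        _ = η / ρ := by field_simp
    · refine Or.inr (Or.inr ⟨h'.cross s hs z hz, ?_⟩)
      rw [norm_mul]
      calc ‖s‖ * ‖z‖ ≤ ‖s‖ * (ρ / η) := by gcongr
        _ < η ^ 2 * (ρ / η) := by
          have := hS s hs
          gcongr
        _ = ρ * η := by field_simp
  cross_inv := by
    intro s hs w hw
    simp only [interSet, Set.mem_ofPred_eq, not_or, not_and, not_lt] at hw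
    obtain ⟨h1, h2, h3⟩ := hw
    have hlt : ∀ r : ℝ, 0 < r → r ≤ ‖w‖ → ‖s / w‖ < η ^ 2 / r := fun r hr hrw => by
      rw [norm_div]
      calc ‖s‖ / ‖w‖ ≤ ‖s‖ / r := by gcongr
        _ < η ^ 2 / r := by
          have := hS s hs
          gcongr
    by_cases ho : w ∈ O
    · refine Or.inr (Or.inr ⟨h'.cross_inv s hs w (h1 ho), ?_⟩)
      have := hlt _ (by positivity) (h2 ho)
      rwa [show η ^ 2 / (η / ρ) = ρ * η by field_simp] at this
    · by_cases ho' : w ∈ O'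
      · refine Or.inr (Or.inl ⟨h.cross_inv s hs w ho, ?_⟩)
        have := hlt _ (by positivity) (h3 ho')
        rwa [show η ^ 2 / (ρ * η) = η / ρ by field_simp] at this
      · exact Or.inl ⟨h.cross_inv s hs w ho, h'.cross_inv s hs w ho'⟩
  cross_mul := by
    have key : ∀ s ∈ S', ∀ z w : ℂ, ‖z‖ < 1 / (ρ * η) → ‖w‖ < ρ / η → s * (z * w) ≠ 1 := by
      intro s hs z w hz hw e
      have h1 := congrArg norm e
      rw [norm_mul, norm_mul, norm_one] at h1
      have h2 : ‖z‖ * ‖w‖ ≤ 1 / (ρ * η) * (ρ / η) := by gcongr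
      have h3 : ‖s‖ * (‖z‖ * ‖w‖) ≤ ‖s‖ * (1 / (ρ * η) * (ρ / η)) := by gcongr
      have h4 : ‖s‖ * (1 / (ρ * η) * (ρ / η)) < η ^ 2 * (1 / (ρ * η) * (ρ / η)) := by
        have := hS' s hs
        gcongr
      rw [show η ^ 2 * (1 / (ρ * η) * (ρ / η)) = 1 by field_simp] at h4
      linarith
    rintro s hs z (⟨hz, hz'⟩ | ⟨hz, hzn⟩ | ⟨hz, hzn⟩) w (⟨hw, hw'⟩ | ⟨hw, hwn⟩ | ⟨hw, hwn⟩)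
    · exact h.cross_mul s hs z hz w hw
    · exact h.cross_mul s hs z hz w hw
    · exact h'.cross_mul s hs z hz' w hw
    · exact h.cross_mul s hs z hz w hw
    · exact h.cross_mul s hs z hz w hw
    · exact key s hs z w hzn hwn
    · exact h'.cross_mul s hs z hz w hw'
    · rw [mul_comm z w]
      exact key s hs w z hwn hzn
    · exact h'.cross_mul s hs z hz w hw

/-- Cutoff functions squeezed between one and the same pair of separating sets give the same
integral. -/
lemma iterInt_eq_of_separates {E X S S' K O K' O' K'' O'' : Set ℂ} {χ χ' : ℂ → ℂ}
    (hχ : IsCut χ K O) (hχ' : IsCut χ' K' O') (h : Separates E X S S' K'' O'')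
    (h1 : K ⊆ K'') (h2 : K' ⊆ K'') (h3 : O'' ⊆ O) (h4 : O'' ⊆ O') {n : ℕ}
    (hU : IsOpen (offPoles n E X S S')) {F : (Fin n → ℂ) → ℂ}
    (hF : DifferentiableOn ℂ F (offPoles n E X S S')) :
    iterInt n (fun _ => cutoffInt χ) F = iterInt n (fun _ => cutoffInt χ') F := by
  refine iterInt_cutoffInt_eq (L := (K ∪ K') \ (O ∩ O')) hχ.contDiff hχ'.contDiff
    ((hχ.isCompact.union hχ'.isCompact).diff (hχ.isOpen.inter hχ'.isOpen))
    (fun h0 => h0.2 ⟨h3 h.zero_mem, h4 h.zero_mem⟩) (fun z hz => hχ.dbar_eq_zero fun hz' =>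
      hz ⟨Or.inl hz'.1, fun ho => hz'.2 ho.1⟩) (fun z hz => hχ'.dbar_eq_zero fun hz' =>
      hz ⟨Or.inr hz'.1, fun ho => hz'.2 ho.2⟩) (fun z hz => ?_) hU ?_ hF
  · by_cases hk : z ∈ K ∪ K'
    · have ho : z ∈ O ∩ O' := by_contra fun ho => hz ⟨hk, ho⟩
      rw [hχ.eq_one z ho.1, hχ'.eq_one z ho.2]
    · rw [Set.mem_union, not_or] at hk
      rw [hχ.eq_zero z hk.1, hχ'.eq_zero z hk.2]
  · intro z hz
    refine h.piSet_subset n fun j => ?_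
    exact ⟨Set.union_subset h1 h2 (hz j).1, fun ho => (hz j).2 ⟨h3 ho, h4 ho⟩⟩

/-- A radial cutoff function, equal to `1` for `‖z‖ ≤ a` and to `0` for `‖z‖ ≥ b`. -/
def radialCut (a b : ℝ) : ℂ → ℂ := discCut 0 ((a + b) / 2) ((b - a) / 2)

lemma radialCut_eq_one {a b : ℝ} (ha : 0 < a) (hab : a < b) {z : ℂ} (hz : ‖z‖ ≤ a) :
    radialCut a b z = 1 :=
  discCut_eq_one (by linarith) (by linarith) (by rw [sub_zero]; linarith)

lemma radialCut_eq_zero {a b : ℝ} (ha : 0 < a) (hab : a < b) {z : ℂ} (hz : b ≤ ‖z‖) :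
    radialCut a b z = 0 :=
  discCut_eq_zero (by linarith) (by linarith) (by rw [sub_zero]; linarith)

/-- The cutoff functions in the deformation from `χ` to `χ'`. -/
def interCut (χ χ' : ℂ → ℂ) (ρ ε : ℝ) (z : ℂ) : ℂ :=
  1 - (1 - χ z * χ' z) * (1 - χ z * radialCut (ε / ρ) (1 / (ρ * ε)) z) *
    (1 - χ' z * radialCut (ρ * ε) (ρ / ε) z)

lemma isCut_interCut {K O K' O' : Set ℂ} {χ χ' : ℂ → ℂ} (hχ : IsCut χ K O) (hχ' : IsCut χ' K' O')
    {ρ ε : ℝ} (hρ : 0 < ρ) (hε : 0 < ε) (hε1 : ε < 1) :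
    IsCut (interCut χ χ' ρ ε)
      (K ∩ K' ∪ (K ∩ Metric.closedBall 0 (1 / (ρ * ε)) ∪ K' ∩ Metric.closedBall 0 (ρ / ε)))
      (interSet O O' (ε / ρ) (ρ * ε)) := by
  have h1 : ε / ρ < 1 / (ρ * ε) := by
    rw [div_lt_div_iff₀ hρ (by positivity)]
    nlinarith [mul_pos hρ hε]
  have h2 : ρ * ε < ρ / ε := by
    rw [lt_div_iff₀ hε]
    nlinarith [mul_pos hρ hε]
  refine ⟨?_, ?_, ?_, ?_, ?_⟩
  · have c1 := hχ.contDiff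
    have c2 := hχ'.contDiff
    have c3 : ∀ a b, ContDiff ℝ 1 (radialCut a b) := fun a b => contDiff_discCut _ _ _
    unfold interCut
    exact contDiff_const.sub (((contDiff_const.sub (c1.mul c2)).mul
      (contDiff_const.sub (c1.mul (c3 _ _)))).mul (contDiff_const.sub (c2.mul (c3 _ _))))
  · exact (hχ.isCompact.inter hχ'.isCompact).union
      ((hχ.isCompact.inter (isCompact_closedBall _ _)).union
        (hχ'.isCompact.inter (isCompact_closedBall _ _)))
  · have : interSet O O' (ε / ρ) (ρ * ε) =
        O ∩ O' ∪ (O ∩ Metric.ball 0 (ε / ρ) ∪ O' ∩ Metric.ball 0 (ρ * ε)) := by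
      ext z
      simp [interSet]
    rw [this]
    exact (hχ.isOpen.inter hχ'.isOpen).union ((hχ.isOpen.inter Metric.isOpen_ball).union
      (hχ'.isOpen.inter Metric.isOpen_ball))
  · intro z hz
    simp only [Set.mem_union, Set.mem_inter_iff, mem_closedBall_zero_iff, not_or, not_and, not_le]
      at hz
    obtain ⟨z1, z2, z3⟩ := hz
    unfold interCut
    by_cases k : z ∈ K
    · rw [hχ'.eq_zero z (z1 k), radialCut_eq_zero (by positivity) h1 (z2 k).le]
      ring
    · rw [hχ.eq_zero z k]
      by_cases k' : z ∈ K'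
      · rw [radialCut_eq_zero (by positivity) h2 (z3 k').le]
        ring
      · rw [hχ'.eq_zero z k']
        ring
  · rintro z (⟨hz, hz'⟩ | ⟨hz, hn⟩ | ⟨hz, hn⟩)
    · simp [interCut, hχ.eq_one z hz, hχ'.eq_one z hz']
    · rw [interCut, hχ.eq_one z hz, radialCut_eq_one (by positivity) h1 hn.le]
      ring
    · rw [interCut, hχ'.eq_one z hz, radialCut_eq_one (by positivity) h2 hn.le]
      ring

/-- The deformation theorem: the integral does not depend on the contour, as long as the contour
separates the poles. -/
theorem iterInt_eq_of_separates_of_separates {E X S S' K O K' O' : Set ℂ} {χ χ' : ℂ → ℂ}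
    (hχ : IsCut χ K O) (hχ' : IsCut χ' K' O') (h : Separates E X S S' K O)
    (h' : Separates E X S S' K' O') {κ : ℝ} (hκ : κ < 1) (hS : ∀ s ∈ S, ‖s‖ ≤ κ)
    (hS' : ∀ s ∈ S', ‖s‖ ≤ κ) {n : ℕ} (hU : IsOpen (offPoles n E X S S')) {F : (Fin n → ℂ) → ℂ}
    (hF : DifferentiableOn ℂ F (offPoles n E X S S')) :
    iterInt n (fun _ => cutoffInt χ) F = iterInt n (fun _ => cutoffInt χ') F := by
  -- the parameter `ρ` moves in finitely many steps of ratio `1 / ε`, where `ε` is so close to `1`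
  -- that successive cutoff functions lie between the same pair of separating sets
  obtain ⟨ε, hε0, hε1, hε⟩ : ∃ ε : ℝ, 0 < ε ∧ ε < 1 ∧ κ < ε ^ 6 := by
    have h1 : Tendsto (fun ε : ℝ => ε ^ 6) (𝓝[<] 1) (𝓝 1) := by
      have : Tendsto (fun ε : ℝ => ε ^ 6) (𝓝 1) (𝓝 (1 ^ 6)) := (continuous_pow 6).tendsto 1
      rw [one_pow] at this
      exact this.mono_left nhdsWithin_le_nhds
    obtain ⟨ε, ⟨h2, h3⟩, h4⟩ := (((h1.eventually (lt_mem_nhds hκ)).and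
      (nhdsWithin_le_nhds (lt_mem_nhds (zero_lt_one' ℝ)))).and self_mem_nhdsWithin).exists
    exact ⟨ε, h3, h4, h2⟩
  have hη : 0 < ε ^ 3 := by positivity
  have hη1 : ε ^ 3 < ε := by
    have : ε ^ 2 < 1 := by nlinarith
    calc ε ^ 3 = ε * ε ^ 2 := by ring
      _ < ε * 1 := by gcongr
      _ = ε := mul_one ε
  have hη2 : ε ^ 3 < ε ^ 2 := by
    calc ε ^ 3 = ε ^ 2 * ε := by ring
      _ < ε ^ 2 * 1 := by gcongr
      _ = ε ^ 2 := mul_one _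
  have hS2 : ∀ s ∈ S, ‖s‖ < (ε ^ 3) ^ 2 := fun s hs => by
    rw [← pow_mul]
    exact (hS s hs).trans_lt hε
  have hS2' : ∀ s ∈ S', ‖s‖ < (ε ^ 3) ^ 2 := fun s hs => by
    rw [← pow_mul]
    exact (hS' s hs).trans_lt hε
  have hsep : ∀ ρ : ℝ, 0 < ρ → Separates E X S S' (interSet K K' (1 / (ρ * ε ^ 3)) (ρ / ε ^ 3))
      (interSet O O' (ε ^ 3 / ρ) (ρ * ε ^ 3)) := fun ρ hρ => h.inter h' hρ hη hS2 hS2'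
  have hK : ∀ ρ : ℝ, 0 < ρ → ∀ ρ', ρ ≤ ρ' → ρ' ≤ ρ / ε →
      K ∩ K' ∪ (K ∩ Metric.closedBall 0 (1 / (ρ' * ε)) ∪ K' ∩ Metric.closedBall 0 (ρ' / ε)) ⊆
        interSet K K' (1 / (ρ * ε ^ 3)) (ρ / ε ^ 3) := by
    rintro ρ hρ ρ' h1 h2 z (hz | ⟨hz, hn⟩ | ⟨hz, hn⟩)
    · exact Or.inl hz
    · refine Or.inr (Or.inl ⟨hz, ?_⟩)
      rw [mem_closedBall_zero_iff] at hn
      refine hn.trans_lt ?_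
      apply one_div_lt_one_div_of_lt (by positivity)
      calc ρ * ε ^ 3 < ρ * ε := by gcongr
        _ ≤ ρ' * ε := by gcongr
    · refine Or.inr (Or.inr ⟨hz, ?_⟩)
      rw [mem_closedBall_zero_iff] at hn
      refine hn.trans_lt ?_
      calc ρ' / ε ≤ ρ / ε / ε := by gcongr
        _ = ρ / ε ^ 2 := by field_simp
        _ < ρ / ε ^ 3 := by gcongr
  have hO : ∀ ρ : ℝ, 0 < ρ → ∀ ρ', ρ ≤ ρ' → ρ' ≤ ρ / ε →
      interSet O O' (ε ^ 3 / ρ) (ρ * ε ^ 3) ⊆ interSet O O' (ε / ρ') (ρ' * ε) := by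
    rintro ρ hρ ρ' h1 h2 z (hz | ⟨hz, hn⟩ | ⟨hz, hn⟩)
    · exact Or.inl hz
    · refine Or.inr (Or.inl ⟨hz, hn.trans_le ?_⟩)
      have hρ' : 0 < ρ' := by linarith
      rw [div_le_div_iff₀ hρ hρ']
      calc ε ^ 3 * ρ' ≤ ε ^ 2 * (ρ / ε) := by gcongr
        _ = ε * ρ := by field_simp
    · refine Or.inr (Or.inr ⟨hz, hn.trans_le ?_⟩)
      calc ρ * ε ^ 3 ≤ ρ * ε := by gcongr
        _ ≤ ρ' * ε := by gcongr
  have hcut : ∀ ρ : ℝ, 0 < ρ → _ := fun ρ hρ => isCut_interCut hχ hχ' hρ hε0 hε1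
  have hself : ∀ ρ : ℝ, 0 < ρ → ρ ≤ ρ / ε := fun ρ hρ => by
    rw [le_div_iff₀ hε0]
    nlinarith
  have hstep : ∀ ρ : ℝ, 0 < ρ → iterInt n (fun _ => cutoffInt (interCut χ χ' ρ ε)) F =
      iterInt n (fun _ => cutoffInt (interCut χ χ' (ρ / ε) ε)) F := fun ρ hρ =>
    iterInt_eq_of_separates (hcut ρ hρ) (hcut (ρ / ε) (by positivity)) (hsep ρ hρ)
      (hK ρ hρ ρ le_rfl (hself ρ hρ)) (hK ρ hρ _ (hself ρ hρ) le_rfl)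
      (hO ρ hρ ρ le_rfl (hself ρ hρ)) (hO ρ hρ _ (hself ρ hρ) le_rfl) hU hF
  have hsteps : ∀ ρ : ℝ, 0 < ρ → ∀ k : ℕ, iterInt n (fun _ => cutoffInt (interCut χ χ' ρ ε)) F =
      iterInt n (fun _ => cutoffInt (interCut χ χ' (ρ / ε ^ k) ε)) F := by
    intro ρ hρ k
    induction k with
    | zero => simp
    | succ k ih =>
      rw [ih, hstep _ (by positivity), div_div, pow_succ]
  obtain ⟨R, hR⟩ := hχ.isCompact.isBounded.exists_norm_le
  obtain ⟨R', hR'⟩ := hχ'.isCompact.isBounded.exists_norm_le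
  obtain ⟨d, hd, hdO⟩ := Metric.isOpen_iff.1 hχ.isOpen 0 h.zero_mem
  obtain ⟨d', hd', hdO'⟩ := Metric.isOpen_iff.1 hχ'.isOpen 0 h'.zero_mem
  have hη3 : ε ^ 3 < 1 := hη1.trans hε1
  -- for small `ρ` the deformation starts at `χ`
  obtain ⟨ρ, hρ, hρ1, hρ2⟩ : ∃ ρ : ℝ, 0 < ρ ∧ ρ * (|R| + 1) ≤ 1 ∧ ρ ≤ d :=
    ⟨min d (|R| + 1)⁻¹, by positivity, by
      have : min d (|R| + 1)⁻¹ ≤ (|R| + 1)⁻¹ := min_le_right _ _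
      calc _ ≤ (|R| + 1)⁻¹ * (|R| + 1) := by gcongr
        _ = 1 := by field_simp, min_le_left _ _⟩
  have hstart : iterInt n (fun _ => cutoffInt χ) F =
      iterInt n (fun _ => cutoffInt (interCut χ χ' ρ ε)) F := by
    refine iterInt_eq_of_separates hχ (hcut ρ hρ) (hsep ρ hρ) (fun z hz => ?_)
      (hK ρ hρ ρ le_rfl (hself ρ hρ)) (fun z hz => ?_) (hO ρ hρ ρ le_rfl (hself ρ hρ)) hU hF
    · refine Or.inr (Or.inl ⟨hz, ?_⟩)
      have h1 := hR z hz
      rw [lt_div_iff₀ (by positivity)]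
      have h2 : ‖z‖ < |R| + 1 := by linarith [le_abs_self R]
      calc ‖z‖ * (ρ * ε ^ 3) < (|R| + 1) * (ρ * 1) := by gcongr
        _ ≤ 1 := by linarith
    · rcases hz with hz | hz | ⟨_, hn⟩
      · exact hz.1
      · exact hz.1
      · refine hdO ?_
        rw [mem_ball_zero_iff]
        calc ‖z‖ < ρ * ε ^ 3 := hn
          _ ≤ ρ * 1 := by gcongr
          _ ≤ d := by linarith
  -- for large `ρ` the deformation ends at `χ'`
  obtain ⟨k, hk⟩ : ∃ k : ℕ, max (|R'| + 1) (1 / d') / ρ < (1 / ε) ^ k :=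
    pow_unbounded_of_one_lt _ (by rw [lt_div_iff₀ hε0]; linarith)
  set ρ' := ρ / ε ^ k with hρ'
  have hρ'0 : 0 < ρ' := by positivity
  have hmax : max (|R'| + 1) (1 / d') < ρ' := by
    rw [div_lt_iff₀ hρ] at hk
    refine hk.trans_eq ?_
    rw [hρ', one_div_pow]
    ring
  have hend : iterInt n (fun _ => cutoffInt χ') F =
      iterInt n (fun _ => cutoffInt (interCut χ χ' ρ' ε)) F := by
    refine iterInt_eq_of_separates hχ' (hcut ρ' hρ'0) (hsep ρ' hρ'0) (fun z hz => ?_)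
      (hK ρ' hρ'0 ρ' le_rfl (hself ρ' hρ'0)) (fun z hz => ?_)
      (hO ρ' hρ'0 ρ' le_rfl (hself ρ' hρ'0)) hU hF
    · refine Or.inr (Or.inr ⟨hz, ?_⟩)
      have h1 := hR' z hz
      rw [lt_div_iff₀ (by positivity)]
      have h2 : ‖z‖ < |R'| + 1 := by linarith [le_abs_self R']
      calc ‖z‖ * ε ^ 3 ≤ ‖z‖ * 1 := by gcongr
        _ < ρ' := by linarith [le_max_left (|R'| + 1) (1 / d')]
    · rcases hz with hz | ⟨_, hn⟩ | hz
      · exact hz.2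
      · refine hdO' ?_
        rw [mem_ball_zero_iff]
        have h1 : 1 / d' < ρ' := (le_max_right _ _).trans_lt hmax
        calc ‖z‖ < ε ^ 3 / ρ' := hn
          _ ≤ 1 / ρ' := by gcongr
          _ ≤ d' := by
            rw [div_le_iff₀ hρ'0]
            rw [div_lt_iff₀ hd'] at h1
            linarith
      · exact hz.1
  rw [hstart, hsteps ρ hρ k, hend]

/-! ### Inversion -/

lemma IsContour.exists_mem_carrier_inv {C : CircleChain} (hC : IsContour C)
    (hs : ∀ w : ℂ, w ≠ 0 → (w ∈ inside C ↔ w⁻¹ ∈ outside C)) {w : ℂ} (hw : w ∈ carrier C) :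
    w⁻¹ ∈ carrier C := by
  have h0 : w ≠ 0 := fun h => hC.zero_notMem (h ▸ hw)
  by_contra h
  rcases hC.region _ h with h1 | h1
  · have := (hs w⁻¹ (inv_ne_zero h0)).1 h1
    rw [inv_inv] at this
    exact this.1 hw
  · exact ((hs w h0).2 h1).1 hw

lemma IsContour.chainFun_inv {C : CircleChain} (hC : IsContour C)
    (hs : ∀ w : ℂ, w ≠ 0 → (w ∈ inside C ↔ w⁻¹ ∈ outside C)) {V : Set ℂ} (hV : IsOpen V)
    (hCV : carrier C ⊆ V) {h : ℂ → ℂ} (hh : DifferentiableOn ℂ h V) :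
    chainFun C (fun z => h z⁻¹) = chainFun C h := by
  have hsymm := fun w hw => hC.exists_mem_carrier_inv hs (w := w) hw
  set W : Set ℂ := {z | z ∈ V ∧ z ≠ 0 ∧ z⁻¹ ∈ V} with hW
  have hWo : IsOpen W := by
    rw [isOpen_iff_mem_nhds]
    rintro z ⟨h1, h2, h3⟩
    filter_upwards [hV.mem_nhds h1, isOpen_ne.mem_nhds h2,
      (continuousAt_inv₀ h2).eventually_mem (hV.mem_nhds h3)] with w k1 k2 k3
    exact ⟨k1, k2, k3⟩
  have hCW : carrier C ⊆ W := fun z hz =>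
    ⟨hCV hz, fun h => hC.zero_notMem (h ▸ hz), hCV (hsymm z hz)⟩
  obtain ⟨δ, ⟨hδW, hδC⟩, hδ⟩ := ((hC.eventually_tube hWo hCW).and self_mem_nhdsWithin).exists
  have hδ : 0 < δ := hδ
  have h0 : (0 : ℂ) ∉ tube C δ := fun h => (hδW h).2.1 rfl
  have hcut := hC.isCut hδ hδC
  have h0O : (0 : ℂ) ∈ inside C \ tube C δ := ⟨hC.zero_mem, h0⟩
  have hinv : IsCompact {z : ℂ | z ≠ 0 ∧ z⁻¹ ∈ tube C δ} := by
    have : {z : ℂ | z ≠ 0 ∧ z⁻¹ ∈ tube C δ} = (fun z => z⁻¹) '' tube C δ := by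
      ext z
      constructor
      · exact fun h => ⟨z⁻¹, h.2, inv_inv z⟩
      · rintro ⟨w, hw, rfl⟩
        exact ⟨inv_ne_zero fun h => h0 (h ▸ hw), by simpa using hw⟩
    rw [this]
    exact (isCompact_tube C δ).image_of_continuousOn fun z hz =>
      (continuousAt_inv₀ (hδW hz).2.1).continuousWithinAt
  rw [chainFun_eq_cutoffInt (h := fun z => h z⁻¹) hδ hδC h0 hWo hδW
    (hh.comp (fun z hz => (differentiableAt_inv hz.2.1).differentiableWithinAt)
      fun z hz => hz.2.2), cutoffInt_comp_inv hcut,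
    chainFun_eq_cutoffInt hδ hδC h0 hWo hδW (hh.mono fun z hz => hz.1)]
  have hcut' := isCut_invCut hcut h0O
  -- off the two annuli both cutoff functions are the indicator function of the inside
  have hoff : ∀ z ∉ tube C δ ∪ {z | z ≠ 0 ∧ z⁻¹ ∈ tube C δ}, invCut (chainCut C δ) z =
      chainCut C δ z := by
    intro z hz
    simp only [Set.mem_union, Set.mem_ofPred_eq, not_or, not_and] at hz
    by_cases hz0 : z = 0
    · rw [hz0, hcut.eq_one 0 h0O]
      simp [invCut]
    · have h1 : z ∉ carrier C := fun h => hz.1 (carrier_subset_tube C hδ.le h)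
      have h2 : z⁻¹ ∉ carrier C := fun h => hz.2 hz0 (carrier_subset_tube C hδ.le h)
      rw [invCut, if_neg hz0, chainCut_eq_winding hδ hδC hz.1,
        chainCut_eq_winding hδ hδC (hz.2 hz0)]
      rcases hC.region z h1 with h3 | h3
      · rw [h3.2, ((hs z hz0).1 h3).2]
        simp
      · have h4 := (hs z⁻¹ (inv_ne_zero hz0)).2 (by rwa [inv_inv])
        rw [h3.2, h4.2]
        simp
  refine cutoffInt_eq (L := tube C δ ∪ {z | z ≠ 0 ∧ z⁻¹ ∈ tube C δ}) hcut'.contDiff hcut.contDiff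
    ((isCompact_tube C δ).union hinv) (by simp [h0]) (fun z hz => ?_) (fun z hz => ?_) hoff hWo ?_
    (hh.mono fun z hz => hz.1)
  · refine hcut'.dbar_eq_zero fun hzK => hz ?_
    obtain ⟨h1, h2⟩ := hzK
    simp only [Set.mem_ofPred_eq, not_or, not_not] at h1 h2
    have h3 := h1.resolve_left h2.1
    refine Or.inr ⟨h2.1, ?_⟩
    by_contra h4
    exact h3 ⟨h2.2.resolve_left h4, h4⟩
  · refine hcut.dbar_eq_zero fun hzK => hz (Or.inl ?_)
    by_contra h4
    exact hzK.2 ⟨hzK.1.resolve_left h4, h4⟩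
  · rintro z (hz | hz)
    · exact hδW hz
    · obtain ⟨k1, k2, k3⟩ := hδW hz.2
      exact ⟨by simpa using k3, hz.1, k1⟩

lemma iterInt_signFlip {n : ℕ} : ∀ (A : Fin n → (ℂ → ℂ) → ℂ) (σ : Fin n → Bool)
    (F : (Fin n → ℂ) → ℂ), iterInt n A (fun z => F (signFlip σ z)) =
      iterInt n (fun j h => A j fun x => h (if σ j then x else x⁻¹)) F := by
  induction n with
  | zero =>
    intro A σ F
    simp only [iterInt]
    congr 1
    exact Subsingleton.elim _ _
  | succ n ih =>
    intro A σ F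
    change A 0 _ = A 0 _
    congr 1
    funext x
    have := ih (fun i => A i.succ) (fun i => σ i.succ)
      (fun y => F (Fin.cons (if σ 0 then x else x⁻¹) y))
    refine Eq.trans ?_ this
    congr 1
    funext y
    refine congrArg F (funext fun i => ?_)
    refine Fin.cases ?_ (fun i => ?_) i
    · simp [signFlip]
    · simp [signFlip]

/-- Integrals over contours with `C = C⁻¹` do not change if some of the variables are inverted. -/
theorem IsContour.chainIntegral_signFlip {C : CircleChain} (hC : IsContour C)
    (hs : ∀ w : ℂ, w ≠ 0 → (w ∈ inside C ↔ w⁻¹ ∈ outside C)) {n : ℕ} {V : Set (Fin n → ℂ)}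
    (hV : IsOpen V) (hCV : piSet n (carrier C) ⊆ V) {F : (Fin n → ℂ) → ℂ}
    (hF : DifferentiableOn ℂ F V) (σ : Fin n → Bool) :
    ContinuousOn (fun z => F (signFlip σ z)) (piSet n (carrier C)) ∧
    chainIntegral n C (fun z => F (signFlip σ z)) = chainIntegral n C F := by
  have hsymm := fun w hw => hC.exists_mem_carrier_inv hs (w := w) hw
  have h0 := hC.zero_notMem
  have hinv : ContinuousOn (fun z : ℂ => z⁻¹) (carrier C) := fun z hz =>
    (continuousAt_inv₀ fun h => h0 (h ▸ hz)).continuousWithinAt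
  have hflip : ContinuousOn (signFlip σ) (piSet n (carrier C)) := by
    rw [continuousOn_pi]
    intro i
    by_cases h : σ i
    · simp only [signFlip, h, if_true]
      exact (continuous_apply i).continuousOn
    · simp only [signFlip, h]
      exact hinv.comp (continuous_apply i).continuousOn fun z hz => hz i
  have hmaps : Set.MapsTo (signFlip σ) (piSet n (carrier C)) (piSet n (carrier C)) := by
    intro z hz i
    by_cases h : σ i
    · simp only [signFlip, h, if_true]
      exact hz i
    · simp only [signFlip, h]
      exact hsymm _ (hz i)
  have hFc : ContinuousOn F (piSet n (carrier C)) := hF.continuousOn.mono hCV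
  have hcont : ContinuousOn (fun z => F (signFlip σ z)) (piSet n (carrier C)) :=
    hFc.comp hflip hmaps
  refine ⟨hcont, ?_⟩
  rw [chainIntegral_eq_iterInt hC hcont, chainIntegral_eq_iterInt hC hFc, iterInt_signFlip]
  have hker := isKernelOn_chainFun hC
  refine iterInt_eq_of_slices (isCompact_carrier C) (fun j => ?_) (fun _ => hker) hFc
    fun j z hz => ?_
  · by_cases h : σ j
    · simp only [h, if_true]
      exact hker
    · simp only [h]
      obtain ⟨X, _, ν, γ, w, hν, hγ, hw, hwK, hAh⟩ := hker
      refine ⟨X, _, ν, fun x => (γ x)⁻¹, w, hν, hγ.inv, hw, fun x hx => hsymm _ (hwK x hx),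
        fun h hh => ?_⟩
      exact hAh _ (hh.comp hinv fun z hz => hsymm z hz)
  · by_cases h : σ j
    · simp [h]
    · simp only [h]
      exact hC.chainFun_inv hs (V := {x | Function.update z j x ∈ V})
        (hV.preimage (continuous_update_apply z j)) (fun x hx => hCV (update_mem_piSet hz j hx))
        (h := fun x => F (Function.update z j x))
        (hF.comp (differentiable_update_apply z j).differentiableOn fun x hx => hx)

/-! ### Separating sets near a contour -/

/-- The points `p^{i+e} q^j v` with `i, j ≥ 0`. -/
def orbitSet (p q : ℂ) (e : ℕ) (v : ℂ) : Set ℂ := {w | ∃ i j : ℕ, w = p ^ (i + e) * q ^ j * v}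

lemma isCompact_insert_orbitSet {p q : ℂ} (hp : ‖p‖ < 1) (hq : ‖q‖ < 1) (e : ℕ) (v : ℂ) :
    IsCompact (insert 0 (orbitSet p q e v)) := by
  have h1 := ((tendsto_pow_atTop_nhds_zero_of_norm_lt_one hp).comp
    (tendsto_add_atTop_nat e)).isCompact_insert_range
  have h2 := (tendsto_pow_atTop_nhds_zero_of_norm_lt_one hq).isCompact_insert_range
  have : insert 0 (orbitSet p q e v) = (fun x : ℂ × ℂ => x.1 * x.2 * v) ''
      (insert 0 (Set.range ((fun n : ℕ => p ^ n) ∘ fun a => a + e)) ×ˢ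
        insert 0 (Set.range fun n : ℕ => q ^ n)) := by
    ext w
    constructor
    · rintro (rfl | ⟨i, j, rfl⟩)
      · exact ⟨(0, 0), ⟨Or.inl rfl, Or.inl rfl⟩, by simp⟩
      · exact ⟨(p ^ (i + e), q ^ j), ⟨Or.inr ⟨i, rfl⟩, Or.inr ⟨j, rfl⟩⟩, rfl⟩
    · rintro ⟨⟨x, y⟩, ⟨hx | ⟨i, hi⟩, hy | ⟨j, hj⟩⟩, rfl⟩
      · exact Or.inl (by simp [show x = 0 from hx])
      · exact Or.inl (by simp [show x = 0 from hx])
      · exact Or.inl (by simp [show y = 0 from hy])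
      · refine Or.inr ⟨i, j, ?_⟩
        rw [show x = p ^ (i + e) from hi.symm, show y = q ^ j from hj.symm]
  rw [this]
  exact (h1.prod h2).image (by fun_prop)

lemma isCompact_insert_iUnion {ι : Type*} [Finite ι] {A : ι → Set ℂ}
    (h : ∀ i, IsCompact (insert 0 (A i))) : IsCompact (insert 0 (⋃ i, A i)) := by
  have : insert (0 : ℂ) (⋃ i, A i) = {0} ∪ ⋃ i, insert 0 (A i) := by
    ext w
    simp only [Set.mem_insert_iff, Set.mem_iUnion, Set.mem_union, Set.mem_singleton_iff]
    exact ⟨fun h => h.imp_right fun ⟨i, hi⟩ => ⟨i, Or.inr hi⟩, fun h => h.elim Or.inl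
      fun ⟨i, hi⟩ => hi.imp_right fun hi => ⟨i, hi⟩⟩
  rw [this]
  exact isCompact_singleton.union (isCompact_iUnion h)

lemma isOpen_forall_mem {Y : Type*} [TopologicalSpace Y] {A : Set ℂ} (hA : IsCompact A)
    {φ : Y → ℂ → ℂ} (hφ : Continuous (Function.uncurry φ)) {W : Set ℂ} (hW : IsOpen W) :
    IsOpen {y | ∀ a ∈ A, φ y a ∈ W} := by
  rw [isOpen_iff_mem_nhds]
  intro y hy
  refine hA.eventually_forall_of_forall_eventually (P := fun y a => φ y a ∈ W) fun a ha => ?_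
  exact hφ.continuousAt.eventually_mem (hW.mem_nhds (hy a ha))

lemma isOpen_offPoles (n : ℕ) {E X S S' : Set ℂ} (hE : IsCompact (insert 0 E))
    (hX : IsCompact (insert 0 X)) (hS : IsCompact (insert 0 S)) (hS' : IsCompact (insert 0 S')) :
    IsOpen (offPoles n E X S S') := by
  have h1 : ∀ j : Fin n, IsOpen {z : Fin n → ℂ | z j ∈ (insert 0 E)ᶜ} := fun j =>
    hE.isClosed.isOpen_compl.preimage (continuous_apply j)
  have h2 : ∀ j : Fin n, IsOpen {z : Fin n → ℂ | ∀ x ∈ insert 0 X, x * z j ∈ ({1}ᶜ : Set ℂ)} :=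
    fun j => isOpen_forall_mem hX (φ := fun (z : Fin n → ℂ) x => x * z j) (by fun_prop)
        isOpen_compl_singleton
  have h3 : ∀ j k : Fin n,
      IsOpen {z : Fin n → ℂ | ∀ s ∈ insert 0 S, z j - s * z k ∈ ({0}ᶜ : Set ℂ)} :=
    fun j k => isOpen_forall_mem hS (φ := fun (z : Fin n → ℂ) s => z j - s * z k) (by fun_prop)
      isOpen_compl_singleton
  have h4 : ∀ j k : Fin n,
      IsOpen {z : Fin n → ℂ | ∀ s ∈ insert 0 S, z j * z k - s ∈ ({0}ᶜ : Set ℂ)} :=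
    fun j k => isOpen_forall_mem hS (φ := fun (z : Fin n → ℂ) s => z j * z k - s) (by fun_prop)
      isOpen_compl_singleton
  have h5 : ∀ j k : Fin n,
      IsOpen {z : Fin n → ℂ | ∀ s ∈ insert 0 S', s * (z j * z k) ∈ ({1}ᶜ : Set ℂ)} :=
    fun j k => isOpen_forall_mem hS' (φ := fun (z : Fin n → ℂ) s => s * (z j * z k)) (by fun_prop)
      isOpen_compl_singleton
  have : offPoles n E X S S' = ⋂ j, ({z : Fin n → ℂ | z j ∈ (insert 0 E)ᶜ} ∩
      {z : Fin n → ℂ | ∀ x ∈ insert 0 X, x * z j ∈ ({1}ᶜ : Set ℂ)} ∩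
      ⋂ k, ⋂ (_ : k ≠ j), {z : Fin n → ℂ | ∀ s ∈ insert 0 S, z j - s * z k ∈ ({0}ᶜ : Set ℂ)} ∩
        {z : Fin n → ℂ | ∀ s ∈ insert 0 S, z j * z k - s ∈ ({0}ᶜ : Set ℂ)} ∩
        {z : Fin n → ℂ | ∀ s ∈ insert 0 S', s * (z j * z k) ∈ ({1}ᶜ : Set ℂ)}) := by
    ext z
    simp only [offPoles, Set.mem_ofPred_eq, Set.mem_iInter, Set.mem_inter_iff, Set.mem_compl_iff,
      Set.mem_insert_iff, Set.mem_singleton_iff, forall_eq_or_imp, not_or, sub_eq_zero, zero_mul]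
    constructor
    · intro h j
      exact ⟨⟨⟨(h j).1, (h j).2.1⟩, zero_ne_one, (h j).2.2.1⟩, fun k hk =>
        ⟨⟨⟨(h j).1, fun s hs => (((h j).2.2.2 k hk).1 s hs).1⟩,
          mul_ne_zero (h j).1 (h k).1, fun s hs => (((h j).2.2.2 k hk).1 s hs).2⟩, zero_ne_one,
          ((h j).2.2.2 k hk).2⟩⟩
    · intro h j
      exact ⟨(h j).1.1.1, (h j).1.1.2, (h j).1.2.2, fun k hk =>
        ⟨fun s hs => ⟨((h j).2 k hk).1.1.2 s hs, ((h j).2 k hk).1.2.2 s hs⟩,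
          ((h j).2 k hk).2.2⟩⟩
  rw [this]
  refine isOpen_iInter_of_finite fun j => ((h1 j).inter (h2 j)).inter ?_
  refine isOpen_iInter_of_finite fun k => isOpen_iInter_of_finite fun _ => ?_
  exact ((h3 j k).inter (h4 j k)).inter (h5 j k)

lemma IsContour.isCompact_union {C : CircleChain} (hC : IsContour C) :
    IsCompact (carrier C ∪ inside C) := by
  refine Metric.isCompact_of_isClosed_isBounded ?_
    ((isCompact_carrier C).isBounded.union (isBounded_inside C))
  have : carrier C ∪ inside C = (outside C)ᶜ := by
    ext w
    simp only [Set.mem_union, Set.mem_compl_iff]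
    constructor
    · rintro (h | h) h'
      · exact h'.1 h
      · exact outside_disjoint_inside h' h
    · intro h
      by_cases hw : w ∈ carrier C
      · exact Or.inl hw
      · exact Or.inr ((hC.region w hw).resolve_right h)
  rw [this]
  exact (isOpen_outside C).isClosed_compl

/-- If multiplication by the elements of a compact set takes the closed region into the region, then
it stays away from a neighbourhood of the contour. -/
lemma IsContour.exists_thickening {C : CircleChain} {S : Set ℂ} (hC : IsContour C)
    (hS : IsCompact S) (h : ∀ s ∈ S, ∀ w ∈ carrier C ∪ inside C, s * w ∈ inside C) :
    ∃ N : Set ℂ, IsOpen N ∧ carrier C ⊆ N ∧ ∃ W : Set ℂ, IsOpen W ∧ carrier C ∪ inside C ⊆ W ∧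
      ∀ s ∈ S, ∀ w ∈ W, s * w ∈ inside C ∧ s * w ∉ N := by
  have hA : IsCompact ((fun x : ℂ × ℂ => x.1 * x.2) '' (S ×ˢ (carrier C ∪ inside C))) :=
    (hS.prod hC.isCompact_union).image (by fun_prop)
  have hdisj : Disjoint (carrier C) ((fun x : ℂ × ℂ => x.1 * x.2) '' (S ×ˢ (carrier C ∪ inside
      C))) := by
    rw [Set.disjoint_right]
    rintro _ ⟨⟨s, w⟩, ⟨hs, hw⟩, rfl⟩
    exact (h s hs w hw).1
  obtain ⟨ε, hε, hd⟩ := hdisj.exists_cthickenings (isCompact_carrier C) hA.isClosed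
  refine ⟨Metric.thickening ε (carrier C), Metric.isOpen_thickening,
    Metric.self_subset_thickening hε _,
    {w | ∀ s ∈ S, s * w ∈ inside C ∩ (Metric.cthickening ε (carrier C))ᶜ},
    isOpen_forall_mem hS (φ := fun w s => s * w) (by fun_prop)
      ((isOpen_inside C).inter Metric.isClosed_cthickening.isOpen_compl), ?_, ?_⟩
  · intro w hw
    rw [Set.mem_ofPred_eq]
    intro s hs
    refine ⟨h s hs w hw, fun hc => ?_⟩
    exact Set.disjoint_left.1 hd hc
      (Metric.self_subset_cthickening _ ⟨(s, w), ⟨hs, hw⟩, rfl⟩)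
  · intro s hs w hw
    exact ⟨(hw s hs).1, fun hc => (hw s hs).2 (Metric.thickening_subset_cthickening _ _ hc)⟩

/-- The poles which the contours of the elliptic integrals contain. -/
def poles (p q : ℂ) (v : Fin 6 → ℂ) (e : Fin 6 → ℕ) : Set ℂ := ⋃ r, orbitSet p q (e r) (v r)

lemma isCompact_insert_poles {p q : ℂ} (hp : ‖p‖ < 1) (hq : ‖q‖ < 1) (v : Fin 6 → ℂ)
    (e : Fin 6 → ℕ) : IsCompact (insert 0 (poles p q v e)) :=
  isCompact_insert_iUnion fun _ => isCompact_insert_orbitSet hp hq _ _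

lemma orbitSet_mono {p q : ℂ} (e : ℕ) (v : ℂ) : orbitSet p q e v ⊆ orbitSet p q 0 v := by
  rintro _ ⟨i, j, rfl⟩
  exact ⟨i + e, j, by simp⟩

lemma poles_mono {p q : ℂ} (v : Fin 6 → ℂ) (e : Fin 6 → ℕ) : poles p q v e ⊆ poles p q v 0 :=
  Set.iUnion_mono fun r => orbitSet_mono (e r) (v r)

/-- Thin tubes around an elliptic contour separate the poles of the integrand, for either choice of
the shift by `e`. -/
theorem IsEllipticContour.eventually_separates {q t p : ℂ} {v : Fin 6 → ℂ} {C : CircleChain}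
    (hC : IsEllipticContour q t p v C) (hp : ‖p‖ < 1) (hq : ‖q‖ < 1) (e : Fin 6 → ℕ) :
    ∀ᶠ δ : ℝ in 𝓝[>] 0, (∀ x ∈ C.support, δ < x.2) ∧ (0 : ℂ) ∉ tube C δ ∧
      Separates (poles p q v 0) (poles p q v e) (orbitSet p q 0 t) (orbitSet p q 1 t)
        (tube C δ ∪ inside C) (inside C \ tube C δ) := by
  have hC' := hC.toIsContour
  have hE := isCompact_insert_poles hp hq v 0
  have hX := isCompact_insert_poles hp hq v e
  have hS := isCompact_insert_orbitSet hp hq 0 t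
  have hEin : insert 0 (poles p q v 0) ⊆ inside C := by
    rintro w (rfl | hw)
    · exact hC'.zero_mem
    · obtain ⟨r, i, j, rfl⟩ := Set.mem_iUnion.1 hw
      exact hC.contains r _ _
  have hXout : ∀ x ∈ poles p q v 0, x⁻¹ ∈ outside C := by
    intro x hx
    obtain ⟨r, i, j, rfl⟩ := Set.mem_iUnion.1 hx
    exact hC.excludes r _ _
  have hSin : ∀ s ∈ insert 0 (orbitSet p q 0 t), ∀ w ∈ carrier C ∪ inside C, s * w ∈ inside C := by
    rintro s (rfl | ⟨i, j, rfl⟩) w hw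
    · rw [zero_mul]
      exact hC'.zero_mem
    · exact hC.cross i j w hw
  obtain ⟨N, hN, hCN, W, hW, hKW, hSW⟩ := hC'.exists_thickening hS hSin
  have hsymm := fun w hw => hC'.exists_mem_carrier_inv hC.symmetric (w := w) hw
  have hV : ∃ V : Set ℂ, IsOpen V ∧ carrier C ⊆ V ∧ ∀ z ∈ V, z ∈ W ∧ z ∈ N ∧ z ≠ 0 ∧ z⁻¹ ∈ W ∧
      z⁻¹ ∈ N ∧ z ∉ insert 0 (poles p q v 0) ∧ ∀ x ∈ poles p q v e, x * z ≠ 1 := by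
    refine ⟨W ∩ N ∩ {z | z ≠ 0 ∧ z⁻¹ ∈ W ∩ N} ∩ (insert 0 (poles p q v 0))ᶜ ∩
      {z | ∀ x ∈ insert 0 (poles p q v e), x * z ∈ ({1}ᶜ : Set ℂ)}, ?_, fun z hz => ?_, ?_⟩
    · refine (((hW.inter hN).inter ?_).inter hE.isClosed.isOpen_compl).inter
        (isOpen_forall_mem hX (φ := fun z x => x * z) (by fun_prop) isOpen_compl_singleton)
      rw [isOpen_iff_mem_nhds]
      rintro z ⟨hz, hz'⟩
      filter_upwards [isOpen_ne.mem_nhds hz,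
        (continuousAt_inv₀ hz).eventually_mem ((hW.inter hN).mem_nhds hz')] with w h1 h2
      exact ⟨h1, h2⟩
    · have hz0 : z ≠ 0 := fun h => hC'.zero_notMem (h ▸ hz)
      refine ⟨⟨⟨⟨hKW (Or.inl hz), hCN hz⟩, hz0, hKW (Or.inl (hsymm z hz)), hCN (hsymm z hz)⟩,
        fun h => (hEin h).1 hz⟩, ?_⟩
      rw [Set.mem_ofPred_eq]
      rintro x (rfl | hx) h
      · simp at h
      · have := hXout x (poles_mono v e hx)
        rw [← eq_inv_of_mul_eq_one_right h] at this
        exact this.1 hz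
    · rintro z ⟨⟨⟨⟨h1, h2⟩, h3, h4, h5⟩, h6⟩, h7⟩
      exact ⟨h1, h2, h3, h4, h5, h6, fun x hx => h7 x (Or.inr hx)⟩
  obtain ⟨V, hVo, hCV, hVp⟩ := hV
  filter_upwards [hC'.eventually_tube hVo hCV] with δ hδ
  obtain ⟨hδV, hδC⟩ := hδ
  have hKW' : tube C δ ∪ inside C ⊆ W := by
    rintro z (hz | hz)
    · exact (hVp z (hδV hz)).1
    · exact hKW (Or.inr hz)
  have h0 : (0 : ℂ) ∉ tube C δ := fun h => (hVp 0 (hδV h)).2.2.1 rfl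
  have hcross : ∀ s ∈ orbitSet p q 0 t, ∀ z ∈ W, s * z ∈ inside C \ tube C δ := fun s hs z hz =>
    ⟨(hSW s (Or.inr hs) z hz).1, fun h => (hSW s (Or.inr hs) z hz).2 (hVp _ (hδV h)).2.1⟩
  refine ⟨hδC, h0, ⟨hC'.zero_mem, h0⟩, ?_, ?_, fun s hs z hz => hcross s hs z (hKW' hz), ?_, ?_⟩
  · intro z hz
    exact ⟨hEin (Or.inr hz), fun h => (hVp z (hδV h)).2.2.2.2.2.1 (Or.inr hz)⟩
  · rintro x hx z (hz | hz)
    · exact (hVp z (hδV hz)).2.2.2.2.2.2 x hx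
    · intro h
      have := hXout x (poles_mono v e hx)
      rw [← eq_inv_of_mul_eq_one_right h] at this
      exact outside_disjoint_inside this hz
  · intro s hs w hw
    rw [div_eq_mul_inv]
    refine hcross s hs _ ?_
    by_cases h : w ∈ tube C δ
    · exact (hVp w (hδV h)).2.2.2.1
    · have hw0 : w ≠ 0 := fun h0' => hw (h0' ▸ ⟨hC'.zero_mem, h0⟩)
      by_cases hc : w ∈ carrier C
      · exact hKW (Or.inl (hsymm w hc))
      · rcases hC'.region w hc with h1 | h1
        · exact absurd ⟨h1, h⟩ hw
        · refine hKW (Or.inr ((hC.symmetric _ (inv_ne_zero hw0)).2 ?_))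
          rwa [inv_inv]
  · intro s hs z hz w hw h1
    have hs' := orbitSet_mono 1 t hs
    have h2 : s * z = w⁻¹ := by
      apply eq_inv_of_mul_eq_one_left
      rw [← h1]
      ring
    have h3 := hSW s (Or.inr hs') z (hKW' hz)
    rw [h2] at h3
    rcases hw with hw | hw
    · exact h3.2 (hVp w (hδV hw)).2.2.2.2.1
    · have hw0 : w ≠ 0 := fun h => by
        rw [h, mul_zero, mul_zero] at h1
        exact zero_ne_one h1
      have h4 := (hC.symmetric w hw0).1 hw
      exact outside_disjoint_inside h4 h3.1

/-- The shift `e_r` in the first kind of poles: `1` for `r ∈ T`, and `0` otherwise. -/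
def shift (T : Finset (Fin 6)) (r : Fin 6) : ℕ := if r ∈ T then 1 else 0

/-- The constraints on the exponents `α_r`. -/
structure IsExponent (α : Fin 6 → ℝ) (ζ : ℝ) (T : Finset (Fin 6)) : Prop where
  zeta_ge : -1 / 2 ≤ ζ
  zeta_neg : ζ < 0
  mem : ∀ r ∈ T, ζ ≤ α r ∧ α r ≤ -ζ
  notMem : ∀ r ∉ T, -ζ ≤ α r ∧ α r ≤ 1 + ζ

lemma norm_cpow_ofReal {p : ℂ} (hp : p ≠ 0) (s : ℝ) : ‖p ^ (s : ℂ)‖ = ‖p‖ ^ s := by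
  rw [Complex.norm_cpow_of_ne_zero hp]
  simp

lemma tendsto_norm_rpow {s : ℝ} (hs : 0 < s) (M : ℝ) :
    Tendsto (fun p : ℂ => ‖p‖ ^ s * M) (𝓝[≠] 0) (𝓝 0) := by
  have h1 : Tendsto (fun p : ℂ => ‖p‖) (𝓝[≠] 0) (𝓝 0) := by
    have := (continuous_norm (E := ℂ)).tendsto 0
    rw [norm_zero] at this
    exact this.mono_left nhdsWithin_le_nhds
  have h2 := (h1.rpow_const (p := s) (Or.inr hs.le)).mul_const M
  rwa [Real.zero_rpow hs.ne', zero_mul] at h2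

section LimitContour

variable {q t : ℂ} {v : Fin 6 → ℂ} {α : Fin 6 → ℝ} {ζ : ℝ} {T : Finset (Fin 6)} {C : CircleChain}

lemma pow_mul_cpow {p : ℂ} (hp : p ≠ 0) (i : ℕ) (x y : ℝ) (c d : ℂ) :
    p ^ i * c * (d * p ^ (x : ℂ)) * p ^ (y : ℂ) = p ^ i * p ^ ((x + y : ℝ) : ℂ) * (c * d) := by
  rw [Complex.ofReal_add, Complex.cpow_add _ _ hp]
  ring

/-- In the limit `p → 0` only the poles on the leading power of `p` matter: near a contour of the
limiting integral there are a slightly larger and a slightly smaller set which, rescaled by `p^ζ`,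
separate the poles for all sufficiently small `p`. -/
theorem IsLimitContour.eventually_separates (hC : IsLimitContour q t v α ζ T C)
    (hα : IsExponent α ζ T) (hq : ‖q‖ < 1) (ht : ‖t‖ < 1) :
    ∀ᶠ δ : ℝ in 𝓝[>] 0, (∀ x ∈ C.support, δ < x.2) ∧ (0 : ℂ) ∉ tube C δ ∧
      ∀ᶠ p : ℂ in 𝓝[≠] 0, Separates (poles p q (scaled v α p) 0)
        (poles p q (scaled v α p) (shift T)) (orbitSet p q 0 t) (orbitSet p q 1 t)
        {z | z / p ^ (ζ : ℂ) ∈ tube C δ ∪ inside C} {z | z / p ^ (ζ : ℂ) ∈ inside C \ tube C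
            δ} := by
  have hC' := hC.toIsContour
  have h0n : ‖(0 : ℂ)‖ < 1 := by simp
  -- the limits of the sets of poles, after rescaling by `p^ζ`; they are compact after adding `0`
  set E : Set ℂ := insert 0 (⋃ r : {r // r ∈ T ∧ α r = ζ}, orbitSet 0 q 0 (v r)) with hE
  set X : Set ℂ := insert 0 (⋃ r : {r // (r ∉ T ∧ α r = -ζ) ∨ (ζ = -1 / 2 ∧ r ∈ T ∧ α r = -1 / 2)},
    orbitSet 0 q 0 (v r)) with hX
  set S : Set ℂ := insert 0 (orbitSet 0 q 0 t) with hS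
  set S' : Set ℂ := {s | s = 0 ∨ (ζ = -1 / 2 ∧ s ∈ S)} with hS'
  have hEc : IsCompact E := isCompact_insert_iUnion fun r => isCompact_insert_orbitSet h0n hq _ _
  have hXc : IsCompact X := isCompact_insert_iUnion fun r => isCompact_insert_orbitSet h0n hq _ _
  have hSc : IsCompact S := isCompact_insert_orbitSet h0n hq _ _
  have hSc' : IsCompact S' := by
    by_cases h : ζ = -1 / 2
    · convert hSc using 1
      ext s
      rw [hS', Set.mem_ofPred_eq]
      exact ⟨fun hs => hs.elim (fun h => Or.inl h) fun h => h.2, fun hs => Or.inr ⟨h, hs⟩⟩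
    · convert isCompact_singleton (x := (0 : ℂ)) using 1
      ext s
      simp [hS', h]
  have horb : ∀ (u w : ℂ), w ∈ orbitSet 0 q 0 u → w = 0 ∨ ∃ j : ℕ, w = q ^ j * u := by
    rintro u w ⟨i, j, rfl⟩
    rcases i with _ | i
    · exact Or.inr ⟨j, by simp⟩
    · exact Or.inl (by simp)
  have hmemorb : ∀ (u : ℂ) (j : ℕ), q ^ j * u ∈ orbitSet 0 q 0 u := fun u j => ⟨0, j, by simp⟩
  have hEin : E ⊆ inside C := by
    rintro w (rfl | hw)
    · exact hC'.zero_mem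
    · obtain ⟨r, hr⟩ := Set.mem_iUnion.1 hw
      rcases horb _ _ hr with rfl | ⟨j, rfl⟩
      · exact hC'.zero_mem
      · exact hC.contains r.1 r.2.1 r.2.2 j
  have hXout : ∀ x ∈ X, x = 0 ∨ x⁻¹ ∈ outside C := by
    rintro x (rfl | hx)
    · exact Or.inl rfl
    · obtain ⟨r, hr⟩ := Set.mem_iUnion.1 hx
      rcases horb _ _ hr with rfl | ⟨j, rfl⟩
      · exact Or.inl rfl
      · rcases r.2 with ⟨h1, h2⟩ | ⟨h1, h2, h3⟩
        · exact Or.inr (hC.excludes r.1 h1 h2 j)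
        · exact Or.inr (hC.excludes_half h1 r.1 h2 h3 j)
  have hSin : ∀ s ∈ S, ∀ w ∈ carrier C ∪ inside C, s * w ∈ inside C := by
    rintro s (rfl | hs) w hw
    · rw [zero_mul]
      exact hC'.zero_mem
    · rcases horb _ _ hs with rfl | ⟨j, rfl⟩
      · rw [zero_mul]
        exact hC'.zero_mem
      · exact hC.cross j w hw
  have hSmul : ∀ s ∈ S', ∀ z ∈ carrier C ∪ inside C, ∀ w ∈ carrier C ∪ inside C,
      s * (z * w) ≠ 1 := by
    rintro s hs z hz w hw h1
    rcases hs with rfl | ⟨hζ, rfl | hs⟩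
    · simp at h1
    · simp at h1
    · rcases horb _ _ hs with rfl | ⟨j, rfl⟩
      · simp at h1
      · have hw0 : w ≠ 0 := fun h => by simp [h] at h1
        have h2 := hC.cross_half hζ j w hw hw0
        have h3 : (q ^ j * t * w)⁻¹ = z := by
          rw [inv_eq_of_mul_eq_one_right]
          rw [← h1]
          ring
        rw [h3] at h2
        rcases hz with hz | hz
        · exact h2.1 hz
        · exact outside_disjoint_inside h2 hz
  obtain ⟨N, hN, hCN, W, hW, hKW, hSW⟩ := hC'.exists_thickening hSc hSin
  -- a neighbourhood of the closed region whose points satisfy the condition on products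
  obtain ⟨U, hU, hKU, hUmul⟩ : ∃ U : Set ℂ, IsOpen U ∧ carrier C ∪ inside C ⊆ U ∧
      ∀ s ∈ S', ∀ z ∈ U, ∀ w ∈ U, s * (z * w) ≠ 1 := by
    have hopen : IsOpen {x : ℂ × ℂ | ∀ s ∈ S', s * (x.1 * x.2) ∈ ({1}ᶜ : Set ℂ)} :=
      isOpen_forall_mem hSc' (φ := fun (x : ℂ × ℂ) s => s * (x.1 * x.2)) (by fun_prop)
        isOpen_compl_singleton
    obtain ⟨U₁, U₂, h1, h2, h3, h4, h5⟩ := generalized_tube_lemma hC'.isCompact_union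
      hC'.isCompact_union hopen (by
        rintro ⟨z, w⟩ ⟨hz, hw⟩
        rw [Set.mem_ofPred_eq]
        intro s hs
        exact hSmul s hs z hz w hw)
    refine ⟨U₁ ∩ U₂, h1.inter h2, Set.subset_inter h3 h4, fun s hs z hz w hw => ?_⟩
    have hzw : (z, w) ∈ U₁ ×ˢ U₂ := ⟨hz.1, hw.2⟩
    exact h5 hzw s hs
  have hVo : IsOpen (W ∩ N ∩ U ∩ Eᶜ ∩ {z | ∀ x ∈ X, x * z ∈ ({1}ᶜ : Set ℂ)}) :=
    (((hW.inter hN).inter hU).inter hEc.isClosed.isOpen_compl).inter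
      (isOpen_forall_mem hXc (φ := fun (z : ℂ) x => x * z) (by fun_prop) isOpen_compl_singleton)
  have hCV : carrier C ⊆ W ∩ N ∩ U ∩ Eᶜ ∩ {z | ∀ x ∈ X, x * z ∈ ({1}ᶜ : Set ℂ)} := by
    intro z hz
    refine ⟨⟨⟨⟨hKW (Or.inl hz), hCN hz⟩, hKU (Or.inl hz)⟩, fun h => (hEin h).1 hz⟩, ?_⟩
    rw [Set.mem_ofPred_eq]
    intro x hx h
    rcases hXout x hx with rfl | hx
    · simp at h
    · rw [← eq_inv_of_mul_eq_one_right h] at hx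
      exact hx.1 hz
  filter_upwards [hC'.eventually_tube hVo hCV, self_mem_nhdsWithin] with δ hδ hδ0
  obtain ⟨hδV, hδC⟩ := hδ
  have hδ0 : 0 < δ := hδ0
  have hcut := hC'.isCut hδ0 hδC
  have h0 : (0 : ℂ) ∉ tube C δ := fun h => (hδV h).1.2 (Or.inl rfl)
  have h0O : (0 : ℂ) ∈ inside C \ tube C δ := ⟨hC'.zero_mem, h0⟩
  have hKW' : tube C δ ∪ inside C ⊆ W := by
    rintro z (hz | hz)
    · exact (hδV hz).1.1.1.1
    · exact hKW (Or.inr hz)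
  have hKU' : tube C δ ∪ inside C ⊆ U := by
    rintro z (hz | hz)
    · exact (hδV hz).1.1.2
    · exact hKU (Or.inr hz)
  -- at `p = 0` all conditions hold
  have hE' : E ⊆ inside C \ tube C δ := fun z hz => ⟨hEin hz, fun h => (hδV h).1.2 hz⟩
  have hX' : ∀ x ∈ X, ∀ z ∈ tube C δ ∪ inside C, x * z ≠ 1 := by
    rintro x hx z (hz | hz) h
    · exact (hδV hz).2 x hx h
    · rcases hXout x hx with rfl | hx
      · simp at h
      · rw [← eq_inv_of_mul_eq_one_right h] at hx
        exact outside_disjoint_inside hx hz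
  have hS1 : ∀ s ∈ S, ∀ z ∈ tube C δ ∪ inside C, s * z ∈ inside C \ tube C δ := fun s hs z hz =>
    ⟨(hSW s hs z (hKW' hz)).1, fun h => (hSW s hs z (hKW' hz)).2 (hδV h).1.1.1.2⟩
  have hS2 : ∀ s ∈ S', ∀ z ∈ tube C δ ∪ inside C, ∀ w ∈ tube C δ ∪ inside C, s * (z * w) ≠ 1 :=
    fun s hs z hz w hw => hUmul s hs z (hKU' hz) w (hKU' hw)
  refine ⟨hδC, h0, ?_⟩
  obtain ⟨d, hd, hdO⟩ := Metric.isOpen_iff.1 hcut.isOpen 0 h0O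
  obtain ⟨R', hR'⟩ := hcut.isCompact.isBounded.exists_norm_le
  set R := |R'| + 1 with hRdef
  have hR0 : 0 < R := by positivity
  have hR : ∀ z ∈ tube C δ ∪ inside C, ‖z‖ ≤ R := fun z hz =>
    (hR' z hz).trans (by rw [hRdef]; linarith [le_abs_self R'])
  have hsmall : ∀ z : ℂ, ‖z‖ < d → z ∈ inside C \ tube C δ := fun z hz =>
    hdO (by rwa [mem_ball_zero_iff])
  -- the other terms are small
  have hev : ∀ {s : ℝ} (_ : 0 < s) (M : ℝ) {c : ℝ} (_ : 0 < c), ∀ᶠ p : ℂ in 𝓝[≠] 0, ‖p‖ ^ s * M <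
      c :=
    fun hs M c hc => (tendsto_norm_rpow hs M).eventually (gt_mem_nhds hc)
  have e1 : ∀ᶠ p : ℂ in 𝓝[≠] 0, ∀ r, 0 < α r - ζ → ‖p‖ ^ (α r - ζ) * ‖v r‖ < d :=
    eventually_all.2 fun r => by
      by_cases h : 0 < α r - ζ
      · filter_upwards [hev h ‖v r‖ hd] with p hp _ using hp
      · exact Eventually.of_forall fun p h' => absurd h' h
  have e2 : ∀ᶠ p : ℂ in 𝓝[≠] 0, ∀ r, ‖p‖ ^ (1 : ℝ) * ‖v r‖ < d :=
    eventually_all.2 fun r => hev one_pos ‖v r‖ hd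
  have e3 : ∀ᶠ p : ℂ in 𝓝[≠] 0, ∀ r, 0 < shift T r + α r + ζ →
      ‖p‖ ^ (shift T r + α r + ζ) * (‖v r‖ * R) < 1 :=
    eventually_all.2 fun r => by
      by_cases h : 0 < shift T r + α r + ζ
      · filter_upwards [hev h (‖v r‖ * R) one_pos] with p hp _ using hp
      · exact Eventually.of_forall fun p h' => absurd h' h
  have e4 : ∀ᶠ p : ℂ in 𝓝[≠] 0, ∀ r, ‖p‖ ^ (1 : ℝ) * (‖v r‖ * R) < 1 :=
    eventually_all.2 fun r => hev one_pos (‖v r‖ * R) one_pos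
  have hζ2 : 0 < -(2 * ζ) := by linarith [hα.zeta_neg]
  have e5 : ∀ᶠ p : ℂ in 𝓝[≠] 0, 0 < 1 + 2 * ζ → ‖p‖ ^ (1 + 2 * ζ) * (R * R) < 1 := by
    by_cases h : 0 < 1 + 2 * ζ
    · filter_upwards [hev h (R * R) one_pos] with p hp _ using hp
    · exact Eventually.of_forall fun p h' => absurd h' h
  have e6 : ∀ᶠ p : ℂ in 𝓝[≠] 0, ‖p‖ < 1 :=
    nhdsWithin_le_nhds ((isOpen_lt continuous_norm continuous_const).mem_nhds (by simp))
  filter_upwards [self_mem_nhdsWithin, e1, e2, e3, e4, e5, e6, hev one_pos R hd,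
    hev hζ2 (1 / d) hd, hev one_pos (R * R) one_pos] with p hp e1 e2 e3 e4 e5 e6 e7 e8 e9
  have hp : p ≠ 0 := hp
  have hp0 : 0 < ‖p‖ := norm_pos_iff.2 hp
  have hpz : p ^ (ζ : ℂ) ≠ 0 := fun h => hp ((Complex.cpow_eq_zero_iff _ _).1 h).1
  simp only [Real.rpow_one] at e2 e4 e7 e9
  have hq1 : ∀ j : ℕ, ‖q‖ ^ j ≤ 1 := fun j => pow_le_one₀ (norm_nonneg _) hq.le
  have hp1 : ∀ i : ℕ, ‖p‖ ^ i ≤ 1 := fun i => pow_le_one₀ (norm_nonneg _) e6.le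
  have hpi : ∀ i : ℕ, ‖p‖ ^ (i + 1) ≤ ‖p‖ := fun i => by
    rw [pow_succ]
    exact mul_le_of_le_one_left hp0.le (hp1 i)
  have hr1 : ∀ s : ℝ, 0 ≤ s → ‖p‖ ^ s ≤ 1 := fun s hs => Real.rpow_le_one hp0.le e6.le hs
  have hαζ : ∀ r, 0 ≤ α r - ζ := fun r => by
    by_cases h : r ∈ T
    · linarith [hα.mem r h]
    · linarith [hα.notMem r h, hα.zeta_neg]
  have hαζ' : ∀ r, 0 ≤ shift T r + α r + ζ := fun r => by
    by_cases h : r ∈ T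
    · simp only [shift, h, if_true, Nat.cast_one]
      linarith [hα.mem r h, hα.zeta_ge]
    · simp only [shift, h, if_false, Nat.cast_zero]
      linarith [hα.notMem r h]
  have hzdiv : ∀ z : ℂ, z = z / p ^ (ζ : ℂ) * p ^ (ζ : ℂ) := fun z => (div_mul_cancel₀ z hpz).symm
  refine ⟨?_, ?_, ?_, ?_, ?_, ?_⟩
  · rw [Set.mem_ofPred_eq, zero_div]
    exact h0O
  · intro z hz
    obtain ⟨r, i, j, rfl⟩ := Set.mem_iUnion.1 hz
    rw [Set.mem_ofPred_eq]
    have heq : p ^ (i + (0 : Fin 6 → ℕ) r) * q ^ j * scaled v α p r / p ^ (ζ : ℂ) =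
        p ^ i * p ^ ((α r - ζ : ℝ) : ℂ) * (q ^ j * v r) := by
      rw [sub_eq_add_neg, ← pow_mul_cpow hp, Complex.ofReal_neg, Complex.cpow_neg]
      simp only [scaled, Pi.zero_apply, add_zero]
      rw [div_eq_mul_inv]
    rw [heq]
    have hnorm : ‖p ^ i * p ^ ((α r - ζ : ℝ) : ℂ) * (q ^ j * v r)‖ =
        ‖p‖ ^ i * ‖p‖ ^ (α r - ζ) * (‖q‖ ^ j * ‖v r‖) := by
      rw [norm_mul, norm_mul, norm_mul, norm_pow, norm_pow, norm_cpow_ofReal hp]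
    rcases i with _ | i
    · rcases (hαζ r).eq_or_lt with h | h
      · rw [← h]
        simp only [pow_zero, Complex.ofReal_zero, Complex.cpow_zero, one_mul]
        have hrT : r ∈ T := by
          by_contra hrT
          linarith [hα.notMem r hrT, hα.zeta_neg]
        exact hE' (Or.inr (Set.mem_iUnion.2 ⟨⟨r, hrT, by linarith⟩, hmemorb _ _⟩))
      · apply hsmall
        rw [hnorm, pow_zero, one_mul]
        calc ‖p‖ ^ (α r - ζ) * (‖q‖ ^ j * ‖v r‖) ≤ ‖p‖ ^ (α r - ζ) * (1 * ‖v r‖) := by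
              gcongr
              exact hq1 j
          _ < d := by
            rw [one_mul]
            exact e1 r h
    · apply hsmall
      rw [hnorm]
      calc ‖p‖ ^ (i + 1) * ‖p‖ ^ (α r - ζ) * (‖q‖ ^ j * ‖v r‖) ≤ ‖p‖ * 1 * (1 * ‖v r‖) := by
            gcongr
            · exact hpi i
            · exact hr1 _ (hαζ r)
            · exact hq1 j
        _ < d := by
          rw [mul_one, one_mul]
          exact e2 r
  · intro x hx z hz
    obtain ⟨r, i, j, rfl⟩ := Set.mem_iUnion.1 hx
    have hz : z / p ^ (ζ : ℂ) ∈ tube C δ ∪ inside C := hz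
    set w := z / p ^ (ζ : ℂ) with hw
    have heq : p ^ (i + shift T r) * q ^ j * scaled v α p r * z =
        p ^ i * p ^ ((shift T r + α r + ζ : ℝ) : ℂ) * (q ^ j * v r * w) := by
      rw [hzdiv z, ← hw, Complex.ofReal_add, Complex.ofReal_add, Complex.cpow_add _ _ hp,
        Complex.cpow_add _ _ hp, Complex.ofReal_natCast, Complex.cpow_natCast]
      simp only [scaled, pow_add]
      ring
    rw [heq]
    have hnorm : ‖p ^ i * p ^ ((shift T r + α r + ζ : ℝ) : ℂ) * (q ^ j * v r * w)‖ =
        ‖p‖ ^ i * ‖p‖ ^ (shift T r + α r + ζ) * (‖q‖ ^ j * (‖v r‖ * ‖w‖)) := by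
      rw [norm_mul, norm_mul, norm_mul, norm_mul, norm_pow, norm_pow, norm_cpow_ofReal hp]
      ring
    have hlt : ∀ y : ℂ, ‖y‖ < 1 → y ≠ 1 := fun y hy h => by
      rw [h, norm_one] at hy
      exact lt_irrefl _ hy
    rcases i with _ | i
    · rcases (hαζ' r).eq_or_lt with h | h
      · rw [← h]
        simp only [pow_zero, Complex.ofReal_zero, Complex.cpow_zero, one_mul]
        refine hX' _ (Or.inr (Set.mem_iUnion.2 ⟨⟨r, ?_⟩, hmemorb _ _⟩)) w hz
        by_cases hrT : r ∈ T
        · simp only [shift, hrT, if_true, Nat.cast_one] at h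
          have h1 := (hα.mem r hrT).1
          have h2 := hα.zeta_ge
          exact Or.inr ⟨by linarith, hrT, by linarith⟩
        · simp only [shift, hrT, if_false, Nat.cast_zero] at h
          exact Or.inl ⟨hrT, by linarith⟩
      · apply hlt
        rw [hnorm, pow_zero, one_mul]
        calc ‖p‖ ^ (shift T r + α r + ζ) * (‖q‖ ^ j * (‖v r‖ * ‖w‖)) ≤
              ‖p‖ ^ (shift T r + α r + ζ) * (1 * (‖v r‖ * R)) := by
              gcongr
              · exact hq1 j
              · exact hR w hz
          _ < 1 := by
            rw [one_mul]
            exact e3 r h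
    · apply hlt
      rw [hnorm]
      calc ‖p‖ ^ (i + 1) * ‖p‖ ^ (shift T r + α r + ζ) * (‖q‖ ^ j * (‖v r‖ * ‖w‖)) ≤
            ‖p‖ * 1 * (1 * (‖v r‖ * R)) := by
            gcongr
            · exact hpi i
            · exact hr1 _ (hαζ' r)
            · exact hq1 j
            · exact hR w hz
        _ < 1 := by
          rw [mul_one, one_mul]
          exact e4 r
  · rintro s ⟨i, j, rfl⟩ z hz
    have hz : z / p ^ (ζ : ℂ) ∈ tube C δ ∪ inside C := hz
    rw [Set.mem_ofPred_eq, mul_div_assoc, add_zero]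
    set w := z / p ^ (ζ : ℂ) with hw
    rcases i with _ | i
    · rw [pow_zero, one_mul]
      exact hS1 _ (Or.inr (hmemorb _ _)) w hz
    · apply hsmall
      rw [norm_mul, norm_mul, norm_mul, norm_pow, norm_pow]
      calc ‖p‖ ^ (i + 1) * ‖q‖ ^ j * ‖t‖ * ‖w‖ ≤ ‖p‖ * 1 * 1 * R := by
            gcongr
            · exact hpi i
            · exact hq1 j
            · exact hR w hz
        _ < d := by
          rw [mul_one, mul_one]
          exact e7
  · rintro s ⟨i, j, rfl⟩ z hz
    have hz : z / p ^ (ζ : ℂ) ∉ inside C \ tube C δ := hz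
    rw [Set.mem_ofPred_eq]
    set w := z / p ^ (ζ : ℂ) with hw
    have hwd : d ≤ ‖w‖ := by
      by_contra h
      exact hz (hsmall w (not_le.1 h))
    have heq : p ^ (i + 0) * q ^ j * t / z / p ^ (ζ : ℂ) =
        p ^ i * q ^ j * t * p ^ ((-(2 * ζ) : ℝ) : ℂ) / w := by
      rw [hw, Complex.ofReal_neg, Complex.cpow_neg, Complex.ofReal_mul, Complex.ofReal_ofNat,
        Complex.cpow_ofNat_mul]
      field_simp
      simp only [add_zero]
      ring
    rw [heq]
    apply hsmall
    rw [norm_div, norm_mul, norm_mul, norm_mul, norm_pow, norm_pow, norm_cpow_ofReal hp]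
    calc ‖p‖ ^ i * ‖q‖ ^ j * ‖t‖ * ‖p‖ ^ (-(2 * ζ)) / ‖w‖ ≤ 1 * 1 * 1 * ‖p‖ ^ (-(2 * ζ)) / d := by
          gcongr
          · exact hp1 i
          · exact hq1 j
      _ < d := by
        rw [one_mul, one_mul, one_mul, div_eq_mul_one_div]
        exact e8
  · rintro s ⟨i, j, rfl⟩ z hz z' hz'
    have hz : z / p ^ (ζ : ℂ) ∈ tube C δ ∪ inside C := hz
    have hz' : z' / p ^ (ζ : ℂ) ∈ tube C δ ∪ inside C := hz'
    set w := z / p ^ (ζ : ℂ) with hw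
    set w' := z' / p ^ (ζ : ℂ) with hw'
    have heq : p ^ (i + 1) * q ^ j * t * (z * z') =
        p ^ i * p ^ ((1 + 2 * ζ : ℝ) : ℂ) * (q ^ j * t * (w * w')) := by
      rw [hzdiv z, hzdiv z', ← hw, ← hw', Complex.ofReal_add, Complex.cpow_add _ _ hp,
        Complex.ofReal_one, Complex.cpow_one, Complex.ofReal_mul, Complex.ofReal_ofNat,
        Complex.cpow_ofNat_mul]
      ring
    rw [heq]
    have hlt : ∀ y : ℂ, ‖y‖ < 1 → y ≠ 1 := fun y hy h => by
      rw [h, norm_one] at hy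
      exact lt_irrefl _ hy
    have hnorm : ‖p ^ i * p ^ ((1 + 2 * ζ : ℝ) : ℂ) * (q ^ j * t * (w * w'))‖ =
        ‖p‖ ^ i * ‖p‖ ^ (1 + 2 * ζ) * (‖q‖ ^ j * ‖t‖ * (‖w‖ * ‖w'‖)) := by
      rw [norm_mul, norm_mul, norm_mul, norm_mul, norm_mul, norm_pow, norm_pow, norm_cpow_ofReal hp]
    have h12 : 0 ≤ 1 + 2 * ζ := by linarith [hα.zeta_ge]
    rcases i with _ | i
    · rcases h12.eq_or_lt with h | h
      · rw [← h]
        simp only [pow_zero, Complex.ofReal_zero, Complex.cpow_zero, one_mul]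
        exact hS2 _ (Or.inr ⟨by linarith, Or.inr (hmemorb _ _)⟩) w hz w' hz'
      · apply hlt
        rw [hnorm, pow_zero, one_mul]
        calc ‖p‖ ^ (1 + 2 * ζ) * (‖q‖ ^ j * ‖t‖ * (‖w‖ * ‖w'‖)) ≤
              ‖p‖ ^ (1 + 2 * ζ) * (1 * 1 * (R * R)) := by
              gcongr
              · exact hq1 j
              · exact hR w hz
              · exact hR w' hz'
          _ < 1 := by
            rw [one_mul, one_mul]
            exact e5 h
    · apply hlt
      rw [hnorm]
      calc ‖p‖ ^ (i + 1) * ‖p‖ ^ (1 + 2 * ζ) * (‖q‖ ^ j * ‖t‖ * (‖w‖ * ‖w'‖)) ≤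
            ‖p‖ * 1 * (1 * 1 * (R * R)) := by
            gcongr
            · exact hpi i
            · exact hr1 _ h12
            · exact hq1 j
            · exact hR w hz
            · exact hR w' hz'
        _ < 1 := by
          rw [mul_one, one_mul, one_mul]
          exact e9

end LimitContour

/-! ### Existence of contours -/

section Islands

/-- A disc `b`, together with pairwise disjoint discs `F₁` outside of it and minus pairwise disjoint
discs `F₂` inside; a disc is given by its centre and radius. -/
structure IsIslands (b : ℂ × ℝ) (F₁ F₂ : Finset (ℂ × ℝ)) : Prop where
  pos : 0 < b.2
  pos₁ : ∀ x ∈ F₁, 0 < x.2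
  pos₂ : ∀ x ∈ F₂, 0 < x.2
  disjoint₁ : ∀ x ∈ F₁, ∀ y ∈ F₁, x ≠ y → ∀ w : ℂ, ‖w - x.1‖ ≤ x.2 → y.2 < ‖w - y.1‖
  disjoint₂ : ∀ x ∈ F₂, ∀ y ∈ F₂, x ≠ y → ∀ w : ℂ, ‖w - x.1‖ ≤ x.2 → y.2 < ‖w - y.1‖
  outer : ∀ x ∈ F₁, ∀ w : ℂ, ‖w - x.1‖ ≤ x.2 → b.2 < ‖w - b.1‖
  inner : ∀ x ∈ F₂, ∀ w : ℂ, ‖w - x.1‖ ≤ x.2 → ‖w - b.1‖ < b.2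

open Classical in
/-- The boundary of the region consisting of `b` and `F₁` without `F₂`. -/
def islandChain (b : ℂ × ℝ) (F₁ F₂ : Finset (ℂ × ℝ)) : CircleChain :=
  Finsupp.onFinset (insert b F₁ ∪ F₂)
    (fun x => if x ∈ F₂ then -1 else if x ∈ insert b F₁ then 1 else 0) fun x hx => by
      by_contra h
      rw [Finset.mem_union, not_or] at h
      exact hx (by rw [if_neg h.2, if_neg h.1])

variable {b : ℂ × ℝ} {F₁ F₂ : Finset (ℂ × ℝ)}

lemma IsIslands.notMem₂ (h : IsIslands b F₁ F₂) {x : ℂ × ℝ} (hx : x = b ∨ x ∈ F₁) : x ∉ F₂ := by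
  intro hx2
  rcases hx with rfl | hx
  · have := h.inner x hx2 (x.1 + x.2) (by simp [abs_of_pos h.pos])
    simp [abs_of_pos h.pos] at this
  · have h1 := h.outer x hx x.1 (by simpa using (h.pos₁ x hx).le)
    have h2 := h.inner x hx2 x.1 (by simpa using (h.pos₁ x hx).le)
    exact lt_asymm h1 h2

lemma IsIslands.notMem₁ (h : IsIslands b F₁ F₂) : b ∉ F₁ := fun hb => by
  have := h.outer b hb b.1 (by simpa using h.pos.le)
  simp only [sub_self, norm_zero] at this
  exact lt_asymm this h.pos

lemma mem_support_islandChain {x : ℂ × ℝ} :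
    x ∈ (islandChain b F₁ F₂).support ↔ x = b ∨ x ∈ F₁ ∨ x ∈ F₂ := by
  classical
  rw [Finsupp.mem_support_iff, islandChain, Finsupp.onFinset_apply]
  by_cases h2 : x ∈ F₂
  · simp [h2]
  · by_cases h1 : x ∈ insert b F₁
    · rw [if_neg h2, if_pos h1]
      simp only [ne_eq, one_ne_zero, not_false_eq_true, true_iff]
      rw [Finset.mem_insert] at h1
      tauto
    · rw [if_neg h2, if_neg h1]
      rw [Finset.mem_insert, not_or] at h1
      simp [h1.1, h1.2, h2]

lemma sum_indicator_discs {F : Finset (ℂ × ℝ)}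
    (h : ∀ x ∈ F, ∀ y ∈ F, x ≠ y → ∀ w : ℂ, ‖w - x.1‖ ≤ x.2 → y.2 < ‖w - y.1‖) (w : ℂ) :
    ((∃ x ∈ F, ‖w - x.1‖ < x.2) → ∑ x ∈ F, (if ‖w - x.1‖ < x.2 then (1 : ℤ) else 0) = 1) ∧
    ((¬∃ x ∈ F, ‖w - x.1‖ < x.2) → ∑ x ∈ F, (if ‖w - x.1‖ < x.2 then (1 : ℤ) else 0) = 0) := by
  constructor
  · rintro ⟨x, hx, hw⟩
    rw [Finset.sum_eq_single_of_mem x hx fun y hy hyx => if_neg (h x hx y hy hyx.symm w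
        hw.le).not_gt,
      if_pos hw]
  · intro hn
    exact Finset.sum_eq_zero fun x hx => if_neg fun hw => hn ⟨x, hx, hw⟩

lemma IsIslands.winding (h : IsIslands b F₁ F₂) (w : ℂ) : winding (islandChain b F₁ F₂) w =
    (if ‖w - b.1‖ < b.2 then 1 else 0) + ∑ x ∈ F₁, (if ‖w - x.1‖ < x.2 then (1 : ℤ) else 0) -
      ∑ x ∈ F₂, (if ‖w - x.1‖ < x.2 then (1 : ℤ) else 0) := by
  classical
  have hs : (islandChain b F₁ F₂).support = insert b F₁ ∪ F₂ := by
    ext x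
    rw [mem_support_islandChain, Finset.mem_union, Finset.mem_insert, or_assoc]
  have hd : Disjoint (insert b F₁) F₂ := Finset.disjoint_left.2 fun x hx =>
    h.notMem₂ (Finset.mem_insert.1 hx)
  rw [winding_eq_sum, hs, Finset.sum_union hd, Finset.sum_insert h.notMem₁]
  have e1 : ∀ x, x = b ∨ x ∈ F₁ → islandChain b F₁ F₂ x = 1 := fun x hx => by
    rw [islandChain, Finsupp.onFinset_apply, if_neg (h.notMem₂ hx), if_pos (Finset.mem_insert.2 hx)]
  have e2 : ∀ x ∈ F₂, islandChain b F₁ F₂ x = -1 := fun x hx => by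
    rw [islandChain, Finsupp.onFinset_apply, if_pos hx]
  have e3 : ∑ x ∈ F₂, (if ‖w - x.1‖ < x.2 then islandChain b F₁ F₂ x else 0) =
      -∑ x ∈ F₂, (if ‖w - x.1‖ < x.2 then (1 : ℤ) else 0) := by
    rw [← Finset.sum_neg_distrib]
    refine Finset.sum_congr rfl fun x hx => ?_
    rw [e2 x hx]
    split_ifs <;> rfl
  have e4 : ∑ x ∈ F₁, (if ‖w - x.1‖ < x.2 then islandChain b F₁ F₂ x else 0) =
      ∑ x ∈ F₁, (if ‖w - x.1‖ < x.2 then (1 : ℤ) else 0) :=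
    Finset.sum_congr rfl fun x hx => by rw [e1 x (Or.inr hx)]
  rw [e1 b (Or.inl rfl), e3, e4, ← sub_eq_add_neg]

lemma IsIslands.mem_carrier (h : IsIslands b F₁ F₂) {w : ℂ} : w ∈ carrier (islandChain b F₁ F₂) ↔
    ‖w - b.1‖ = b.2 ∨ (∃ x ∈ F₁, ‖w - x.1‖ = x.2) ∨ ∃ x ∈ F₂, ‖w - x.1‖ = x.2 := by
  rw [EllipticSelberg.mem_carrier]
  constructor
  · rintro ⟨x, hx, e⟩
    rcases mem_support_islandChain.1 hx with rfl | hx | hx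
    · exact Or.inl e
    · exact Or.inr (Or.inl ⟨x, hx, e⟩)
    · exact Or.inr (Or.inr ⟨x, hx, e⟩)
  · rintro (e | ⟨x, hx, e⟩ | ⟨x, hx, e⟩)
    · exact ⟨b, mem_support_islandChain.2 (Or.inl rfl), e⟩
    · exact ⟨x, mem_support_islandChain.2 (Or.inr (Or.inl hx)), e⟩
    · exact ⟨x, mem_support_islandChain.2 (Or.inr (Or.inr hx)), e⟩

lemma IsIslands.mem_inside_of (h : IsIslands b F₁ F₂) {w : ℂ}
    (hw : (‖w - b.1‖ < b.2 ∧ ∀ x ∈ F₂, x.2 < ‖w - x.1‖) ∨ ∃ x ∈ F₁, ‖w - x.1‖ < x.2) :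
    w ∈ inside (islandChain b F₁ F₂) := by
  have s1 := sum_indicator_discs h.disjoint₁ w
  have s2 := sum_indicator_discs h.disjoint₂ w
  rcases hw with ⟨h1, h2⟩ | ⟨x, hx, hxw⟩
  · have n1 : ∀ x ∈ F₁, x.2 < ‖w - x.1‖ := fun x hx => by
      by_contra hlt
      exact lt_asymm h1 (h.outer x hx w (not_lt.1 hlt))
    refine ⟨fun hc => ?_, ?_⟩
    · rcases h.mem_carrier.1 hc with e | ⟨x, hx, e⟩ | ⟨x, hx, e⟩
      · exact h1.ne e
      · exact (n1 x hx).ne' e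
      · exact (h2 x hx).ne' e
    · rw [h.winding, if_pos h1, s1.2 fun ⟨x, hx, hxw⟩ => lt_asymm hxw (n1 x hx),
        s2.2 fun ⟨x, hx, hxw⟩ => lt_asymm hxw (h2 x hx)]
      rfl
  · have n1 := h.outer x hx w hxw.le
    have n2 : ∀ x ∈ F₂, x.2 < ‖w - x.1‖ := fun x hx => by
      by_contra hlt
      exact lt_asymm n1 (h.inner x hx w (not_lt.1 hlt))
    refine ⟨fun hc => ?_, ?_⟩
    · rcases h.mem_carrier.1 hc with e | ⟨y, hy, e⟩ | ⟨y, hy, e⟩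
      · exact n1.ne' e
      · by_cases hxy : x = y
        · rw [hxy] at hxw
          exact hxw.ne e
        · exact (h.disjoint₁ x hx y hy hxy w hxw.le).ne' e
      · exact (n2 y hy).ne' e
    · rw [h.winding, if_neg n1.not_gt, s1.1 ⟨x, hx, hxw⟩,
        s2.2 fun ⟨x, hx, hxw⟩ => lt_asymm hxw (n2 x hx)]
      rfl

lemma IsIslands.mem_outside_of (h : IsIslands b F₁ F₂) {w : ℂ}
    (hw : (b.2 < ‖w - b.1‖ ∧ ∀ x ∈ F₁, x.2 < ‖w - x.1‖) ∨ ∃ x ∈ F₂, ‖w - x.1‖ < x.2) :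
    w ∈ outside (islandChain b F₁ F₂) := by
  have s1 := sum_indicator_discs h.disjoint₁ w
  have s2 := sum_indicator_discs h.disjoint₂ w
  rcases hw with ⟨h1, h2⟩ | ⟨x, hx, hxw⟩
  · have n1 : ∀ x ∈ F₂, x.2 < ‖w - x.1‖ := fun x hx => by
      by_contra hlt
      exact lt_asymm h1 (h.inner x hx w (not_lt.1 hlt))
    refine ⟨fun hc => ?_, ?_⟩
    · rcases h.mem_carrier.1 hc with e | ⟨x, hx, e⟩ | ⟨x, hx, e⟩
      · exact h1.ne' e
      · exact (h2 x hx).ne' e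
      · exact (n1 x hx).ne' e
    · rw [h.winding, if_neg h1.not_gt, s1.2 fun ⟨x, hx, hxw⟩ => lt_asymm hxw (h2 x hx),
        s2.2 fun ⟨x, hx, hxw⟩ => lt_asymm hxw (n1 x hx)]
      rfl
  · have n1 := h.inner x hx w hxw.le
    have n2 : ∀ x ∈ F₁, x.2 < ‖w - x.1‖ := fun x hx => by
      by_contra hlt
      exact lt_asymm n1 (h.outer x hx w (not_lt.1 hlt))
    refine ⟨fun hc => ?_, ?_⟩
    · rcases h.mem_carrier.1 hc with e | ⟨y, hy, e⟩ | ⟨y, hy, e⟩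
      · exact n1.ne e
      · exact (n2 y hy).ne' e
      · by_cases hxy : x = y
        · rw [hxy] at hxw
          exact hxw.ne e
        · exact (h.disjoint₂ x hx y hy hxy w hxw.le).ne' e
    · rw [h.winding, if_pos n1, s2.1 ⟨x, hx, hxw⟩,
        s1.2 fun ⟨x, hx, hxw⟩ => lt_asymm hxw (n2 x hx)]
      rfl

lemma IsIslands.region (h : IsIslands b F₁ F₂) {w : ℂ} (hw : w ∉ carrier (islandChain b F₁ F₂)) :
    ((‖w - b.1‖ < b.2 ∧ ∀ x ∈ F₂, x.2 < ‖w - x.1‖) ∨ ∃ x ∈ F₁, ‖w - x.1‖ < x.2) ∨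
    ((b.2 < ‖w - b.1‖ ∧ ∀ x ∈ F₁, x.2 < ‖w - x.1‖) ∨ ∃ x ∈ F₂, ‖w - x.1‖ < x.2) := by
  rw [h.mem_carrier, not_or, not_or] at hw
  obtain ⟨h0, h1, h2⟩ := hw
  by_cases k1 : ∃ x ∈ F₁, ‖w - x.1‖ < x.2
  · exact Or.inl (Or.inr k1)
  by_cases k2 : ∃ x ∈ F₂, ‖w - x.1‖ < x.2
  · exact Or.inr (Or.inr k2)
  have m1 : ∀ x ∈ F₁, x.2 < ‖w - x.1‖ := fun x hx =>
    lt_of_le_of_ne (not_lt.1 fun hlt => k1 ⟨x, hx, hlt⟩) fun e => h1 ⟨x, hx, e.symm⟩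
  have m2 : ∀ x ∈ F₂, x.2 < ‖w - x.1‖ := fun x hx =>
    lt_of_le_of_ne (not_lt.1 fun hlt => k2 ⟨x, hx, hlt⟩) fun e => h2 ⟨x, hx, e.symm⟩
  rcases lt_or_gt_of_ne h0 with h0 | h0
  · exact Or.inl (Or.inl ⟨h0, m2⟩)
  · exact Or.inr (Or.inl ⟨h0, m1⟩)

lemma IsIslands.mem_inside (h : IsIslands b F₁ F₂) {w : ℂ} : w ∈ inside (islandChain b F₁ F₂) ↔
    (‖w - b.1‖ < b.2 ∧ ∀ x ∈ F₂, x.2 < ‖w - x.1‖) ∨ ∃ x ∈ F₁, ‖w - x.1‖ < x.2 :=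
  ⟨fun hw => (h.region hw.1).resolve_right fun h' =>
    outside_disjoint_inside (h.mem_outside_of h') hw, h.mem_inside_of⟩

lemma IsIslands.mem_outside (h : IsIslands b F₁ F₂) {w : ℂ} : w ∈ outside (islandChain b F₁ F₂) ↔
    (b.2 < ‖w - b.1‖ ∧ ∀ x ∈ F₁, x.2 < ‖w - x.1‖) ∨ ∃ x ∈ F₂, ‖w - x.1‖ < x.2 :=
  ⟨fun hw => (h.region hw.1).resolve_left fun h' =>
    outside_disjoint_inside hw (h.mem_inside_of h'), h.mem_outside_of⟩

lemma IsIslands.isContour (h : IsIslands b F₁ F₂)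
    (h0 : ‖(0 : ℂ) - b.1‖ < b.2 ∧ ∀ x ∈ F₂, x.2 < ‖(0 : ℂ) - x.1‖) :
    IsContour (islandChain b F₁ F₂) where
  radius_pos := fun x hx => by
    rcases mem_support_islandChain.1 hx with rfl | hx | hx
    · exact h.pos
    · exact h.pos₁ x hx
    · exact h.pos₂ x hx
  region := fun w hw => (h.region hw).imp h.mem_inside_of h.mem_outside_of
  zero_mem := h.mem_inside_of (Or.inl h0)

lemma IsIslands.mem_closure (h : IsIslands b F₁ F₂) {w : ℂ}
    (hw : w ∈ carrier (islandChain b F₁ F₂) ∪ inside (islandChain b F₁ F₂)) :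
    (‖w - b.1‖ ≤ b.2 ∧ ∀ x ∈ F₂, x.2 ≤ ‖w - x.1‖) ∨ ∃ x ∈ F₁, ‖w - x.1‖ ≤ x.2 := by
  rcases hw with hw | hw
  · rcases h.mem_carrier.1 hw with e | ⟨x, hx, e⟩ | ⟨x, hx, e⟩
    · refine Or.inl ⟨e.le, fun x hx => ?_⟩
      by_contra hlt
      exact (h.inner x hx w (not_le.1 hlt).le).ne e
    · exact Or.inr ⟨x, hx, e.le⟩
    · refine Or.inl ⟨(h.inner x hx w e.le).le, fun y hy => ?_⟩
      by_cases hxy : x = y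
      · rw [← hxy]
        exact e.ge
      · exact (h.disjoint₂ x hx y hy hxy w e.le).le
  · rcases h.mem_inside.1 hw with ⟨h1, h2⟩ | ⟨x, hx, h1⟩
    · exact Or.inl ⟨h1.le, fun x hx => (h2 x hx).le⟩
    · exact Or.inr ⟨x, hx, h1.le⟩

end Islands

section SymmetricContour

/-- The points `p^i q^j t^k v_r` with `i, j, k ≥ 0`. -/
def orbit (p q t : ℂ) (v : Fin 6 → ℂ) : Set ℂ :=
  {w | ∃ r, ∃ i j k : ℕ, w = p ^ i * q ^ j * t ^ k * v r}

variable {p q t : ℂ} {v : Fin 6 → ℂ}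

lemma countable_orbit (p q t : ℂ) (v : Fin 6 → ℂ) : (orbit p q t v).Countable := by
  refine (Set.countable_range fun x : Fin 6 × ℕ × ℕ × ℕ =>
    p ^ x.2.1 * q ^ x.2.2.1 * t ^ x.2.2.2 * v x.1).mono ?_
  rintro _ ⟨r, i, j, k, rfl⟩
  exact ⟨(r, i, j, k), rfl⟩

lemma mul_mem_orbit {s x : ℂ} (hs : s ∈ orbitSet p q 0 t) (hx : x ∈ orbit p q t v) :
    s * x ∈ orbit p q t v := by
  obtain ⟨i, j, rfl⟩ := hs
  obtain ⟨r, i', j', k', rfl⟩ := hx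
  exact ⟨r, i + i', j + j', k' + 1, by ring⟩

lemma norm_orbitSet_le (hp : ‖p‖ < 1) (hq : ‖q‖ < 1) (e : ℕ) {s : ℂ} (hs : s ∈ orbitSet p q e t) :
    ‖s‖ ≤ ‖t‖ := by
  obtain ⟨i, j, rfl⟩ := hs
  rw [norm_mul, norm_mul, norm_pow, norm_pow]
  exact mul_le_of_le_one_left (norm_nonneg t) (mul_le_one₀ (pow_le_one₀ (norm_nonneg p) hp.le)
    (by positivity) (pow_le_one₀ (norm_nonneg q) hq.le))

lemma isCompact_insert_orbit (hp : ‖p‖ < 1) (hq : ‖q‖ < 1) (ht : ‖t‖ < 1) (v : Fin 6 → ℂ) :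
    IsCompact (insert 0 (orbit p q t v)) := by
  have h2 := (tendsto_pow_atTop_nhds_zero_of_norm_lt_one ht).isCompact_insert_range
  have : insert 0 (orbit p q t v) = insert 0 (⋃ r, (fun x : ℂ × ℂ => x.1 * x.2) ''
      (insert 0 (orbitSet p q 0 (v r)) ×ˢ insert 0 (Set.range fun n : ℕ => t ^ n))) := by
    ext w
    constructor
    · rintro (rfl | ⟨r, i, j, k, rfl⟩)
      · exact Or.inl rfl
      · exact Or.inr (Set.mem_iUnion.2 ⟨r, (p ^ (i + 0) * q ^ j * v r, t ^ k),
          ⟨Or.inr ⟨i, j, rfl⟩, Or.inr ⟨k, rfl⟩⟩, by simp only [add_zero]; ring⟩)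
    · rintro (rfl | hw)
      · exact Or.inl rfl
      · obtain ⟨r, ⟨x, y⟩, ⟨hx | ⟨i, j, hx⟩, hy | ⟨k, hy⟩⟩, rfl⟩ := Set.mem_iUnion.1 hw
        · exact Or.inl (by simp [show x = 0 from hx])
        · exact Or.inl (by simp [show x = 0 from hx])
        · exact Or.inl (by simp [show y = 0 from hy])
        · refine Or.inr ⟨r, i, j, k, ?_⟩
          rw [show x = _ from hx, show y = t ^ k from hy.symm]
          ring
  rw [this]
  have hc : ∀ r, IsCompact (insert (0 : ℂ) ((fun x : ℂ × ℂ => x.1 * x.2) ''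
      (insert 0 (orbitSet p q 0 (v r)) ×ˢ insert 0 (Set.range fun n : ℕ => t ^ n)))) := fun r =>
    (((isCompact_insert_orbitSet hp hq 0 (v r)).prod h2).image (by fun_prop)).insert 0
  exact isCompact_insert_iUnion hc

lemma finite_orbit (hp : ‖p‖ < 1) (hq : ‖q‖ < 1) (ht : ‖t‖ < 1) (v : Fin 6 → ℂ) {c : ℝ}
    (hc : 0 < c) : {w ∈ orbit p q t v | c ≤ ‖w‖}.Finite := by
  have hM : ∃ M : ℝ, 0 < M ∧ ∀ r, ‖v r‖ ≤ M :=
    ⟨∑ r, ‖v r‖ + 1, by positivity, fun r => by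
      have := Finset.single_le_sum (f := fun r => ‖v r‖) (fun r _ => norm_nonneg _)
        (Finset.mem_univ r)
      linarith⟩
  obtain ⟨M, hM0, hM⟩ := hM
  have hN : ∀ {a : ℂ}, ‖a‖ < 1 → ∃ N : ℕ, ∀ n, N ≤ n → ‖a‖ ^ n < c / M := fun {a} ha => by
    have := (tendsto_pow_atTop_nhds_zero_of_lt_one (norm_nonneg a) ha).eventually
      (gt_mem_nhds (div_pos hc hM0))
    exact eventually_atTop.1 this
  obtain ⟨N₁, h1⟩ := hN hp
  obtain ⟨N₂, h2⟩ := hN hq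
  obtain ⟨N₃, h3⟩ := hN ht
  refine Set.Finite.subset (Set.Finite.image (fun x : Fin 6 × ℕ × ℕ × ℕ =>
    p ^ x.2.1 * q ^ x.2.2.1 * t ^ x.2.2.2 * v x.1) (Finset.finite_toSet
      (Finset.univ ×ˢ Finset.range N₁ ×ˢ Finset.range N₂ ×ˢ Finset.range N₃))) ?_
  rintro w ⟨⟨r, i, j, k, rfl⟩, hw⟩
  refine ⟨(r, i, j, k), ?_, rfl⟩
  simp only [norm_mul, norm_pow] at hw
  have b1 : ‖p‖ ^ i ≤ 1 := pow_le_one₀ (norm_nonneg _) hp.le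
  have b2 : ‖q‖ ^ j ≤ 1 := pow_le_one₀ (norm_nonneg _) hq.le
  have b3 : ‖t‖ ^ k ≤ 1 := pow_le_one₀ (norm_nonneg _) ht.le
  have hlt : ∀ x : ℝ, x < c / M → x * M < c := fun x hx => by rwa [lt_div_iff₀ hM0] at hx
  simp only [Finset.coe_product, Set.mem_prod, Finset.mem_coe, Finset.mem_univ, Finset.mem_range,
    true_and]
  refine ⟨?_, ?_, ?_⟩
  · by_contra h
    have h4 := hlt _ (h1 i (not_lt.1 h))
    have : ‖p‖ ^ i * ‖q‖ ^ j * ‖t‖ ^ k * ‖v r‖ ≤ ‖p‖ ^ i * 1 * 1 * M := by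
      gcongr
      exact hM r
    linarith
  · by_contra h
    have h4 := hlt _ (h2 j (not_lt.1 h))
    have : ‖p‖ ^ i * ‖q‖ ^ j * ‖t‖ ^ k * ‖v r‖ ≤ 1 * ‖q‖ ^ j * 1 * M := by
      gcongr
      exact hM r
    linarith
  · by_contra h
    have h4 := hlt _ (h3 k (not_lt.1 h))
    have : ‖p‖ ^ i * ‖q‖ ^ j * ‖t‖ ^ k * ‖v r‖ ≤ 1 * 1 * ‖t‖ ^ k * M := by
      gcongr
      exact hM r
    linarith

open Complex in
/-- The circle with centre `iy` through `1` and `-1` is invariant under inversion. -/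
lemma norm_inv_sub_sq (y : ℝ) {w : ℂ} (hw : w ≠ 0) :
    ‖w⁻¹ - y * I‖ ^ 2 - (1 + y ^ 2) = -(‖w - y * I‖ ^ 2 - (1 + y ^ 2)) / ‖w‖ ^ 2 := by
  have hn : normSq w ≠ 0 := (normSq_pos.2 hw).ne'
  rw [← normSq_eq_norm_sq, ← normSq_eq_norm_sq, ← normSq_eq_norm_sq]
  have e1 : w⁻¹ - y * I = ⟨w.re / normSq w, -w.im / normSq w - y⟩ := by
    apply Complex.ext <;> simp [inv_re, inv_im]
  have e2 : w - y * I = ⟨w.re, w.im - y⟩ := by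
    apply Complex.ext <;> simp
  have e3 : normSq w = w.re * w.re + w.im * w.im := normSq_apply w
  rw [normSq_apply (w⁻¹ - y * I), normSq_apply (w - y * I), e1, e2]
  simp only
  generalize normSq w = m at hn e3 ⊢
  field_simp
  rw [e3]
  ring

open Complex in
/-- The image of a disc under inversion. -/
lemma norm_sub_inv_sq {e w : ℂ} {ε : ℝ} (hw : w ≠ 0) (hε : ε < ‖e‖) (hε0 : 0 < ε) :
    ‖w - (starRingEnd ℂ) e / ((‖e‖ ^ 2 - ε ^ 2 : ℝ) : ℂ)‖ ^ 2 - (ε / (‖e‖ ^ 2 - ε ^ 2)) ^ 2 =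
      (‖w⁻¹ - e‖ ^ 2 - ε ^ 2) * ‖w‖ ^ 2 / (‖e‖ ^ 2 - ε ^ 2) := by
  have hD : 0 < ‖e‖ ^ 2 - ε ^ 2 := by nlinarith
  set D := ‖e‖ ^ 2 - ε ^ 2 with hDdef
  have hn : normSq w ≠ 0 := (normSq_pos.2 hw).ne'
  have e4 : D = e.re * e.re + e.im * e.im - ε ^ 2 := by
    rw [hDdef, ← normSq_eq_norm_sq, normSq_apply]
  rw [← normSq_eq_norm_sq, ← normSq_eq_norm_sq, ← normSq_eq_norm_sq]
  have e1 : w⁻¹ - e = ⟨w.re / normSq w - e.re, -w.im / normSq w - e.im⟩ := by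
    apply Complex.ext <;> simp [inv_re, inv_im]
  have e2 : w - (starRingEnd ℂ) e / (D : ℂ) = ⟨w.re - e.re / D, w.im + e.im / D⟩ := by
    apply Complex.ext <;> simp [neg_div]
  have e3 : normSq w = w.re * w.re + w.im * w.im := normSq_apply w
  rw [normSq_apply (w⁻¹ - e), normSq_apply (w - (starRingEnd ℂ) e / (D : ℂ)), e1, e2]
  simp only
  generalize normSq w = m at hn e3 ⊢
  clear_value D
  field_simp
  rw [e3, e4]
  ring

/-- If no product of two points of the orbit is `1`, there is a contour `C = C⁻¹` which contains the
orbit and its multiples by the crossing factors. It consists of a circle through `1` and `-1`, small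
circles around the points of the orbit outside of it, and the images of these under inversion. -/
theorem exists_symmetric_contour (hp : ‖p‖ < 1) (hq : ‖q‖ < 1) (ht : ‖t‖ < 1)
    (hgen : ∀ x ∈ orbit p q t v, ∀ y ∈ orbit p q t v, x * y ≠ 1) :
    ∃ C, IsContour C ∧ (∀ w : ℂ, w ≠ 0 → (w ∈ inside C ↔ w⁻¹ ∈ outside C)) ∧
      orbit p q t v ⊆ inside C ∧
      ∀ s ∈ orbitSet p q 0 t, ∀ w ∈ carrier C ∪ inside C, s * w ∈ inside C := by
  have hOrb := isCompact_insert_orbit hp hq ht v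
  -- the base circle, with centre `iy` on the imaginary axis and close to `0`, through no point of
  -- the orbit
  obtain ⟨y, hy0, hyt, hyo⟩ : ∃ y : ℝ, 0 < y ∧ ‖t‖ * (√(1 + y ^ 2) + y) + y < √(1 + y ^ 2) ∧
      ∀ x ∈ orbit p q t v, ‖x - y * Complex.I‖ ^ 2 ≠ 1 + y ^ 2 := by
    have hcont : Continuous fun y : ℝ => √(1 + y ^ 2) - (‖t‖ * (√(1 + y ^ 2) + y) + y) := by
        fun_prop
    have hpos : ∀ᶠ y : ℝ in 𝓝 0, 0 < √(1 + y ^ 2) - (‖t‖ * (√(1 + y ^ 2) + y) + y) :=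
      hcont.continuousAt.eventually (lt_mem_nhds (by simpa using ht))
    obtain ⟨d, hd, hdp⟩ := Metric.eventually_nhds_iff.1 hpos
    have hcount : (⋃ x ∈ orbit p q t v, {y : ℝ | ‖x - y * Complex.I‖ ^ 2 = 1 + y ^
        2}).Countable := by
      refine (countable_orbit p q t v).biUnion fun x hx => Set.Subsingleton.countable ?_
      have hx2 : ∀ y : ℝ, ‖x - y * Complex.I‖ ^ 2 = 1 + y ^ 2 →
          x.re * x.re + x.im * x.im - 2 * y * x.im = 1 := by
        intro y hy
        rw [← Complex.normSq_eq_norm_sq, Complex.normSq_apply] at hy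
        simp at hy
        linarith
      intro y1 h1 y2 h2
      have k1 := hx2 y1 h1
      have k2 := hx2 y2 h2
      have him : x.im ≠ 0 := by
        intro h
        refine hgen x hx x hx ?_
        rw [h] at k1
        apply Complex.ext
        · simp [h]
          linarith
        · simp [h]
      have : (y1 - y2) * x.im = 0 := by linarith
      rcases mul_eq_zero.1 this with h | h
      · linarith
      · exact absurd h him
    obtain ⟨y, hy, hyd⟩ := (hcount.dense_compl ℝ).exists_mem_open isOpen_Ioo
      (Set.nonempty_Ioo.2 hd)
    refine ⟨y, hyd.1, ?_, fun x hx h => hy (Set.mem_biUnion hx h)⟩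
    have := hdp (y := y) (by rw [Real.dist_0_eq_abs, abs_of_pos hyd.1]; exact hyd.2)
    linarith
  set c : ℂ := y * Complex.I with hc
  set R : ℝ := √(1 + y ^ 2) with hR
  have hR2 : R ^ 2 = 1 + y ^ 2 := Real.sq_sqrt (by positivity)
  have hR0 : 0 < R := Real.sqrt_pos.2 (by positivity)
  have hcn : ‖c‖ = y := by
    rw [hc, norm_mul, Complex.norm_real, Complex.norm_I, mul_one, Real.norm_eq_abs, abs_of_pos hy0]
  have hyR : y < R := by
    have : 0 ≤ ‖t‖ * (R + y) := by positivity
    linarith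
  have hsq : ∀ w : ℂ, (‖w - c‖ < R ↔ ‖w - c‖ ^ 2 < 1 + y ^ 2) ∧ (R < ‖w - c‖ ↔ 1 + y ^ 2 < ‖w - c‖ ^
      2) :=
    fun w => by
      rw [← hR2]
      exact ⟨(pow_lt_pow_iff_left₀ (norm_nonneg _) hR0.le two_ne_zero).symm,
        (pow_lt_pow_iff_left₀ hR0.le (norm_nonneg _) two_ne_zero).symm⟩
  have hinv : ∀ w : ℂ, w ≠ 0 → (‖w - c‖ < R ↔ R < ‖w⁻¹ - c‖) := by
    intro w hw
    have hw2 : 0 < ‖w‖ ^ 2 := by positivity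
    have := norm_inv_sub_sq y hw
    rw [eq_div_iff hw2.ne'] at this
    rw [(hsq w).1, (hsq w⁻¹).2]
    constructor
    · intro h
      by_contra h'
      nlinarith
    · intro h
      by_contra h'
      nlinarith
  have hinv' : ∀ w : ℂ, w ≠ 0 → (R < ‖w - c‖ ↔ ‖w⁻¹ - c‖ < R) := fun w hw => by
    rw [hinv w⁻¹ (inv_ne_zero hw), inv_inv]
  have hoR : ∀ x ∈ orbit p q t v, ‖x - c‖ ≠ R := fun x hx h => hyo x hx (by rw [h, hR2])
  -- the points of the orbit outside the base circle
  have hfin : {x ∈ orbit p q t v | R < ‖x - c‖}.Finite := by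
    refine (finite_orbit hp hq ht v (sub_pos.2 hyR)).subset fun x hx => ⟨hx.1, ?_⟩
    have := norm_sub_le x c
    rw [hcn] at this
    linarith [hx.2]
  set F : Finset ℂ := hfin.toFinset with hF
  have hFm : ∀ e, e ∈ F ↔ e ∈ orbit p q t v ∧ R < ‖e - c‖ := fun e => by
    rw [hF, Set.Finite.mem_toFinset]
    rfl
  have hFn : ∀ e ∈ F, 0 < ‖e‖ := fun e he => by
    have := norm_sub_le e c
    rw [hcn] at this
    linarith [((hFm e).1 he).2]
  -- the choice of the radius of the small circles
  have hev : ∀ᶠ ε : ℝ in 𝓝[>] 0, (∀ e ∈ F, ∀ e' ∈ F, e ≠ e' → 2 * ε < ‖e - e'‖) ∧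
      (∀ e ∈ F, R + ε < ‖e - c‖ ∧ ε < ‖e‖) ∧
      (∀ x ∈ orbit p q t v, ‖x - c‖ < R → ∀ w : ℂ, ‖w - x‖ ≤ ε → ‖w - c‖ < R) ∧
      (∀ e ∈ F, ∀ x ∈ orbit p q t v, ∀ w : ℂ, ‖w - e‖ ≤ ε → x * w ≠ 1) ∧
      (∀ e ∈ F, ∀ e' ∈ F, ∀ s ∈ orbitSet p q 0 t, ∀ w w' : ℂ, ‖w - e‖ ≤ ε → ‖w' - e'‖ ≤ ε →
        s * (w * w') ≠ 1) := by
    have hid : Tendsto (fun ε : ℝ => ε) (𝓝[>] 0) (𝓝 0) := tendsto_id.mono_right nhdsWithin_le_nhds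
    refine .and ?_ (.and ?_ (.and ?_ (.and ?_ ?_)))
    · refine (Finset.eventually_all F).2 fun e he => (Finset.eventually_all F).2 fun e' he' => ?_
      by_cases h : e = e'
      · exact Eventually.of_forall fun ε h' => absurd h h'
      · have h0 : 2 * 0 < ‖e - e'‖ := by simpa [sub_eq_zero] using h
        have := (hid.const_mul 2).eventually (gt_mem_nhds h0)
        filter_upwards [this] with ε hε _ using hε
    · refine (Finset.eventually_all F).2 fun e he => ?_
      have h0 : R + 0 < ‖e - c‖ := by rw [add_zero]; exact ((hFm e).1 he).2
      have h1 := (hid.const_add R).eventually (gt_mem_nhds h0)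
      filter_upwards [h1, hid.eventually (gt_mem_nhds (hFn e he))] with ε h1 h2 using ⟨h1, h2⟩
    · have hKc : IsCompact (insert 0 (orbit p q t v) ∩ Metric.closedBall c R) :=
        hOrb.inter (isCompact_closedBall c R)
      have hKB : insert 0 (orbit p q t v) ∩ Metric.closedBall c R ⊆ Metric.ball c R := by
        rintro x ⟨hx, hxR⟩
        rw [Metric.mem_closedBall, dist_eq_norm] at hxR
        rw [Metric.mem_ball, dist_eq_norm]
        rcases hx with rfl | hx
        · rw [zero_sub, norm_neg, hcn]
          exact hyR
        · exact lt_of_le_of_ne hxR (hoR x hx)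
      obtain ⟨ε₀, hε₀, hsub⟩ := hKc.exists_cthickening_subset_open Metric.isOpen_ball hKB
      filter_upwards [hid.eventually (gt_mem_nhds hε₀)] with ε hε x hx hxR w hw
      have : w ∈ Metric.ball c R := hsub (Metric.mem_cthickening_of_dist_le w x ε₀ _
        ⟨Or.inr hx, by rw [Metric.mem_closedBall, dist_eq_norm]; exact hxR.le⟩
        (by rw [dist_eq_norm]; linarith))
      rwa [Metric.mem_ball, dist_eq_norm] at this
    · refine (Finset.eventually_all F).2 fun e he => ?_
      have hop : IsOpen {w : ℂ | ∀ x ∈ insert 0 (orbit p q t v), x * w ∈ ({1}ᶜ : Set ℂ)} :=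
        isOpen_forall_mem hOrb (φ := fun (w : ℂ) x => x * w) (by fun_prop) isOpen_compl_singleton
      obtain ⟨ε₀, hε₀, hsub⟩ := Metric.isOpen_iff.1 hop e (by
        rw [Set.mem_ofPred_eq]
        rintro x (rfl | hx) h
        · simp at h
        · exact hgen x hx e ((hFm e).1 he).1 h)
      filter_upwards [hid.eventually (gt_mem_nhds hε₀)] with ε hε x hx w hw
      have hm : w ∈ Metric.ball e ε₀ := by rw [Metric.mem_ball, dist_eq_norm]; linarith
      have := hsub hm
      rw [Set.mem_ofPred_eq] at this
      exact this x (Or.inr hx)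
    · refine (Finset.eventually_all F).2 fun e he => (Finset.eventually_all F).2 fun e' he' => ?_
      have hop : IsOpen {x : ℂ × ℂ | ∀ s ∈ insert 0 (orbitSet p q 0 t),
          s * (x.1 * x.2) ∈ ({1}ᶜ : Set ℂ)} :=
        isOpen_forall_mem (isCompact_insert_orbitSet hp hq 0 t)
          (φ := fun (x : ℂ × ℂ) s => s * (x.1 * x.2)) (by fun_prop) isOpen_compl_singleton
      obtain ⟨ε₀, hε₀, hsub⟩ := Metric.isOpen_iff.1 hop (e, e') (by
        rw [Set.mem_ofPred_eq]
        rintro s (rfl | hs) h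
        · simp at h
        · refine hgen (s * e) (mul_mem_orbit hs ((hFm e).1 he).1) e' ((hFm e').1 he').1 ?_
          rw [mul_assoc]
          exact h)
      filter_upwards [hid.eventually (gt_mem_nhds hε₀)] with ε hε s hs w w' hw hw'
      have hm : ((w, w') : ℂ × ℂ) ∈ Metric.ball (e, e') ε₀ := by
        rw [Metric.mem_ball, Prod.dist_eq, dist_eq_norm, dist_eq_norm]
        exact max_lt (hw.trans_lt hε) (hw'.trans_lt hε)
      have := hsub hm
      rw [Set.mem_ofPred_eq] at this
      exact this s (Or.inr hs)
  obtain ⟨ε, ⟨i1, i2, i3, i4, i5⟩, hε⟩ := (hev.and self_mem_nhdsWithin).exists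
  have hε : 0 < ε := hε
  classical
  set hole : ℂ → ℂ × ℝ := fun e =>
    ((starRingEnd ℂ) e / ((‖e‖ ^ 2 - ε ^ 2 : ℝ) : ℂ), ε / (‖e‖ ^ 2 - ε ^ 2)) with hhole
  have hD : ∀ e ∈ F, 0 < ‖e‖ ^ 2 - ε ^ 2 := fun e he => by nlinarith [(i2 e he).2]
  have hole_pos : ∀ e ∈ F, 0 < (hole e).2 := fun e he => div_pos hε (hD e he)
  have hole_iff : ∀ e ∈ F, ∀ w : ℂ, w ≠ 0 → ((‖w - (hole e).1‖ < (hole e).2 ↔ ‖w⁻¹ - e‖ < ε) ∧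
      (‖w - (hole e).1‖ ≤ (hole e).2 ↔ ‖w⁻¹ - e‖ ≤ ε)) := by
    intro e he w hw
    have key := norm_sub_inv_sq (e := e) hw (i2 e he).2 hε
    rw [eq_div_iff (hD e he).ne'] at key
    have hw2 : 0 < ‖w‖ ^ 2 := by positivity
    have hDe := hD e he
    rw [← pow_lt_pow_iff_left₀ (norm_nonneg _) (hole_pos e he).le two_ne_zero,
      ← pow_lt_pow_iff_left₀ (norm_nonneg _) hε.le two_ne_zero,
      ← pow_le_pow_iff_left₀ (norm_nonneg _) (hole_pos e he).le two_ne_zero,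
      ← pow_le_pow_iff_left₀ (norm_nonneg _) hε.le two_ne_zero, ← sub_neg, ← sub_neg (b := ε ^ 2),
      ← sub_nonpos, ← sub_nonpos (b := ε ^ 2)]
    set A := ‖w - (hole e).1‖ ^ 2 - (hole e).2 ^ 2 with hA
    set B := ‖w⁻¹ - e‖ ^ 2 - ε ^ 2 with hB
    have key' : A * (‖e‖ ^ 2 - ε ^ 2) = B * ‖w‖ ^ 2 := key
    refine ⟨?_, ?_⟩
    · rw [← neg_pos, ← mul_pos_iff_of_pos_right hDe, neg_mul, key', ← neg_mul,
        mul_pos_iff_of_pos_right hw2, neg_pos]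
    · rw [← neg_nonneg, ← mul_nonneg_iff_of_pos_right hDe, neg_mul, key', ← neg_mul,
        mul_nonneg_iff_of_pos_right hw2, neg_nonneg]
  have hole_zero : ∀ e ∈ F, (hole e).2 < ‖(0 : ℂ) - (hole e).1‖ := by
    intro e he
    rw [zero_sub, norm_neg]
    simp only [hhole, norm_div, RCLike.norm_conj, Complex.norm_real, Real.norm_eq_abs,
      abs_of_pos (hD e he)]
    exact div_lt_div_of_pos_right (i2 e he).2 (hD e he)
  have hole_ne : ∀ e ∈ F, ∀ w, ‖w - (hole e).1‖ ≤ (hole e).2 → w ≠ 0 := fun e he w hw h => by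
    rw [h] at hw
    exact absurd hw (not_le.2 (hole_zero e he))
  have houter : ∀ e ∈ F, ∀ w : ℂ, ‖w - e‖ ≤ ε → R < ‖w - c‖ := by
    intro e he w hw
    have h1 := norm_sub_le_norm_sub_add_norm_sub e w c
    rw [norm_sub_rev e w] at h1
    linarith [(i2 e he).1]
  have hdisj : ∀ e ∈ F, ∀ e' ∈ F, e ≠ e' → ∀ w : ℂ, ‖w - e‖ ≤ ε → ε < ‖w - e'‖ := by
    intro e he e' he' hne w hw
    have h1 := norm_sub_le_norm_sub_add_norm_sub e w e'
    rw [norm_sub_rev e w] at h1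
    linarith [i1 e he e' he' hne]
  have hisl : IsIslands (c, R) (F.image fun e => (e, ε)) (F.image hole) := by
    refine ⟨hR0, ?_, ?_, ?_, ?_, ?_, ?_⟩
    · intro x hx
      obtain ⟨e, he, rfl⟩ := Finset.mem_image.1 hx
      exact hε
    · intro x hx
      obtain ⟨e, he, rfl⟩ := Finset.mem_image.1 hx
      exact hole_pos e he
    · intro x hx x' hx' hne w hw
      obtain ⟨e, he, rfl⟩ := Finset.mem_image.1 hx
      obtain ⟨e', he', rfl⟩ := Finset.mem_image.1 hx'
      exact hdisj e he e' he' (fun h => hne (by rw [h])) w hw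
    · intro x hx x' hx' hne w hw
      obtain ⟨e, he, rfl⟩ := Finset.mem_image.1 hx
      obtain ⟨e', he', rfl⟩ := Finset.mem_image.1 hx'
      have hw0 := hole_ne e he w hw
      have h1 := hdisj e he e' he' (fun h => hne (by rw [h])) w⁻¹ ((hole_iff e he w hw0).2.1 hw)
      by_contra h2
      exact absurd ((hole_iff e' he' w hw0).2.1 (not_lt.1 h2)) (not_le.2 h1)
    · intro x hx w hw
      obtain ⟨e, he, rfl⟩ := Finset.mem_image.1 hx
      exact houter e he w hw
    · intro x hx w hw
      obtain ⟨e, he, rfl⟩ := Finset.mem_image.1 hx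
      have hw0 := hole_ne e he w hw
      exact (hinv w hw0).2 (houter e he w⁻¹ ((hole_iff e he w hw0).2.1 hw))
  set C := islandChain (c, R) (F.image fun e => (e, ε)) (F.image hole) with hC
  have hin : ∀ w : ℂ, w ≠ 0 → (w ∈ inside C ↔ (‖w - c‖ < R ∧ ∀ e ∈ F, ε < ‖w⁻¹ - e‖) ∨
      ∃ e ∈ F, ‖w - e‖ < ε) := by
    intro w hw
    rw [hisl.mem_inside]
    simp only [Finset.forall_mem_image, Finset.exists_mem_image]
    refine or_congr (and_congr_right fun _ => forall₂_congr fun e he => ?_) Iff.rfl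
    rw [← not_le, (hole_iff e he w hw).2, not_le]
  have hout : ∀ w : ℂ, w ≠ 0 → (w ∈ outside C ↔ (R < ‖w - c‖ ∧ ∀ e ∈ F, ε < ‖w - e‖) ∨
      ∃ e ∈ F, ‖w⁻¹ - e‖ < ε) := by
    intro w hw
    rw [hisl.mem_outside]
    simp only [Finset.forall_mem_image, Finset.exists_mem_image]
    refine or_congr Iff.rfl (exists_congr fun e => and_congr_right fun he => ?_)
    exact (hole_iff e he w hw).1
  have h0 : ‖(0 : ℂ) - c‖ < R ∧ ∀ x ∈ F.image hole, x.2 < ‖(0 : ℂ) - x.1‖ := by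
    refine ⟨by rw [zero_sub, norm_neg, hcn]; exact hyR, fun x hx => ?_⟩
    obtain ⟨e, he, rfl⟩ := Finset.mem_image.1 hx
    exact hole_zero e he
  have hcont : IsContour C := hisl.isContour h0
  refine ⟨C, hcont, ?_, ?_, ?_⟩
  · intro w hw
    rw [hin w hw, hout w⁻¹ (inv_ne_zero hw), inv_inv, hinv w hw]
  · intro x hx
    by_cases hx0 : x = 0
    · rw [hx0]
      exact hcont.zero_mem
    · rw [hin x hx0]
      rcases lt_or_gt_of_ne (hoR x hx) with h | h
      · refine Or.inl ⟨h, fun e he => ?_⟩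
        by_contra h1
        exact i4 e he x hx x⁻¹ (not_lt.1 h1) (mul_inv_cancel₀ hx0)
      · exact Or.inr ⟨x, (hFm x).2 ⟨hx, h⟩, by simpa using hε⟩
  · intro s hs w hw
    have hs1 : ‖s‖ ≤ ‖t‖ := norm_orbitSet_le hp hq 0 hs
    by_cases hsw : s * w = 0
    · rw [hsw]
      exact hcont.zero_mem
    have hs0 : s ≠ 0 := left_ne_zero_of_mul hsw
    have hw0 : w ≠ 0 := right_ne_zero_of_mul hsw
    rw [hin _ hsw]
    -- the image of a small disc around a point of the orbit
    have himg : ∀ e ∈ F, ∀ u : ℂ, ‖u - e‖ ≤ ε → (∃ e' ∈ F, ‖s * u - e'‖ < ε) ∨ ‖s * u - c‖ < R := by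
      intro e he u hu
      have hse := mul_mem_orbit hs ((hFm e).1 he).1
      have hsu : ‖s * u - s * e‖ ≤ ‖t‖ * ε := by
        rw [← mul_sub, norm_mul]
        gcongr
      have hlt : ‖t‖ * ε < ε := by nlinarith
      rcases lt_or_gt_of_ne (hoR _ hse) with h | h
      · exact Or.inr (i3 _ hse h _ (by linarith))
      · exact Or.inl ⟨s * e, (hFm _).2 ⟨hse, h⟩, by linarith⟩
    rcases hisl.mem_closure hw with ⟨h1, h2⟩ | ⟨x, hx, h1⟩
    · refine Or.inl ⟨?_, fun e he => ?_⟩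
      · have h3 : ‖w‖ ≤ R + y := by
          have := norm_sub_norm_le w c
          rw [hcn] at this
          have h1 : ‖w - c‖ ≤ R := h1
          linarith
        calc ‖s * w - c‖ ≤ ‖s * w‖ + ‖c‖ := norm_sub_le _ _
          _ ≤ ‖t‖ * (R + y) + y := by
            rw [norm_mul, hcn]
            gcongr
          _ < R := hyt
      · by_contra hle
        have hu := not_lt.1 hle
        -- `w` is the inverse of a point of `s` times a small disc
        have hsu : s * (s * w)⁻¹ = w⁻¹ := by
          rw [mul_inv, mul_inv_cancel_left₀ hs0]
        rcases himg e he _ hu with ⟨e', he', h3⟩ | h3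
        · rw [hsu] at h3
          have h4 := (hole_iff e' he' w hw0).1.2 h3
          exact absurd h4 (not_lt.2 (h2 _ (Finset.mem_image_of_mem hole he')))
        · rw [hsu] at h3
          have h4 := (hinv' w hw0).2 h3
          exact absurd h1 (not_le.2 h4)
    · obtain ⟨e, he, rfl⟩ := Finset.mem_image.1 hx
      rcases himg e he w h1 with h3 | h3
      · exact Or.inr h3
      · refine Or.inl ⟨h3, fun e' he' => ?_⟩
        by_contra hle
        refine i5 e he e' he' s hs w _ h1 (not_lt.1 hle) ?_
        rw [← mul_assoc, mul_inv_cancel₀ hsw]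

end SymmetricContour

section Generic

/-- The order of the shift of the parameter `τ_r` in the definition of `tilde`. -/
def poleOrder (mf mg : ℕ) : Fin 6 → ℕ := ![0, 0, 0, 0, mf, mg]

lemma tilde_apply (q : ℂ) (mf mg : ℕ) (τ : Fin 6 → ℂ) (r : Fin 6) :
    tilde q mf mg τ r = τ r / q ^ poleOrder mf mg r := by
  fin_cases r <;> simp [tilde, poleOrder]

lemma scaled_tilde (q : ℂ) (mf mg : ℕ) (τ : Fin 6 → ℂ) (α : Fin 6 → ℝ) (p : ℂ) :
    scaled (tilde q mf mg τ) α p = tilde q mf mg (scaled τ α p) := by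
  ext r
  rw [tilde_apply, scaled, scaled, tilde_apply]
  ring

variable {q t : ℂ} {τ : Fin 6 → ℂ}

/-- The genericity conditions are inherited by the shifted parameters `tilde`. -/
lemma IsGeneric.mul_ne {S : Set ℂ} (h : IsGeneric S q t τ) {mf mg : ℕ} (hq0 : q ≠ 0) (ht0 : t ≠ 0)
    {w : ℂ} (hw : w ∈ S) (r s : Fin 6) (j k : ℕ) :
    q ^ j * t ^ k * (tilde q mf mg τ r * tilde q mf mg τ s) ≠ w := by
  have key : ∀ r s : Fin 6, (s = 4 ∨ s = 5) →
      q ^ j * t ^ k * (tilde q mf mg τ r * tilde q mf mg τ s) ≠ w := by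
    intro r s hs heq
    refine h.2 r s hs w hw ((poleOrder mf mg r + poleOrder mf mg s : ℕ) - j : ℤ) k ?_
    rw [← heq, tilde_apply, tilde_apply, zpow_sub₀ hq0, zpow_natCast, zpow_natCast, pow_add]
    field_simp
  by_cases hs : s = 4 ∨ s = 5
  · exact key r s hs
  by_cases hr : r = 4 ∨ r = 5
  · rw [mul_comm (tilde q mf mg τ r)]
    exact key s r hr
  intro heq
  have hle : ∀ x : Fin 6, ¬(x = 4 ∨ x = 5) → x.val ≤ 3 ∧ tilde q mf mg τ x = τ x := by
    intro x hx
    fin_cases x <;> simp_all [tilde]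
  refine h.1 r s (hle r hr).1 (hle s hs).1 w hw j k ?_
  rw [← heq, (hle r hr).2, (hle s hs).2]
  field_simp

lemma IsGeneric.orbit_mul_ne_one {p : ℂ} (h : IsGeneric {w | ∃ i : ℕ, w = (p ^ i)⁻¹} q t τ)
    (mf mg : ℕ) (hq0 : q ≠ 0) (ht0 : t ≠ 0) :
    ∀ x ∈ orbit p q t (tilde q mf mg τ), ∀ y ∈ orbit p q t (tilde q mf mg τ), x * y ≠ 1 := by
  rintro _ ⟨r, i, j, k, rfl⟩ _ ⟨s, i', j', k', rfl⟩ hxy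
  refine h.mul_ne hq0 ht0 ⟨i + i', rfl⟩ r s (j + j') (k + k') (mf := mf) (mg := mg) ?_
  rw [eq_comm, inv_eq_iff_eq_inv, ← one_div, eq_div_iff]
  · rw [← hxy]
    ring
  · intro h0
    apply one_ne_zero (α := ℂ)
    calc (1 : ℂ) = (p ^ (i + i')) *
          (q ^ (j + j') * t ^ (k + k') * (tilde q mf mg τ r * tilde q mf mg τ s)) := by
            rw [← hxy]; ring
      _ = 0 := by rw [h0, mul_zero]

lemma exists_isEllipticContour {p : ℂ} (hp0 : p ≠ 0) (hp : ‖p‖ < 1) (hq0 : q ≠ 0) (hq : ‖q‖ < 1)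
    (ht0 : t ≠ 0) (ht : ‖t‖ < 1) (h : IsGeneric {w | ∃ i : ℕ, w = (p ^ i)⁻¹} q t τ)
    (hτ : ∀ r, τ r ≠ 0) (mf mg : ℕ) :
    ∃ C, IsEllipticContour q t p (tilde q mf mg τ) C := by
  obtain ⟨C, hC, hsym, hcont, hcross⟩ :=
    exists_symmetric_contour hp hq ht (h.orbit_mul_ne_one mf mg hq0 ht0)
  have hmem : ∀ (r : Fin 6) (i j : ℕ), p ^ i * q ^ j * tilde q mf mg τ r ∈ inside C := fun r i j =>
    hcont ⟨r, i, j, 0, by ring⟩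
  refine ⟨C, hC, hsym, hmem, fun r i j => ?_, fun i j w hw => hcross _ ⟨i, j, rfl⟩ w hw⟩
  have h0 : p ^ i * q ^ j * tilde q mf mg τ r ≠ 0 := by
    rw [tilde_apply]
    have := hτ r
    positivity
  exact (hsym _ h0).1 (hmem r i j)

/-- The limit contours arise from the construction of the symmetric contours with `p = 0`. -/
lemma exists_isLimitContour (hq0 : q ≠ 0) (hq : ‖q‖ < 1) (ht0 : t ≠ 0) (ht : ‖t‖ < 1)
    (h : IsGeneric {1} q t τ) (hτ : ∀ r, τ r ≠ 0) (mf mg : ℕ) (α : Fin 6 → ℝ) (ζ : ℝ)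
    (T : Finset (Fin 6)) : ∃ C, IsLimitContour q t (tilde q mf mg τ) α ζ T C := by
  have hgen : ∀ x ∈ orbit 0 q t (tilde q mf mg τ), ∀ y ∈ orbit 0 q t (tilde q mf mg τ),
      x * y ≠ 1 := by
    rintro _ ⟨r, i, j, k, rfl⟩ _ ⟨s, i', j', k', rfl⟩ hxy
    rcases Nat.eq_zero_or_pos i with rfl | hi
    · rcases Nat.eq_zero_or_pos i' with rfl | hi'
      · refine h.mul_ne hq0 ht0 rfl r s (j + j') (k + k') (mf := mf) (mg := mg) ?_
        rw [← hxy]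
        ring
      · simp [hi'.ne'] at hxy
    · simp [hi.ne'] at hxy
  obtain ⟨C, hC, hsym, hcont, hcross⟩ :=
    exists_symmetric_contour (by simp : ‖(0 : ℂ)‖ < 1) hq ht hgen
  have hmem : ∀ (r : Fin 6) (j : ℕ), q ^ j * tilde q mf mg τ r ∈ inside C := fun r j =>
    hcont ⟨r, 0, j, 0, by ring⟩
  have hexc : ∀ (r : Fin 6) (j : ℕ), (q ^ j * tilde q mf mg τ r)⁻¹ ∈ outside C := fun r j => by
    have h0 : q ^ j * tilde q mf mg τ r ≠ 0 := by
      rw [tilde_apply]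
      have := hτ r
      positivity
    exact (hsym _ h0).1 (hmem r j)
  have hcr : ∀ j : ℕ, ∀ w ∈ carrier C ∪ inside C, q ^ j * t * w ∈ inside C := fun j w hw =>
    hcross _ ⟨0, j, by simp⟩ w hw
  refine ⟨C, hC, fun r _ _ j => hmem r j, fun r _ _ j => hexc r j, hcr, fun _ r _ _ j => hexc r j,
    fun _ j w hw hw0 => (hsym _ (by positivity)).1 (hcr j w hw)⟩

/-- Non-generic values of `p` have an absolute value in a countable set. -/
lemma exists_countable_norm_notMem_genericSet (hq0 : q ≠ 0) (ht0 : t ≠ 0)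
    (h : IsGeneric {1} q t τ) (hτ : ∀ r, τ r ≠ 0) (α : Fin 6 → ℝ) :
    ∃ N : Set ℝ, N.Countable ∧ ∀ p : ℂ, p ≠ 0 → ‖p‖ ∉ N → p ∈ genericSet q t τ α := by
  refine ⟨Set.range fun x : Fin 6 × Fin 6 × ℕ × ℤ × ℕ =>
    (‖q‖ ^ x.2.2.2.1 * (‖t‖ ^ x.2.2.2.2)⁻¹ / ‖τ x.1 * τ x.2.1‖) ^
      (α x.1 + α x.2.1 + x.2.2.1)⁻¹, Set.countable_range _, fun p hp0 hpN => ?_⟩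
  have key : ∀ (r s : Fin 6) (i : ℕ) (j : ℤ) (k : ℕ),
      scaled τ α p r * scaled τ α p s = (p ^ i)⁻¹ * q ^ j * (t ^ k)⁻¹ →
      τ r * τ s = 1 * q ^ j * (t ^ k)⁻¹ := by
    intro r s i j k heq
    have h1 : τ r * τ s * p ^ ((α r + α s + i : ℝ) : ℂ) = q ^ j * (t ^ k)⁻¹ := by
      have e : p ^ ((α r + α s + i : ℝ) : ℂ) = p ^ (α r : ℂ) * p ^ (α s : ℂ) * p ^ i := by
        push_cast
        rw [Complex.cpow_add _ _ hp0, Complex.cpow_add _ _ hp0, Complex.cpow_natCast]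
      rw [e]
      simp only [scaled] at heq
      calc τ r * τ s * (p ^ (α r : ℂ) * p ^ (α s : ℂ) * p ^ i)
          = τ r * p ^ (α r : ℂ) * (τ s * p ^ (α s : ℂ)) * p ^ i := by ring
        _ = q ^ j * (t ^ k)⁻¹ := by
          rw [heq]
          field_simp
    by_cases hβ : α r + α s + i = 0
    · rw [hβ] at h1
      simpa using h1
    · refine absurd ⟨(r, s, i, j, k), ?_⟩ hpN
      have h2 := congrArg norm h1
      rw [norm_mul, norm_cpow_ofReal hp0, norm_mul (q ^ j), norm_zpow, norm_inv, norm_pow] at h2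
      have h3 : 0 < ‖τ r * τ s‖ := norm_pos_iff.2 (mul_ne_zero (hτ r) (hτ s))
      simp only
      rw [← h2, mul_div_cancel_left₀ _ h3.ne', Real.rpow_rpow_inv (norm_nonneg p) hβ]
  refine ⟨hp0, fun r s hr hs w hw j k heq => ?_, fun r s hs w hw j k heq => ?_⟩
  · obtain ⟨i, rfl⟩ := hw
    refine h.1 r s hr hs 1 rfl j k ?_
    have := key r s i (-j) k (by rw [heq, zpow_neg, zpow_natCast])
    rw [this, zpow_neg, zpow_natCast]
  · obtain ⟨i, rfl⟩ := hw
    exact h.2 r s hs 1 rfl j k (key r s i j k heq)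

lemma nhdsWithin_genericSet_neBot (hq0 : q ≠ 0) (ht0 : t ≠ 0) (h : IsGeneric {1} q t τ)
    (hτ : ∀ r, τ r ≠ 0) (α : Fin 6 → ℝ) : (𝓝[genericSet q t τ α] (0 : ℂ)).NeBot := by
  obtain ⟨N, hN, hNp⟩ := exists_countable_norm_notMem_genericSet hq0 ht0 h hτ α
  rw [← mem_closure_iff_nhdsWithin_neBot, Metric.mem_closure_iff]
  intro ε hε
  obtain ⟨x, hx, hx0, hxε⟩ := (hN.dense_compl ℝ).exists_mem_open isOpen_Ioo (Set.nonempty_Ioo.2 hε)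
  have hn : ‖(x : ℂ)‖ = x := by rw [Complex.norm_real, Real.norm_eq_abs, abs_of_pos hx0]
  refine ⟨x, hNp x (by exact_mod_cast hx0.ne') (by rwa [hn]), ?_⟩
  rwa [dist_comm, dist_zero_right, hn]

end Generic

/-! ### Zero sets of polynomials on tori -/

section Null

open MeasureTheory MvPolynomial

/-- The zero set of a nonzero polynomial pulls back to a null set along a product of curves that
    take
each value countably often. -/
lemma volume_eval_comp_eq_zero {n : ℕ} : ∀ {γ : Fin n → ℝ → ℂ} (_ : ∀ j, Continuous (γ j))
    (_ : ∀ j x, (γ j ⁻¹' {x}).Countable) {P : MvPolynomial (Fin n) ℂ} (_ : P ≠ 0),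
    volume {θ : Fin n → ℝ | eval (fun j => γ j (θ j)) P = 0} = 0 := by
  induction n with
  | zero =>
    intro γ _ _ P hP
    have : {θ : Fin 0 → ℝ | eval (fun j => γ j (θ j)) P = 0} = ∅ := by
      refine Set.eq_empty_of_forall_notMem fun θ hθ => hP ?_
      rw [Set.mem_ofPred_eq] at hθ
      rw [eq_C_of_isEmpty P] at hθ ⊢
      rw [eval_C] at hθ
      rw [hθ, map_zero]
    rw [this, measure_empty]
  | succ n ih =>
    intro γ hγ hγc P hP
    set Q := finSuccEquiv ℂ n P with hQ
    have hQ0 : Q ≠ 0 := by simpa [hQ] using hP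
    have heval : ∀ (y : ℂ) (s : Fin n → ℂ),
        eval (Fin.cons y s : Fin (n + 1) → ℂ) P = eval s (Q.eval (C y)) := by
      intro y s
      rw [eval_eq_eval_mv_eval', Polynomial.eval_map, ← hQ, Polynomial.eval,
        Polynomial.hom_eval₂, RingHom.comp_id, eval_C]
    set A : Set (ℝ × (Fin n → ℝ)) :=
      {x | eval (fun j => γ (Fin.succ j) (x.2 j)) (Q.eval (C (γ 0 x.1))) = 0} with hA
    have hAe : ∀ x : ℝ × (Fin n → ℝ), x ∈ A ↔
        eval (Fin.cons (γ 0 x.1) (fun j => γ (Fin.succ j) (x.2 j)) : Fin (n + 1) → ℂ) P = 0 :=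
      fun x => by rw [heval, hA, Set.mem_ofPred_eq]
    have hAm : MeasurableSet A := by
      have : A = (fun x : ℝ × (Fin n → ℝ) => eval (Fin.cons (γ 0 x.1)
          (fun j => γ (Fin.succ j) (x.2 j)) : Fin (n + 1) → ℂ) P) ⁻¹' {0} := by
        ext x
        exact hAe x
      rw [this]
      have hc : Continuous fun x : ℝ × (Fin n → ℝ) => (Fin.cons (γ 0 x.1)
          (fun j => γ (Fin.succ j) (x.2 j)) : Fin (n + 1) → ℂ) := by
        refine continuous_pi fun j => ?_
        refine Fin.cases ?_ (fun i => ?_) j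
        · exact (hγ 0).comp continuous_fst
        · exact (hγ _).comp ((continuous_apply i).comp continuous_snd)
      exact (isClosed_singleton.preimage (P.continuous_eval.comp hc)).measurableSet
    have hA0 : (volume : Measure (ℝ × (Fin n → ℝ))) A = 0 := by
      rw [Measure.volume_eq_prod, Measure.measure_prod_null hAm]
      have hcount : {x : ℝ | Q.eval (C (γ 0 x)) = 0}.Countable := by
        have hf : {y : ℂ | Q.eval (C y) = 0}.Finite := by
          refine Set.Finite.of_finite_image (f := fun y => (C y : MvPolynomial (Fin n) ℂ))
            ((Q.roots.toFinset.finite_toSet).subset ?_) ((C_injective _ _).injOn)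
          rintro _ ⟨y, hy, rfl⟩
          simpa [hQ0] using hy
        exact (hf.countable.biUnion fun y _ => hγc 0 y).mono fun x hx =>
          Set.mem_biUnion (x := γ 0 x) hx rfl
      filter_upwards [hcount.ae_notMem volume] with x hx
      have hx' : Q.eval (C (γ 0 x)) ≠ 0 := hx
      have hih := ih (γ := fun j => γ (Fin.succ j)) (fun j => hγ _) (fun j => hγc _) hx'
      have hpre : Prod.mk x ⁻¹' A = {θ : Fin n → ℝ | eval (fun j => γ (Fin.succ j) (θ j))
          (Q.eval (C (γ 0 x))) = 0} := by
        ext θ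
        rw [Set.mem_preimage, hA, Set.mem_ofPred_eq, Set.mem_ofPred_eq]
      rw [hpre, hih, Pi.zero_apply]
    have hmp := volume_preserving_piFinSuccAbove (fun _ : Fin (n + 1) => ℝ) 0
    have hpre : {θ : Fin (n + 1) → ℝ | eval (fun j => γ j (θ j)) P = 0} =
        MeasurableEquiv.piFinSuccAbove (fun _ : Fin (n + 1) => ℝ) 0 ⁻¹' A := by
      ext θ
      have e : (fun j => γ j (θ j)) = (Fin.cons (γ 0 (θ 0))
          (fun j => γ (Fin.succ j) (θ (Fin.succ j))) : Fin (n + 1) → ℂ) :=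
        funext fun j => Fin.cases rfl (fun i => rfl) j
      have e2 : MeasurableEquiv.piFinSuccAbove (fun _ : Fin (n + 1) => ℝ) 0 θ =
        (θ 0, fun j => θ (Fin.succ j)) := rfl
      rw [Set.mem_preimage, e2, hAe, Set.mem_ofPred_eq, e]
    rw [hpre]
    exact (hmp.measure_preimage hAm.nullMeasurableSet).trans hA0

lemma countable_circleMap_preimage (c x : ℂ) {R : ℝ} (hR : R ≠ 0) :
    ((fun θ : ℝ => c + R * Complex.exp (θ * Complex.I)) ⁻¹' {x}).Countable := by
  rcases Set.eq_empty_or_nonempty ((fun θ : ℝ => c + R * Complex.exp (θ * Complex.I)) ⁻¹' {x})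
    with h | ⟨θ₀, h₀⟩
  · rw [h]
    exact Set.countable_empty
  · refine (Set.countable_range fun k : ℤ => θ₀ + k * (2 * Real.pi)).mono fun θ hθ => ?_
    have h1 : c + R * Complex.exp (θ * Complex.I) = c + R * Complex.exp (θ₀ * Complex.I) :=
      (show _ = x from hθ).trans (show _ = x from h₀).symm
    have hR' : (R : ℂ) ≠ 0 := by exact_mod_cast hR
    obtain ⟨k, hk⟩ := Complex.exp_eq_exp_iff_exists_int.1 (mul_left_cancel₀ hR' (add_left_cancel
        h1))
    refine ⟨k, ?_⟩
    have h2 : (θ : ℂ) = θ₀ + k * (2 * Real.pi) :=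
      mul_right_cancel₀ Complex.I_ne_zero (by rw [hk]; ring)
    exact_mod_cast h2.symm

lemma ae_eval_torusMap_ne_zero {n : ℕ} (c : Fin n → ℂ) {R : Fin n → ℝ} (hR : ∀ j, R j ≠ 0)
    {P : MvPolynomial (Fin n) ℂ} (hP : P ≠ 0) :
    ∀ᵐ θ : Fin n → ℝ, eval (torusMap c R θ) P ≠ 0 := by
  have := volume_eval_comp_eq_zero (γ := fun j θ => c j + R j * Complex.exp (θ * Complex.I))
    (fun j => by fun_prop) (fun j x => countable_circleMap_preimage (c j) x (hR j)) hP
  rw [ae_iff]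
  simp only [not_not]
  exact this

/-- Integrals over `C^n` only depend on the values of the function off countably many zero sets of
polynomials. -/
lemma IsContour.chainIntegral_congr_ae {C : CircleChain} (hC : IsContour C) {n : ℕ}
    {Z : Set (MvPolynomial (Fin n) ℂ)} (hZ : Z.Countable) (hZ0 : 0 ∉ Z) {F F' : (Fin n → ℂ) → ℂ}
    (h : ∀ z ∈ piSet n (carrier C), (∀ P ∈ Z, eval z P ≠ 0) → F z = F' z) :
    chainIntegral n C F = chainIntegral n C F' := by
  unfold chainIntegral
  refine Finset.sum_congr rfl fun x hx => ?_
  rw [Fintype.mem_piFinset] at hx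
  congr 1
  unfold torusIntegral
  refine integral_congr_ae ?_
  have hall : ∀ᵐ θ : Fin n → ℝ, ∀ P ∈ Z, eval (torusMap (fun j => (x j).1) (fun j => (x j).2) θ) P ≠
      0 :=
    (ae_ball_iff hZ).2 fun P hP => ae_eval_torusMap_ne_zero _
      (fun j => (hC.radius_pos _ (hx j)).ne') fun h => hZ0 (h ▸ hP)
  filter_upwards [ae_restrict_of_ae hall] with θ hθ
  rw [h _ (fun j => sphere_subset_carrier (hx j) ?_) hθ]
  simp [torusMap, abs_of_pos (hC.radius_pos _ (hx j))]

/-- Dominated convergence for integrals over `C^n`. -/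
lemma IsContour.tendsto_chainIntegral {C : CircleChain} (hC : IsContour C) {n : ℕ}
    {P : MvPolynomial (Fin n) ℂ} (hP : P ≠ 0) {ι : Type*} {l : Filter ι} [l.IsCountablyGenerated]
    {F : ι → (Fin n → ℂ) → ℂ} {F₀ : (Fin n → ℂ) → ℂ} {B : ℝ}
    (hc : ∀ᶠ i in l, ContinuousOn (F i) (piSet n (carrier C)))
    (hB : ∀ᶠ i in l, ∀ z ∈ piSet n (carrier C), ‖F i z‖ ≤ B)
    (h : ∀ z ∈ piSet n (carrier C), eval z P ≠ 0 → Tendsto (fun i => F i z) l (𝓝 (F₀ z))) :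
    Tendsto (fun i => chainIntegral n C (F i)) l (𝓝 (chainIntegral n C F₀)) := by
  unfold chainIntegral
  refine tendsto_finsetSum _ fun x hx => Tendsto.const_mul _ ?_
  rw [Fintype.mem_piFinset] at hx
  have hmem : ∀ θ : Fin n → ℝ, torusMap (fun j => (x j).1) (fun j => (x j).2) θ ∈
      piSet n (carrier C) := fun θ j => by
    refine sphere_subset_carrier (hx j) ?_
    simp [torusMap, abs_of_pos (hC.radius_pos _ (hx j))]
  have hmap : Continuous (torusMap (fun j => (x j).1) (fun j => (x j).2)) := by
    unfold torusMap
    fun_prop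
  have hinv : Continuous fun θ : Fin n → ℝ => ∏ j, (2 * (Real.pi : ℂ) * Complex.I *
      torusMap (fun j => (x j).1) (fun j => (x j).2) θ j)⁻¹ := by
    refine continuous_finsetProd _ fun j _ => Continuous.inv₀ ?_ fun θ => ?_
    · exact continuous_const.mul ((continuous_apply j).comp hmap)
    · have h0 : torusMap (fun j => (x j).1) (fun j => (x j).2) θ j ≠ 0 := fun h0 =>
        hC.zero_notMem (h0 ▸ hmem θ j)
      simp [h0, Real.pi_ne_zero]
  set w : (Fin n → ℝ) → ℂ := fun θ => ∏ j, (2 * (Real.pi : ℂ) * Complex.I *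
      torusMap (fun j => (x j).1) (fun j => (x j).2) θ j)⁻¹ with hw
  set d : (Fin n → ℝ) → ℂ := fun θ => ∏ j, ((x j).2 : ℂ) * Complex.exp (θ j * Complex.I) * Complex.I
    with hd
  have hdc : Continuous d := by
    rw [hd]
    fun_prop
  unfold torusIntegral
  refine tendsto_integral_filter_of_dominated_convergence (fun θ => ‖d θ‖ * (B * ‖w θ‖)) ?_ ?_ ?_ ?_
  · filter_upwards [hc] with i hi
    have : Continuous fun θ => F i (torusMap (fun j => (x j).1) (fun j => (x j).2) θ) :=
      hi.comp_continuous hmap hmem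
    exact (hdc.smul (this.mul hinv)).aestronglyMeasurable
  · filter_upwards [hB] with i hi
    refine Eventually.of_forall fun θ => ?_
    rw [norm_smul, norm_mul]
    have := hi _ (hmem θ)
    gcongr
  · have : Continuous fun θ => ‖d θ‖ * (B * ‖w θ‖) := by fun_prop
    exact this.continuousOn.integrableOn_compact isCompact_Icc
  · filter_upwards [ae_restrict_of_ae (ae_eval_torusMap_ne_zero (fun j => (x j).1)
      (fun j => (hC.radius_pos _ (hx j)).ne') hP)] with θ hθ
    exact ((h _ (hmem θ) hθ).mul_const _).const_smul _

end Null

/-! ### The integrand after breaking the symmetry -/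

section BrokenWeight

/-- For `e ≤ 1` the quotient of `Γ(p^e x)` by `∏_{1 ≤ k ≤ m} θ(q^{-k} x; p)`, written such that it
    has
the poles of `Γ(p^e q^{-m} x)` only. -/
def gammaShift (q p : ℂ) (e m : ℕ) (x : ℂ) : ℂ :=
  ellGamma (p ^ e * (x / q ^ m)) p q * (∏ k ∈ Finset.range m, -(q ^ (k + 1) / x)) ^ e

lemma gammaShift_zero (q p : ℂ) (e : ℕ) (x : ℂ) :
    gammaShift q p e 0 x = ellGamma (p ^ e * x) p q := by
  simp [gammaShift]

variable {p q t : ℂ}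

/-- Multiplication by the theta factors undoes the shift of the parameter. -/
lemma gammaShift_mul_prod_theta (hp : ‖p‖ < 1) (hp0 : p ≠ 0) (hq : ‖q‖ < 1) (hq0 : q ≠ 0) {e : ℕ}
    (he : e ≤ 1) {x : ℂ} (hx : x ≠ 0) {m : ℕ}
    (h : ∀ i j : ℕ, p ^ (i + e) * q ^ j * (x / q ^ m) ≠ 1) :
    gammaShift q p e m x * ∏ k ∈ Finset.range m, theta (x / q ^ (k + 1)) p =
      ellGamma (p ^ e * x) p q := by
  induction m with
  | zero => simp [gammaShift]
  | succ m ih =>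
    have hm : q * (x / q ^ (m + 1)) = x / q ^ m := by
      rw [pow_succ]
      field_simp
    rw [← ih fun i j => by
      convert h i (j + 1) using 1
      rw [← hm]
      ring]
    set w := x / q ^ (m + 1) with hw
    have hw0 : w ≠ 0 := by positivity
    have h1 : ellGamma (p ^ e * (x / q ^ m)) p q = theta (p ^ e * w) p * ellGamma (p ^ e * w) p
        q := by
      rw [← hm, show p ^ e * (q * w) = q * (p ^ e * w) by ring, ellGamma_comm, ellGamma_comm (p ^ e
          * w)]
      refine ellGamma_mul_left hq hp hq0 ?_
      rw [qPoch_ne_zero_iff hp]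
      intro i
      convert h i 0 using 1
      ring
    have h2 : theta (p ^ e * w) p = (-(q ^ (m + 1) / x)) ^ e * theta w p := by
      have : e = 0 ∨ e = 1 := by omega
      rcases this with rfl | rfl
      · simp
      · rw [pow_one, theta_mul_left hp hp0 hw0, hw, inv_div, pow_one]
    unfold gammaShift
    rw [h1, h2, Finset.prod_range_succ, Finset.prod_range_succ, mul_pow, ← hw]
    ring

lemma differentiableAt_prod {ι V : Type*} [NormedAddCommGroup V] [NormedSpace ℂ V] {s : Finset ι}
    {f : ι → V → ℂ} {x : V} (h : ∀ i ∈ s, DifferentiableAt ℂ (f i) x) :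
    DifferentiableAt ℂ (fun x => ∏ i ∈ s, f i x) x := by
  classical
  exact (HasFDerivAt.finsetProd fun i hi => (h i hi).hasFDerivAt).differentiableAt

lemma differentiableAt_gammaShift (hp : ‖p‖ < 1) (hp0 : p ≠ 0) (hq : ‖q‖ < 1) (hq0 : q ≠ 0) {e : ℕ}
    {x : ℂ} (hx : x ≠ 0) {m : ℕ} (h : ∀ i j : ℕ, p ^ (i + e) * q ^ j * (x / q ^ m) ≠ 1) :
    DifferentiableAt ℂ (gammaShift q p e m) x := by
  unfold gammaShift
  have h1 : DifferentiableAt ℂ (fun x => ellGamma x p q) (p ^ e * (x / q ^ m)) := by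
    refine differentiableAt_ellGamma hp hq (by positivity) ?_
    rw [pqPoch_ne_zero_iff hp hq]
    intro i j
    convert h i j using 1
    ring
  have h2 : DifferentiableAt ℂ (fun x => p ^ e * (x / q ^ m)) x := by fun_prop
  refine (h1.comp x h2).mul (DifferentiableAt.pow (differentiableAt_prod
    fun k _ => ?_) _)
  exact ((differentiableAt_const _).div differentiableAt_id hx).neg

/-- The factor of the symmetry breaking integrand which depends on a single variable `x`: the pole
orders `m_r` are absorbed by a shift of the parameters, see `gammaShift`. -/
def oneWeight (n : ℕ) (q t p : ℂ) (T : Finset (Fin 6)) (m : Fin 6 → ℕ) (τ : Fin 6 → ℂ) (x : ℂ) :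
    ℂ :=
  (∏ r, gammaShift q p (shift T r) (m r) (τ r * x) * gammaShift q p 0 (m r) (τ r / x)) *
    (theta (1 / x ^ 2) p * theta (q * x / (t ^ (n - 1) * ∏ r ∈ T, τ r)) q)

/-- The factor of the symmetry breaking integrand which depends on two variables. -/
def pairWeight (q t p x y : ℂ) : ℂ :=
  ellGamma (t * p * (x * y)) p q * ellGamma (t / (x * y)) p q *
    (ellGamma (t * x / y) p q * ellGamma (t * y / x) p q) *
    (theta (1 / (x * y)) p * (theta (x / y) p * theta (y / x) q))

/-- The integrand, divided by the pole factors of `f` and `g` if `m` is given by `poleOrder`, after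
multiplication by `breakingFactor` with parameters `τ_a, τ_b, τ_c, q / (t^{n-1} τ_a τ_b τ_c)`. -/
def brokenWeight (n : ℕ) (q t p : ℂ) (T : Finset (Fin 6)) (m : Fin 6 → ℕ) (τ : Fin 6 → ℂ)
    (z : Fin n → ℂ) : ℂ :=
  (∏ j, oneWeight n q t p T m τ (z j)) * ∏ j, ∏ k ∈ Finset.Ioi j, pairWeight q t p (z j) (z k)

variable {n : ℕ} {T : Finset (Fin 6)} {m : Fin 6 → ℕ} {τ : Fin 6 → ℂ}

lemma shift_le (T : Finset (Fin 6)) (r : Fin 6) : shift T r ≤ 1 := by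
  unfold shift
  split_ifs <;> simp

lemma mem_poles {v : Fin 6 → ℂ} {e : Fin 6 → ℕ} {x : ℂ} :
    x ∈ poles p q v e ↔ ∃ r, ∃ i j : ℕ, x = p ^ (i + e r) * q ^ j * v r := by
  simp [poles, orbitSet]

theorem differentiableOn_brokenWeight (hp : ‖p‖ < 1) (hp0 : p ≠ 0) (hq : ‖q‖ < 1) (hq0 : q ≠ 0)
    (ht0 : t ≠ 0) (hτ : ∀ r, τ r ≠ 0) :
    DifferentiableOn ℂ (brokenWeight n q t p T m τ)
      (offPoles n (poles p q (fun r => τ r / q ^ m r) 0) (poles p q (fun r => τ r / q ^ m r) (shift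
          T))
        (orbitSet p q 0 t) (orbitSet p q 1 t)) := by
  intro z hz
  refine DifferentiableAt.differentiableWithinAt ?_
  have hz0 : ∀ j, z j ≠ 0 := fun j => (hz j).1
  have hap : ∀ j : Fin n, DifferentiableAt ℂ (fun z : Fin n → ℂ => z j) z := fun j =>
    differentiableAt_apply j z
  have hTne : ∏ r ∈ T, τ r ≠ 0 := Finset.prod_ne_zero_iff.2 fun r _ => hτ r
  unfold brokenWeight
  refine DifferentiableAt.mul (differentiableAt_prod fun j _ => ?_)
    (differentiableAt_prod fun j _ => differentiableAt_prod fun k hk => ?_)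
  · have h1 : DifferentiableAt ℂ (oneWeight n q t p T m τ) (z j) := by
      have hzj := hz0 j
      unfold oneWeight
      generalize ∏ r ∈ T, τ r = A at hTne
      refine DifferentiableAt.mul (differentiableAt_prod fun r _ => DifferentiableAt.mul ?_ ?_)
        (DifferentiableAt.mul ?_ ?_)
      · refine DifferentiableAt.comp (g := gammaShift q p (shift T r) (m r)) (z j)
          (differentiableAt_gammaShift hp hp0 hq hq0 (mul_ne_zero (hτ r) hzj) fun i l h => ?_)
          (by fun_prop)
        refine (hz j).2.2.1 _ (mem_poles.2 ⟨r, i, l, rfl⟩) ?_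
        rw [← h]
        ring
      · have := hτ r
        refine DifferentiableAt.comp (g := gammaShift q p 0 (m r)) (z j)
          (differentiableAt_gammaShift hp hp0 hq hq0 (by positivity) fun i l h => ?_)
          (by fun_prop (disch := assumption))
        refine (hz j).2.1 (mem_poles.2 ⟨r, i, l, ?_⟩)
        simp only [Pi.zero_apply]
        have h2 := congrArg (fun x => x * z j) h
        simp only [one_mul] at h2
        rw [← h2]
        field_simp
      · exact DifferentiableAt.comp (g := fun x => theta x p) (z j)
          (differentiableAt_theta hp (one_div_ne_zero (by positivity))) (by fun_prop (disch :=
              positivity))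
      · exact DifferentiableAt.comp (g := fun x => theta x q) (z j)
          (differentiableAt_theta hq (by positivity)) (by fun_prop)
    exact h1.comp z (hap j)
  · have hkj : k ≠ j := (Finset.mem_Ioi.1 hk).ne'
    have hzj := hz0 j
    have hzk := hz0 k
    have hS : ∀ i l : ℕ, p ^ i * q ^ l * t ∈ orbitSet p q 0 t := fun i l => ⟨i, l, rfl⟩
    have hG : ∀ (φ : (Fin n → ℂ) → ℂ), DifferentiableAt ℂ φ z → φ z ≠ 0 →
        (∀ i l : ℕ, φ z * p ^ i * q ^ l ≠ 1) → DifferentiableAt ℂ (fun z => ellGamma (φ z) p q) z :=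
      fun φ hφ h0 h => DifferentiableAt.comp (g := fun x => ellGamma x p q) z
        (differentiableAt_ellGamma hp hq h0 ((pqPoch_ne_zero_iff hp hq _).2 h)) hφ
    have hΘ : ∀ {p : ℂ} (_ : ‖p‖ < 1) (φ : (Fin n → ℂ) → ℂ), DifferentiableAt ℂ φ z → φ z ≠ 0 →
        DifferentiableAt ℂ (fun z => theta (φ z) p) z :=
      fun hp φ hφ h0 => DifferentiableAt.comp (g := fun x => theta x _) z
        (differentiableAt_theta hp h0) hφ
    unfold pairWeight
    refine ((DifferentiableAt.mul (hG _ (by fun_prop) (by positivity) fun i l h => ?_)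
      (hG _ (by fun_prop (disch := positivity)) (by positivity) fun i l h => ?_)).mul
      (DifferentiableAt.mul (hG _ (by fun_prop (disch := positivity)) (by positivity) fun i l h =>
          ?_)
        (hG _ (by fun_prop (disch := positivity)) (by positivity) fun i l h => ?_))).mul
      ((hΘ hp _ (by fun_prop (disch := positivity)) (one_div_ne_zero (by positivity))).mul
        ((hΘ hp _ (by fun_prop (disch := positivity)) (by positivity)).mul
          (hΘ hq _ (by fun_prop (disch := positivity)) (by positivity))))
    · refine ((hz j).2.2.2 k hkj).2 (p ^ (i + 1) * q ^ l * t) ⟨i, l, rfl⟩ ?_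
      rw [← h]
      ring
    · refine (((hz j).2.2.2 k hkj).1 _ (hS i l)).2 ?_
      field_simp at h
      rw [← h]
      ring
    · refine (((hz k).2.2.2 j hkj.symm).1 _ (hS i l)).1 ?_
      field_simp at h
      rw [← h]
      ring
    · refine (((hz j).2.2.2 k hkj).1 _ (hS i l)).1 ?_
      field_simp at h
      rw [← h]
      ring

lemma poleFactor_eq (hp0 : p ≠ 0) (hq0 : q ≠ 0) {u : ℂ} (hu : u ≠ 0) (M : ℕ) {z : Fin n → ℂ}
    (hz : ∀ j, z j ≠ 0) :
    poleFactor n M q p u z = ∏ j, ((∏ k ∈ Finset.range M, theta (u / z j / q ^ (k + 1)) p) *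
      ∏ k ∈ Finset.range M, theta (u * z j / q ^ (k + 1)) p) := by
  unfold poleFactor thetaPoch
  refine Finset.prod_congr rfl fun j _ => ?_
  have hj := hz j
  congr 1 <;> refine Finset.prod_congr rfl fun k _ => ?_
  · rw [← theta_inv_mul _ hp0, pow_succ]
    congr 1
    field_simp
  · rw [← theta_inv_mul _ hp0, pow_succ]
    congr 1
    field_simp

/-- Division by the pole factors amounts to the shift of the parameters `τ_4` and `τ_5`. -/
theorem brokenWeight_mul_poleFactor (hp : ‖p‖ < 1) (hp0 : p ≠ 0) (hq : ‖q‖ < 1) (hq0 : q ≠ 0)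
    (hτ : ∀ r, τ r ≠ 0) (mf mg : ℕ) {z : Fin n → ℂ} (hz0 : ∀ j, z j ≠ 0)
    (hz1 : ∀ j, z j ∉ poles p q (tilde q mf mg τ) 0)
    (hz2 : ∀ j, ∀ x ∈ poles p q (tilde q mf mg τ) (shift T), x * z j ≠ 1) :
    brokenWeight n q t p T (poleOrder mf mg) τ z *
      (poleFactor n mf q p (τ 4) z * poleFactor n mg q p (τ 5) z) = brokenWeight n q t p T 0 τ
          z := by
  rw [poleFactor_eq hp0 hq0 (hτ 4) mf hz0, poleFactor_eq hp0 hq0 (hτ 5) mg hz0]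
  unfold brokenWeight
  rw [mul_right_comm, ← Finset.prod_mul_distrib, ← Finset.prod_mul_distrib]
  congr 1
  refine Finset.prod_congr rfl fun j _ => ?_
  have hzj := hz0 j
  have hfac : ∀ r, (gammaShift q p (shift T r) (poleOrder mf mg r) (τ r * z j) *
        ∏ k ∈ Finset.range (poleOrder mf mg r), theta (τ r * z j / q ^ (k + 1)) p) *
      (gammaShift q p 0 (poleOrder mf mg r) (τ r / z j) *
        ∏ k ∈ Finset.range (poleOrder mf mg r), theta (τ r / z j / q ^ (k + 1)) p) =
      gammaShift q p (shift T r) 0 (τ r * z j) * gammaShift q p 0 0 (τ r / z j) := by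
    intro r
    have hr := hτ r
    rw [gammaShift_zero, gammaShift_zero, gammaShift_mul_prod_theta hp hp0 hq hq0 (shift_le T r)
      (by positivity), gammaShift_mul_prod_theta hp hp0 hq hq0 zero_le_one (by positivity)]
    · intro i l h
      refine hz1 j (mem_poles.2 ⟨r, i, l, ?_⟩)
      rw [tilde_apply, Pi.zero_apply]
      have h2 := congrArg (fun x => x * z j) h
      simp only [one_mul] at h2
      rw [← h2]
      field_simp
    · intro i l h
      refine hz2 j _ (mem_poles.2 ⟨r, i, l, rfl⟩) ?_
      rw [← h, tilde_apply]
      ring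
  have hprod := Finset.prod_congr (rfl : (Finset.univ : Finset (Fin 6)) = Finset.univ)
    fun r _ => hfac r
  unfold oneWeight
  simp only [Pi.zero_apply]
  rw [← hprod]
  simp only [Fin.prod_univ_six]
  simp only [show poleOrder mf mg 0 = 0 from rfl, show poleOrder mf mg 1 = 0 from rfl,
    show poleOrder mf mg 2 = 0 from rfl, show poleOrder mf mg 3 = 0 from rfl,
    show poleOrder mf mg 4 = mf from rfl, show poleOrder mf mg 5 = mg from rfl,
    Finset.range_zero, Finset.prod_empty]
  ring

end BrokenWeight

/-! ### Unfolding the integral -/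

section Unfold

open MvPolynomial

/-- The numbers `p^i q^j t^k` with integral exponents. -/
def lattice (p q t : ℂ) : Set ℂ := {w | ∃ i j k : ℤ, w = p ^ i * q ^ j * t ^ k}

variable {p q t : ℂ}

lemma countable_lattice (p q t : ℂ) : (lattice p q t).Countable := by
  refine (Set.countable_range fun x : ℤ × ℤ × ℤ => p ^ x.1 * q ^ x.2.1 * t ^ x.2.2).mono ?_
  rintro _ ⟨i, j, k, rfl⟩
  exact ⟨(i, j, k), rfl⟩

lemma inv_mem_lattice {w : ℂ} (hw : w ∈ lattice p q t) : w⁻¹ ∈ lattice p q t := by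
  obtain ⟨i, j, k, rfl⟩ := hw
  exact ⟨-i, -j, -k, by rw [zpow_neg, zpow_neg, zpow_neg, mul_inv, mul_inv]⟩

/-- Points at which the integrand has neither zeros nor poles. -/
structure TorusGeneric {n : ℕ} (p q t : ℂ) (v : Fin 6 → ℂ) (z : Fin n → ℂ) : Prop where
  ne_zero : ∀ j, z j ≠ 0
  one : ∀ j r, ∀ l ∈ lattice p q t, v r * z j ≠ l ∧ v r ≠ l * z j
  sq : ∀ j, ∀ l ∈ lattice p q t, z j ^ 2 ≠ l
  pair : ∀ j k, j ≠ k → ∀ l ∈ lattice p q t, z j * z k ≠ l ∧ z j ≠ l * z k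

variable {n : ℕ} {v : Fin 6 → ℂ} {z : Fin n → ℂ}

lemma TorusGeneric.signFlip (h : TorusGeneric p q t v z) (σ : Fin n → Bool) :
    TorusGeneric p q t v (signFlip σ z) where
  ne_zero j := by
    have := h.ne_zero j
    unfold EllipticSelberg.signFlip
    split_ifs
    · exact this
    · exact inv_ne_zero this
  one j r l hl := by
    have h0 := h.ne_zero j
    have h1 := h.one j r l hl
    unfold EllipticSelberg.signFlip
    split_ifs
    · exact h1
    · refine ⟨fun e => h1.2 ?_, fun e => h1.1 ?_⟩
      · rw [← e]
        field_simp
      · rw [e]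
        field_simp
  sq j l hl := by
    have h0 := h.ne_zero j
    unfold EllipticSelberg.signFlip
    split_ifs
    · exact h.sq j l hl
    · intro e
      refine h.sq j _ (inv_mem_lattice hl) ?_
      rw [← e]
      simp
  pair j k hjk l hl := by
    have hj := h.ne_zero j
    have hk := h.ne_zero k
    have h1 := h.pair j k hjk l hl
    have h2 := h.pair j k hjk l⁻¹ (inv_mem_lattice hl)
    unfold EllipticSelberg.signFlip
    split_ifs
    · exact h1
    · refine ⟨fun e => h1.2 ?_, fun e => h1.1 ?_⟩
      · rw [← e]
        field_simp
      · rw [e]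
        field_simp
    · refine ⟨fun e => h2.2 ?_, fun e => h2.1 ?_⟩
      · rw [← e]
        field_simp
      · have hl' : l = (z j)⁻¹ * (z k)⁻¹ := by
          rw [e]
          field_simp
        rw [hl']
        field_simp
    · refine ⟨fun e => h2.1 ?_, fun e => h2.2 ?_⟩
      · rw [← e]
        field_simp
      · have hl' : l = (z j)⁻¹ * z k := by
          rw [e]
          field_simp
        rw [hl']
        field_simp

/-- Almost all points of a torus are generic. -/
lemma exists_countable_torusGeneric (n : ℕ) (p q t : ℂ) (v : Fin 6 → ℂ) (hv : ∀ r, v r ≠ 0) :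
    ∃ Z : Set (MvPolynomial (Fin n) ℂ), Z.Countable ∧ 0 ∉ Z ∧
      ∀ z : Fin n → ℂ, (∀ P ∈ Z, eval z P ≠ 0) → TorusGeneric p q t v z := by
  have hL := countable_lattice p q t
  refine ⟨{P | P ≠ 0} ∩ (Set.range (fun j => X j) ∪ ⋃ l ∈ lattice p q t,
    (Set.range (fun x : Fin n × Fin 6 => C (v x.2) * X x.1 - C l) ∪
      Set.range (fun x : Fin n × Fin 6 => C l * X x.1 - C (v x.2)) ∪
      Set.range (fun j => X j ^ 2 - C l) ∪
      Set.range (fun x : Fin n × Fin n => X x.1 * X x.2 - C l) ∪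
      Set.range (fun x : Fin n × Fin n => X x.1 - C l * X x.2))), ?_, fun h => h.1 rfl, ?_⟩
  · refine Set.Countable.mono Set.inter_subset_right ((Set.countable_range _).union
      (hL.biUnion fun l _ => ?_))
    exact ((((Set.countable_range _).union (Set.countable_range _)).union
      (Set.countable_range _)).union (Set.countable_range _)).union (Set.countable_range _)
  · intro z hz
    have key : ∀ (P : MvPolynomial (Fin n) ℂ) (l : ℂ), l ∈ lattice p q t → (∃ w, eval w P ≠ 0) →
        P ∈ (Set.range (fun x : Fin n × Fin 6 => C (v x.2) * X x.1 - C l) ∪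
      Set.range (fun x : Fin n × Fin 6 => C l * X x.1 - C (v x.2)) ∪
      Set.range (fun j => X j ^ 2 - C l) ∪
      Set.range (fun x : Fin n × Fin n => X x.1 * X x.2 - C l) ∪
      Set.range (fun x : Fin n × Fin n => X x.1 - C l * X x.2)) → eval z P ≠ 0 := by
      rintro P l hl ⟨w, hw⟩ hP
      exact hz P ⟨fun h => hw (by rw [h, map_zero]), Or.inr (Set.mem_biUnion hl hP)⟩
    refine ⟨fun j => ?_, fun j r l hl => ⟨fun e => ?_, fun e => ?_⟩, fun j l hl e => ?_,
      fun j k hjk l hl => ⟨fun e => ?_, fun e => ?_⟩⟩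
    · simpa using hz (X j) ⟨X_ne_zero j, Or.inl ⟨j, rfl⟩⟩
    · refine key (C (v r) * X j - C l) l hl ⟨fun _ => (l + 1) / v r, ?_⟩
        (Or.inl (Or.inl (Or.inl (Or.inl ⟨(j, r), rfl⟩)))) (by simp [e])
      simp [mul_div_cancel₀ _ (hv r)]
    · refine key (C l * X j - C (v r)) l hl ⟨fun _ => 0, ?_⟩
        (Or.inl (Or.inl (Or.inl (Or.inr ⟨(j, r), rfl⟩)))) (by simp [← e])
      simpa using hv r
    · obtain ⟨w, hw⟩ : ∃ w : ℂ, w ^ 2 ≠ l := by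
        by_cases h : l = 0
        · exact ⟨1, by simp [h]⟩
        · exact ⟨0, by simpa [eq_comm] using h⟩
      exact key (X j ^ 2 - C l) l hl ⟨fun _ => w, by simpa [sub_eq_zero] using hw⟩
        (Or.inl (Or.inl (Or.inr ⟨j, rfl⟩))) (by simp [e])
    · refine key (X j * X k - C l) l hl ⟨fun i => if i = j then l + 1 else 1, ?_⟩
        (Or.inl (Or.inr ⟨(j, k), rfl⟩)) (by simp [e])
      simp [hjk.symm]
    · refine key (X j - C l * X k) l hl ⟨fun i => if i = j then 1 else 0, ?_⟩
        (Or.inr ⟨(j, k), rfl⟩) (by simp [e])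
      simp [hjk.symm]

end Unfold

section Unfold

variable {p q t : ℂ} {n : ℕ} {v : Fin 6 → ℂ} {z : Fin n → ℂ}

lemma selbergWeight_signFlip (σ : Fin n → Bool) (z : Fin n → ℂ) :
    selbergWeight n q t p v (signFlip σ z) = selbergWeight n q t p v z := by
  unfold selbergWeight
  refine congrArg₂ (· * ·) ?_ ?_
  · refine Finset.prod_congr rfl fun j _ => Finset.prod_congr rfl fun k _ => ?_
    unfold signFlip
    split_ifs
    · rfl
    all_goals
      simp only [div_eq_mul_inv, inv_inv, mul_inv, one_mul]
      ring_nf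
  · refine Finset.prod_congr rfl fun j _ => ?_
    unfold signFlip
    split_ifs
    · rfl
    · simp only [div_eq_mul_inv, inv_inv, one_mul, inv_pow]
      rw [mul_comm (ellGamma ((z j ^ 2)⁻¹) p q)]
      congr 1
      exact Finset.prod_congr rfl fun r _ => mul_comm _ _

lemma lattice_pow (i j k : ℕ) : p ^ i * q ^ j * t ^ k ∈ lattice p q t := ⟨i, j, k, by simp⟩

lemma lattice_inv_pow (i j k : ℕ) : (p ^ i * q ^ j * t ^ k)⁻¹ ∈ lattice p q t :=
  inv_mem_lattice (lattice_pow i j k)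

/-- `1 / (Γ(x)Γ(1/x)) = θ(1/x;p) θ(x;q)`, for `x` off the lattice of zeros. -/
lemma inv_gamma_mul_gamma (hp : ‖p‖ < 1) (hq : ‖q‖ < 1) {x : ℂ} (hx : x ≠ 0)
    (h : ∀ l ∈ lattice p q t, x ≠ l) :
    (ellGamma x p q * ellGamma (1 / x) p q)⁻¹ = theta (1 / x) p * theta x q := by
  have h1 := ellGamma_mul_ellGamma_inv (p := p) (q := q) hp hq (one_div_ne_zero hx) ?_ ?_
  · rw [one_div_one_div] at h1
    rw [mul_comm, h1]
  · rw [pqPoch_ne_zero_iff hp hq]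
    intro i j e
    refine h _ (lattice_pow (i + 1) (j + 1) 0) ?_
    rw [mul_one_div, div_mul_eq_mul_div, div_mul_eq_mul_div, div_eq_one_iff_eq hx] at e
    rw [← e]
    ring
  · rw [pqPoch_ne_zero_iff hp hq]
    intro i j e
    refine h _ (lattice_inv_pow (i + 1) (j + 1) 0) ?_
    rw [div_div_eq_mul_div, div_one] at e
    rw [eq_comm, inv_eq_of_mul_eq_one_right]
    rw [← e]
    ring

/-- Multiplication by the symmetry breaking factor turns the weight into `brokenWeight`. -/
lemma selbergWeight_mul_breakingFactor (hp : ‖p‖ < 1) (hp0 : p ≠ 0) (hq : ‖q‖ < 1) (hq0 : q ≠ 0)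
    {a b c : Fin 6} (hab : a ≠ b) (hac : a ≠ c) (hbc : b ≠ c) (hz : TorusGeneric p q t v z) :
    selbergWeight n q t p v z * breakingFactor q t (v a) (v b) (v c)
      (q / (t ^ (n - 1) * (v a * v b * v c))) z = brokenWeight n q t p {a, b, c} 0 v z := by
  unfold selbergWeight breakingFactor brokenWeight
  have hT : ∀ φ : Fin 6 → ℂ, ∏ r ∈ ({a, b, c} : Finset (Fin 6)), φ r = φ a * φ b * φ c := by
    intro φ
    rw [Finset.prod_insert (by simp [hab, hac]), Finset.prod_insert (by simp [hbc]),
      Finset.prod_singleton, mul_assoc]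
  rw [mul_comm (∏ j : Fin n, ∏ k ∈ Finset.Ioi j, _) (∏ j : Fin n, _), mul_mul_mul_comm,
    ← Finset.prod_mul_distrib, ← Finset.prod_mul_distrib]
  refine congrArg₂ (· * ·) ?_ ?_
  · refine Finset.prod_congr rfl fun j _ => ?_
    have hzj := hz.ne_zero j
    have hsq : z j ^ 2 ≠ 0 := by positivity
    have h1 := inv_gamma_mul_gamma hp hq hsq (hz.sq j)
    have h2 : theta (z j ^ 2) q ≠ 0 := by
      rw [theta_ne_zero_iff hq hq0 hsq]
      exact fun k => hz.sq j _ ⟨0, k, 0, by simp⟩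
    have hg : ∀ r : Fin 6, gammaShift q p (shift {a, b, c} r) ((0 : Fin 6 → ℕ) r) (v r * z j) *
        gammaShift q p 0 ((0 : Fin 6 → ℕ) r) (v r / z j) =
        (ellGamma (v r * z j) p q * ellGamma (v r / z j) p q) *
          if r ∈ ({a, b, c} : Finset (Fin 6)) then theta (v r * z j) q else 1 := by
      intro r
      rw [Pi.zero_apply, gammaShift_zero, gammaShift_zero, pow_zero, one_mul, shift]
      split_ifs with hr
      · rw [pow_one, ellGamma_mul_left hp hq hp0]
        · ring
        · rw [qPoch_ne_zero_iff hq]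
          intro i e
          refine (hz.one j r _ (lattice_inv_pow 0 i 0)).1 ?_
          rw [eq_comm, inv_eq_of_mul_eq_one_right]
          rw [← e]
          ring
      · rw [pow_zero, one_mul, mul_one]
    have h3 := Finset.prod_congr (rfl : (Finset.univ : Finset (Fin 6)) = Finset.univ)
      fun r _ => hg r
    rw [Finset.prod_mul_distrib (f := fun r => ellGamma (v r * z j) p q * ellGamma (v r / z j) p q),
      Finset.prod_ite_mem, Finset.univ_inter, hT] at h3
    unfold oneWeight
    rw [h3, hT, div_eq_mul_inv _ (ellGamma (z j ^ 2) p q * _), h1,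
      show q / (t ^ (n - 1) * (v a * v b * v c)) * z j = q * z j / (t ^ (n - 1) * (v a * v b * v c))
        by ring]
    generalize ∏ r, ellGamma (v r * z j) p q * ellGamma (v r / z j) p q = G
    field_simp
  · refine Finset.prod_congr rfl fun j _ => ?_
    rw [← Finset.prod_mul_distrib]
    refine Finset.prod_congr rfl fun k hk => ?_
    have hjk : j ≠ k := (Finset.mem_Ioi.1 hk).ne
    have hzj := hz.ne_zero j
    have hzk := hz.ne_zero k
    have h0 : z j * z k ≠ 0 := mul_ne_zero hzj hzk
    have h1 := inv_gamma_mul_gamma hp hq h0 fun l hl => (hz.pair j k hjk l hl).1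
    have h2 := inv_gamma_mul_gamma (t := t) hp hq (div_ne_zero hzk hzj) fun l hl e =>
      (hz.pair k j hjk.symm l hl).2 (by rw [← e, div_mul_cancel₀ _ hzj])
    rw [one_div_div] at h2
    have h3 : theta (z j * z k) q ≠ 0 := by
      rw [theta_ne_zero_iff hq hq0 h0]
      exact fun i => (hz.pair j k hjk _ ⟨0, i, 0, by simp⟩).1
    have h4 : ellGamma (t * p * (z j * z k)) p q =
        theta (t * (z j * z k)) q * ellGamma (t * z j * z k) p q := by
      rw [show t * p * (z j * z k) = p * (t * (z j * z k)) by ring, ellGamma_mul_left hp hq hp0,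
        mul_assoc t]
      rw [qPoch_ne_zero_iff hq]
      intro i e
      refine (hz.pair j k hjk _ (lattice_inv_pow 0 i 1)).1 ?_
      rw [eq_comm, inv_eq_of_mul_eq_one_right]
      rw [← e]
      ring
    unfold pairWeight crossTheta
    rw [h4, div_eq_mul_inv _ (ellGamma (z j * z k) p q * _ * _ * _),
      show ellGamma (z j * z k) p q * ellGamma (z j / z k) p q * ellGamma (z k / z j) p q *
        ellGamma (1 / (z j * z k)) p q = (ellGamma (z j * z k) p q * ellGamma (1 / (z j * z k)) p q)
            *
        (ellGamma (z k / z j) p q * ellGamma (z j / z k) p q) by ring, mul_inv, h1, h2]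
    field_simp

end Unfold

section UnfoldIntegral

variable {p q t : ℂ} {n : ℕ} {τ : Fin 6 → ℂ}

lemma TorusGeneric.mem_regularSet {v : Fin 6 → ℂ} {z : Fin n → ℂ} (hp : ‖p‖ < 1) (hp0 : p ≠ 0)
    (hq0 : q ≠ 0) (hv : ∀ r, v r ≠ 0) (hz : TorusGeneric p q t v z) (r : Fin 6) (M : ℕ) :
    z ∈ regularSet n M q p (v r) := by
  refine ⟨hz.ne_zero, ?_⟩
  rw [poleFactor_eq hp0 hq0 (hv r) M hz.ne_zero]
  refine Finset.prod_ne_zero_iff.2 fun j _ => mul_ne_zero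
    (Finset.prod_ne_zero_iff.2 fun k _ => ?_) (Finset.prod_ne_zero_iff.2 fun k _ => ?_)
  · have hj := hz.ne_zero j
    have hr := hv r
    rw [theta_ne_zero_iff hp hp0 (by positivity)]
    intro i e
    refine (hz.one j r _ ⟨i, (k + 1 : ℕ), 0, rfl⟩).2 ?_
    rw [← e, zpow_natCast]
    field_simp
  · have hj := hz.ne_zero j
    have hr := hv r
    rw [theta_ne_zero_iff hp hp0 (by positivity)]
    intro i e
    refine (hz.one j r _ ⟨i, (k + 1 : ℕ), 0, rfl⟩).1 ?_
    rw [← e, zpow_natCast]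
    field_simp

lemma MemA.signFlip {M : ℕ} {u : ℂ} {f : (Fin n → ℂ) → ℂ} (hf : MemA n M q p u f) {z : Fin n → ℂ}
    (hz : ∀ σ, signFlip σ z ∈ regularSet n M q p u) (σ : Fin n → Bool) :
    f (signFlip σ z) = f z := by
  have key : ∀ s : Finset (Fin n), f (EllipticSelberg.signFlip (fun i => decide (i ∉ s)) z) = f
      z := by
    intro s
    induction s using Finset.induction_on with
    | empty =>
      congr 1
    | insert a s ha ih =>
      rw [← ih, ← hf.inv a _ (hz _)]
      congr 1
      funext i
      by_cases h : i = a
      · subst h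
        simp [EllipticSelberg.signFlip, ha]
      · simp [EllipticSelberg.signFlip, h]
  convert key (Finset.univ.filter fun i => σ i = false) using 3
  funext i
  simp

lemma const_mul_chainIntegral (C : CircleChain) (n : ℕ) (a : ℂ) (F : (Fin n → ℂ) → ℂ) :
    a * chainIntegral n C F = chainIntegral n C fun z => a * F z := by
  unfold chainIntegral
  rw [Finset.mul_sum]
  refine Finset.sum_congr rfl fun x _ => ?_
  rw [mul_left_comm, ← torusIntegral_const_mul]
  congr 2
  funext z
  ring

open MeasureTheory in
lemma IsContour.chainIntegral_sum {C : CircleChain} (hC : IsContour C) {ι : Type*} (s : Finset ι)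
    {F : ι → (Fin n → ℂ) → ℂ} (hF : ∀ i ∈ s, ContinuousOn (F i) (piSet n (carrier C))) :
    chainIntegral n C (fun z => ∑ i ∈ s, F i z) = ∑ i ∈ s, chainIntegral n C (F i) := by
  unfold chainIntegral
  rw [Finset.sum_comm]
  refine Finset.sum_congr rfl fun x hx => ?_
  rw [Fintype.mem_piFinset] at hx
  rw [← Finset.mul_sum]
  congr 1
  unfold torusIntegral
  have hmap : ∀ θ, torusMap (fun j => (x j).1) (fun j => (x j).2) θ ∈ piSet n (carrier C) :=
    fun θ j => sphere_subset_carrier (hx j)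
      (circleMap_mem_sphere _ (hC.radius_pos _ (hx j)).le (θ j))
  rw [← integral_finsetSum]
  · congr 1
    funext θ
    simp only
    rw [Finset.sum_mul, Finset.smul_sum]
  · intro i hi
    have hint : TorusIntegrable (fun z => F i z * ∏ j, (2 * (Real.pi : ℂ) * Complex.I * z j)⁻¹)
        (fun j => (x j).1) (fun j => (x j).2) := ?_
    · exact hint.function_integrable
    unfold TorusIntegrable
    refine ContinuousOn.integrableOn_compact isCompact_Icc (Continuous.continuousOn ?_)
    have hc : ContinuousOn (fun z : Fin n → ℂ =>
        F i z * ∏ j, (2 * (Real.pi : ℂ) * Complex.I * z j)⁻¹) (piSet n (carrier C)) := by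
      refine (hF i hi).mul (continuousOn_finsetProd _ fun j _ => ContinuousOn.inv₀ (by fun_prop) ?_)
      intro z hz
      exact mul_ne_zero Complex.two_pi_I_ne_zero fun h => hC.zero_notMem (h ▸ hz j)
    refine hc.comp_continuous ?_ hmap
    unfold torusMap
    fun_prop

/-- The domain of holomorphy of the integrand after breaking the symmetry, for parameters `v`. -/
def brokenDomain (n : ℕ) (q t p : ℂ) (T : Finset (Fin 6)) (v : Fin 6 → ℂ) : Set (Fin n → ℂ) :=
  offPoles n (poles p q v 0) (poles p q v (shift T)) (orbitSet p q 0 t) (orbitSet p q 1 t)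

lemma isOpen_brokenDomain (hp : ‖p‖ < 1) (hq : ‖q‖ < 1) (n : ℕ) (t : ℂ) (T : Finset (Fin 6))
    (v : Fin 6 → ℂ) : IsOpen (brokenDomain n q t p T v) :=
  isOpen_offPoles n (isCompact_insert_poles hp hq _ _) (isCompact_insert_poles hp hq _ _)
    (isCompact_insert_orbitSet hp hq _ _) (isCompact_insert_orbitSet hp hq _ _)

lemma differentiableOn_brokenIntegrand (hp : ‖p‖ < 1) (hp0 : p ≠ 0) (hq : ‖q‖ < 1) (hq0 : q ≠ 0)
    (ht0 : t ≠ 0) (hτ : ∀ r, τ r ≠ 0) (T : Finset (Fin 6)) (mf mg : ℕ) {F G : (Fin n → ℂ) → ℂ}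
    (hF : DifferentiableOn ℂ F {z | ∀ i, z i ≠ 0}) (hG : DifferentiableOn ℂ G {z | ∀ i, z i ≠ 0}) :
    DifferentiableOn ℂ (fun z => F z * G z * brokenWeight n q t p T (poleOrder mf mg) τ z)
      (brokenDomain n q t p T (tilde q mf mg τ)) := by
  have hsub : brokenDomain n q t p T (tilde q mf mg τ) ⊆ {z | ∀ i, z i ≠ 0} := fun z hz i => (hz
      i).1
  have h1 := differentiableOn_brokenWeight (n := n) (T := T) (m := poleOrder mf mg) hp hp0 hq hq0
    ht0 hτ
  rw [← funext (tilde_apply q mf mg τ)] at h1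
  exact ((hF.mono hsub).mul (hG.mono hsub)).mul h1

/-- Summation over the sign changes `z_j → 1 / z_j`. -/
theorem IsEllipticContour.const_mul_chainIntegral (hn : 1 ≤ n) (hp : ‖p‖ < 1) (hp0 : p ≠ 0)
    (hq : ‖q‖ < 1) (hq0 : q ≠ 0) (ht0 : t ≠ 0) (hτ : ∀ r, τ r ≠ 0) {mf mg : ℕ} {D : CircleChain}
    (hD : IsEllipticContour q t p (tilde q mf mg τ) D) {f g F G : (Fin n → ℂ) → ℂ}
    (hf : MemA n mf q p (τ 4) f) (hg : MemA n mg q p (τ 5) g)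
    (hF : DifferentiableOn ℂ F {z | ∀ i, z i ≠ 0}) (hG : DifferentiableOn ℂ G {z | ∀ i, z i ≠ 0})
    (hfF : ∀ z ∈ regularSet n mf q p (τ 4), poleFactor n mf q p (τ 4) z * f z = F z)
    (hgG : ∀ z ∈ regularSet n mg q p (τ 5), poleFactor n mg q p (τ 5) z * g z = G z)
    {a b c : Fin 6} (hab : a ≠ b) (hac : a ≠ c) (hbc : b ≠ c) :
    (∏ i ∈ Finset.range n, theta (t ^ i * (τ a * τ b)) q * theta (t ^ i * (τ a * τ c)) q *
        theta (t ^ i * (τ a * (q / (t ^ (n - 1) * (τ a * τ b * τ c))))) q) *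
      chainIntegral n D (fun z => f z * g z * selbergWeight n q t p τ z) =
    2 ^ n * chainIntegral n D
      (fun z => F z * G z * brokenWeight n q t p {a, b, c} (poleOrder mf mg) τ z) := by
  set H : (Fin n → ℂ) → ℂ :=
    fun z => F z * G z * brokenWeight n q t p {a, b, c} (poleOrder mf mg) τ z with hH
  have hHd := differentiableOn_brokenIntegrand hp hp0 hq hq0 ht0 hτ {a, b, c} mf mg hF hG
  obtain ⟨δ, ⟨hδC, h0, hsep⟩, hδ⟩ := ((hD.eventually_separates hp hq (shift {a, b, c})).and
    self_mem_nhdsWithin).exists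
  have hδ : 0 < δ := hδ
  have hcar : piSet n (carrier D) ⊆ brokenDomain n q t p {a, b, c} (tilde q mf mg τ) := by
    intro z hz
    refine hsep.piSet_subset n fun j => ?_
    have := carrier_subset_tube D hδ.le (hz j)
    exact ⟨Or.inl this, fun h => h.2 this⟩
  have hflip := hD.toIsContour.chainIntegral_signFlip hD.symmetric
    (isOpen_brokenDomain hp hq n t {a, b, c} (tilde q mf mg τ)) hcar hHd
  obtain ⟨Z, hZc, hZ0, hZ⟩ := exists_countable_torusGeneric n p q t τ hτ
  have hcard : (2 : ℂ) ^ n * chainIntegral n D H =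
      ∑ σ : Fin n → Bool, chainIntegral n D (fun z => H (signFlip σ z)) := by
    refine ((Finset.sum_congr rfl fun σ _ => (hflip σ).2).trans ?_).symm
    rw [Finset.sum_const, Finset.card_univ, nsmul_eq_mul]
    simp [hH]
  rw [hcard, ← hD.toIsContour.chainIntegral_sum _ fun σ _ => (hflip σ).1,
    EllipticSelberg.const_mul_chainIntegral]
  refine hD.toIsContour.chainIntegral_congr_ae hZc hZ0 fun z hzD hz => ?_
  have hzg := hZ z hz
  have hreg : ∀ σ r M, signFlip σ z ∈ regularSet n M q p (τ r) := fun σ r M =>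
    (hzg.signFlip σ).mem_regularSet hp hp0 hq0 hτ r M
  have hsum := sum_breakingFactor hq hq0 ht0 n z ⟨hzg.ne_zero,
    fun i k => hzg.sq i _ ⟨0, k, 0, by simp⟩,
    fun i j hij k => (hzg.pair i j hij _ ⟨0, k, 0, by simp⟩).1,
    fun i j hij k e => (hzg.pair i j hij _ ⟨0, k, 0, rfl⟩).2 (by
      rw [zpow_zero, zpow_zero, one_mul, mul_one, ← e, div_mul_cancel₀ _ (hzg.ne_zero j)])⟩ (τ a) (τ
          b) (τ c)
    (q / (t ^ (n - 1) * (τ a * τ b * τ c))) (hτ a) (hτ b) (hτ c)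
    (div_ne_zero hq0 (mul_ne_zero (pow_ne_zero _ ht0)
      (mul_ne_zero (mul_ne_zero (hτ a) (hτ b)) (hτ c)))) (by
      have h1 := hτ a
      have h2 := hτ b
      have h3 := hτ c
      obtain ⟨m, rfl⟩ : ∃ m, n = m + 1 := ⟨n - 1, by omega⟩
      rw [Nat.add_sub_cancel, pow_succ]
      field_simp)
  rw [← hsum, Finset.sum_mul]
  refine Finset.sum_congr rfl fun σ _ => ?_
  have hy := hzg.signFlip σ
  have hpole : signFlip σ z ∈ brokenDomain n q t p {a, b, c} (tilde q mf mg τ) := by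
    refine hcar fun j => ?_
    unfold signFlip
    split_ifs
    · exact hzD j
    · exact hD.toIsContour.exists_mem_carrier_inv hD.symmetric (hzD j)
  rw [← hfF _ (hreg σ 4 mf), ← hgG _ (hreg σ 5 mg), hf.signFlip (fun σ => hreg σ 4 mf),
    hg.signFlip (fun σ => hreg σ 5 mg), ← selbergWeight_signFlip σ]
  have h1 := selbergWeight_mul_breakingFactor hp hp0 hq hq0 hab hac hbc hy
  have h2 := brokenWeight_mul_poleFactor (t := t) (T := {a, b, c}) hp hp0 hq hq0 hτ mf mg
    (fun j => (hpole j).1) (fun j => (hpole j).2.1) (fun j => (hpole j).2.2.1)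
  rw [← h2] at h1
  linear_combination f z * g z * h1

lemma iterInt_comp_mul {n : ℕ} {χ : ℂ → ℂ} (hχ : ContDiff ℝ 1 χ) {l : ℂ} (hl : l ≠ 0) :
    ∀ F : (Fin n → ℂ) → ℂ, iterInt n (fun _ => cutoffInt χ) (fun z => F fun i => l * z i) =
      iterInt n (fun _ => cutoffInt fun z => χ (z / l)) F := by
  induction n with
  | zero =>
    intro F
    simp only [iterInt]
    congr 1
    exact Subsingleton.elim _ _
  | succ n ih =>
    intro F
    change cutoffInt χ _ = cutoffInt (fun z => χ (z / l)) _
    rw [← cutoffInt_comp_mul hχ hl]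
    congr 1
    funext x
    refine Eq.trans ?_ (ih fun y => F (Fin.cons (l * x) y))
    congr 1
    funext y
    refine congrArg F (funext fun i => ?_)
    refine Fin.cases ?_ (fun i => ?_) i <;> simp

/-- Deformation of an elliptic contour to the rescaled limit contour. -/
theorem IsEllipticContour.chainIntegral_eq_rescaled {C D : CircleChain} {v : Fin 6 → ℂ}
    {T : Finset (Fin 6)} (hp : ‖p‖ < 1) (hq : ‖q‖ < 1) (ht : ‖t‖ < 1)
    (hD : IsEllipticContour q t p v D) (hC : IsContour C) {δ : ℝ} (hδ : 0 < δ)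
    (hδC : ∀ x ∈ C.support, δ < x.2) (h0 : (0 : ℂ) ∉ tube C δ) {l : ℂ} (hl : l ≠ 0)
    (hsep : Separates (poles p q v 0) (poles p q v (shift T)) (orbitSet p q 0 t) (orbitSet p q 1 t)
      {z | z / l ∈ tube C δ ∪ inside C} {z | z / l ∈ inside C \ tube C δ})
    {H : (Fin n → ℂ) → ℂ} (hH : DifferentiableOn ℂ H (brokenDomain n q t p T v)) :
    chainIntegral n D H = chainIntegral n C fun z => H fun i => l * z i := by
  obtain ⟨δ', ⟨hδD, h0D, hsepD⟩, hδ'⟩ := ((hD.eventually_separates hp hq (shift T)).and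
    self_mem_nhdsWithin).exists
  have hδ' : 0 < δ' := hδ'
  have hopen := isOpen_brokenDomain hp hq n t T v
  have htube : ∀ (K O A : Set ℂ), A ⊆ K \ O → piSet n A ⊆ piSet n (K \ O) :=
    fun K O A h z hz j => h (hz j)
  rw [hD.toIsContour.chainIntegral_eq_cutoffInt hδ' hδD h0D hopen
    ((htube _ _ _ fun z hz => ⟨Or.inl hz, fun h => h.2 hz⟩).trans (hsepD.piSet_subset n)) hH]
  have hcut := hC.isCut hδ hδC
  have hmul : Continuous fun (z : Fin n → ℂ) i => l * z i := by fun_prop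
  rw [hC.chainIntegral_eq_cutoffInt hδ hδC h0 (V := (fun (z : Fin n → ℂ) i => l * z i) ⁻¹'
    brokenDomain n q t p T v) (hopen.preimage hmul) ?_ ?_, iterInt_comp_mul hcut.contDiff hl]
  · exact iterInt_eq_of_separates_of_separates (hD.toIsContour.isCut hδ' hδD) (hcut.comp_div hl)
      hsepD hsep ht (fun s hs => norm_orbitSet_le hp hq 0 hs) (fun s hs => norm_orbitSet_le hp hq 1
          hs)
      hopen hH
  · intro z hz
    refine hsep.piSet_subset n fun j => ?_
    have e : l * z j / l = z j := mul_div_cancel_left₀ _ hl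
    refine ⟨?_, ?_⟩
    · rw [Set.mem_ofPred_eq, e]
      exact Or.inl (hz j)
    · rw [Set.mem_ofPred_eq, e]
      exact fun h => h.2 (hz j)
  · refine hH.comp (Differentiable.differentiableOn ?_) fun z hz => hz
    exact differentiable_pi.2 fun j => (differentiable_const l).mul (differentiable_apply j)

end UnfoldIntegral

/-! ### The limits of the special functions -/

section LimitFunctions

variable {ι : Type*} {l : Filter ι} {p x : ι → ℂ} {x₀ q : ℂ} {s : ℝ}

/-- The limit of `Γ(x p^s;p,q)` as `p → 0`, for `0 ≤ s ≤ 1`. -/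
def limGamma (s : ℝ) (q x : ℂ) : ℂ :=
  (if s = 1 then qPoch (q / x) q else 1) / (if s = 0 then qPoch x q else 1)

/-- The limit of `θ(x p^s;p)` as `p → 0`, for `0 ≤ s ≤ 1`. -/
def limTheta (s : ℝ) (x : ℂ) : ℂ :=
  (if s = 0 then 1 - x else 1) * (if s = 1 then 1 - 1 / x else 1)

lemma tendsto_cpow (hp : Tendsto p l (𝓝[≠] 0)) (hs : 0 ≤ s) :
    Tendsto (fun a => p a ^ (s : ℂ)) l (𝓝 (if s = 0 then 1 else 0)) := by
  split_ifs with h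
  · simp only [h, Complex.ofReal_zero, Complex.cpow_zero]
    exact tendsto_const_nhds
  · have h1 := (tendsto_norm_rpow (lt_of_le_of_ne hs (Ne.symm h)) 1).comp hp
    refine tendsto_zero_iff_norm_tendsto_zero.2 (h1.congr' ?_)
    filter_upwards [hp self_mem_nhdsWithin] with a ha
    rw [Function.comp_apply, mul_one, norm_cpow_ofReal ha]

lemma tendsto_mul_cpow (hp : Tendsto p l (𝓝[≠] 0)) (hx : Tendsto x l (𝓝 x₀)) (hs : 0 ≤ s) :
    Tendsto (fun a => x a * p a ^ (s : ℂ)) l (𝓝 (if s = 0 then x₀ else 0)) := by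
  have := hx.mul (tendsto_cpow hp hs)
  split_ifs at this ⊢ with h
  · simpa using this
  · simpa using this

lemma tendsto_div_mul_cpow (hp : Tendsto p l (𝓝[≠] 0)) (hx : Tendsto x l (𝓝 x₀)) (hx0 : x₀ ≠ 0)
    (hs : s ≤ 1) (c : ℂ) :
    Tendsto (fun a => p a * c / (x a * p a ^ (s : ℂ))) l (𝓝 (if s = 1 then c / x₀ else 0)) := by
  have h1 := tendsto_mul_cpow hp ((tendsto_const_nhds (x := c)).div hx hx0) (sub_nonneg.2 hs)
  have h2 : (if 1 - s = 0 then c / x₀ else 0) = if s = 1 then c / x₀ else 0 :=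
    if_congr (by rw [sub_eq_zero, eq_comm]) rfl rfl
  rw [← h2]
  refine h1.congr' ?_
  filter_upwards [hp self_mem_nhdsWithin] with a ha
  rw [Complex.ofReal_sub, Complex.cpow_sub _ _ ha, Complex.ofReal_one, Complex.cpow_one]
  simp only [Pi.div_apply, div_eq_mul_inv, mul_inv]
  ring

lemma tendsto_ellGamma_cpow (hq : ‖q‖ < 1) (hp : Tendsto p l (𝓝[≠] 0)) (hx : Tendsto x l (𝓝 x₀))
    (hx0 : x₀ ≠ 0) (hs0 : 0 ≤ s) (hs1 : s ≤ 1) (h : s = 0 → qPoch x₀ q ≠ 0) :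
    Tendsto (fun a => ellGamma (x a * p a ^ (s : ℂ)) (p a) q) l (𝓝 (limGamma s q x₀)) := by
  have hp' : Tendsto p l (𝓝 0) := hp.mono_right nhdsWithin_le_nhds
  have h1 := Tendsto.pqPoch (tendsto_div_mul_cpow hp hx hx0 hs1 q) hp' tendsto_const_nhds
    (by simp) hq
  have h2 := Tendsto.pqPoch (tendsto_mul_cpow hp hx hs0) hp' (tendsto_const_nhds (x := q))
    (by simp) hq
  rw [pqPoch_zero_left hq] at h1 h2
  have e1 : qPoch (if s = 1 then q / x₀ else 0) q = if s = 1 then qPoch (q / x₀) q else 1 := by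
    split_ifs <;> simp
  have e2 : qPoch (if s = 0 then x₀ else 0) q = if s = 0 then qPoch x₀ q else 1 := by
    split_ifs <;> simp
  rw [e1] at h1
  rw [e2] at h2
  refine h1.div h2 ?_
  split_ifs with h0
  · exact h h0
  · exact one_ne_zero

lemma qPoch_zero_right (x : ℂ) : qPoch x 0 = 1 - x := by
  rw [qPoch_eq_mul (by simp), zero_mul, qPoch_zero, mul_one]

lemma tendsto_theta_cpow (hp : Tendsto p l (𝓝[≠] 0)) (hx : Tendsto x l (𝓝 x₀))
    (hx0 : x₀ ≠ 0) (hs0 : 0 ≤ s) (hs1 : s ≤ 1) :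
    Tendsto (fun a => theta (x a * p a ^ (s : ℂ)) (p a)) l (𝓝 (limTheta s x₀)) := by
  have hp' : Tendsto p l (𝓝 0) := hp.mono_right nhdsWithin_le_nhds
  have h1 := Tendsto.qPoch (tendsto_div_mul_cpow hp hx hx0 hs1 1) hp' (by simp)
  have h2 := Tendsto.qPoch (tendsto_mul_cpow hp hx hs0) hp' (by simp)
  rw [qPoch_zero_right] at h1 h2
  have e1 : 1 - (if s = 1 then 1 / x₀ else 0) = if s = 1 then 1 - 1 / x₀ else 1 := by
    split_ifs <;> simp
  have e2 : 1 - (if s = 0 then x₀ else 0) = if s = 0 then 1 - x₀ else 1 := by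
    split_ifs <;> simp
  rw [e1] at h1
  rw [e2] at h2
  refine (h2.mul h1).congr fun a => ?_
  rw [mul_one, theta]

lemma tendsto_theta (hq : ‖q‖ < 1) (hx : Tendsto x l (𝓝 x₀)) (hx0 : x₀ ≠ 0) :
    Tendsto (fun a => theta (x a) q) l (𝓝 (theta x₀ q)) :=
  (differentiableAt_theta hq hx0).continuousAt.tendsto.comp hx

end LimitFunctions

section LimitWeight

lemma prod_cpow {κ : Type*} {p : ℂ} (hp : p ≠ 0) (s : Finset κ) (α : κ → ℝ) :
    ∏ r ∈ s, p ^ (α r : ℂ) = p ^ ((∑ r ∈ s, α r : ℝ) : ℂ) := by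
  classical
  induction s using Finset.induction_on with
  | empty => simp
  | insert a s ha ih =>
    rw [Finset.prod_insert ha, Finset.sum_insert ha, ih, Complex.ofReal_add, Complex.cpow_add _ _
        hp]

variable {n : ℕ} {q t : ℂ} {τ : Fin 6 → ℂ} {α : Fin 6 → ℝ} {ζ : ℝ} {T : Finset (Fin 6)}

/-- The limit of `oneWeight`. -/
def limOne (n : ℕ) (q t : ℂ) (τ : Fin 6 → ℂ) (α : Fin 6 → ℝ) (ζ : ℝ) (T : Finset (Fin 6)) (x : ℂ) :
    ℂ :=
  (∏ r, limGamma (shift T r + α r + ζ) q (τ r * x) * limGamma (α r - ζ) q (τ r / x)) *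
    (limTheta (-(2 * ζ)) (1 / x ^ 2) * theta (q * x / (t ^ (n - 1) * ∏ r ∈ T, τ r)) q)

/-- The limit of `pairWeight`. -/
def limPair (q t : ℂ) (ζ : ℝ) (x y : ℂ) : ℂ :=
  limGamma (1 + 2 * ζ) q (t * (x * y)) * limGamma (-(2 * ζ)) q (t / (x * y)) *
    (limGamma 0 q (t * x / y) * limGamma 0 q (t * y / x)) *
    (limTheta (-(2 * ζ)) (1 / (x * y)) * (limTheta 0 (x / y) * theta (y / x) q))

/-- The domain of holomorphy of the limit of the integrand. -/
structure LimitRegular (q t : ℂ) (τ : Fin 6 → ℂ) (α : Fin 6 → ℝ) (ζ : ℝ) (T : Finset (Fin 6))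
    (z : Fin n → ℂ) : Prop where
  ne_zero : ∀ j, z j ≠ 0
  div : ∀ j, ∀ r ∈ T, α r = ζ → qPoch (τ r / z j) q ≠ 0
  mul : ∀ j, ∀ r ∉ T, α r = -ζ → qPoch (τ r * z j) q ≠ 0
  mul_half : ζ = -1 / 2 → ∀ j, ∀ r ∈ T, α r = -1 / 2 → qPoch (τ r * z j) q ≠ 0
  cross : ∀ j k, j ≠ k → qPoch (t * z j / z k) q ≠ 0
  cross_half : ζ = -1 / 2 → ∀ j k, j ≠ k → qPoch (t * (z j * z k)) q ≠ 0

lemma IsExponent.shift_add_mem (hα : IsExponent α ζ T) (r : Fin 6) :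
    0 ≤ shift T r + α r + ζ ∧ shift T r + α r + ζ ≤ 1 ∧ 0 ≤ α r - ζ ∧ α r - ζ ≤ 1 := by
  have h1 := hα.zeta_ge
  have h2 := hα.zeta_neg
  unfold shift
  split_ifs with hr
  · have := hα.mem r hr
    push_cast
    exact ⟨by linarith, by linarith, by linarith, by linarith⟩
  · have := hα.notMem r hr
    push_cast
    exact ⟨by linarith, by linarith, by linarith, by linarith⟩

/-- After rescaling by `p^ζ`, all gamma factors have the form `Γ(x p^s)` with `0 ≤ s ≤ 1`. -/
theorem LimitRegular.tendsto_brokenWeight {z₀ : Fin n → ℂ} (h : LimitRegular q t τ α ζ T z₀)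
    (hα : IsExponent α ζ T) (hT : ∑ r ∈ T, α r = ζ) (hq : ‖q‖ < 1) (hq0 : q ≠ 0) (ht0 : t ≠ 0)
    (hτ : ∀ r, τ r ≠ 0) {ι : Type*} {l : Filter ι} {p : ι → ℂ} {x : ι → Fin n → ℂ}
    (hp : Tendsto p l (𝓝[≠] 0)) (hx : Tendsto x l (𝓝 z₀)) :
    Tendsto (fun a => brokenWeight n q t (p a) T 0 (scaled τ α (p a)) fun j => p a ^ (ζ : ℂ) * x a
        j) l
      (𝓝 ((∏ j, limOne n q t τ α ζ T (z₀ j)) * ∏ j, ∏ k ∈ Finset.Ioi j, limPair q t ζ (z₀ j) (z₀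
          k))) := by
  have hxj : ∀ j, Tendsto (fun a => x a j) l (𝓝 (z₀ j)) := fun j => (tendsto_pi_nhds.1 hx) j
  have hpne : ∀ᶠ a in l, p a ≠ 0 := hp self_mem_nhdsWithin
  have hζ1 := hα.zeta_ge
  have hζ2 := hα.zeta_neg
  have hTne : ∏ r ∈ T, τ r ≠ 0 := Finset.prod_ne_zero_iff.2 fun r _ => hτ r
  unfold brokenWeight
  refine Tendsto.mul (tendsto_finsetProd _ fun j _ => ?_)
    (tendsto_finsetProd _ fun j _ => tendsto_finsetProd _ fun k hk => ?_)
  · have hj := h.ne_zero j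
    unfold oneWeight limOne
    refine Tendsto.mul (tendsto_finsetProd _ fun r _ => Tendsto.mul ?_ ?_) (Tendsto.mul ?_ ?_)
    · have hr := hα.shift_add_mem r
      refine (tendsto_ellGamma_cpow hq hp (((hxj j).const_mul (τ r))) (mul_ne_zero (hτ r) hj)
        hr.1 hr.2.1 fun h0 => ?_).congr' ?_
      · by_cases hrT : r ∈ T
        · have hm := hα.mem r hrT
          simp only [shift, hrT, if_true, Nat.cast_one] at h0
          exact h.mul_half (by linarith) j r hrT (by linarith)
        · simp only [shift, hrT, if_false, Nat.cast_zero] at h0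
          exact h.mul j r hrT (by linarith)
      · filter_upwards [hpne] with a ha
        rw [Pi.zero_apply, gammaShift_zero]
        congr 1
        push_cast
        rw [scaled, Complex.cpow_add _ _ ha, Complex.cpow_add _ _ ha, Complex.cpow_natCast]
        ring
    · have hr := hα.shift_add_mem r
      refine (tendsto_ellGamma_cpow hq hp ((tendsto_const_nhds (x := τ r)).div (hxj j) hj)
        (div_ne_zero (hτ r) hj) hr.2.2.1 hr.2.2.2 fun h0 => ?_).congr' ?_
      · by_cases hrT : r ∈ T
        · exact h.div j r hrT (by linarith)
        · have := hα.notMem r hrT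
          linarith
      · filter_upwards [hpne] with a ha
        rw [Pi.zero_apply, gammaShift_zero, pow_zero, one_mul]
        congr 1
        rw [scaled, Complex.ofReal_sub, Complex.cpow_sub _ _ ha]
        simp only [Pi.div_apply, div_eq_mul_inv, mul_inv]
        ring
    · refine (tendsto_theta_cpow hp ((tendsto_const_nhds (x := (1 : ℂ))).div ((hxj j).pow 2)
        (pow_ne_zero 2 hj)) (one_div_ne_zero (pow_ne_zero 2 hj)) (by linarith) (by linarith)).congr'
            ?_
      filter_upwards [hpne] with a ha
      congr 1
      push_cast
      rw [Complex.cpow_neg, mul_comm (2 : ℂ), Complex.cpow_mul_ofNat]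
      simp only [Pi.div_apply, div_eq_mul_inv, mul_inv, mul_pow]
      ring
    · refine (tendsto_theta hq (((hxj j).const_mul q).div_const (t ^ (n - 1) * ∏ r ∈ T, τ r))
        (by positivity)).congr' ?_
      filter_upwards [hpne] with a ha
      congr 1
      have e : ∏ r ∈ T, scaled τ α (p a) r = (∏ r ∈ T, τ r) * p a ^ (ζ : ℂ) := by
        simp only [scaled]
        rw [Finset.prod_mul_distrib, ← hT, prod_cpow ha]
      have hpz : p a ^ (ζ : ℂ) ≠ 0 := fun h => ha ((Complex.cpow_eq_zero_iff _ _).1 h).1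
      rw [e]
      field_simp
  · have hkj : j ≠ k := (Finset.mem_Ioi.1 hk).ne
    have hj := h.ne_zero j
    have hk := h.ne_zero k
    have hjk := (hxj j).mul (hxj k)
    have hjk0 : z₀ j * z₀ k ≠ 0 := mul_ne_zero hj hk
    have hpz : ∀ a, p a ≠ 0 → p a ^ (ζ : ℂ) ≠ 0 := fun a ha h => ha ((Complex.cpow_eq_zero_iff _
        _).1 h).1
    unfold pairWeight limPair
    refine ((Tendsto.mul ?_ ?_).mul (Tendsto.mul ?_ ?_)).mul (Tendsto.mul ?_ (Tendsto.mul ?_ ?_))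
    · refine (tendsto_ellGamma_cpow hq hp (hjk.const_mul t) (mul_ne_zero ht0 hjk0)
        (s := 1 + 2 * ζ) (by linarith) (by linarith)
        fun h0 => h.cross_half (by linarith) j k hkj).congr' ?_
      filter_upwards [hpne] with a ha
      congr 1
      push_cast
      rw [Complex.cpow_add _ _ ha, Complex.cpow_one, mul_comm (2 : ℂ), Complex.cpow_mul_ofNat]
      ring
    · refine (tendsto_ellGamma_cpow hq hp ((tendsto_const_nhds (x := t)).div hjk hjk0)
        (div_ne_zero ht0 hjk0) (s := -(2 * ζ)) (by linarith) (by linarith)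
        fun h0 => by linarith).congr' ?_
      filter_upwards [hpne] with a ha
      congr 1
      push_cast
      rw [Complex.cpow_neg, mul_comm (2 : ℂ), Complex.cpow_mul_ofNat]
      simp only [Pi.div_apply, div_eq_mul_inv, mul_inv]
      ring
    · refine (tendsto_ellGamma_cpow hq hp (((hxj j).const_mul t).div (hxj k) hk)
        (div_ne_zero (mul_ne_zero ht0 hj) hk) le_rfl zero_le_one fun _ => h.cross j k hkj).congr' ?_
      filter_upwards [hpne] with a ha
      have := hpz a ha
      congr 1
      rw [Complex.ofReal_zero, Complex.cpow_zero, mul_one, mul_left_comm, mul_div_mul_left _ _ this]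
      rfl
    · refine (tendsto_ellGamma_cpow hq hp (((hxj k).const_mul t).div (hxj j) hj)
        (div_ne_zero (mul_ne_zero ht0 hk) hj) le_rfl zero_le_one
        fun _ => h.cross k j hkj.symm).congr' ?_
      filter_upwards [hpne] with a ha
      have := hpz a ha
      congr 1
      rw [Complex.ofReal_zero, Complex.cpow_zero, mul_one, mul_left_comm, mul_div_mul_left _ _ this]
      rfl
    · refine (tendsto_theta_cpow hp ((tendsto_const_nhds (x := (1 : ℂ))).div hjk hjk0)
        (one_div_ne_zero hjk0) (s := -(2 * ζ)) (by linarith) (by linarith)).congr' ?_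
      filter_upwards [hpne] with a ha
      congr 1
      push_cast
      rw [Complex.cpow_neg, mul_comm (2 : ℂ), Complex.cpow_mul_ofNat]
      simp only [Pi.div_apply, div_eq_mul_inv, mul_inv]
      ring
    · refine (tendsto_theta_cpow hp ((hxj j).div (hxj k) hk)
        (div_ne_zero hj hk) le_rfl zero_le_one).congr' ?_
      filter_upwards [hpne] with a ha
      have := hpz a ha
      congr 1
      rw [Complex.ofReal_zero, Complex.cpow_zero, mul_one, mul_div_mul_left _ _ this]
      rfl
    · refine (tendsto_theta hq ((hxj k).div (hxj j) hj) (div_ne_zero hk hj)).congr' ?_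
      filter_upwards [hpne] with a ha
      rw [mul_div_mul_left _ _ (hpz a ha)]
      rfl

end LimitWeight

section LimitWeightFormula

variable {n : ℕ} {q t : ℂ} {τ : Fin 6 → ℂ} {α : Fin 6 → ℝ} {ζ : ℝ} {T : Finset (Fin 6)}

/-- The gamma factors of one parameter contribute to the limiting weight for boundary values of
    `α_r`
only. -/
lemma limGamma_mul_limGamma (hα : IsExponent α ζ T) (x : ℂ) (r : Fin 6) :
    limGamma (shift T r + α r + ζ) q (τ r * x) * limGamma (α r - ζ) q (τ r / x) =
      ((if r ∈ T ∧ α r + ζ = 0 then qPoch (q / (τ r * x)) q else 1) *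
        (if r ∉ T ∧ α r = 1 + ζ then qPoch (q * x / τ r) q else 1)) /
      ((if r ∈ T ∧ α r = ζ then qPoch (τ r / x) q else 1) *
        (if r ∉ T ∧ α r = -ζ then qPoch (τ r * x) q else 1)) *
      ((if ζ = -1 / 2 ∧ r ∈ T ∧ α r = 1 / 2 then qPoch (q * x / τ r) q else 1) /
        (if ζ = -1 / 2 ∧ r ∈ T ∧ α r = -1 / 2 then qPoch (τ r * x) q else 1)) := by
  have h1 := hα.zeta_ge
  have h2 := hα.zeta_neg
  have hdiv : q / (τ r / x) = q * x / τ r := by rw [div_div_eq_mul_div]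
  unfold limGamma
  rw [hdiv]
  by_cases hr : r ∈ T
  · have hm := hα.mem r hr
    have e1 : ((shift T r : ℝ) + α r + ζ = 1) ↔ (r ∈ T ∧ α r + ζ = 0) := by
      simp only [shift, hr, if_true, Nat.cast_one, true_and]
      constructor <;> intro h <;> linarith
    have e2 : ((shift T r : ℝ) + α r + ζ = 0) ↔ (ζ = -1 / 2 ∧ r ∈ T ∧ α r = -1 / 2) := by
      simp only [shift, hr, if_true, Nat.cast_one, true_and]
      exact ⟨fun h => ⟨by linarith, by linarith⟩, fun h => by linarith [h.1, h.2]⟩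
    have e3 : (α r - ζ = 1) ↔ (ζ = -1 / 2 ∧ r ∈ T ∧ α r = 1 / 2) := by
      simp only [hr, true_and]
      exact ⟨fun h => ⟨by linarith, by linarith⟩, fun h => by linarith [h.1, h.2]⟩
    have e4 : (α r - ζ = 0) ↔ (r ∈ T ∧ α r = ζ) := by
      simp only [hr, true_and]
      exact sub_eq_zero
    rw [if_congr e1 rfl rfl, if_congr e2 rfl rfl, if_congr e3 rfl rfl, if_congr e4 rfl rfl,
      if_neg (fun h => h.1 hr : ¬(r ∉ T ∧ α r = 1 + ζ)), if_neg (fun h => h.1 hr : ¬(r ∉ T ∧ α r =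
          -ζ))]
    simp only [div_eq_mul_inv, mul_inv, mul_one]
    ring
  · have hm := hα.notMem r hr
    have e1 : ¬((shift T r : ℝ) + α r + ζ = 1) := by
      simp only [shift, hr, if_false, Nat.cast_zero]
      intro h
      linarith
    have e2 : ((shift T r : ℝ) + α r + ζ = 0) ↔ (r ∉ T ∧ α r = -ζ) := by
      simp only [shift, hr, if_false, Nat.cast_zero, not_false_eq_true, true_and]
      constructor <;> intro h <;> linarith
    have e3 : (α r - ζ = 1) ↔ (r ∉ T ∧ α r = 1 + ζ) := by
      simp only [hr, not_false_eq_true, true_and]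
      constructor <;> intro h <;> linarith
    have e4 : ¬(α r - ζ = 0) := by
      intro h
      linarith
    rw [if_neg e1, if_congr e2 rfl rfl, if_congr e3 rfl rfl, if_neg e4,
      if_neg (fun h => hr h.1 : ¬(r ∈ T ∧ α r + ζ = 0)), if_neg (fun h => hr h.1 : ¬(r ∈ T ∧ α r =
          ζ)),
      if_neg (fun h => hr h.2.1 : ¬(ζ = -1 / 2 ∧ r ∈ T ∧ α r = 1 / 2)),
      if_neg (fun h => hr h.2.1 : ¬(ζ = -1 / 2 ∧ r ∈ T ∧ α r = -1 / 2))]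
    simp only [div_eq_mul_inv, inv_one, mul_one, one_mul]
    ring

lemma limTheta_eq (hζ0 : -1 / 2 ≤ ζ) (hζ1 : ζ < 0) (hq : ‖q‖ < 1) {x : ℂ} (h : qPoch (q * x) q ≠ 0)
    :
    limTheta (-(2 * ζ)) (1 / x) = if ζ = -1 / 2 then qPoch x q / qPoch (q * x) q else 1 := by
  unfold limTheta
  rw [if_neg (by linarith : ¬(-(2 * ζ) = 0)), one_mul, one_div_one_div]
  refine if_congr (by constructor <;> intro h <;> linarith) ?_ rfl
  rw [qPoch_eq_mul hq x, mul_div_cancel_right₀ _ h]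

lemma limOne_eq (hα : IsExponent α ζ T) (hq : ‖q‖ < 1) {x : ℂ} (h : qPoch (q * x ^ 2) q ≠ 0) :
    limOne n q t τ α ζ T x =
    ((∏ r : Fin 6 with r ∈ T ∧ α r + ζ = 0, qPoch (q / (τ r * x)) q) *
      ∏ r : Fin 6 with r ∉ T ∧ α r = 1 + ζ, qPoch (q * x / τ r) q) /
    ((∏ r : Fin 6 with r ∈ T ∧ α r = ζ, qPoch (τ r / x) q) *
      ∏ r : Fin 6 with r ∉ T ∧ α r = -ζ, qPoch (τ r * x) q) *
    (if ζ = -1 / 2 then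
      (qPoch (x ^ 2) q * ∏ r : Fin 6 with r ∈ T ∧ α r = 1 / 2, qPoch (q * x / τ r) q) /
        (qPoch (q * x ^ 2) q * ∏ r : Fin 6 with r ∈ T ∧ α r = -1 / 2, qPoch (τ r * x) q)
    else 1) *
    theta (q * x / (t ^ (n - 1) * ∏ r ∈ T, τ r)) q := by
  unfold limOne
  rw [Finset.prod_congr rfl fun r _ => limGamma_mul_limGamma hα x r, Finset.prod_mul_distrib,
    Finset.prod_div_distrib, Finset.prod_div_distrib, Finset.prod_mul_distrib,
    Finset.prod_mul_distrib, limTheta_eq hα.zeta_ge hα.zeta_neg hq h]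
  simp only [Finset.prod_filter]
  split_ifs with hζ
  · simp only [hζ, true_and]
    simp only [div_eq_mul_inv, mul_inv]
    ring
  · simp only [hζ, false_and, if_false, Finset.prod_const_one]
    ring

lemma limPair_eq (hζ0 : -1 / 2 ≤ ζ) (hζ1 : ζ < 0) (hq : ‖q‖ < 1) {x y : ℂ}
    (h : qPoch (q * (x * y)) q ≠ 0) :
    limPair q t ζ x y = (qPoch (x / y) q * qPoch (y / x) q) /
      (qPoch (t * x / y) q * qPoch (t * y / x) q) *
    if ζ = -1 / 2 then
      (qPoch (x * y) q * qPoch (q * x * y / t) q) / (qPoch (t * x * y) q * qPoch (q * x * y) q)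
    else 1 := by
  have hg : ∀ y, limGamma 0 q y = 1 / qPoch y q := fun y => by
    unfold limGamma
    rw [if_neg zero_ne_one, if_pos rfl]
  unfold limPair
  have e1 : limGamma (1 + 2 * ζ) q (t * (x * y)) =
      1 / if ζ = -1 / 2 then qPoch (t * x * y) q else 1 := by
    unfold limGamma
    rw [if_neg (by linarith : ¬(1 + 2 * ζ = 1)), mul_assoc t]
    congr 1
    exact if_congr (by constructor <;> intro h <;> linarith) rfl rfl
  have e2 : limGamma (-(2 * ζ)) q (t / (x * y)) =
      if ζ = -1 / 2 then qPoch (q * x * y / t) q else 1 := by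
    unfold limGamma
    rw [if_neg (by linarith : ¬(-(2 * ζ) = 0)), div_one, div_div_eq_mul_div, ← mul_assoc]
    exact if_congr (by constructor <;> intro h <;> linarith) rfl rfl
  have e3 : limTheta 0 (x / y) * theta (y / x) q = qPoch (x / y) q * qPoch (y / x) q := by
    unfold limTheta theta
    rw [if_pos rfl, if_neg zero_ne_one, qPoch_eq_mul hq (x / y), div_div_eq_mul_div, mul_div_assoc
        q]
    ring
  rw [e1, e2, e3, hg, hg, limTheta_eq hζ0 hζ1 hq h, ← mul_assoc q]
  split_ifs
  · simp only [div_eq_mul_inv, mul_inv]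
    ring
  · simp only [div_eq_mul_inv, mul_inv]
    ring

/-- Generically, the limit of `brokenWeight` is the weight of the limiting integral. -/
lemma limOne_mul_limPair_eq_limitWeight (hα : IsExponent α ζ T) (hq : ‖q‖ < 1) {z : Fin n → ℂ}
    (h1 : ∀ j, qPoch (q * z j ^ 2) q ≠ 0) (h2 : ∀ j k, j ≠ k → qPoch (q * (z j * z k)) q ≠ 0) :
    (∏ j, limOne n q t τ α ζ T (z j)) * ∏ j, ∏ k ∈ Finset.Ioi j, limPair q t ζ (z j) (z k) =
      limitWeight n q t τ α ζ T z := by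
  unfold limitWeight
  rw [mul_comm]
  refine congrArg₂ (· * ·) ?_ ?_
  · refine Finset.prod_congr rfl fun j _ => Finset.prod_congr rfl fun k hk => ?_
    exact limPair_eq hα.zeta_ge hα.zeta_neg hq (h2 j k (Finset.mem_Ioi.1 hk).ne)
  · exact Finset.prod_congr rfl fun j _ => limOne_eq hα hq (h1 j)

lemma eventually_qPoch_ne_zero {q : ℂ} (hq : ‖q‖ < 1) {φ : (Fin n → ℂ) → ℂ} {z : Fin n → ℂ}
    (hφ : ContinuousAt φ z) (h : qPoch (φ z) q ≠ 0) : ∀ᶠ z in 𝓝 z, qPoch (φ z) q ≠ 0 :=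
  (Tendsto.qPoch hφ.tendsto tendsto_const_nhds hq).eventually_ne h

lemma eventually_imp {X : Type*} {l : Filter X} {a : Prop} {P : X → Prop} (h : a → ∀ᶠ x in l, P x) :
    ∀ᶠ x in l, a → P x := by
  by_cases ha : a
  · exact (h ha).mono fun x hx _ => hx
  · exact Eventually.of_forall fun x h => absurd h ha

lemma LimitRegular.eventually (hq : ‖q‖ < 1) {z : Fin n → ℂ} (h : LimitRegular q t τ α ζ T z) :
    ∀ᶠ z in 𝓝 z, LimitRegular q t τ α ζ T z := by
  have hc : ∀ j, ContinuousAt (fun z : Fin n → ℂ => z j) z := fun j => (continuous_apply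
      j).continuousAt
  have h0 : ∀ᶠ z in 𝓝 z, ∀ j, z j ≠ 0 := eventually_all.2 fun j => (hc j).eventually_ne (h.ne_zero
      j)
  have h1 : ∀ᶠ z in 𝓝 z, ∀ j, ∀ r, r ∈ T → α r = ζ → qPoch (τ r / z j) q ≠ 0 :=
    eventually_all.2 fun j => eventually_all.2 fun r => eventually_imp fun hr => eventually_imp fun
        hα =>
      eventually_qPoch_ne_zero hq (continuousAt_const.div (hc j) (h.ne_zero j)) (h.div j r hr hα)
  have h2 : ∀ᶠ z in 𝓝 z, ∀ j, ∀ r, r ∉ T → α r = -ζ → qPoch (τ r * z j) q ≠ 0 :=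
    eventually_all.2 fun j => eventually_all.2 fun r => eventually_imp fun hr => eventually_imp fun
        hα =>
      eventually_qPoch_ne_zero hq (continuousAt_const.mul (hc j)) (h.mul j r hr hα)
  have h3 : ∀ᶠ z in 𝓝 z, ζ = -1 / 2 → ∀ j, ∀ r, r ∈ T → α r = -1 / 2 → qPoch (τ r * z j) q ≠ 0 :=
    eventually_imp fun hζ => eventually_all.2 fun j => eventually_all.2 fun r =>
      eventually_imp fun hr => eventually_imp fun hα =>
      eventually_qPoch_ne_zero hq (continuousAt_const.mul (hc j)) (h.mul_half hζ j r hr hα)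
  have h4 : ∀ᶠ z in 𝓝 z, ∀ j k, j ≠ k → qPoch (t * z j / z k) q ≠ 0 :=
    eventually_all.2 fun j => eventually_all.2 fun k => eventually_imp fun hjk =>
      eventually_qPoch_ne_zero hq ((continuousAt_const.mul (hc j)).div (hc k) (h.ne_zero k))
        (h.cross j k hjk)
  have h5 : ∀ᶠ z in 𝓝 z, ζ = -1 / 2 → ∀ j k, j ≠ k → qPoch (t * (z j * z k)) q ≠ 0 :=
    eventually_imp fun hζ => eventually_all.2 fun j => eventually_all.2 fun k => eventually_imp fun
        hjk =>
      eventually_qPoch_ne_zero hq (continuousAt_const.mul ((hc j).mul (hc k))) (h.cross_half hζ j k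
          hjk)
  filter_upwards [h0, h1, h2, h3, h4, h5] with z h0 h1 h2 h3 h4 h5
  exact ⟨h0, h1, h2, h3, h4, h5⟩

lemma IsLimitContour.limitRegular {mf mg : ℕ} {C : CircleChain}
    (hC : IsLimitContour q t (tilde q mf mg τ) α ζ T C) (hq : ‖q‖ < 1) (hq0 : q ≠ 0)
    {z : Fin n → ℂ} (hz : z ∈ piSet n (carrier C)) : LimitRegular q t τ α ζ T z := by
  have h0 : ∀ j, z j ≠ 0 := fun j h => hC.toIsContour.zero_notMem (h ▸ hz j)
  have hin : ∀ j, z j ∉ inside C := fun j h => h.1 (hz j)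
  have hout : ∀ j, z j ∉ outside C := fun j h => h.1 (hz j)
  have htil : ∀ r i, q ^ (i + poleOrder mf mg r) * tilde q mf mg τ r = q ^ i * τ r := fun r i => by
    rw [tilde_apply, pow_add]
    field_simp
  have hinv : ∀ {a b : ℂ}, a * b = 1 → b = a⁻¹ := fun h => (inv_eq_of_mul_eq_one_right h).symm
  refine ⟨h0, fun j r hr hα => ?_, fun j r hr hα => ?_, fun hζ j r hr hα => ?_, fun j k _ => ?_,
    fun hζ j k _ => ?_⟩ <;> rw [qPoch_ne_zero_iff hq] <;> intro i e
  · refine hin j ?_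
    have := hC.contains r hr hα (i + poleOrder mf mg r)
    rwa [htil, show q ^ i * τ r = z j by
      rw [div_mul_eq_mul_div, div_eq_one_iff_eq (h0 j)] at e
      rw [← e, mul_comm]] at this
  · refine hout j ?_
    have := hC.excludes r hr hα (i + poleOrder mf mg r)
    rwa [htil, ← hinv (show q ^ i * τ r * z j = 1 by rw [← e]; ring)] at this
  · refine hout j ?_
    have := hC.excludes_half hζ r hr hα (i + poleOrder mf mg r)
    rwa [htil, ← hinv (show q ^ i * τ r * z j = 1 by rw [← e]; ring)] at this
  · refine hin k ?_
    have := hC.cross i (z j) (Or.inl (hz j))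
    rwa [show q ^ i * t * z j = z k by
      rw [div_mul_eq_mul_div, div_eq_one_iff_eq (h0 k)] at e
      rw [← e]
      ring] at this
  · refine hout k ?_
    have := hC.cross_half hζ i (z j) (Or.inl (hz j)) (h0 j)
    rwa [← hinv (show q ^ i * t * z j * z k = 1 by rw [← e]; ring)] at this

end LimitWeightFormula

/-! ### Bounds and limits of the integrand -/

section Series

open MvPolynomial

variable {n : ℕ}

lemma eventually_norm_lt {δ : ℝ} (hδ : 0 < δ) : ∀ᶠ p in 𝓝[≠] (0 : ℂ), ‖p‖ < δ := by
  refine nhdsWithin_le_nhds ?_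
  filter_upwards [Metric.ball_mem_nhds (0 : ℂ) hδ] with p hp
  simpa using hp

lemma RatFun.eval_zero (z : Fin n → ℂ) : RatFun.eval (0 : RatFun n) z = 0 := by
  rw [RatFun.eval, IsFractionRing.num_zero, map_zero, zero_div]

/-- Off the zero set of a polynomial, `p^{-v} F_p` is bounded on compact sets and converges to the
leading coefficient. -/
lemma HasLeadingTerm.exists_polynomial {F : ℂ → (Fin n → ℂ) → ℂ} {v : ℝ} {l : RatFun n}
    (h : HasLeadingTerm F v l) : ∃ P : MvPolynomial (Fin n) ℂ, P ≠ 0 ∧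
      (∀ K : Set (Fin n → ℂ), IsCompact K → (∀ z ∈ K, (∀ i, z i ≠ 0) ∧ eval z P ≠ 0) →
        ∃ B, ∀ᶠ p in 𝓝[≠] (0 : ℂ), ∀ z ∈ K, ‖p ^ ((-v : ℝ) : ℂ) * F p z‖ ≤ B) ∧
      ∀ z : Fin n → ℂ, (∀ i, z i ≠ 0) → eval z P ≠ 0 →
        Tendsto (fun p => p ^ ((-v : ℝ) : ℂ) * F p z) (𝓝[≠] 0) (𝓝 (l.eval z)) := by
  obtain ⟨a, ha, hv, rfl⟩ := h
  obtain ⟨P, hP, -, hconv⟩ := ha.converges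
  have key : ∀ K : Set (Fin n → ℂ), IsCompact K → (∀ z ∈ K, (∀ i, z i ≠ 0) ∧ eval z P ≠ 0) →
      ∃ b : ℝ → ℝ, Summable b ∧ ∀ᶠ p in 𝓝[≠] (0 : ℂ), p ≠ 0 ∧ ∀ z ∈ K,
        HasSum (fun s : ℝ => (a s).eval z * p ^ ((s - v : ℝ) : ℂ)) (p ^ ((-v : ℝ) : ℂ) * F p z) ∧
        ∀ s : ℝ, ‖(a s).eval z * p ^ ((s - v : ℝ) : ℂ)‖ ≤ b s := by
    intro K hK hKP
    obtain ⟨δ, hδ, ⟨b, hb, hbK⟩, hsum⟩ := hconv K hK hKP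
    refine ⟨fun s => b s * δ ^ (-v), hb.mul_right _, ?_⟩
    filter_upwards [eventually_norm_lt hδ, self_mem_nhdsWithin] with p hpδ hp0
    have hp0 : p ≠ 0 := hp0
    have hpn : 0 < ‖p‖ := norm_pos_iff.2 hp0
    refine ⟨hp0, fun z hz => ⟨?_, fun s => ?_⟩⟩
    · refine ((hsum p hpn hpδ z hz).mul_left (p ^ ((-v : ℝ) : ℂ))).congr_fun ?_
      intro s
      rw [sub_eq_add_neg, Complex.ofReal_add, Complex.cpow_add _ _ hp0]
      ring
    · by_cases hs : a s = 0
      · rw [hs, RatFun.eval_zero, zero_mul, norm_zero]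
        have := hbK s z hz
        rw [hs, RatFun.eval_zero, norm_zero, zero_mul] at this
        positivity
      · have hvs : v ≤ s := hv.2 hs
        rw [norm_mul, norm_cpow_ofReal hp0]
        calc ‖(a s).eval z‖ * ‖p‖ ^ (s - v) ≤ ‖(a s).eval z‖ * δ ^ (s - v) := by
              have := Real.rpow_le_rpow hpn.le hpδ.le (sub_nonneg.2 hvs)
              gcongr
          _ = ‖(a s).eval z‖ * δ ^ s * δ ^ (-v) := by
              rw [sub_eq_add_neg, Real.rpow_add hδ]
              ring
          _ ≤ b s * δ ^ (-v) := by
              have := hbK s z hz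
              gcongr
  refine ⟨P, hP, fun K hK hKP => ?_, fun z hz0 hzP => ?_⟩
  · obtain ⟨b, hb, hev⟩ := key K hK hKP
    refine ⟨∑' s, b s, hev.mono fun p hp z hz => ?_⟩
    obtain ⟨h1, h2⟩ := hp.2 z hz
    exact h1.norm_le_of_bounded hb.hasSum h2
  · obtain ⟨b, hb, hev⟩ := key {z} isCompact_singleton (by
      intro w hw
      rw [Set.mem_singleton_iff.1 hw]
      exact ⟨hz0, hzP⟩)
    have hlim := tendsto_tsum_of_dominated_convergence (𝓕 := 𝓝[≠] (0 : ℂ))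
      (f := fun (p : ℂ) (s : ℝ) => (a s).eval z * p ^ ((s - v : ℝ) : ℂ))
      (g := fun s => if s = v then (a v).eval z else 0) (bound := b) hb ?_ ?_
    · rw [tsum_ite_eq] at hlim
      refine hlim.congr' ?_
      filter_upwards [hev] with p hp
      exact (hp.2 z rfl).1.tsum_eq
    · intro s
      by_cases hs : a s = 0
      · have hsv : s ≠ v := fun e => hv.1 (e ▸ hs)
        rw [if_neg hsv, hs]
        simp only [RatFun.eval_zero, zero_mul]
        exact tendsto_const_nhds
      · have hvs : v ≤ s := hv.2 hs
        have := (tendsto_cpow tendsto_id (sub_nonneg.2 hvs)).const_mul ((a s).eval z)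
        have e : (if s = v then (a v).eval z else 0) =
            (a s).eval z * if s - v = 0 then 1 else 0 := by
          by_cases h : s = v
          · simp [h]
          · simp [h, sub_eq_zero]
        rw [e]
        exact this
    · filter_upwards [hev] with p hp s
      exact (hp.2 z rfl).2 s

end Series

section PoleFactor

open MvPolynomial

variable {n : ℕ} {q : ℂ}

/-- For `p → 0` the powers of `p` stay away from `w p^s`, except where `w = 1`. -/
lemma eventually_mul_cpow_ne_zpow {K : Set ℂ} (hK : IsCompact K) (hK0 : 0 ∉ K) (s : ℝ) :
    ∀ᶠ p in 𝓝[≠] (0 : ℂ), ∀ w ∈ K, w ≠ 1 → ∀ i : ℤ, w * p ^ (s : ℂ) ≠ p ^ i := by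
  obtain ⟨M, hM1, hM⟩ : ∃ M : ℝ, 1 < M ∧ ∀ w ∈ K, ‖w‖ < M ∧ ‖w‖⁻¹ < M := by
    obtain ⟨A, hA⟩ := hK.exists_bound_of_continuousOn (f := fun w => w) continuousOn_id
    obtain ⟨A', hA'⟩ := hK.exists_bound_of_continuousOn (f := fun w => w⁻¹)
      (continuousOn_id.inv₀ fun w hw h => hK0 (h ▸ hw))
    refine ⟨max 1 (max A A') + 1, by linarith [le_max_left 1 (max A A')], fun w hw => ⟨?_, ?_⟩⟩
    · linarith [hA w hw, (le_max_left A A').trans (le_max_right 1 (max A A'))]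
    · have := hA' w hw
      rw [norm_inv] at this
      linarith [(le_max_right A A').trans (le_max_right 1 (max A A'))]
  -- `c` is a lower bound for the nonzero values of `|i - s|`
  obtain ⟨c, hc0, hc⟩ : ∃ c : ℝ, 0 < c ∧ ∀ i : ℤ, (i : ℝ) ≠ s → c ≤ |(i : ℝ) - s| := by
    by_cases hs : Int.fract s = 0
    · refine ⟨1, one_pos, fun i hi => ?_⟩
      obtain ⟨k, rfl⟩ : ∃ k : ℤ, (k : ℝ) = s := ⟨⌊s⌋, by
        have := Int.self_sub_floor s
        linarith⟩
      have : i - k ≠ 0 := fun h => hi (by exact_mod_cast sub_eq_zero.1 h)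
      exact_mod_cast Int.one_le_abs this
    · have h1 : 0 < Int.fract s := lt_of_le_of_ne (Int.fract_nonneg s) (Ne.symm hs)
      have h2 := Int.fract_lt_one s
      refine ⟨min (Int.fract s) (1 - Int.fract s), lt_min h1 (by linarith), fun i _ => ?_⟩
      have h3 := Int.self_sub_floor s
      rcases le_or_gt i ⌊s⌋ with h | h
      · have : (i : ℝ) ≤ ⌊s⌋ := by exact_mod_cast h
        rw [abs_sub_comm]
        exact (min_le_left _ _).trans ((by linarith : Int.fract s ≤ s - i).trans (le_abs_self _))
      · have : (⌊s⌋ : ℝ) + 1 ≤ i := by exact_mod_cast h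
        exact (min_le_right _ _).trans ((by linarith : 1 - Int.fract s ≤ i - s).trans (le_abs_self
            _))
  have hlim := (tendsto_norm_rpow hc0 1).eventually (gt_mem_nhds (inv_pos.2 (one_pos.trans hM1)))
  have h1 := eventually_norm_lt one_pos
  filter_upwards [hlim, h1, self_mem_nhdsWithin] with p hp hp1 hp0 w hw hw1 i heq
  have hp0 : p ≠ 0 := hp0
  have hpn : 0 < ‖p‖ := norm_pos_iff.2 hp0
  rw [mul_one] at hp
  by_cases his : (i : ℝ) = s
  · refine hw1 ?_
    rw [← his, Complex.ofReal_intCast, Complex.cpow_intCast] at heq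
    exact mul_right_cancel₀ (zpow_ne_zero i hp0) (heq.trans (one_mul _).symm)
  · have hn := congrArg norm heq
    rw [norm_mul, norm_cpow_ofReal hp0, norm_zpow, ← Real.rpow_intCast] at hn
    have hn' : ‖w‖ = ‖p‖ ^ ((i : ℝ) - s) := by
      rw [Real.rpow_sub hpn, eq_div_iff (Real.rpow_pos_of_pos hpn s).ne', hn]
    have habs := hc i his
    have hMinv : ‖p‖ ^ |(i : ℝ) - s| < M⁻¹ :=
      (Real.rpow_le_rpow_of_exponent_ge hpn hp1.le habs).trans_lt hp
    rcases abs_cases ((i : ℝ) - s) with ⟨h, _⟩ | ⟨h, _⟩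
    · rw [h, ← hn'] at hMinv
      have := (hM w hw).2
      have hw0 : 0 < ‖w‖ := norm_pos_iff.2 fun h => hK0 (h ▸ hw)
      rw [lt_inv_comm₀ hw0 (one_pos.trans hM1)] at hMinv
      linarith
    · rw [h, Real.rpow_neg hpn.le, ← hn'] at hMinv
      have hw0 : 0 < ‖w‖ := norm_pos_iff.2 fun h => hK0 (h ▸ hw)
      rw [inv_lt_inv₀ hw0 (one_pos.trans hM1)] at hMinv
      linarith [(hM w hw).1]

/-- For small `p`, the rescaled pole factor has no zeros on a compact set, away from the zero set of
    a
polynomial. -/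
lemma exists_polynomial_poleFactor (n M : ℕ) (hq0 : q ≠ 0) {u : ℂ} (hu : u ≠ 0) (a ζ : ℝ) :
    ∃ P : MvPolynomial (Fin n) ℂ, P ≠ 0 ∧ ∀ K : Set (Fin n → ℂ), IsCompact K →
      (∀ z ∈ K, (∀ i, z i ≠ 0) ∧ eval z P ≠ 0) → ∀ᶠ p in 𝓝[≠] (0 : ℂ), ∀ z ∈ K,
        (fun i => p ^ (ζ : ℂ) * z i) ∈ regularSet n M q p (u * p ^ (a : ℂ)) := by
  refine ⟨∏ j, ∏ k ∈ Finset.range M, ((C u * X j - C (q ^ (k + 1))) *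
    (C u - C (q ^ (k + 1)) * X j)), ?_, fun K hK hKP => ?_⟩
  · refine Finset.prod_ne_zero_iff.2 fun j _ => Finset.prod_ne_zero_iff.2 fun k _ =>
      mul_ne_zero (fun h => ?_) fun h => ?_
    · have := congrArg (eval fun _ => (0 : ℂ)) h
      simp [hq0] at this
    · have := congrArg (eval fun _ => (0 : ℂ)) h
      simp [hu] at this
  · have hzj : ∀ z ∈ K, ∀ j, ∀ k ∈ Finset.range M,
        u * z j / q ^ (k + 1) ≠ 1 ∧ u / z j / q ^ (k + 1) ≠ 1 := by
      intro z hz j k hk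
      have h1 := (hKP z hz).2
      rw [map_prod, Finset.prod_ne_zero_iff] at h1
      have h2 := h1 j (Finset.mem_univ j)
      rw [map_prod, Finset.prod_ne_zero_iff] at h2
      have h3 := h2 k hk
      simp only [map_mul, map_sub, eval_C, eval_X, map_pow] at h3
      obtain ⟨h4, h5⟩ := mul_ne_zero_iff.1 h3
      have hzj := (hKP z hz).1 j
      refine ⟨fun e => h4 ?_, fun e => h5 ?_⟩
      · rw [div_eq_one_iff_eq (by positivity)] at e
        rw [e, sub_self]
      · rw [div_eq_one_iff_eq (by positivity), div_eq_iff hzj] at e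
        rw [← e, sub_self]
    have hA : ∀ j k, IsCompact ((fun z : Fin n → ℂ => u * z j / q ^ (k + 1)) '' K) := fun j k =>
      hK.image (by fun_prop)
    have hB : ∀ j k, IsCompact ((fun z : Fin n → ℂ => u / z j / q ^ (k + 1)) '' K) := fun j k =>
      hK.image_of_continuousOn ((continuousOn_const.div (continuous_apply j).continuousOn
        fun z hz => (hKP z hz).1 j).div_const _)
    have hev : ∀ᶠ p in 𝓝[≠] (0 : ℂ), ∀ j, ∀ k ∈ Finset.range M,
        (∀ w ∈ (fun z : Fin n → ℂ => u * z j / q ^ (k + 1)) '' K, w ≠ 1 →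
          ∀ i : ℤ, w * p ^ ((a + ζ : ℝ) : ℂ) ≠ p ^ i) ∧
        ∀ w ∈ (fun z : Fin n → ℂ => u / z j / q ^ (k + 1)) '' K, w ≠ 1 →
          ∀ i : ℤ, w * p ^ ((a - ζ : ℝ) : ℂ) ≠ p ^ i := by
      refine eventually_all.2 fun j => (Finset.eventually_all _).2 fun k _ => ?_
      refine (eventually_mul_cpow_ne_zpow (hA j k) ?_ _).and
        (eventually_mul_cpow_ne_zpow (hB j k) ?_ _)
      · rintro ⟨z, hz, h⟩
        have := (hKP z hz).1 j
        exact absurd h (by positivity)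
      · rintro ⟨z, hz, h⟩
        have := (hKP z hz).1 j
        exact absurd h (by positivity)
    have h1 := eventually_norm_lt one_pos
    filter_upwards [hev, h1, self_mem_nhdsWithin] with p hp hp1 hp0 z hz
    have hp0 : p ≠ 0 := hp0
    have hpc : ∀ x : ℝ, p ^ (x : ℂ) ≠ 0 := fun x h => hp0 ((Complex.cpow_eq_zero_iff _ _).1 h).1
    have hζ := hpc ζ
    have ha := hpc a
    have hz0 : ∀ i, p ^ (ζ : ℂ) * z i ≠ 0 := fun i => mul_ne_zero hζ ((hKP z hz).1 i)
    refine ⟨hz0, ?_⟩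
    rw [poleFactor_eq hp0 hq0 (mul_ne_zero hu ha) M hz0]
    refine Finset.prod_ne_zero_iff.2 fun j _ => mul_ne_zero
      (Finset.prod_ne_zero_iff.2 fun k hk => ?_) (Finset.prod_ne_zero_iff.2 fun k hk => ?_)
    · have hj := (hKP z hz).1 j
      rw [theta_ne_zero_iff hp1 hp0 (by positivity)]
      intro i e
      refine (hp j k hk).2 _ ⟨z, hz, rfl⟩ (hzj z hz j k hk).2 i ?_
      rw [← e, Complex.ofReal_sub, Complex.cpow_sub _ _ hp0]
      field_simp
    · have hj := (hKP z hz).1 j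
      rw [theta_ne_zero_iff hp1 hp0 (by positivity)]
      intro i e
      refine (hp j k hk).1 _ ⟨z, hz, rfl⟩ (hzj z hz j k hk).1 i ?_
      rw [← e, Complex.ofReal_add, Complex.cpow_add _ _ hp0]
      field_simp

end PoleFactor

section Bound

open MvPolynomial

variable {n : ℕ}

/-- A locally uniform bound off the zero set of a polynomial extends across the zero set, by the
maximum principle on small discs whose boundary circles avoid the zero set. -/
theorem exists_bound_of_bound_off_zeros {ι : Type*} {l : Filter ι} {Φ : ι → (Fin n → ℂ) → ℂ}
    {A N : Set (Fin n → ℂ)} (hA : IsCompact A) (hN : IsOpen N) (hAN : A ⊆ N)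
    {P : MvPolynomial (Fin n) ℂ} (hP : P ≠ 0) (hd : ∀ᶠ i in l, DifferentiableOn ℂ (Φ i) N)
    (hB : ∀ K : Set (Fin n → ℂ), IsCompact K → K ⊆ N → (∀ z ∈ K, eval z P ≠ 0) →
      ∃ B : ℝ, ∀ᶠ i in l, ∀ z ∈ K, ‖Φ i z‖ ≤ B) :
    ∃ B : ℝ, ∀ᶠ i in l, ∀ z ∈ A, ‖Φ i z‖ ≤ B := by
  refine hA.induction_on (p := fun S => ∃ B : ℝ, ∀ᶠ i in l, ∀ z ∈ S, ‖Φ i z‖ ≤ B)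
    ⟨0, Eventually.of_forall fun i z hz => absurd hz (Set.notMem_empty z)⟩ ?_ ?_ ?_
  · rintro S S' hS ⟨B, hB⟩
    exact ⟨B, hB.mono fun i hi z hz => hi z (hS hz)⟩
  · rintro S S' ⟨B, hB⟩ ⟨B', hB'⟩
    refine ⟨max B B', ?_⟩
    filter_upwards [hB, hB'] with i h1 h2 z hz
    rcases hz with hz | hz
    · exact (h1 z hz).trans (le_max_left _ _)
    · exact (h2 z hz).trans (le_max_right _ _)
  intro z₀ hz₀
  -- a direction in which the polynomial does not vanish identically
  obtain ⟨w, hw⟩ : ∃ w, eval w P ≠ 0 := by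
    by_contra h
    push Not at h
    exact hP (MvPolynomial.funext fun w => by rw [h w, map_zero])
  set d : Fin n → ℂ := w - z₀ with hdw
  set g : Polynomial ℂ := aeval (fun i => Polynomial.C (z₀ i) + Polynomial.C (d i) * Polynomial.X) P
    with hg
  have hge : ∀ c : ℂ, g.eval c = eval (z₀ + c • d) P := by
    intro c
    have h1 : Polynomial.eval c g = Polynomial.aeval c g := by
      rw [Polynomial.coe_aeval_eq_eval]
    rw [h1, hg, ← AlgHom.comp_apply, comp_aeval, ← coe_aeval_eq_eval]
    refine congrArg (fun φ => aeval φ P) (_root_.funext fun i => ?_)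
    simp only [map_add, map_mul, Polynomial.coe_aeval_eq_eval, Polynomial.eval_C, Polynomial.eval_X,
      Pi.add_apply, Pi.smul_apply, smul_eq_mul, mul_comm]
  have hg0 : g ≠ 0 := by
    intro h
    have := hge 1
    rw [h, Polynomial.eval_zero, one_smul, hdw, add_sub_cancel] at this
    exact hw this.symm
  obtain ⟨ρ, hρ, hρN⟩ := Metric.isOpen_iff.1 hN z₀ (hAN hz₀)
  obtain ⟨r, hr, hr0, hrρ⟩ := (((g.roots.toFinset.image fun c =>
      ‖c‖).finite_toSet.countable).dense_compl
    ℝ).exists_mem_open isOpen_Ioo (Set.nonempty_Ioo.2 (by positivity : 0 < ρ / (2 * (‖d‖ + 1))))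
  have hrd : ∀ c : ℂ, ‖c‖ ≤ r → ‖c • d‖ < ρ / 2 := by
    intro c hc
    rw [norm_smul]
    calc ‖c‖ * ‖d‖ ≤ r * (‖d‖ + 1) := by
          gcongr
          linarith
      _ < ρ / (2 * (‖d‖ + 1)) * (‖d‖ + 1) := by gcongr
      _ = ρ / 2 := by
        field_simp
  set S : Set (Fin n → ℂ) := (fun c : ℂ => z₀ + c • d) '' Metric.sphere 0 r with hS
  have hSc : IsCompact S := (isCompact_sphere 0 r).image (by fun_prop)
  have hopen : IsOpen ({z : Fin n → ℂ | eval z P ≠ 0} ∩ Metric.ball z₀ ρ) :=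
    (isOpen_ne_fun P.continuous_eval continuous_const).inter Metric.isOpen_ball
  have hSsub : S ⊆ {z : Fin n → ℂ | eval z P ≠ 0} ∩ Metric.ball z₀ ρ := by
    rintro _ ⟨c, hc, rfl⟩
    rw [mem_sphere_zero_iff_norm] at hc
    refine ⟨?_, ?_⟩
    · rw [Set.mem_ofPred_eq, ← hge]
      intro h
      refine hr ?_
      rw [Finset.mem_coe, Finset.mem_image]
      exact ⟨c, by simpa [hg0] using h, hc⟩
    · rw [Metric.mem_ball, dist_eq_norm, add_sub_cancel_left]
      linarith [hrd c hc.le]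
  obtain ⟨η, hη, hηS⟩ := hSc.exists_cthickening_subset_open hopen hSsub
  obtain ⟨B, hBK⟩ := hB _ hSc.cthickening (hηS.trans fun z hz => hρN hz.2) fun z hz => (hηS hz).1
  refine ⟨Metric.ball z₀ (min η (ρ / 2)), mem_nhdsWithin_of_mem_nhds
    (Metric.ball_mem_nhds _ (lt_min hη (half_pos hρ))), B, ?_⟩
  filter_upwards [hd, hBK] with i hdi hBi z hz
  rw [Metric.mem_ball, dist_eq_norm, lt_min_iff] at hz
  have hline : ∀ c : ℂ, ‖c‖ ≤ r → z + c • d ∈ Metric.ball z₀ ρ := by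
    intro c hc
    rw [Metric.mem_ball, dist_eq_norm, add_sub_right_comm]
    linarith [norm_add_le (z - z₀) (c • d), hrd c hc, hz.2]
  have hdiff : DifferentiableOn ℂ (fun c : ℂ => Φ i (z + c • d)) (Metric.closedBall 0 r) := by
    refine hdi.comp (Differentiable.differentiableOn (by fun_prop)) fun c hc => ?_
    rw [mem_closedBall_zero_iff] at hc
    exact hρN (hline c hc)
  have hcl : DiffContOnCl ℂ (fun c : ℂ => Φ i (z + c • d)) (Metric.ball 0 r) :=
    (hdiff.mono Metric.closure_ball_subset_closedBall).diffContOnCl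
  have := Complex.norm_le_of_forall_mem_frontier_norm_le Metric.isBounded_ball hcl (C := B) ?_
    (subset_closure (Metric.mem_ball_self hr0))
  · simpa using this
  · intro c hc
    rw [frontier_ball _ hr0.ne', mem_sphere_zero_iff_norm] at hc
    refine hBi _ (Metric.mem_cthickening_of_dist_le _ (z₀ + c • d) η _
      ⟨c, by rw [mem_sphere_zero_iff_norm]; exact hc, rfl⟩ ?_)
    rw [dist_eq_norm, add_sub_add_right_eq_sub]
    exact hz.1.le

/-- Joint convergence at the points of a compact set gives a uniform bound on it. -/
lemma exists_bound_of_tendsto {X ι : Type*} [TopologicalSpace X] {l : Filter ι} {K : Set X}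
    (hK : IsCompact K) {φ : ι → X → ℂ} {g : X → ℂ}
    (h : ∀ z ∈ K, Tendsto (fun x : ι × X => φ x.1 x.2) (l ×ˢ 𝓝 z) (𝓝 (g z))) :
    ∃ B : ℝ, ∀ᶠ i in l, ∀ z ∈ K, ‖φ i z‖ ≤ B := by
  refine hK.induction_on (p := fun S => ∃ B : ℝ, ∀ᶠ i in l, ∀ z ∈ S, ‖φ i z‖ ≤ B)
    ⟨0, Eventually.of_forall fun i z hz => absurd hz (Set.notMem_empty z)⟩ ?_ ?_ ?_
  · rintro S S' hS ⟨B, hB⟩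
    exact ⟨B, hB.mono fun i hi z hz => hi z (hS hz)⟩
  · rintro S S' ⟨B, hB⟩ ⟨B', hB'⟩
    refine ⟨max B B', ?_⟩
    filter_upwards [hB, hB'] with i h1 h2 z hz
    rcases hz with hz | hz
    · exact (h1 z hz).trans (le_max_left _ _)
    · exact (h2 z hz).trans (le_max_right _ _)
  · intro z hz
    have h1 := (h z hz).norm.eventually (gt_mem_nhds (lt_add_one ‖g z‖))
    obtain ⟨pa, ha, pb, hb, hab⟩ := eventually_prod_iff.1 h1
    exact ⟨{x | pb x}, mem_nhdsWithin_of_mem_nhds hb, ‖g z‖ + 1, ha.mono fun i hi x hx =>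
      (hab hi hx).le⟩

end Bound

section LimitIntegral

open MvPolynomial

variable {n : ℕ} {q t : ℂ} {τ : Fin 6 → ℂ} {α : Fin 6 → ℝ} {ζ : ℝ} {T : Finset (Fin 6)}

/-- The limit of the rescaled integrals over a limit contour, after breaking the symmetry. -/
theorem IsLimitContour.tendsto_chainIntegral_rescaled {mf mg : ℕ} {C : CircleChain}
    (hC : IsLimitContour q t (tilde q mf mg τ) α ζ T C) (hα : IsExponent α ζ T)
    (hT : ∑ r ∈ T, α r = ζ) (hq : ‖q‖ < 1) (hq0 : q ≠ 0) (ht0 : t ≠ 0) (ht : ‖t‖ < 1)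
    (hτ : ∀ r, τ r ≠ 0) {f g F G : ℂ → (Fin n → ℂ) → ℂ} {vf vg : ℝ} {lf lg : RatFun n}
    (hlf : HasLeadingTerm (fun p z => f p (fun i => p ^ (ζ : ℂ) * z i)) vf lf)
    (hlg : HasLeadingTerm (fun p z => g p (fun i => p ^ (ζ : ℂ) * z i)) vg lg)
    (hF : ∀ p : ℂ, 0 < ‖p‖ → ‖p‖ < 1 → DifferentiableOn ℂ (F p) {z | ∀ i, z i ≠ 0} ∧
      ∀ z ∈ regularSet n mf q p (scaled τ α p 4), poleFactor n mf q p (scaled τ α p 4) z * f p z = F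
          p z)
    (hG : ∀ p : ℂ, 0 < ‖p‖ → ‖p‖ < 1 → DifferentiableOn ℂ (G p) {z | ∀ i, z i ≠ 0} ∧
      ∀ z ∈ regularSet n mg q p (scaled τ α p 5), poleFactor n mg q p (scaled τ α p 5) z * g p z = G
          p z) :
    Tendsto (fun p : ℂ => p ^ ((-vf - vg : ℝ) : ℂ) * chainIntegral n C fun z =>
        F p (fun i => p ^ (ζ : ℂ) * z i) * G p (fun i => p ^ (ζ : ℂ) * z i) *
          brokenWeight n q t p T (poleOrder mf mg) (scaled τ α p) fun i => p ^ (ζ : ℂ) * z i)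
      (𝓝[≠] 0) (𝓝 (chainIntegral n C fun z =>
        lf.eval z * lg.eval z * limitWeight n q t τ α ζ T z)) := by
  set H : ℂ → (Fin n → ℂ) → ℂ := fun p z =>
    F p z * G p z * brokenWeight n q t p T (poleOrder mf mg) (scaled τ α p) z with hH
  set Φ : ℂ → (Fin n → ℂ) → ℂ := fun p z =>
    p ^ ((-vf - vg : ℝ) : ℂ) * H p fun i => p ^ (ζ : ℂ) * z i with hΦ
  set W : ℂ → (Fin n → ℂ) → ℂ := fun p z =>
    brokenWeight n q t p T 0 (scaled τ α p) fun i => p ^ (ζ : ℂ) * z i with hW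
  set L : (Fin n → ℂ) → ℂ := fun z =>
    (∏ j, limOne n q t τ α ζ T (z j)) * ∏ j, ∏ k ∈ Finset.Ioi j, limPair q t ζ (z j) (z k) with hL
  simp only [const_mul_chainIntegral]
  set A : Set (Fin n → ℂ) := piSet n (carrier C) with hA
  have hAc : IsCompact A := isCompact_piSet n (isCompact_carrier C)
  have hAreg : ∀ z ∈ A, LimitRegular q t τ α ζ T z := fun z hz => hC.limitRegular hq hq0 hz
  -- a neighbourhood of the contour on which the integrand is holomorphic
  obtain ⟨δ, ⟨hδC, h0, hsep⟩, hδ⟩ := ((hC.eventually_separates hα hq ht).and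
    self_mem_nhdsWithin).exists
  have hδ : 0 < δ := hδ
  set N : Set (Fin n → ℂ) := {z | LimitRegular q t τ α ζ T z} ∩ Metric.thickening δ A with hN
  have hNo : IsOpen N := IsOpen.inter (isOpen_iff_mem_nhds.2 fun z hz => hz.eventually hq)
    Metric.isOpen_thickening
  have hAN : A ⊆ N := fun z hz => ⟨hAreg z hz, Metric.self_subset_thickening hδ A hz⟩
  have htube : ∀ z ∈ N, ∀ j, z j ∈ tube C δ := by
    intro z hz j
    obtain ⟨w, hw, hzw⟩ := Metric.mem_thickening_iff.1 hz.2
    obtain ⟨x, hx, e⟩ := mem_carrier.1 (hw j)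
    have h1 : ‖z j - w j‖ < δ := by
      rw [← dist_eq_norm]
      exact (dist_le_pi_dist z w j).trans_lt hzw
    refine mem_tube.2 ⟨x, hx, ?_, ?_⟩
    · have := norm_sub_le_norm_sub_add_norm_sub (w j) (z j) x.1
      rw [norm_sub_rev (w j) (z j)] at this
      linarith
    · have := norm_sub_le_norm_sub_add_norm_sub (z j) (w j) x.1
      linarith
  have hsmall : ∀ᶠ p in 𝓝[≠] (0 : ℂ), p ≠ 0 ∧ ‖p‖ < 1 ∧ ∀ z ∈ N,
      (fun i => p ^ (ζ : ℂ) * z i) ∈ brokenDomain n q t p T (tilde q mf mg (scaled τ α p)) := by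
    filter_upwards [hsep, eventually_norm_lt one_pos, self_mem_nhdsWithin] with p hp hp1 hp0
    have hp0 : p ≠ 0 := hp0
    refine ⟨hp0, hp1, fun z hz => ?_⟩
    rw [← scaled_tilde]
    refine hp.piSet_subset n fun j => ?_
    have hpz : p ^ (ζ : ℂ) ≠ 0 := fun h => hp0 ((Complex.cpow_eq_zero_iff _ _).1 h).1
    have e : p ^ (ζ : ℂ) * z j / p ^ (ζ : ℂ) = z j := mul_div_cancel_left₀ _ hpz
    refine ⟨?_, ?_⟩
    · rw [Set.mem_ofPred_eq, e]
      exact Or.inl (htube z hz j)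
    · rw [Set.mem_ofPred_eq, e]
      exact fun h => h.2 (htube z hz j)
  have hτs : ∀ p : ℂ, p ≠ 0 → ∀ r, scaled τ α p r ≠ 0 := fun p hp r =>
    mul_ne_zero (hτ r) fun h => hp ((Complex.cpow_eq_zero_iff _ _).1 h).1
  have hd : ∀ᶠ p in 𝓝[≠] (0 : ℂ), DifferentiableOn ℂ (Φ p) N := by
    filter_upwards [hsmall] with p ⟨hp0, hp1, hpN⟩
    have hpn := norm_pos_iff.2 hp0
    have h1 := differentiableOn_brokenIntegrand hp1 hp0 hq hq0 ht0 (hτs p hp0) T mf mg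
      (hF p hpn hp1).1 (hG p hpn hp1).1
    refine DifferentiableOn.const_mul (h1.comp (Differentiable.differentiableOn ?_) hpN) _
    exact differentiable_pi.2 fun j => (differentiable_const _).mul (differentiable_apply j)
  -- the integrand in terms of `f` and `g`
  obtain ⟨Pf, hPf, hPfB, hPfL⟩ := hlf.exists_polynomial
  obtain ⟨Pg, hPg, hPgB, hPgL⟩ := hlg.exists_polynomial
  obtain ⟨P₄, hP₄, hP₄K⟩ := exists_polynomial_poleFactor n mf hq0 (hτ 4) (α 4) ζ
  obtain ⟨P₅, hP₅, hP₅K⟩ := exists_polynomial_poleFactor n mg hq0 (hτ 5) (α 5) ζ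
  set P : MvPolynomial (Fin n) ℂ := Pf * Pg * (P₄ * P₅) with hP
  have hP0 : P ≠ 0 := mul_ne_zero (mul_ne_zero hPf hPg) (mul_ne_zero hP₄ hP₅)
  have hPe : ∀ z, eval z P ≠ 0 → eval z Pf ≠ 0 ∧ eval z Pg ≠ 0 ∧ eval z P₄ ≠ 0 ∧ eval z P₅ ≠ 0 := by
    intro z hz
    rw [hP, map_mul, map_mul, map_mul] at hz
    exact ⟨fun h => hz (by rw [h]; ring), fun h => hz (by rw [h]; ring),
      fun h => hz (by rw [h]; ring), fun h => hz (by rw [h]; ring)⟩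
  have hkey : ∀ K : Set (Fin n → ℂ), IsCompact K → K ⊆ N → (∀ z ∈ K, eval z P ≠ 0) →
      ∀ᶠ p in 𝓝[≠] (0 : ℂ), ∀ z ∈ K, Φ p z =
        (p ^ ((-vf : ℝ) : ℂ) * f p fun i => p ^ (ζ : ℂ) * z i) *
          (p ^ ((-vg : ℝ) : ℂ) * g p fun i => p ^ (ζ : ℂ) * z i) * W p z := by
    intro K hK hKN hKP
    filter_upwards [hsmall, hP₄K K hK fun z hz => ⟨(hKN hz).1.ne_zero, (hPe z (hKP z hz)).2.2.1⟩,
      hP₅K K hK fun z hz => ⟨(hKN hz).1.ne_zero, (hPe z (hKP z hz)).2.2.2⟩] with p ⟨hp0, hp1, hpN⟩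
          h4 h5 z hz
    have hpn := norm_pos_iff.2 hp0
    have hdom := hpN z (hKN hz)
    have h1 := (hF p hpn hp1).2 _ (h4 z hz)
    have h2 := (hG p hpn hp1).2 _ (h5 z hz)
    have h3 := brokenWeight_mul_poleFactor (t := t) (T := T) hp1 hp0 hq hq0 (hτs p hp0) mf mg
      (fun j => (hdom j).1) (fun j => (hdom j).2.1) (fun j => (hdom j).2.2.1)
    simp only [hΦ, hH, hW]
    rw [← h1, ← h2, ← h3, sub_eq_add_neg, Complex.ofReal_add, Complex.cpow_add _ _ hp0]
    ring
  have hWlim : ∀ z ∈ N, Tendsto (fun x : ℂ × (Fin n → ℂ) => W x.1 x.2) (𝓝[≠] 0 ×ˢ 𝓝 z) (𝓝 (L z)) :=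
    fun z hz => hz.1.tendsto_brokenWeight hα hT hq hq0 ht0 hτ tendsto_fst tendsto_snd
  have hbound : ∃ B : ℝ, ∀ᶠ p in 𝓝[≠] (0 : ℂ), ∀ z ∈ A, ‖Φ p z‖ ≤ B := by
    refine exists_bound_of_bound_off_zeros hAc hNo hAN hP0 hd fun K hK hKN hKP => ?_
    obtain ⟨B₁, hB₁⟩ := hPfB K hK fun z hz => ⟨(hKN hz).1.ne_zero, (hPe z (hKP z hz)).1⟩
    obtain ⟨B₂, hB₂⟩ := hPgB K hK fun z hz => ⟨(hKN hz).1.ne_zero, (hPe z (hKP z hz)).2.1⟩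
    obtain ⟨B₃, hB₃⟩ := exists_bound_of_tendsto hK fun z hz => hWlim z (hKN hz)
    refine ⟨B₁ * B₂ * B₃, ?_⟩
    filter_upwards [hkey K hK hKN hKP, hB₁, hB₂, hB₃] with p h h1 h2 h3 z hz
    rw [h z hz, norm_mul, norm_mul]
    have h1z := h1 z hz
    have h2z := h2 z hz
    have hb1 := (norm_nonneg _).trans h1z
    have hb2 := (norm_nonneg _).trans h2z
    have h3z := h3 z hz
    gcongr
  obtain ⟨B, hB⟩ := hbound
  have hlim := hC.toIsContour.tendsto_chainIntegral hP0 (F := Φ)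
    (F₀ := fun z => lf.eval z * lg.eval z * L z) (hd.mono fun p hp => hp.continuousOn.mono hAN) hB
    fun z hz hzP => by
      have hz0 := (hAreg z hz).ne_zero
      have h1 := hkey {z} isCompact_singleton (Set.singleton_subset_iff.2 (hAN hz)) fun w hw => by
        rwa [Set.mem_singleton_iff.1 hw]
      refine Tendsto.congr' (h1.mono fun p hp => (hp z rfl).symm) ?_
      refine ((hPfL z hz0 (hPe z hzP).1).mul (hPgL z hz0 (hPe z hzP).2.1)).mul ?_
      exact (hAreg z hz).tendsto_brokenWeight hα hT hq hq0 ht0 hτ tendsto_id tendsto_const_nhds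
  -- the limit of the weight agrees with the weight of the limiting integral almost everywhere
  have hfinal : chainIntegral n C (fun z => lf.eval z * lg.eval z * L z) =
      chainIntegral n C fun z => lf.eval z * lg.eval z * limitWeight n q t τ α ζ T z := by
    refine hC.toIsContour.chainIntegral_congr_ae (Z := Set.range fun x : Fin n × Fin n × ℕ =>
      MvPolynomial.C (q ^ (x.2.2 + 1)) * (X x.1 * X x.2.1) - 1) (Set.countable_range _) ?_ fun z hz
          hzZ => ?_
    · rintro ⟨x, hx⟩
      have := congrArg (eval fun _ => (0 : ℂ)) hx
      simp at this
    · have hne : ∀ j k, qPoch (q * (z j * z k)) q ≠ 0 := by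
        intro j k
        rw [qPoch_ne_zero_iff hq]
        intro i e
        refine hzZ _ ⟨(j, k, i), rfl⟩ ?_
        simp only [map_sub, map_mul, eval_C, eval_X, map_one]
        rw [← e]
        ring
      rw [hL]
      simp only
      rw [limOne_mul_limPair_eq_limitWeight hα hq (fun j => by rw [sq]; exact hne j j)
        fun j k _ => hne j k]
  rw [← hfinal]
  exact hlim

end LimitIntegral

/-! ### The normalizing constant -/

section Constant

variable {n : ℕ} {q t : ℂ} {τ : Fin 6 → ℂ} {α : Fin 6 → ℝ} {ζ : ℝ} {T : Finset (Fin 6)}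

lemma prod_prod_Ioi_eq (f : Fin 6 → Fin 6 → ℂ) :
    ∏ r, ∏ s ∈ Finset.Ioi r, f r s = ∏ x : Fin 6 × Fin 6, if x.1 < x.2 then f x.1 x.2 else 1 := by
  rw [Fintype.prod_prod_type]
  refine Finset.prod_congr rfl fun r _ => ?_
  rw [← Finset.prod_filter]
  exact Finset.prod_congr (by ext; simp) fun _ _ => rfl

/-- A product over all pairs as a product over the ordered pairs. -/
lemma prod_eq_prod_lt (g : Fin 6 × Fin 6 → ℂ) (hg : ∀ r, g (r, r) = 1) :
    ∏ x, g x = ∏ x : Fin 6 × Fin 6, if x.1 < x.2 then g x * g x.swap else 1 := by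
  have h1 : ∏ x : Fin 6 × Fin 6, (if x.2 < x.1 then g x else 1) =
      ∏ x : Fin 6 × Fin 6, if x.1 < x.2 then g x.swap else 1 :=
    (Equiv.prodComm (Fin 6) (Fin 6)).prod_comp fun x => if x.1 < x.2 then g x.swap else 1
  calc ∏ x, g x = ∏ x : Fin 6 × Fin 6, (if x.1 < x.2 then g x else 1) *
        (if x.2 < x.1 then g x else 1) := Finset.prod_congr rfl fun x _ => by
          rcases lt_trichotomy x.1 x.2 with h | h | h
          · simp [h, h.not_gt]
          · have hx : g x = 1 := (congrArg g (Prod.ext rfl h.symm : x = (x.1, x.1))).trans (hg x.1)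
            simp [h, hx]
          · simp [h, h.not_gt]
    _ = _ := by
      rw [Finset.prod_mul_distrib, h1, ← Finset.prod_mul_distrib]
      refine Finset.prod_congr rfl fun x _ => ?_
      split_ifs <;> simp

/-- The pairs of a three-element set, ordered. -/
lemma filter_pairs_eq {a b c : Fin 6} (hab : a ≠ b) (hac : a ≠ c) (hbc : b ≠ c) :
    (Finset.univ.filter fun x : Fin 6 × Fin 6 => x.1 < x.2 ∧ x.1 ∈ ({a, b, c} : Finset (Fin 6)) ∧
      x.2 ∈ ({a, b, c} : Finset (Fin 6))) =
    {(min a b, max a b), (min a c, max a c), (min b c, max b c)} := by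
  revert a b c
  decide

lemma prod_pairs {a b c : Fin 6} (hab : a ≠ b) (hac : a ≠ c) (hbc : b ≠ c)
    {φ : Fin 6 → Fin 6 → ℂ} (hφ : ∀ r s, φ r s = φ s r) :
    (∏ x : Fin 6 × Fin 6, if x.1 < x.2 ∧ x.1 ∈ ({a, b, c} : Finset (Fin 6)) ∧
      x.2 ∈ ({a, b, c} : Finset (Fin 6)) then φ x.1 x.2 else 1) = φ a b * φ a c * φ b c := by
  have hm : ∀ r s, φ (min r s) (max r s) = φ r s := by
    intro r s
    rcases le_total r s with h | h
    · simp [h]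
    · simp [h, hφ s r]
  rw [← Finset.prod_filter, filter_pairs_eq hab hac hbc, Finset.prod_insert, Finset.prod_insert,
    Finset.prod_singleton, hm, hm, hm, mul_assoc]
  · clear hm
    revert a b c
    decide
  · clear hm
    revert a b c
    decide

lemma prod_Icc_sub (n : ℕ) (ψ : ℕ → ℂ) :
    ∏ j ∈ Finset.Icc 1 n, ψ (n - j) = ∏ i ∈ Finset.range n, ψ i := by
  refine Finset.prod_nbij' (fun j => n - j) (fun i => n - i) ?_ ?_ ?_ ?_ fun _ _ => rfl <;>
  · intro j hj
    simp only [Finset.mem_Icc, Finset.mem_range] at hj ⊢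
    omega

/-- The constant that arises from breaking the symmetry, as a product over the pairs in `T`. -/
lemma prod_theta_breaking (hq0 : q ≠ 0) (ht0 : t ≠ 0) (hτ : ∀ r, τ r ≠ 0)
    {a b c : Fin 6} (hab : a ≠ b) (hac : a ≠ c) (hbc : b ≠ c) :
    (∏ i ∈ Finset.range n, theta (t ^ i * (τ a * τ b)) q * theta (t ^ i * (τ a * τ c)) q *
        theta (t ^ i * (τ a * (q / (t ^ (n - 1) * (τ a * τ b * τ c))))) q) =
      ∏ j ∈ Finset.Icc 1 n, ∏ x : Fin 6 × Fin 6, if x.1 < x.2 ∧ x.1 ∈ ({a, b, c} : Finset (Fin 6)) ∧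
      x.2 ∈ ({a, b, c} : Finset (Fin 6)) then theta (t ^ (n - j) * (τ x.1 * τ x.2)) q else 1 := by
  have h3 : ∏ i ∈ Finset.range n, theta (t ^ i * (τ a * (q / (t ^ (n - 1) * (τ a * τ b * τ c))))) q
      =
      ∏ i ∈ Finset.range n, theta (t ^ i * (τ b * τ c)) q := by
    rw [← Finset.prod_range_reflect]
    refine Finset.prod_congr rfl fun i hi => ?_
    have ha := hτ a
    have hb := hτ b
    have hc := hτ c
    have e : n - 1 = (n - 1 - i) + i := by
      have := Finset.mem_range.1 hi
      omega
    rw [← theta_inv_mul (t ^ i * (τ b * τ c)) hq0]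
    congr 1
    nth_rewrite 2 [e]
    rw [pow_add]
    field_simp
  rw [prod_Icc_sub n fun k => ∏ x : Fin 6 × Fin 6, if x.1 < x.2 ∧ x.1 ∈ ({a, b, c} : Finset (Fin 6))
      ∧
      x.2 ∈ ({a, b, c} : Finset (Fin 6)) then theta (t ^ k * (τ x.1 * τ x.2)) q else 1]
  rw [Finset.prod_mul_distrib, h3, ← Finset.prod_mul_distrib]
  exact Finset.prod_congr rfl fun i _ => (prod_pairs hab hac hbc
    (φ := fun r s => theta (t ^ i * (τ r * τ s)) q) fun r s => by rw [mul_comm (τ r)]).symm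

lemma exists_sum_eq_add_add {S : Finset (Fin 6)} (hS : S.card = 3) {r s : Fin 6} (hr : r ∈ S)
    (hs : s ∈ S) (hrs : r ≠ s) : ∃ u ∈ S, ∑ x ∈ S, α x = α r + α s + α u := by
  have hs' : s ∈ S.erase r := Finset.mem_erase.2 ⟨hrs.symm, hs⟩
  obtain ⟨u, hu⟩ := Finset.card_eq_one.1 (show ((S.erase r).erase s).card = 1 by
    rw [Finset.card_erase_of_mem hs', Finset.card_erase_of_mem hr, hS])
  refine ⟨u, Finset.mem_of_mem_erase (Finset.mem_of_mem_erase (hu ▸ Finset.mem_singleton_self u)),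
      ?_⟩
  rw [← Finset.add_sum_erase S α hr, ← Finset.add_sum_erase _ α hs', hu, Finset.sum_singleton,
      add_assoc]

/-- The exponent of `p` in `p^{e_r e_s} τ_r τ_s`. -/
def pairExponent (α : Fin 6 → ℝ) (T : Finset (Fin 6)) (r s : Fin 6) : ℝ :=
  α r + α s + if r ∈ T ∧ s ∈ T then 1 else 0

/-- The sum of two exponents in `T` is `ζ` minus the third one. -/
lemma IsExponent.add_mem (hα : IsExponent α ζ T) (hT : ∑ r ∈ T, α r = ζ) (hT3 : T.card = 3)
    {r s : Fin 6} (hrs : r ≠ s) (hr : r ∈ T) (hs : s ∈ T) : 2 * ζ ≤ α r + α s ∧ α r + α s ≤ 0 := by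
  obtain ⟨u, hu, h⟩ := exists_sum_eq_add_add (α := α) hT3 hr hs hrs
  have := hα.mem u hu
  constructor <;> linarith

/-- The bounds on the exponents of a pair follow from those on the third element of `T`,
    respectively
of its complement. -/
lemma IsExponent.pairExponent_mem (hα : IsExponent α ζ T) (hT : ∑ r ∈ T, α r = ζ)
    (hT3 : T.card = 3) (h1 : ∑ r, α r = 1) {r s : Fin 6} (hrs : r ≠ s) :
    0 ≤ pairExponent α T r s ∧ pairExponent α T r s ≤ 1 ∧
      (r ∉ T → s ∉ T → 0 < pairExponent α T r s) := by
  have h0 := hα.zeta_ge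
  have h0' := hα.zeta_neg
  unfold pairExponent
  by_cases hr : r ∈ T <;> by_cases hs : s ∈ T <;> simp only [hr, hs, and_self, and_true,
    if_true, if_false, not_true_eq_false, false_imp_iff, imp_true_iff, true_imp_iff,
    not_false_eq_true, and_false]
  · have := hα.add_mem hT hT3 hrs hr hs
    constructor <;> linarith
  · have := hα.mem r hr
    have := hα.notMem s hs
    constructor <;> linarith
  · have := hα.mem s hs
    have := hα.notMem r hr
    constructor <;> linarith
  · obtain ⟨u, hu, h⟩ := exists_sum_eq_add_add (α := α) (S := Tᶜ) (by
      rw [Finset.card_compl, hT3, Fintype.card_fin]) (Finset.mem_compl.2 hr) (Finset.mem_compl.2 hs)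
          hrs
    have h2 := Finset.sum_add_sum_compl T α
    have := hα.notMem u (Finset.mem_compl.1 hu)
    have := hα.notMem r hr
    have := hα.notMem s hs
    refine ⟨?_, ?_, ?_⟩ <;> linarith

/-- The conditions on the parameters under which the normalizing constant has a finite limit. -/
structure IsDenGeneric (n : ℕ) (q t : ℂ) (τ : Fin 6 → ℂ) (α : Fin 6 → ℝ) (T : Finset (Fin 6)) :
    Prop where
  ne_zero : ∀ r, τ r ≠ 0
  generic : IsGeneric {1} q t τ
  ne_pow : ∀ r s : Fin 6, r ≠ s → ((r ∈ T ∧ s ∈ T ∧ α r + α s = 0) ∨ α r + α s = 1) →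
    ∀ k < n, ∀ i : ℕ, t ^ k * (τ r * τ s) ≠ q ^ (i + 1)

lemma IsGeneric.qPoch_ne_zero {S : Set ℂ} (h : IsGeneric S q t τ) (h1 : (1 : ℂ) ∈ S) (hq : ‖q‖ < 1)
    (hq0 : q ≠ 0) (ht0 : t ≠ 0) (r s : Fin 6) (k : ℕ) : qPoch (t ^ k * (τ r * τ s)) q ≠ 0 := by
  rw [qPoch_ne_zero_iff hq]
  intro j
  have := h.mul_ne (mf := 0) (mg := 0) hq0 ht0 h1 r s j k
  have e : ∀ r, tilde q 0 0 τ r = τ r := fun r => by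
    rw [tilde_apply, show poleOrder 0 0 r = 0 by fin_cases r <;> rfl, pow_zero, div_one]
  rw [e, e] at this
  intro h
  exact this (by rw [← h]; ring)

lemma IsDenGeneric.qPoch_div_ne_zero (hD : IsDenGeneric n q t τ α T) (ht0 : t ≠ 0) (hq : ‖q‖ < 1)
    {r s : Fin 6} (hrs : r ≠ s) (h : (r ∈ T ∧ s ∈ T ∧ α r + α s = 0) ∨ α r + α s = 1) {k : ℕ}
    (hk : k < n) : qPoch (q / (t ^ k * (τ r * τ s))) q ≠ 0 := by
  have hr := hD.ne_zero r
  have hs := hD.ne_zero s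
  rw [qPoch_ne_zero_iff hq]
  intro j e
  refine hD.ne_pow r s hrs h k hk j ?_
  field_simp at e
  rw [← mul_assoc, ← e, pow_succ']

lemma scaled_mul_scaled {p : ℂ} (hp : p ≠ 0) (k : ℕ) (r s : Fin 6) :
    t ^ k * (scaled τ α p r * scaled τ α p s) =
      t ^ k * (τ r * τ s) * p ^ ((α r + α s : ℝ) : ℂ) := by
  rw [scaled, scaled, Complex.ofReal_add, Complex.cpow_add _ _ hp]
  ring

lemma one_mem_inv_pow (p : ℂ) : (1 : ℂ) ∈ {w : ℂ | ∃ i : ℕ, w = (p ^ i)⁻¹} := ⟨0, by simp⟩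

lemma IsDenGeneric.eventually_theta_ne_zero (hD : IsDenGeneric n q t τ α T) (hα : IsExponent α ζ T)
    (hT : ∑ r ∈ T, α r = ζ) (hT3 : T.card = 3) (hq0 : q ≠ 0) (hq : ‖q‖ < 1) (ht0 : t ≠ 0)
    {r s : Fin 6} (hrs : r ≠ s) (hr : r ∈ T) (hs : s ∈ T) {k : ℕ} (hk : k < n) :
    ∀ᶠ p in 𝓝[genericSet q t τ α] 0, theta (t ^ k * (scaled τ α p r * scaled τ α p s)) q ≠ 0 := by
  have hle : 𝓝[genericSet q t τ α] (0 : ℂ) ≤ 𝓝[≠] 0 := nhdsWithin_mono _ fun p hp => hp.1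
  have hsum := (hα.add_mem hT hT3 hrs hr hs).2
  have h1 := Tendsto.qPoch (tendsto_mul_cpow (p := id) (l := 𝓝[≠] (0 : ℂ)) tendsto_id
    (tendsto_const_nhds (x := q / (t ^ k * (τ r * τ s)))) (neg_nonneg.2 hsum))
    (tendsto_const_nhds (x := q)) hq
  have h2 := hle (h1.eventually_ne (by
    split_ifs with h
    · exact hD.qPoch_div_ne_zero ht0 hq hrs (Or.inl ⟨hr, hs, neg_eq_zero.1 h⟩) hk
    · simp) : ∀ᶠ p in 𝓝[≠] (0 : ℂ), _)
  filter_upwards [h2, self_mem_nhdsWithin] with p hp hpG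
  refine mul_ne_zero (hpG.2.qPoch_ne_zero (one_mem_inv_pow p) hq hq0 ht0 r s k) ?_
  rwa [scaled_mul_scaled hpG.1, ← div_div, div_eq_mul_inv _ (p ^ _), ← Complex.cpow_neg,
    ← Complex.ofReal_neg]

/-- The factors of the normalizing constant for one pair of parameters: the theta factor that
comes from breaking the symmetry shifts the argument of the gamma factor by `p`. -/
lemma IsDenGeneric.tendsto_pair (hD : IsDenGeneric n q t τ α T) (hα : IsExponent α ζ T)
    (hT : ∑ r ∈ T, α r = ζ) (hT3 : T.card = 3) (h1 : ∑ r, α r = 1) (hq0 : q ≠ 0) (hq : ‖q‖ < 1)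
    (ht0 : t ≠ 0) {r s : Fin 6} (hrs : r ≠ s) (k : ℕ) :
    Tendsto (fun p => ellGamma (t ^ k * (scaled τ α p r * scaled τ α p s)) p q *
      if r ∈ T ∧ s ∈ T then theta (t ^ k * (scaled τ α p r * scaled τ α p s)) q else 1)
      (𝓝[genericSet q t τ α] 0)
      (𝓝 (limGamma (pairExponent α T r s) q (t ^ k * (τ r * τ s)))) := by
  have hle : 𝓝[genericSet q t τ α] (0 : ℂ) ≤ 𝓝[≠] 0 := nhdsWithin_mono _ fun p hp => hp.1
  obtain ⟨h0, h1, -⟩ := hα.pairExponent_mem hT hT3 h1 hrs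
  have hlim := tendsto_ellGamma_cpow hq (tendsto_id'.2 hle)
    (tendsto_const_nhds (x := t ^ k * (τ r * τ s)))
    (mul_ne_zero (pow_ne_zero _ ht0) (mul_ne_zero (hD.ne_zero r) (hD.ne_zero s))) h0 h1
    fun _ => hD.generic.qPoch_ne_zero rfl hq hq0 ht0 r s k
  refine hlim.congr' ?_
  filter_upwards [self_mem_nhdsWithin, hle (eventually_norm_lt one_pos)] with p hpG hp1
  have hp0 := hpG.1
  have hx := hpG.2.qPoch_ne_zero (one_mem_inv_pow p) hq hq0 ht0 r s k
  rw [id, pairExponent]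
  split_ifs with h
  · rw [mul_comm (ellGamma _ _ _), ← ellGamma_mul_left hp1 hq hp0 hx, scaled_mul_scaled hp0,
        Complex.ofReal_add,
      Complex.cpow_add _ _ hp0, Complex.ofReal_one, Complex.cpow_one]
    congr 1
    ring
  · rw [add_zero, mul_one, scaled_mul_scaled hp0]

lemma IsDenGeneric.limGamma_ne_zero (hD : IsDenGeneric n q t τ α T) (hq0 : q ≠ 0) (hq : ‖q‖ < 1)
    (ht0 : t ≠ 0) {r s : Fin 6} (hrs : r ≠ s) {k : ℕ} (hk : k < n) :
    limGamma (pairExponent α T r s) q (t ^ k * (τ r * τ s)) ≠ 0 := by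
  refine div_ne_zero ?_ ?_
  · split_ifs with h
    · refine hD.qPoch_div_ne_zero ht0 hq hrs ?_ hk
      unfold pairExponent at h
      split_ifs at h with h'
      · exact Or.inl ⟨h'.1, h'.2, by linarith⟩
      · exact Or.inr (by linarith)
    · exact one_ne_zero
  · split_ifs
    · exact hD.generic.qPoch_ne_zero rfl hq hq0 ht0 r s k
    · exact one_ne_zero

/-- The factors of the constant of the limit for fixed `k = n - j`. -/
lemma IsExponent.prod_limGamma_inv (hα : IsExponent α ζ T) (hT : ∑ r ∈ T, α r = ζ)
    (hT3 : T.card = 3) (h1 : ∑ r, α r = 1) (q : ℂ) {φ : Fin 6 → Fin 6 → ℂ}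
    (hφ : ∀ r s, φ r s = φ s r) :
    (∏ x : Fin 6 × Fin 6, if x.1 < x.2 then limGamma (pairExponent α T x.1 x.2) q (φ x.1 x.2) else
        1)⁻¹ =
    ((∏ x : Fin 6 × Fin 6 with x.1 < x.2 ∧ x.1 ∈ T ∧ x.2 ∈ T ∧ α x.1 + α x.2 = -1,
        qPoch (φ x.1 x.2) q) *
      ∏ x : Fin 6 × Fin 6 with x.1 ∈ T ∧ x.2 ∉ T ∧ α x.1 + α x.2 = 0, qPoch (φ x.1 x.2) q) /
    ((∏ x : Fin 6 × Fin 6 with x.1 < x.2 ∧ x.1 ∈ T ∧ x.2 ∈ T ∧ α x.1 + α x.2 = 0,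
        qPoch (q / φ x.1 x.2) q) *
      ∏ x : Fin 6 × Fin 6 with x.1 < x.2 ∧ α x.1 + α x.2 = 1, qPoch (q / φ x.1 x.2) q) := by
  simp only [Finset.prod_filter]
  rw [prod_eq_prod_lt fun x => if x.1 ∈ T ∧ x.2 ∉ T ∧ α x.1 + α x.2 = 0 then qPoch (φ x.1 x.2) q
      else 1]
  · rw [← Finset.prod_mul_distrib, ← Finset.prod_mul_distrib, ← Finset.prod_inv_distrib,
      ← Finset.prod_div_distrib]
    refine Finset.prod_congr rfl fun ⟨r, s⟩ _ => ?_
    by_cases hrs : r < s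
    · obtain ⟨-, -, h3⟩ := hα.pairExponent_mem hT hT3 h1 hrs.ne
      simp only [hrs, if_true, true_and, Prod.swap, limGamma, hφ s r, inv_div, add_comm (α s) (α r)]
      unfold pairExponent at h3 ⊢
      by_cases hr : r ∈ T <;> by_cases hs : s ∈ T <;> simp only [hr, hs, and_self, and_true,
          true_and,
        if_true, if_false, false_and, and_false, not_true_eq_false, not_false_eq_true, one_mul,
        mul_one, add_zero, add_eq_zero_iff_eq_neg, add_eq_right] at h3 ⊢
      · have := hα.add_mem hT hT3 hrs.ne hr hs
        have h4 : α r + α s ≠ 1 := by linarith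
        rw [if_neg h4, mul_one]
      · rw [if_neg fun h => by linarith [h3 trivial trivial]]
    · simp [hrs]
  · intro r
    rw [if_neg fun h => h.2.1 h.1]

lemma tendsto_ellGamma_const {x : ℂ} (hq : ‖q‖ < 1) (hx : ‖x‖ < 1) (hx0 : x ≠ 0) :
    Tendsto (fun p => ellGamma x p q) (𝓝[≠] 0) (𝓝 (1 / qPoch x q)) := by
  have h := tendsto_ellGamma_cpow hq tendsto_id (tendsto_const_nhds (x := x)) hx0 le_rfl zero_le_one
    fun _ => qPoch_ne_zero_of_norm_lt hq hx
  simpa [limGamma] using h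

/-- The limit of the normalization of the bilinear form, divided by the constant that comes from
breaking the symmetry of the integrand. -/
theorem IsDenGeneric.tendsto_constant (hD : IsDenGeneric n q t τ α T) (hα : IsExponent α ζ T)
    (hT : ∑ r ∈ T, α r = ζ) (hT3 : T.card = 3) (h1 : ∑ r, α r = 1) (hq0 : q ≠ 0) (hq : ‖q‖ < 1)
    (ht0 : t ≠ 0) (ht : ‖t‖ < 1) :
    Tendsto (fun p => qPoch q q ^ n * qPoch p p ^ n * ellGamma t p q ^ n /
      (2 ^ n * (n.factorial : ℂ) * ∏ j ∈ Finset.Icc 1 n, (ellGamma (t ^ j) p q *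
        ∏ r : Fin 6, ∏ s ∈ Finset.Ioi r,
          ellGamma (t ^ (n - j) * (scaled τ α p r * scaled τ α p s)) p q)) *
      (2 ^ n / ∏ j ∈ Finset.Icc 1 n, ∏ x : Fin 6 × Fin 6, if x.1 < x.2 ∧ x.1 ∈ T ∧ x.2 ∈ T then
        theta (t ^ (n - j) * (scaled τ α p x.1 * scaled τ α p x.2)) q else 1))
      (𝓝[genericSet q t τ α] 0) (𝓝 (limitConstant n q t τ α T)) := by
  have hle : 𝓝[genericSet q t τ α] (0 : ℂ) ≤ 𝓝[≠] 0 := nhdsWithin_mono _ fun p hp => hp.1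
  have hp : Tendsto (fun p : ℂ => qPoch p p) (𝓝[genericSet q t τ α] 0) (𝓝 1) := by
    have := Tendsto.qPoch (tendsto_id (x := 𝓝 (0 : ℂ))) tendsto_id (by simp)
    rw [qPoch_zero] at this
    exact this.mono_left nhdsWithin_le_nhds
  have hΓ := (tendsto_ellGamma_const hq ht ht0).mono_left hle
  have hj : ∀ j ∈ Finset.Icc 1 n, ‖t ^ j‖ < 1 ∧ n - j < n := fun j hj => by
    have := Finset.mem_Icc.1 hj
    exact ⟨by rw [norm_pow]; exact pow_lt_one₀ (norm_nonneg _) ht (by omega), by omega⟩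
  have hprod : Tendsto (fun p => ∏ j ∈ Finset.Icc 1 n, (ellGamma (t ^ j) p q *
      ∏ x : Fin 6 × Fin 6, if x.1 < x.2 then
        ellGamma (t ^ (n - j) * (scaled τ α p x.1 * scaled τ α p x.2)) p q *
          (if x.1 ∈ T ∧ x.2 ∈ T then
            theta (t ^ (n - j) * (scaled τ α p x.1 * scaled τ α p x.2)) q else 1) else 1))
      (𝓝[genericSet q t τ α] 0) (𝓝 (∏ j ∈ Finset.Icc 1 n, (1 / qPoch (t ^ j) q *
        ∏ x : Fin 6 × Fin 6, if x.1 < x.2 then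
          limGamma (pairExponent α T x.1 x.2) q (t ^ (n - j) * (τ x.1 * τ x.2)) else 1))) := by
    refine tendsto_finsetProd _ fun j hjm => ?_
    refine ((tendsto_ellGamma_const hq (hj j hjm).1 (pow_ne_zero _ ht0)).mono_left hle).mul ?_
    refine tendsto_finsetProd _ fun x _ => ?_
    by_cases hx : x.1 < x.2
    · simpa only [hx, if_true] using hD.tendsto_pair hα hT hT3 h1 hq0 hq ht0 hx.ne (n - j)
    · simpa only [hx, if_false] using tendsto_const_nhds
  have hne : (∏ j ∈ Finset.Icc 1 n, (1 / qPoch (t ^ j) q * ∏ x : Fin 6 × Fin 6, if x.1 < x.2 then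
      limGamma (pairExponent α T x.1 x.2) q (t ^ (n - j) * (τ x.1 * τ x.2)) else 1)) ≠ 0 := by
    refine Finset.prod_ne_zero_iff.2 fun j hjm => mul_ne_zero
      (one_div_ne_zero (qPoch_ne_zero_of_norm_lt hq (hj j hjm).1))
      (Finset.prod_ne_zero_iff.2 fun x _ => ?_)
    split_ifs with hx
    · exact hD.limGamma_ne_zero hq0 hq ht0 hx.ne (hj j hjm).2
    · exact one_ne_zero
  have hfac : (n.factorial : ℂ) ≠ 0 := Nat.cast_ne_zero.2 n.factorial_ne_zero
  have hlim := (((tendsto_const_nhds (x := qPoch q q ^ n)).mul (hp.pow n)).mul (hΓ.pow n)).div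
    ((tendsto_const_nhds (x := (n.factorial : ℂ))).mul hprod) (mul_ne_zero hfac hne)
  refine (hlim.congr fun p => ?_).trans (le_of_eq (congrArg 𝓝 ?_))
  · have e : ∀ j, (∏ x : Fin 6 × Fin 6, if x.1 < x.2 then
        ellGamma (t ^ (n - j) * (scaled τ α p x.1 * scaled τ α p x.2)) p q *
          (if x.1 ∈ T ∧ x.2 ∈ T then
            theta (t ^ (n - j) * (scaled τ α p x.1 * scaled τ α p x.2)) q else 1) else 1) =
        (∏ r : Fin 6, ∏ s ∈ Finset.Ioi r,
          ellGamma (t ^ (n - j) * (scaled τ α p r * scaled τ α p s)) p q) *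
        ∏ x : Fin 6 × Fin 6, if x.1 < x.2 ∧ x.1 ∈ T ∧ x.2 ∈ T then
          theta (t ^ (n - j) * (scaled τ α p x.1 * scaled τ α p x.2)) q else 1 := fun j => by
      rw [prod_prod_Ioi_eq, ← Finset.prod_mul_distrib]
      refine Finset.prod_congr rfl fun x _ => ?_
      by_cases hx : x.1 < x.2 <;> simp [hx]
    simp only [Pi.div_apply, e]
    rw [Finset.prod_mul_distrib, Finset.prod_mul_distrib, Finset.prod_mul_distrib,
      div_mul_div_comm, mul_comm (2 ^ n : ℂ) (n.factorial : ℂ), mul_comm _ ((2 : ℂ) ^ n),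
      mul_comm (n.factorial : ℂ) ((2 : ℂ) ^ n), mul_assoc ((2 : ℂ) ^ n), mul_assoc ((2 : ℂ) ^ n),
      mul_div_mul_left _ _ (pow_ne_zero n two_ne_zero)]
    ring_nf
  · have e := fun k => hα.prod_limGamma_inv hT hT3 h1 q (φ := fun r s => t ^ k * (τ r * τ s))
      fun r s => by rw [mul_comm (τ r)]
    rw [limitConstant, div_eq_mul_inv _ (_ * _), mul_inv, ← Finset.prod_inv_distrib]
    simp only [mul_inv, e, one_div, inv_inv]
    simp only [Finset.prod_mul_distrib, Finset.prod_inv_distrib, div_eq_mul_inv, mul_inv, one_pow,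
      inv_pow, mul_one]
    ring

end Constant

end EllipticSelberg

end

theorem mainTheorem6 (n : ℕ) (hn : 1 ≤ n) (q t : ℂ)
    (hq0 : q ≠ 0) (hq1 : ‖q‖ < 1) (ht0 : t ≠ 0) (ht1 : ‖t‖ < 1)
    (τ : Fin 6 → ℂ) (hbal : t ^ (2 * (n - 1)) * ∏ r, τ r = q)
    (hgen : IsGeneric {1} q t τ)
    (a b c : Fin 6) (hab : a ≠ b) (hac : a ≠ c) (hbc : b ≠ c)
    (α : Fin 6 → ℝ) (ζ : ℝ) (hζ0 : -1 / 2 ≤ ζ) (hζ1 : ζ < 0)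
    (hα : ∑ r, α r = 1) (hαζ : α a + α b + α c = ζ)
    (hin : ∀ r ∈ ({a, b, c} : Finset (Fin 6)), ζ ≤ α r ∧ α r ≤ -ζ)
    (hout : ∀ r ∉ ({a, b, c} : Finset (Fin 6)), -ζ ≤ α r ∧ α r ≤ 1 + ζ)
    (hden : ∀ r s : Fin 6, r ≠ s →
      ((r ∈ ({a, b, c} : Finset (Fin 6)) ∧ s ∈ ({a, b, c} : Finset (Fin 6)) ∧ α r + α s = 0) ∨
        α r + α s = 1) →
      ∀ k < n, ∀ i : ℕ, t ^ k * (τ r * τ s) ≠ q ^ (i + 1))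
    (mf mg : ℕ) (f g : ℂ → (Fin n → ℂ) → ℂ)
    (hf : MemATilde n mf q (fun p => scaled τ α p 4) f)
    (hg : MemATilde n mg q (fun p => scaled τ α p 5) g)
    (vf vg : ℝ) (lf lg : RatFun n)
    (hlf : HasLeadingTerm (fun p z => f p (fun i => p ^ (ζ : ℂ) * z i)) vf lf)
    (hlg : HasLeadingTerm (fun p z => g p (fun i => p ^ (ζ : ℂ) * z i)) vg lg) :
    (𝓝[genericSet q t τ α] (0 : ℂ)).NeBot ∧
    (∀ p ∈ genericSet q t τ α, ‖p‖ < 1 →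
      ∃ C, IsEllipticContour q t p (tilde q mf mg (scaled τ α p)) C) ∧
    (∃ C, IsLimitContour q t (tilde q mf mg τ) α ζ {a, b, c} C) ∧
    ∀ D : ℂ → CircleChain,
      (∀ p ∈ genericSet q t τ α, ‖p‖ < 1 →
        IsEllipticContour q t p (tilde q mf mg (scaled τ α p)) (D p)) →
      ∀ C, IsLimitContour q t (tilde q mf mg τ) α ζ {a, b, c} C →
        Tendsto
          (fun p : ℂ => p ^ ((-vf - vg : ℝ) : ℂ) *
            bilinearForm n q t p (scaled τ α p) (D p) (f p) (g p))
          (𝓝[genericSet q t τ α] 0)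
          (𝓝 (limitConstant n q t τ α {a, b, c} *
            chainIntegral n C
              (fun z => lf.eval z * lg.eval z * limitWeight n q t τ α ζ {a, b, c} z))) := by
  have hτ : ∀ r, τ r ≠ 0 := by
    intro r hr
    rw [Finset.prod_eq_zero (Finset.mem_univ r) hr, mul_zero] at hbal
    exact hq0 hbal.symm
  have hαT : IsExponent α ζ {a, b, c} := ⟨hζ0, hζ1, hin, hout⟩
  have hT : ∑ r ∈ ({a, b, c} : Finset (Fin 6)), α r = ζ := by
    rw [Finset.sum_insert (by simp [hab, hac]), Finset.sum_pair hbc, ← hαζ, add_assoc]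
  have hT3 : ({a, b, c} : Finset (Fin 6)).card = 3 := Finset.card_eq_three.2
    ⟨a, b, c, hab, hac, hbc, rfl⟩
  have hD : IsDenGeneric n q t τ α {a, b, c} := ⟨hτ, hgen, hden⟩
  refine ⟨nhdsWithin_genericSet_neBot hq0 ht0 hgen hτ α, fun p hp hp1 =>
    exists_isEllipticContour hp.1 hp1 hq0 hq1 ht0 ht1 hp.2
      (fun r => mul_ne_zero (hτ r) fun h => hp.1 ((Complex.cpow_eq_zero_iff _ _).1 h).1) mf mg,
    exists_isLimitContour hq0 hq1 ht0 ht1 hgen hτ mf mg α ζ _, fun D hDc C hC => ?_⟩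
  have hle : 𝓝[genericSet q t τ α] (0 : ℂ) ≤ 𝓝[≠] 0 := nhdsWithin_mono _ fun p hp => hp.1
  -- the holomorphic functions that extend the products of `f` and `g` with their pole factors
  choose! F hF using fun p hp hp1 => (hf.mem p hp hp1).holomorphic
  choose! G hG using fun p hp hp1 => (hg.mem p hp hp1).holomorphic
  have hlim := (hD.tendsto_constant hαT hT hT3 hα hq0 hq1 ht0 ht1).mul
    ((hC.tendsto_chainIntegral_rescaled hαT hT hq1 hq0 ht0 ht1 hτ hlf hlg hF hG).mono_left hle)
  refine hlim.congr' ?_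
  -- for small `p`, the integral over `C_p` is an integral over `C`
  obtain ⟨δ, ⟨hδC, h0, hsep⟩, hδ⟩ := ((hC.eventually_separates hαT hq1 ht1).and
    self_mem_nhdsWithin).exists
  -- none of the theta factors that are divided out vanishes
  have hθ : ∀ᶠ p in 𝓝[genericSet q t τ α] 0, ∀ k < n, ∀ x : Fin 6 × Fin 6, x.1 < x.2 ∧
      x.1 ∈ ({a, b, c} : Finset (Fin 6)) ∧ x.2 ∈ ({a, b, c} : Finset (Fin 6)) →
      theta (t ^ k * (scaled τ α p x.1 * scaled τ α p x.2)) q ≠ 0 := by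
    refine (Set.finite_Iio n).eventually_all.2 fun k hk => eventually_all.2 fun x => ?_
    by_cases hx : x.1 < x.2 ∧ x.1 ∈ ({a, b, c} : Finset (Fin 6)) ∧ x.2 ∈ ({a, b, c} : Finset (Fin
        6))
    · filter_upwards [hD.eventually_theta_ne_zero hαT hT hT3 hq0 hq1 ht0 hx.1.ne hx.2.1 hx.2.2 hk]
        with p hp _ using hp
    · exact Eventually.of_forall fun p h => absurd h hx
  filter_upwards [hθ, self_mem_nhdsWithin, hle (eventually_norm_lt one_pos), hle hsep]
    with p hθp hpG hp1 hsepp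
  have hp0 := hpG.1
  have hpn : 0 < ‖p‖ := norm_pos_iff.2 hp0
  have hσ : ∀ r, scaled τ α p r ≠ 0 := fun r =>
    mul_ne_zero (hτ r) fun h => hp0 ((Complex.cpow_eq_zero_iff _ _).1 h).1
  obtain ⟨hFd, hFe⟩ := hF p hpn hp1
  obtain ⟨hGd, hGe⟩ := hG p hpn hp1
  have hDp := hDc p hpG hp1
  have h1 := hDp.const_mul_chainIntegral hn hp1 hp0 hq1 hq0 ht0 hσ (hf.mem p hpn hp1)
    (hg.mem p hpn hp1) hFd hGd hFe hGe hab hac hbc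
  rw [hDp.chainIntegral_eq_rescaled hp1 hq1 ht1 hC.toIsContour hδ hδC h0
    (fun h => hp0 ((Complex.cpow_eq_zero_iff _ _).1 h).1) (scaled_tilde q mf mg τ α p ▸ hsepp)
    (differentiableOn_brokenIntegrand hp1 hp0 hq1 hq0 ht0 hσ _ mf mg hFd hGd),
    prod_theta_breaking hq0 ht0 hσ hab hac hbc] at h1
  have hne : (∏ j ∈ Finset.Icc 1 n, ∏ x : Fin 6 × Fin 6, if x.1 < x.2 ∧
      x.1 ∈ ({a, b, c} : Finset (Fin 6)) ∧ x.2 ∈ ({a, b, c} : Finset (Fin 6)) then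
        theta (t ^ (n - j) * (scaled τ α p x.1 * scaled τ α p x.2)) q else 1) ≠ 0 := by
    refine Finset.prod_ne_zero_iff.2 fun j hj => Finset.prod_ne_zero_iff.2 fun x _ => ?_
    split_ifs with hx
    · have := Finset.mem_Icc.1 hj
      exact hθp _ (by omega) x hx
    · exact one_ne_zero
  rw [bilinearForm, eq_div_of_mul_eq hne ((mul_comm _ _).trans h1)]
  ring
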